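/- **Setting.** Fix model parameters $0<s_*<s^*$ and $\tau>1$. Let $n\ge 1$, let $X=(x_{ij})\in\mathbb C^{n\times n}$ be a random matrix with independent, centered, square integrable entries, $\mathscr S=(\mathbb E|x_{ij}|^2)_{i,j}$ with $s_*/n\le \mathbb E|x_{ij}|^2\le s^*/n$ and spectral radius $\varrho(\mathscr S)=1$. On $\mathbb C^{2n}$ let $\langle x,y\rangle=\frac1{2n}\sum_a\overline{x_a}y_a$ with norm $\|x\|$; on $\mathbb C^{2n\times 2n}$ let $\langle V\rangle=\frac1{2n}\operatorname{Tr}V$, $\langle V,W\rangle=\langle V^*W\rangle$, and let $\|V\|$ be the operator norm; adjoints of linear maps on matrices are taken with respect to $\langle\cdot,\cdot\rangle$. Put $\operatorname{Re}R=\frac12(R+R^*)$, $\operatorname{Im}R=\frac1{2i}(R-R^*)$, $E_-=\begin{pmatrix}1&0\\0&-1\end{pmatrix}$ and $$\mathcal S[R]=\begin{pmatrix}\operatorname{diag}(\mathscr S r_2)&0\\0&\operatorname{diag}(\mathscr S^t r_1)\end{pmatrix},\quad r_1=(r_{ii})_{i\le n},\; r_2=(r_{ii})_{i>n}.$$ For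 $|z|<\tau$ and $\eta\in(0,1]$ let $M$ be the solution, with $\operatorname{Im}M$ positive definite, of $-M^{-1}=\begin{pmatrix}i\eta&z\\\bar z&i\eta\end{pmatrix}+\mathcal S[M]$. Put $\rho=\frac1\pi\langle\operatorname{Im}M\rangle$ and $\mathcal B[R]=R-M\mathcal S[R]M$. **Unstable directions.** For $\varepsilon,C_0>0$, an *unstable pair* consists of $\beta,\beta_*\in\mathbb C$ with $\operatorname{spec}(\mathcal B)\cap\{|w|<\varepsilon\}=\{\beta,\beta_*\}$ and $|\beta_*|<|\beta|$, and matrices with $\mathcal B[B]=\beta B$, $\mathcal B[B_*]=\beta_*B_*$, $\mathcal B^*[\widehat B]=\bar\beta\widehat B$, $\mathcal B^*[\widehat B_*]=\bar\beta_*\widehat B_*$, normalized so that $B$, $B_*$, $\widehat B$, $\widehat B_*$ differ in operator norm by at most $C_0(\rho^2+\eta/\rho)$ from, respectively, $\rho^{-1}\operatorname{Im}M-2i\rho^{-1}(\operatorname{Im}M)(\operatorname{Im}M^{-1})(\operatorname{Re}M)$, $\rho^{-1}E_-\operatorname{Im}M$, $-\rho^{-1}\operatorname{Im}(M^{-1})$,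 $-\rho^{-1}E_-\operatorname{Im}(M^{-1})$. Let $\mathcal Q$ be the spectral projection of $\mathcal B$ associated to $\operatorname{spec}(\mathcal B)\setminus\{\beta,\beta_*\}$, and $R_1=M^*(\mathcal B^{-1}\mathcal Q)^*[E_-]$. **The norm.** Let $W=H_z-\mathbb EH_z$ with $H_z=\begin{pmatrix}0&X-z\\(X-z)^*&0\end{pmatrix}$, $s_{ab}=\mathbb E|w_{ab}|^2$, $t_{ab}=\mathbb Ew_{ab}^2$, $\kappa_c(ab,cd)=\delta_{ad}\delta_{bc}s_{ab}$, $\kappa_d(ab,cd)=\delta_{ac}\delta_{bd}t_{ab}$, and for a vector $\mathbf x$ let $\kappa(\mathbf xb,c\,\cdot)$ be the vector $\big(\sum_a x_a\kappa(ab,cd)\big)_d$. For $\mathbf x,\mathbf y\in\mathbb C^{2n}$ put $$I_0=\{\mathbf x,\mathbf y\}\cup\{\mathbf e_a,(\widehat B^*)_{a\cdot},((\widehat B_*)^*)_{a\cdot}:a\in[2n]\},$$ $$I_{k+1}=I_k\cup\{M\mathbf u:\mathbf u\in I_k\}\cup\{\kappa_c((M\mathbf u)a,b\,\cdot),\ \kappa_d((M\mathbf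 u)a,b\,\cdot):\mathbf u\in I_k,\ a,b\in[2n]\}.$$ For an integer $K\ge1$ let $$\|R\|_*=\sum_{0\le k<K}(2n)^{-k/2K}\max_{\mathbf u,\mathbf v\in I_k}\frac{|\langle\mathbf u,R\mathbf v\rangle|}{\|\mathbf u\|\|\mathbf v\|}+(2n)^{-1/2}\max_{\mathbf u\in I_K}\frac{\|R\mathbf u\|}{\|\mathbf u\|}$$ (zero vectors are omitted). **Proposition.** There are $\varepsilon>0$ and $C_1>0$, depending only on $s_*,s^*,\tau$, such that for every $C_0\ge C_1$ there are $\rho_*>0$ and $C>0$, depending only on $s_*,s^*,\tau,C_0$, such that for all integers $K\ge1$ and all $A>0$ there are $c,C'>0$, depending only on $s_*,s^*,\tau,C_0,K,A$, such that for all $n$, $X$, $z$, $\eta$ as above with $\rho+\eta/\rho\le\rho_*$ the following holds. An unstable pair for $\varepsilon,C_0$ exists. For every such pair, $\mathcal B$ is invertible, $\langle\widehat B,B\rangle\ne0$, $\|R_1\|\le C$, and there is $R_2\in\mathbb C^{2n\times2n}$ with $\|R_2\|\le C$ (independent of $\mathbf x,\mathbf y,G,D$) such that for all $\mathbf x,\mathbf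 y\in\mathbb C^{2n}$ and all $G,D\in\mathbb C^{2n\times2n}$ with $G$ invertible, $$-G^{-1}=\begin{pmatrix}i\eta&z\\\bar z&i\eta\end{pmatrix}+\mathcal S[G]-DG^{-1},\qquad \langle E_-,G\rangle=0,\qquad \|G-M\|_*+\|D\|_*\le\min\{A\,n^{-30/K},\,c\},$$ one has, with $\Theta=\langle\widehat B,G-M\rangle/\langle\widehat B,B\rangle$: (i) $G-M=\Theta B-\mathcal B^{-1}\mathcal Q[MD]+\Theta^2\mathcal B^{-1}\mathcal Q[M\mathcal S[B]B]+E$, where $$\|E\|_*\le C'\Big(|\Theta|^2(\rho+\eta/\rho)+n^{16/K}\big(|\Theta|^3+|\Theta|(\|D\|_*+\rho^2+\eta/\rho)+\|D\|_*^2+|\langle R_1,D\rangle|\big)\Big);$$ (ii) there are $\xi_2,\xi_1,\varepsilon_*\in\mathbb C$ with $\Theta^3+\xi_2\Theta^2+\xi_1\Theta=\varepsilon_*$, with $C^{-1}\rho\le|\xi_2|\le C\rho$ and $C^{-1}(\eta/\rho+\rho^2)\le|\xi_1|\le C(\eta/\rho+\rho^2)$, and $$|\varepsilon_*|\le C'\Big(n^{62/K}\big(\|D\|_*^3+|\langle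 R_1,D\rangle|^{3/2}+|\langle R_2,D\rangle|^{3/2}\big)+|\langle\widehat B,MD\rangle|+\big|\langle\widehat B,M(\mathcal S\mathcal B^{-1}\mathcal Q[MD])(\mathcal B^{-1}\mathcal Q[MD])\rangle\big|\Big).$$ -/

import Mathlib

open Matrix MeasureTheory ProbabilityTheory
open scoped ComplexConjugate ComplexOrder

noncomputable section

namespace CuspMDE

/-! ### Vectors and matrices of size `2n`

The index set `[2n]` is `Fin n ⊕ Fin n`, so that `2n × 2n` matrices are the `2 × 2` block matrices
with blocks of size `n × n`. -/

/-- The index set `[2n]`. -/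
abbrev Idx (n : ℕ) := Fin n ⊕ Fin n

/-- Vectors in `ℂ^{2n}`. -/
abbrev Vec (n : ℕ) := Idx n → ℂ

/-- Matrices in `ℂ^{2n × 2n}`. -/
abbrev Mat (n : ℕ) := Matrix (Idx n) (Idx n) ℂ

variable {n : ℕ}

/-- The normalized Euclidean scalar product, conjugate linear in the first argument. -/
def scal (x y : Vec n) : ℂ := (2 * n : ℂ)⁻¹ * ∑ a, conj (x a) * y a

/-- The normalized Euclidean norm. -/
def vnorm (x : Vec n) : ℝ := Real.sqrt ((2 * n : ℝ)⁻¹ * ∑ a, ‖x a‖ ^ 2)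

/-- The `a`-th standard basis vector, normalized so that `vnorm (stdVec a) = 1`. -/
def stdVec (a : Idx n) : Vec n := Pi.single a (Real.sqrt (2 * n) : ℂ)

/-- The normalized trace. -/
def avg (V : Mat n) : ℂ := (2 * n : ℂ)⁻¹ * V.trace

/-- The normalized Hilbert-Schmidt scalar product, conjugate linear in the first argument. -/
def hs (V W : Mat n) : ℂ := avg (Vᴴ * W)

/-- The operator norm of a matrix induced by the Euclidean norm (the normalization of the
Euclidean norm is irrelevant here). -/
def opNorm (V : Mat n) : ℝ := ‖Matrix.toEuclideanCLM (n := Idx n) (𝕜 := ℂ) V‖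

/-- `Re R = (R + R^*) / 2`. -/
def matRe (R : Mat n) : Mat n := (2 : ℂ)⁻¹ • (R + Rᴴ)

/-- `Im R = (R - R^*) / (2 i)`. -/
def matIm (R : Mat n) : Mat n := (2 * Complex.I)⁻¹ • (R - Rᴴ)

/-- The matrix `E_- = diag(1, -1)`. -/
def Eminus : Mat n := Matrix.fromBlocks 1 0 0 (-1)

/-! ### Linear maps on `ℂ^{2n × 2n}` -/

/-- The adjoint of a linear map on matrices with respect to the Hilbert-Schmidt scalar product,
see `hs_hsAdjoint`. -/
def hsAdjoint (T : Module.End ℂ (Mat n)) (V : Mat n) : Mat n :=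
  Matrix.of fun a b => conj ((Vᴴ * T (Matrix.single a b 1)).trace)

theorem hs_hsAdjoint (T : Module.End ℂ (Mat n)) (V W : Mat n) :
    hs (hsAdjoint T V) W = hs V (T W) := by
  have hW : T W = ∑ a, ∑ b, W a b • T (Matrix.single a b 1) := by
    conv_lhs => rw [Matrix.matrix_eq_sum_single W]
    simp only [map_sum]
    refine Finset.sum_congr rfl fun a _ => Finset.sum_congr rfl fun b _ => ?_
    rw [← map_smul, Matrix.smul_single, smul_eq_mul, mul_one]
  unfold hs avg
  congr 1
  rw [hW]
  simp only [Finset.mul_sum, Matrix.mul_smul, Matrix.trace_sum, Matrix.trace_smul]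
  rw [Finset.sum_comm]
  simp [Matrix.trace, Matrix.mul_apply, hsAdjoint, mul_comm]

/-- Generalized eigenspaces belonging to complementary sets of eigenvalues are complementary. -/
theorem isCompl_genEigenspaces (T : Module.End ℂ (Mat n)) (Λ : Set ℂ) :
    IsCompl (⨆ μ ∈ Λ, T.maxGenEigenspace μ) (⨆ μ ∈ Λᶜ, T.maxGenEigenspace μ) := by
  constructor
  · exact T.independent_maxGenEigenspace.disjoint_biSup_biSup disjoint_compl_right
  · rw [codisjoint_iff, ← iSup_union, Set.union_compl_self, iSup_univ]
    exact Module.End.iSup_maxGenEigenspace_eq_top T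

/-- The spectral projection of `T` associated to the set `Λ` of eigenvalues: the projection onto
the sum of the generalized eigenspaces for eigenvalues in `Λ` along the sum of the generalized
eigenspaces for the other eigenvalues. -/
def spectralProj (T : Module.End ℂ (Mat n)) (Λ : Set ℂ) : Module.End ℂ (Mat n) :=
  Submodule.projection _ _ (isCompl_genEigenspaces T Λ)

/-! ### The random matrix and its variances -/

/-- The matrix `𝒮 = (E |x_ij|^2)`. -/
def varMat {Ω : Type*} [MeasurableSpace Ω] (P : Measure Ω)
    (X : Ω → Matrix (Fin n) (Fin n) ℂ) : Matrix (Fin n) (Fin n) ℝ :=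
  Matrix.of fun i j => ∫ ω, ‖X ω i j‖ ^ 2 ∂P

/-- The standing assumptions on the random matrix `X`: independent, centered, square integrable
entries, a flat variance matrix with parameters `s_lo`, `s_hi`, and the normalization that the
spectral radius of the variance matrix is one. -/
structure FlatModel (s_lo s_hi : ℝ) {Ω : Type*} [MeasurableSpace Ω] (P : Measure Ω)
    (X : Ω → Matrix (Fin n) (Fin n) ℂ) : Prop where
  memLp : ∀ i j, MemLp (fun ω => X ω i j) 2 P
  indep : iIndepFun (fun (p : Fin n × Fin n) ω => X ω p.1 p.2) P
  centered : ∀ i j, ∫ ω, X ω i j ∂P = 0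
  flat_lower : ∀ i j, s_lo / n ≤ varMat P X i j
  flat_upper : ∀ i j, varMat P X i j ≤ s_hi / n
  radius_one : spectralRadius ℂ ((varMat P X).map Complex.ofReal) = 1

/-- The Hermitization `H_z` of a matrix. -/
def hermitization (X : Matrix (Fin n) (Fin n) ℂ) (z : ℂ) : Mat n :=
  Matrix.fromBlocks 0 (X - z • 1) (X - z • 1)ᴴ 0

/-- The fluctuation matrix `W = H_z - E H_z`. -/
def fluct {Ω : Type*} [MeasurableSpace Ω] (P : Measure Ω)
    (X : Ω → Matrix (Fin n) (Fin n) ℂ) (z : ℂ) (ω : Ω) : Mat n :=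
  Matrix.of fun a b => hermitization (X ω) z a b - ∫ ω', hermitization (X ω') z a b ∂P

/-- `s_ab = E |w_ab|^2`. -/
def sCov {Ω : Type*} [MeasurableSpace Ω] (P : Measure Ω)
    (X : Ω → Matrix (Fin n) (Fin n) ℂ) (z : ℂ) (a b : Idx n) : ℂ :=
  ((∫ ω, ‖fluct P X z ω a b‖ ^ 2 ∂P : ℝ) : ℂ)

/-- `t_ab = E w_ab^2`. -/
def tCov {Ω : Type*} [MeasurableSpace Ω] (P : Measure Ω)
    (X : Ω → Matrix (Fin n) (Fin n) ℂ) (z : ℂ) (a b : Idx n) : ℂ :=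
  ∫ ω, (fluct P X z ω a b) ^ 2 ∂P

/-! ### The Dyson equation and its stability operator -/

/-- The self-energy operator `𝒮[R] = diag(𝒮 r₂, 𝒮ᵗ r₁)`, where `r₁`, `r₂` are the diagonals of the
two diagonal blocks of `R`. -/
def selfEnergy (S : Matrix (Fin n) (Fin n) ℝ) : Module.End ℂ (Mat n) where
  toFun R := Matrix.fromBlocks
    (Matrix.diagonal ((S.map Complex.ofReal) *ᵥ fun i => R (Sum.inr i) (Sum.inr i))) 0 0
    (Matrix.diagonal ((S.map Complex.ofReal)ᵀ *ᵥ fun i => R (Sum.inl i) (Sum.inl i)))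
  map_add' R T := by
    ext a b
    rcases a with i | i <;> rcases b with j | j <;>
      simp [Matrix.diagonal_apply, Matrix.mulVec, dotProduct, mul_add, Finset.sum_add_distrib]
    all_goals split_ifs <;> simp
  map_smul' c R := by
    ext a b
    rcases a with i | i <;> rcases b with j | j <;>
      simp [Matrix.diagonal_apply, Matrix.mulVec, dotProduct, Finset.mul_sum, mul_left_comm]

/-- The matrix with blocks `iη, z; z̄, iη`. -/
def spectralMat (n : ℕ) (z : ℂ) (η : ℝ) : Mat n :=
  Matrix.fromBlocks ((Complex.I * η) • 1) (z • 1) ((conj z) • 1) ((Complex.I * η) • 1)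

/-- `M` is the solution of the matrix Dyson equation with positive definite imaginary part. -/
structure IsDysonSolution (S : Matrix (Fin n) (Fin n) ℝ) (z : ℂ) (η : ℝ) (M : Mat n) : Prop where
  isUnit : IsUnit M
  equation : -M⁻¹ = spectralMat n z η + selfEnergy S M
  posDef : (matIm M).PosDef

/-- `G` solves the Dyson equation perturbed by `D`. -/
structure IsPerturbedDysonSolution (S : Matrix (Fin n) (Fin n) ℝ) (z : ℂ) (η : ℝ)
    (D G : Mat n) : Prop where
  isUnit : IsUnit G
  equation : -G⁻¹ = spectralMat n z η + selfEnergy S G - D * G⁻¹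

/-- `ρ = ⟨Im M⟩ / π`. -/
def rho (M : Mat n) : ℝ := (1 / Real.pi) * (avg (matIm M)).re

/-- The stability operator `𝓑[R] = R - M 𝒮[R] M`. -/
def stabOp (S : Matrix (Fin n) (Fin n) ℝ) (M : Mat n) : Module.End ℂ (Mat n) :=
  1 - LinearMap.mulLeft ℂ M ∘ₗ LinearMap.mulRight ℂ M ∘ₗ selfEnergy S

/-- Eigenvalues `β`, `βs` (for `β_*`) of the stability operator and right eigenvectors `B`, `Bs`
and left eigenvectors `L`, `Ls` belonging to `β`, `βs`: the two eigenvalues are those in the disk of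
radius `ε` around zero, `βs` has the smaller modulus, and the eigenvectors are normalized by their
leading order, up to an error of at most `C₀ (ρ² + η/ρ)`. -/
structure IsUnstablePair (S : Matrix (Fin n) (Fin n) ℝ) (η : ℝ) (M : Mat n) (ε C₀ : ℝ)
    (β βs : ℂ) (B Bs L Ls : Mat n) : Prop where
  spectrum_eq : spectrum ℂ (stabOp S M) ∩ Metric.ball 0 ε = {β, βs}
  norm_lt : ‖βs‖ < ‖β‖
  right : stabOp S M B = β • B
  right_star : stabOp S M Bs = βs • Bs
  left : hsAdjoint (stabOp S M) L = conj β • L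
  left_star : hsAdjoint (stabOp S M) Ls = conj βs • Ls
  expand_right :
    opNorm (B - (((rho M)⁻¹ : ℂ) • matIm M
      - (2 * Complex.I * (rho M)⁻¹ : ℂ) • (matIm M * matIm (M⁻¹) * matRe M)))
      ≤ C₀ * (rho M ^ 2 + η / rho M)
  expand_right_star :
    opNorm (Bs - ((rho M)⁻¹ : ℂ) • (Eminus * matIm M)) ≤ C₀ * (rho M ^ 2 + η / rho M)
  expand_left :
    opNorm (L - (-((rho M)⁻¹ : ℂ) • matIm (M⁻¹))) ≤ C₀ * (rho M ^ 2 + η / rho M)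
  expand_left_star :
    opNorm (Ls - (-((rho M)⁻¹ : ℂ) • (Eminus * matIm (M⁻¹)))) ≤ C₀ * (rho M ^ 2 + η / rho M)

/-- `𝓑⁻¹ 𝒬`, where `𝒬` is the spectral projection of `𝓑` associated to
`spec(𝓑) \ {β, β_*}`. -/
def invQ (S : Matrix (Fin n) (Fin n) ℝ) (M : Mat n) (β βs : ℂ) : Module.End ℂ (Mat n) :=
  Ring.inverse (stabOp S M) * spectralProj (stabOp S M) (spectrum ℂ (stabOp S M) \ {β, βs})

/-- `R₁ = M^* (𝓑⁻¹ 𝒬)^*[E_-]`. -/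
def matR₁ (S : Matrix (Fin n) (Fin n) ℝ) (M : Mat n) (β βs : ℂ) : Mat n :=
  Mᴴ * hsAdjoint (invQ S M β βs) Eminus

/-! ### The norm `‖·‖_*` -/

/-- `κ_c(ab, cd) = δ_ad δ_bc s_ab`. -/
def kappaC (s : Idx n → Idx n → ℂ) (a b c d : Idx n) : ℂ :=
  if a = d ∧ b = c then s a b else 0

/-- `κ_d(ab, cd) = δ_ac δ_bd t_ab`. -/
def kappaD (t : Idx n → Idx n → ℂ) (a b c d : Idx n) : ℂ :=
  if a = c ∧ b = d then t a b else 0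

/-- The vector `κ(x b, c ·)`, i.e. `(∑_a x_a κ(ab, cd))_d`. -/
def weightedKappa (κ : Idx n → Idx n → Idx n → Idx n → ℂ) (x : Vec n) (b c : Idx n) : Vec n :=
  fun d => ∑ a, x a * κ a b c d

/-- The set `I_0`; the vectors `(L^*)_{a ·}` are the rows of `L^*`. -/
def testBase (L Ls : Mat n) (x y : Vec n) : Set (Vec n) :=
  {x, y} ∪ {u | ∃ a, u = stdVec a ∨ u = (fun b => Lᴴ a b) ∨ u = (fun b => Lsᴴ a b)}

/-- The sets `I_k` of test vectors. -/
def testVecs (s t : Idx n → Idx n → ℂ) (M L Ls : Mat n) (x y : Vec n) : ℕ → Set (Vec n)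
  | 0 => testBase L Ls x y
  | k + 1 =>
      testVecs s t M L Ls x y k
      ∪ {w | ∃ u ∈ testVecs s t M L Ls x y k, w = M *ᵥ u}
      ∪ {w | ∃ u ∈ testVecs s t M L Ls x y k, ∃ a b,
          w = weightedKappa (kappaC s) (M *ᵥ u) a b ∨
          w = weightedKappa (kappaD t) (M *ᵥ u) a b}

/-- `‖R‖_I = max_{u, v ∈ I} |⟨u, R v⟩| / (‖u‖ ‖v‖)`; zero vectors do not contribute. -/
def testNorm (I : Set (Vec n)) (R : Mat n) : ℝ :=
  sSup {r | ∃ u ∈ I, ∃ v ∈ I, r = ‖scal u (R *ᵥ v)‖ / (vnorm u * vnorm v)}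

/-- `‖R‖_* = ∑_{0 ≤ k < K} (2n)^{-k/2K} ‖R‖_{I_k} + (2n)^{-1/2} max_{u ∈ I_K} ‖R u‖ / ‖u‖`. -/
def starNorm (s t : Idx n → Idx n → ℂ) (M L Ls : Mat n) (K : ℕ) (x y : Vec n) (R : Mat n) : ℝ :=
  (∑ k ∈ Finset.range K,
      (2 * n : ℝ) ^ (-(k : ℝ) / (2 * K)) * testNorm (testVecs s t M L Ls x y k) R)
    + (2 * n : ℝ) ^ (-(1 / 2) : ℝ)
      * sSup {r | ∃ u ∈ testVecs s t M L Ls x y K, r = vnorm (R *ᵥ u) / vnorm u}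

end CuspMDE

end

namespace CuspMDE

variable {n : ℕ}

open Complex (I norm_real conj_ofReal norm_I)
open Real (norm_of_nonneg)

noncomputable section
open scoped Matrix.Norms.L2Operator

/-! ### The operator norm and the scalar product -/

theorem opNorm_eq (V : Mat n) : opNorm V = ‖V‖ := rfl

theorem norm_entry_le (V : Mat n) (a b : Idx n) : ‖V a b‖ ≤ ‖V‖ := by
  have h := l2_opNorm_mulVec V (EuclideanSpace.single b (1 : ℂ))
  have h2 := PiLp.norm_apply_le (p := 2) ((EuclideanSpace.equiv (Idx n) ℂ).symm
    (V *ᵥ (EuclideanSpace.single b (1 : ℂ)))) a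
  simp at h h2
  exact h2.trans h

theorem norm_avg_le {V : Mat n} {c : ℝ} (hc : 0 ≤ c) (h : ∀ a, ‖V a a‖ ≤ c) : ‖avg V‖ ≤ c := by
  unfold avg
  rcases Nat.eq_zero_or_pos n with rfl | hn
  · simpa using hc
  have hn' : (0 : ℝ) < 2 * n := by positivity
  have h1 : ‖V.trace‖ ≤ 2 * n * c := by
    refine (norm_sum_le _ _).trans ((Finset.sum_le_sum fun a _ => h a).trans ?_)
    simp
    linarith
  rw [norm_mul, norm_inv]
  have : ‖(2 * n : ℂ)‖ = 2 * n := by simp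
  rw [this, inv_mul_le_iff₀ hn']
  exact h1

theorem norm_avg_le_norm (V : Mat n) : ‖avg V‖ ≤ ‖V‖ :=
  norm_avg_le (norm_nonneg _) fun a => norm_entry_le V a a

theorem norm_hs_le (V W : Mat n) : ‖hs V W‖ ≤ ‖V‖ * ‖W‖ := by
  refine (norm_avg_le_norm _).trans ((norm_mul_le _ _).trans ?_)
  rw [l2_opNorm_conjTranspose]

theorem hs_add_right (V W W' : Mat n) : hs V (W + W') = hs V W + hs V W' := by
  simp [hs, avg, mul_add]

theorem hs_sub_right (V W W' : Mat n) : hs V (W - W') = hs V W - hs V W' := by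
  simp [hs, avg, mul_sub]

theorem hs_neg_right (V W : Mat n) : hs V (-W) = -hs V W := by
  simp [hs, avg]

theorem hs_smul_right (V W : Mat n) (c : ℂ) : hs V (c • W) = c * hs V W := by
  simp [hs, avg]; ring

theorem hs_zero_right (V : Mat n) : hs V 0 = 0 := by simp [hs, avg]

theorem hs_add_left (V V' W : Mat n) : hs (V + V') W = hs V W + hs V' W := by
  simp [hs, avg, add_mul, mul_add]

theorem hs_sub_left (V V' W : Mat n) : hs (V - V') W = hs V W - hs V' W := by
  simp [hs, avg, sub_mul, mul_sub]

theorem hs_smul_left (V W : Mat n) (c : ℂ) : hs (c • V) W = conj c * hs V W := by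
  simp [hs, avg]; ring

theorem hs_conj (V W : Mat n) : conj (hs V W) = hs W V := by
  unfold hs avg
  rw [map_mul, starRingEnd_apply (R := ℂ) ((Vᴴ * W).trace), ← trace_conjTranspose]
  simp [Complex.conj_ofNat]

theorem hs_mul_left (V X W : Mat n) : hs V (X * W) = hs (Xᴴ * V) W := by
  simp [hs, Matrix.mul_assoc]

theorem hs_mul_right (V X W : Mat n) : hs V (W * X) = hs (V * Xᴴ) W := by
  unfold hs avg
  rw [conjTranspose_mul, conjTranspose_conjTranspose, Matrix.mul_assoc,
    trace_mul_comm X, Matrix.mul_assoc]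

theorem hs_ext {V W : Mat n} (h : ∀ R, hs V R = hs W R) : V = W := by
  rcases Nat.eq_zero_or_pos n with rfl | hn
  · ext a; rcases a with i | i <;> exact i.elim0
  ext a b
  have h1 := h (Matrix.single a b 1)
  have hn' : (2 * n : ℂ)⁻¹ ≠ 0 := by
    have : (n : ℂ) ≠ 0 := by exact_mod_cast hn.ne'
    simp [this]
  unfold hs avg at h1
  have h2 := mul_left_cancel₀ hn' h1
  simp [trace_mul_single] at h2
  exact star_injective h2

/-- The scalar product with `V` as a linear functional. -/
def hsLin (V : Mat n) : Mat n →ₗ[ℂ] ℂ where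
  toFun := hs V
  map_add' := hs_add_right V
  map_smul' c W := by simp [hs_smul_right]

theorem hs_diagonal_left (d : Idx n → ℂ) (W : Mat n) :
    hs (diagonal d) W = (2 * n : ℂ)⁻¹ * ∑ a, conj (d a) * W a a := by
  simp [hs, avg, Matrix.trace, diagonal_conjTranspose, diagonal_mul]

/-! ### The self-energy and the off-diagonal matrix -/

/-- The symmetric `2n × 2n` variance matrix with blocks `0, S; Sᵗ, 0`. -/
def symVar (S : Matrix (Fin n) (Fin n) ℝ) : Matrix (Idx n) (Idx n) ℝ :=
  Matrix.fromBlocks 0 S Sᵀ 0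

theorem symVar_comm (S : Matrix (Fin n) (Fin n) ℝ) (a b : Idx n) :
    symVar S a b = symVar S b a := by
  rcases a with i | i <;> rcases b with j | j <;> simp [symVar]

/-- The action of the variance matrix on vectors. -/
def act (S : Matrix (Fin n) (Fin n) ℝ) : (Idx n → ℂ) →ₗ[ℂ] (Idx n → ℂ) :=
  mulVecLin ((symVar S).map Complex.ofReal)

theorem act_apply (S : Matrix (Fin n) (Fin n) ℝ) (r : Idx n → ℂ) (a : Idx n) :
    act S r a = ∑ b, (symVar S a b : ℂ) * r b := by
  simp [act, mulVec, dotProduct]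

theorem selfEnergy_eq (S : Matrix (Fin n) (Fin n) ℝ) (R : Mat n) :
    selfEnergy S R = diagonal (act S R.diag) := by
  ext a b
  rcases a with i | i <;> rcases b with j | j <;>
    simp [selfEnergy, act_apply, symVar, diagonal_apply, mulVec, dotProduct]

theorem hs_selfEnergy (S : Matrix (Fin n) (Fin n) ℝ) (V W : Mat n) :
    hs (selfEnergy S V) W = hs V (selfEnergy S W) := by
  rw [selfEnergy_eq, selfEnergy_eq, ← hs_conj _ V, hs_diagonal_left, hs_diagonal_left, map_mul]
  congr 1
  · simp [Complex.conj_ofNat]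
  rw [map_sum]
  simp only [act_apply, map_sum, map_mul, Complex.conj_conj, conj_ofReal, Finset.sum_mul]
  rw [Finset.sum_comm]
  refine Finset.sum_congr rfl fun a _ => Finset.sum_congr rfl fun b _ => ?_
  rw [symVar_comm S b a, diag_apply, diag_apply]
  ring

/-- The off-diagonal matrix with blocks `0, z; z̄, 0`. -/
def offDiag (n : ℕ) (z : ℂ) : Mat n := Matrix.fromBlocks 0 (z • 1) (conj z • 1) 0

theorem offDiag_conjTranspose (z : ℂ) : (offDiag n z)ᴴ = offDiag n z := by
  simp [offDiag, Matrix.fromBlocks_conjTranspose]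

theorem offDiag_mul_self (z : ℂ) : offDiag n z * offDiag n z = ((‖z‖ ^ 2 : ℝ) : ℂ) • 1 := by
  simp [offDiag, Matrix.fromBlocks_multiply, ← Matrix.fromBlocks_one, Matrix.fromBlocks_smul,
    smul_smul, Complex.mul_conj', Complex.conj_mul']

theorem offDiag_mul_diagonal (z : ℂ) (d : Idx n → ℂ) :
    offDiag n z * diagonal d = diagonal (d ∘ Sum.swap) * offDiag n z := by
  ext a b
  rcases a with i | i <;> rcases b with j | j <;>
    simp [offDiag, Matrix.mul_diagonal, diagonal_mul, Matrix.one_apply]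
  all_goals split_ifs with h <;> simp_all [mul_comm]

theorem offDiag_diag (z : ℂ) (a : Idx n) : offDiag n z a a = 0 := by
  rcases a with i | i <;> simp [offDiag]

theorem norm_offDiag_le (z : ℂ) : ‖offDiag n z‖ ≤ ‖z‖ := by
  have h := l2_opNorm_conjTranspose_mul_self (offDiag n z)
  rw [offDiag_conjTranspose, offDiag_mul_self, norm_smul] at h
  have h1 : ‖(1 : Mat n)‖ ≤ 1 := by
    rw [← diagonal_one, l2_opNorm_diagonal]
    exact (pi_norm_le_iff_of_nonneg zero_le_one).2 fun a => by simp
  have h2 : ‖((‖z‖ ^ 2 : ℝ) : ℂ)‖ = ‖z‖ ^ 2 := by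
    rw [norm_real, norm_of_nonneg (by positivity)]
  rw [h2] at h
  refine abs_le_of_sq_le_sq' ?_ (norm_nonneg z) |>.2
  nlinarith [sq_nonneg ‖z‖]

theorem norm_diagonal_le {d : Idx n → ℂ} {c : ℝ} (hc : 0 ≤ c) (h : ∀ a, ‖d a‖ ≤ c) :
    ‖(diagonal d : Mat n)‖ ≤ c := by
  rw [l2_opNorm_diagonal]
  exact (pi_norm_le_iff_of_nonneg hc).2 h

theorem Eminus_eq : (Eminus : Mat n) = diagonal (Sum.elim (fun _ => 1) (fun _ => -1)) := by
  ext a b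
  rcases a with i | i <;> rcases b with j | j <;>
    simp [Eminus, diagonal_apply, Matrix.one_apply, apply_ite]

theorem spectralMat_eq (z : ℂ) (η : ℝ) :
    spectralMat n z η = (I * η) • 1 + offDiag n z := by
  simp [spectralMat, offDiag, ← Matrix.fromBlocks_one, Matrix.fromBlocks_smul,
    Matrix.fromBlocks_add]

/-! ### The stability operator and its adjoint -/

theorem stabOp_apply (S : Matrix (Fin n) (Fin n) ℝ) (M R : Mat n) :
    stabOp S M R = R - M * selfEnergy S R * M := by
  simp [stabOp, Matrix.mul_assoc]

theorem hsAdjoint_stabOp (S : Matrix (Fin n) (Fin n) ℝ) (M V : Mat n) :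
    hsAdjoint (stabOp S M) V = V - selfEnergy S (Mᴴ * V * Mᴴ) := by
  refine hs_ext fun R => ?_
  rw [hs_hsAdjoint, stabOp_apply, hs_sub_right, hs_sub_left, hs_mul_right, hs_mul_left,
    hs_selfEnergy, Matrix.mul_assoc]

end

/-! ### The Perron-Frobenius eigenvector -/

section Perron
attribute [local instance] Matrix.linftyOpNormedRing Matrix.linftyOpNormedAlgebra

open scoped NNReal ENNReal in
theorem exists_perron_vector {n : ℕ} (S : Matrix (Fin n) (Fin n) ℝ) (hn : 0 < n)
    (hpos : ∀ i j, 0 < S i j) (hrad : spectralRadius ℂ (S.map Complex.ofReal) = 1) :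
    ∃ g : Fin n → ℝ, (∀ i, 0 < g i) ∧ S *ᵥ g = g := by
  have : Nonempty (Fin n) := ⟨⟨0, hn⟩⟩
  set A : Matrix (Fin n) (Fin n) ℂ := S.map Complex.ofReal with hA
  obtain ⟨k, hk, hk1⟩ := spectrum.exists_nnnorm_eq_spectralRadius A
  rw [hrad] at hk1
  have hk1' : ‖k‖ = 1 := by
    have : ‖k‖₊ = 1 := by exact_mod_cast hk1
    simpa using congrArg NNReal.toReal this
  rw [spectrum.mem_iff, Matrix.isUnit_iff_isUnit_det, isUnit_iff_ne_zero, not_not] at hk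
  obtain ⟨w, hw0, hw⟩ := Matrix.exists_mulVec_eq_zero_iff.2 hk
  have hw' : A *ᵥ w = k • w := by
    rw [Matrix.sub_mulVec, sub_eq_zero] at hw
    rw [← hw, Algebra.algebraMap_eq_smul_one, Matrix.smul_mulVec, Matrix.one_mulVec]
  set y : Fin n → ℝ := fun i => ‖w i‖ with hy
  have hy0 : ∀ i, 0 ≤ y i := fun i => norm_nonneg _
  have hle : ∀ i, y i ≤ (S *ᵥ y) i := by
    intro i
    have h1 : (A *ᵥ w) i = k * w i := by rw [hw']; rfl
    have h2 : y i = ‖(A *ᵥ w) i‖ := by rw [h1, norm_mul, hk1', one_mul]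
    have h3 : (A *ᵥ w) i = ∑ j, A i j * w j := rfl
    rw [h2, h3]
    refine (norm_sum_le _ _).trans (Finset.sum_le_sum fun j _ => ?_)
    simp [hA, hy, abs_of_pos (hpos i j)]
  have hposvec : ∀ d : Fin n → ℝ, (∀ i, 0 ≤ d i) → d ≠ 0 → ∀ i, 0 < (S *ᵥ d) i := by
    intro d hd hd0 i
    obtain ⟨j, hj⟩ := Function.ne_iff.1 hd0
    refine Finset.sum_pos' (fun j _ => mul_nonneg (hpos i j).le (hd j)) ⟨j, Finset.mem_univ _, ?_⟩
    exact mul_pos (hpos i j) (lt_of_le_of_ne (hd j) (Ne.symm hj))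
  have hyne : y ≠ 0 := by
    intro h
    apply hw0
    ext i
    have := congrFun h i
    simpa [hy] using this
  by_cases heq : S *ᵥ y = y
  · exact ⟨y, fun i => by rw [← heq]; exact hposvec y hy0 hyne i, heq⟩
  exfalso
  set v := S *ᵥ y with hv
  have hvpos : ∀ i, 0 < v i := hposvec y hy0 hyne
  have hd : ∀ i, 0 < (S *ᵥ (v - y)) i := hposvec _ (fun i => sub_nonneg.2 (hle i))
    (sub_ne_zero.2 heq)
  obtain ⟨i₀, hi₀⟩ := Finite.exists_min (fun i => (S *ᵥ (v - y)) i / v i)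
  set ε := (S *ᵥ (v - y)) i₀ / v i₀ with hε
  have hεpos : 0 < ε := div_pos (hd i₀) (hvpos i₀)
  have hgrow : ∀ i, (1 + ε) * v i ≤ (S *ᵥ v) i := by
    intro i
    have h1 := (le_div_iff₀ (hvpos i)).1 (hi₀ i)
    rw [mulVec_sub, Pi.sub_apply, ← hv] at h1
    linarith
  have hpow : ∀ m : ℕ, ∀ i, (1 + ε) ^ m * v i ≤ ((S ^ m) *ᵥ v) i := by
    intro m
    induction m with
    | zero => simp
    | succ m ih =>
      intro i
      rw [pow_succ', pow_succ', ← mulVec_mulVec]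
      calc (1 + ε) * (1 + ε) ^ m * v i = (1 + ε) ^ m * ((1 + ε) * v i) := by ring
        _ ≤ (1 + ε) ^ m * (S *ᵥ v) i := by gcongr; exact hgrow i
        _ = ∑ j, S i j * ((1 + ε) ^ m * v j) := by
          simp only [mulVec, dotProduct, Finset.mul_sum]
          exact Finset.sum_congr rfl fun j _ => by ring
        _ ≤ (S *ᵥ ((S ^ m) *ᵥ v)) i :=
          Finset.sum_le_sum fun j _ => mul_le_mul_of_nonneg_left (ih j) (hpos i j).le
  obtain ⟨i₁, hi₁⟩ := Finite.exists_max v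
  set vc : Fin n → ℂ := fun i => (v i : ℂ) with hvc
  have hnormv : ‖vc‖ = v i₁ := by
    apply le_antisymm
    · exact (pi_norm_le_iff_of_nonneg (hvpos i₁).le).2 fun i => by
        simp [hvc, abs_of_pos (hvpos i)]; exact hi₁ i
    · have := norm_le_pi_norm vc i₁
      simpa [hvc, abs_of_pos (hvpos i₁)] using this
  have hAm : ∀ m : ℕ, 1 + ε ≤ 1 + ε ∧ (1 + ε) ^ m ≤ ‖A ^ m‖ := by
    intro m
    refine ⟨le_rfl, ?_⟩
    have h1 : ((A ^ m) *ᵥ vc) i₁ = (((S ^ m) *ᵥ v) i₁ : ℝ) := by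
      have : A ^ m = (S ^ m).map Complex.ofReal := by
        rw [hA]
        exact (map_pow (Complex.ofRealHom.mapMatrix) S m).symm
      rw [this]
      simp [mulVec, dotProduct, hvc]
    have h2 := (norm_le_pi_norm ((A ^ m) *ᵥ vc) i₁).trans (Matrix.linfty_opNorm_mulVec (A ^ m) vc)
    rw [h1, hnormv, norm_real, Real.norm_eq_abs] at h2
    have h3 := (hpow m i₁).trans ((le_abs_self _).trans h2)
    exact le_of_mul_le_mul_right h3 (hvpos i₁)
  have hlim := spectrum.pow_norm_pow_one_div_tendsto_nhds_spectralRadius A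
  rw [hrad] at hlim
  have hge : ENNReal.ofReal (1 + ε) ≤ 1 := by
    refine ge_of_tendsto hlim ?_
    filter_upwards [Filter.eventually_gt_atTop 0] with m hm
    apply ENNReal.ofReal_le_ofReal
    have h1 : (1 + ε) = ((1 + ε) ^ m) ^ (1 / (m : ℝ)) := by
      rw [← Real.rpow_natCast, ← Real.rpow_mul (by positivity)]
      field_simp
      simp
    rw [h1]
    exact Real.rpow_le_rpow (by positivity) (hAm m).2 (by positivity)
  rw [ENNReal.ofReal_le_one] at hge
  linarith

end Perron

noncomputable section
open scoped Matrix.Norms.L2Operator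

/-! ### Parametrization of the solution near the spectral edge -/

/-- The variance matrix, the parameters `z`, `η`, the density `ρ`, and the functions `F`, `u` that
parametrize the solution of the Dyson equation. -/
structure Data (n : ℕ) where
  S : Matrix (Fin n) (Fin n) ℝ
  z : ℂ
  η : ℝ
  ρ : ℝ
  F : Idx n → ℝ
  u : Idx n → ℝ

namespace Data

/-- The solution of the Dyson equation. -/
def M (D : Data n) : Mat n :=
  diagonal (fun a => I * D.ρ * D.F a)
    - diagonal (fun a => (D.u a : ℂ)) * offDiag n D.z

/-- The error parameter `ρ² + η / ρ`. -/
def del (D : Data n) : ℝ := D.ρ ^ 2 + D.η / D.ρ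

/-- The profile with its two halves swapped. -/
def G (D : Data n) (a : Idx n) : ℝ := D.F a.swap

/-- Uniform bounds and identities satisfied by the solution near the spectral edge. -/
structure Regular (Λ : ℝ) (D : Data n) : Prop where
  n_pos : 0 < n
  one_le : 1 ≤ Λ
  S_lower : ∀ i j, Λ⁻¹ / n ≤ D.S i j
  S_upper : ∀ i j, D.S i j ≤ Λ / n
  η_pos : 0 < D.η
  ρ_pos : 0 < D.ρ
  F_lower : ∀ a, Λ⁻¹ ≤ D.F a
  F_upper : ∀ a, D.F a ≤ Λ
  u_near : ∀ a, |D.u a - 1| ≤ Λ * D.del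
  z_near : |‖D.z‖ ^ 2 - 1| ≤ Λ * D.del
  small : Λ * D.del ≤ 1 / 2
  u_swap : ∀ a : Idx n, D.u a.swap = D.u a
  F_eq : ∀ a : Idx n, D.F a.swap = D.u a * (D.η / D.ρ + ∑ b, symVar D.S a b * D.F b)
  det_eq : ∀ a : Idx n, D.ρ ^ 2 * (D.F a * D.F a.swap) + D.u a ^ 2 * ‖D.z‖ ^ 2 = D.u a
  sum_inl : ∑ i, D.F (Sum.inl i) = n * Real.pi
  sum_inr : ∑ i, D.F (Sum.inr i) = n * Real.pi
  perron : ∃ g : Idx n → ℝ, (∀ a, 0 < g a) ∧ ∀ a : Idx n, ∑ b, symVar D.S a b * g b = g a.swap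

variable {D : Data n} {Λ : ℝ}

namespace Regular

theorem Λ_pos (h : D.Regular Λ) : 0 < Λ := zero_lt_one.trans_le h.one_le

theorem n_pos' (h : D.Regular Λ) : (0 : ℝ) < n := by exact_mod_cast h.n_pos

theorem η_div_pos (h : D.Regular Λ) : 0 < D.η / D.ρ := div_pos h.η_pos h.ρ_pos

theorem del_pos (h : D.Regular Λ) : 0 < D.del :=
  add_pos_of_nonneg_of_pos (sq_nonneg _) h.η_div_pos

theorem del_le (h : D.Regular Λ) : D.del ≤ 1 / 2 := by
  have := h.small
  nlinarith [h.one_le, h.del_pos]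

theorem ρ_sq_le (h : D.Regular Λ) : D.ρ ^ 2 ≤ D.del := by
  have := h.η_div_pos
  unfold del; linarith

theorem η_div_le (D : Data n) : D.η / D.ρ ≤ D.del := by
  unfold del; nlinarith [sq_nonneg D.ρ]

theorem ρ_le_one (h : D.Regular Λ) : D.ρ ≤ 1 := by
  nlinarith [h.ρ_sq_le, h.del_le, h.ρ_pos]

theorem F_pos (h : D.Regular Λ) (a : Idx n) : 0 < D.F a :=
  (inv_pos.2 h.Λ_pos).trans_le (h.F_lower a)

theorem G_pos (h : D.Regular Λ) (a : Idx n) : 0 < D.G a := h.F_pos _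

theorem u_lower (h : D.Regular Λ) (a : Idx n) : 1 / 2 ≤ D.u a := by
  have := abs_le.1 (h.u_near a)
  linarith [h.small, this.1]

theorem u_pos (h : D.Regular Λ) (a : Idx n) : 0 < D.u a := by linarith [h.u_lower a]

theorem u_upper (h : D.Regular Λ) (a : Idx n) : D.u a ≤ 3 / 2 := by
  have := abs_le.1 (h.u_near a)
  linarith [h.small, this.2]

theorem z_sq_lower (h : D.Regular Λ) : 1 / 2 ≤ ‖D.z‖ ^ 2 := by
  have := abs_le.1 h.z_near
  linarith [h.small, this.1]

theorem z_sq_upper (h : D.Regular Λ) : ‖D.z‖ ^ 2 ≤ 3 / 2 := by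
  have := abs_le.1 h.z_near
  linarith [h.small, this.2]

theorem z_upper (h : D.Regular Λ) : ‖D.z‖ ≤ 2 := by
  nlinarith [h.z_sq_upper, norm_nonneg D.z]

theorem symVar_nonneg (h : D.Regular Λ) (a b : Idx n) : 0 ≤ symVar D.S a b := by
  have h0 : 0 ≤ Λ⁻¹ / n := div_nonneg (inv_nonneg.2 h.Λ_pos.le) h.n_pos'.le
  rcases a with i | i <;> rcases b with j | j <;> simp [symVar]
  exacts [h0.trans (h.S_lower _ _), h0.trans (h.S_lower _ _)]

theorem symVar_le (h : D.Regular Λ) (a b : Idx n) : symVar D.S a b ≤ Λ / n := by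
  have h0 : 0 ≤ Λ / n := div_nonneg h.Λ_pos.le h.n_pos'.le
  rcases a with i | i <;> rcases b with j | j <;> simp [symVar]
  exacts [h0, h.S_upper _ _, h.S_upper _ _, h0]

theorem symVar_sum_le (h : D.Regular Λ) (a : Idx n) : ∑ b, symVar D.S a b ≤ Λ := by
  have hn := h.n_pos'
  have key : ∀ f : Fin n → ℝ, (∀ i, f i ≤ Λ / n) → ∑ i, f i ≤ Λ := by
    intro f hf
    refine (Finset.sum_le_sum fun i _ => hf i).trans ?_
    simp only [Finset.sum_const, Finset.card_univ, Fintype.card_fin, nsmul_eq_mul]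
    rw [mul_div_cancel₀ _ hn.ne']
  rcases a with i | i <;> simp [symVar]
  exacts [key _ fun j => h.S_upper _ _, key _ fun j => h.S_upper _ _]

theorem norm_act_le (h : D.Regular Λ) {r : Idx n → ℂ} {c : ℝ} (hr : ∀ b, ‖r b‖ ≤ c)
    (a : Idx n) : ‖act D.S r a‖ ≤ Λ * c := by
  rw [act_apply]
  have hc : 0 ≤ c := (norm_nonneg _).trans (hr a)
  calc ‖∑ b, (symVar D.S a b : ℂ) * r b‖ ≤ ∑ b, symVar D.S a b * c := by
        refine (norm_sum_le _ _).trans (Finset.sum_le_sum fun b _ => ?_)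
        rw [norm_mul, norm_real, norm_of_nonneg (h.symVar_nonneg a b)]
        exact mul_le_mul_of_nonneg_left (hr b) (h.symVar_nonneg a b)
    _ ≤ Λ * c := by
        rw [← Finset.sum_mul]
        exact mul_le_mul_of_nonneg_right (h.symVar_sum_le a) hc

theorem norm_selfEnergy_le (h : D.Regular Λ) {R : Mat n} {c : ℝ} (hc : 0 ≤ c)
    (hr : ∀ b, ‖R b b‖ ≤ c) : ‖selfEnergy D.S R‖ ≤ Λ * c := by
  rw [selfEnergy_eq]
  exact norm_diagonal_le (mul_nonneg h.Λ_pos.le hc) fun a => h.norm_act_le hr a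

theorem norm_selfEnergy_le_norm (h : D.Regular Λ) (R : Mat n) :
    ‖selfEnergy D.S R‖ ≤ Λ * ‖R‖ :=
  h.norm_selfEnergy_le (norm_nonneg _) fun b => norm_entry_le R b b

theorem norm_M_le (h : D.Regular Λ) : ‖D.M‖ ≤ 4 * Λ := by
  have h1 : ‖(diagonal (fun a => I * D.ρ * D.F a) : Mat n)‖ ≤ Λ := by
    refine norm_diagonal_le h.Λ_pos.le fun a => ?_
    simp only [norm_mul, norm_I, one_mul, norm_real]
    rw [norm_of_nonneg h.ρ_pos.le, norm_of_nonneg (h.F_pos a).le]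
    nlinarith [h.ρ_le_one, h.F_upper a, h.F_pos a, h.ρ_pos]
  have h2 : ‖(diagonal (fun a => (D.u a : ℂ)) : Mat n)‖ ≤ 3 / 2 := by
    refine norm_diagonal_le (by norm_num) fun a => ?_
    rw [norm_real, norm_of_nonneg (h.u_pos a).le]
    exact h.u_upper a
  have h3 := (norm_offDiag_le (n := n) D.z).trans h.z_upper
  have h4 : ‖(diagonal (fun a => (D.u a : ℂ)) : Mat n) * offDiag n D.z‖ ≤ 3 := by
    refine (norm_mul_le _ _).trans ?_
    nlinarith [norm_nonneg (diagonal (fun a => (D.u a : ℂ)) : Mat n),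
      norm_nonneg (offDiag n D.z)]
  unfold Data.M
  refine (norm_sub_le _ _).trans ?_
  linarith [h.one_le]

theorem u_comp_swap (h : D.Regular Λ) :
    (fun a : Idx n => (D.u a : ℂ)) ∘ Sum.swap = fun a => (D.u a : ℂ) := by
  funext a; simp [h.u_swap]

theorem offDiag_mul_u (h : D.Regular Λ) :
    offDiag n D.z * diagonal (fun a => (D.u a : ℂ))
      = diagonal (fun a => (D.u a : ℂ)) * offDiag n D.z := by
  rw [offDiag_mul_diagonal, h.u_comp_swap]

theorem act_F (h : D.Regular Λ) (a : Idx n) :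
    act D.S (fun b => (D.F b : ℂ)) a = D.G a / D.u a - (D.η / D.ρ : ℝ) := by
  have h1 : ∑ b, symVar D.S a b * D.F b = D.G a / D.u a - D.η / D.ρ := by
    have := h.F_eq a
    have h2 := (h.u_pos a).ne'
    rw [eq_sub_iff_add_eq, eq_div_iff h2, Data.G, this]
    ring
  rw [act_apply]
  have h2 := congrArg (fun x : ℝ => (x : ℂ)) h1
  push_cast at h2 ⊢
  exact h2

/-- The diagonal of `M diag(y) M`. -/
theorem diag_M_mul_diagonal_mul_M (h : D.Regular Λ) (y : Idx n → ℂ) (a : Idx n) :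
    (D.M * diagonal y * D.M) a a
      = -(D.ρ ^ 2 * D.F a ^ 2 : ℝ) * y a + (‖D.z‖ ^ 2 * D.u a ^ 2 : ℝ) * y a.swap := by
  set d : Idx n → ℂ := fun a => I * D.ρ * D.F a with hd
  set U : Mat n := diagonal (fun a => (D.u a : ℂ)) with hU
  set Z := offDiag n D.z with hZ
  have h1 : D.M * diagonal y * D.M
      = diagonal d * diagonal y * diagonal d
        + U * (Z * diagonal y) * Z * U
        - diagonal d * diagonal y * U * Z
        - U * (Z * diagonal y) * diagonal d := by
    have : D.M = diagonal d - U * Z := rfl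
    rw [this]
    have h2 : Z * U = U * Z := h.offDiag_mul_u
    rw [Matrix.mul_assoc (U * (Z * diagonal y)) Z U, h2]
    noncomm_ring
  have h3 : U * (Z * diagonal y) * Z * U
      = diagonal (fun a => (D.u a : ℂ)) * diagonal (y ∘ Sum.swap)
        * (((‖D.z‖ ^ 2 : ℝ) : ℂ) • 1) * diagonal (fun a => (D.u a : ℂ)) := by
    rw [offDiag_mul_diagonal, ← offDiag_mul_self, ← hU]
    simp only [Matrix.mul_assoc]
    rfl
  rw [h1, h3, offDiag_mul_diagonal, hU, hZ]
  simp only [diagonal_mul_diagonal, Matrix.mul_smul, Matrix.mul_one, Matrix.smul_mul,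
    ← Matrix.mul_assoc, Matrix.sub_apply, Matrix.add_apply, diagonal_mul,
    Matrix.mul_diagonal, diagonal_apply_eq, Matrix.smul_apply, offDiag_diag, hd]
  simp only [smul_eq_mul, Function.comp_apply, mul_zero, zero_mul, sub_zero]
  push_cast
  linear_combination (D.ρ ^ 2 * D.F a ^ 2 * y a : ℂ) * Complex.I_sq

end Regular

end Data

end

/-! ### The structure of the solution of the Dyson equation -/

theorem norm_offDiag_sq_mul (z : ℂ) : (z * conj z) = ((‖z‖ ^ 2 : ℝ) : ℂ) := by
  simp [Complex.mul_conj']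

theorem act_re (S : Matrix (Fin n) (Fin n) ℝ) (m : Idx n → ℂ) (a : Idx n) :
    (act S m a).re = ∑ b, symVar S a b * (m b).re := by
  rw [act_apply, Complex.re_sum]; simp

theorem act_im (S : Matrix (Fin n) (Fin n) ℝ) (m : Idx n → ℂ) (a : Idx n) :
    (act S m a).im = ∑ b, symVar S a b * (m b).im := by
  rw [act_apply, Complex.im_sum]; simp

theorem matIm_diag_re (M : Mat n) (a : Idx n) : (matIm M a a).re = (M a a).im := by
  have : M a a - conj (M a a) = (2 * (M a a).im : ℝ) * I := Complex.sub_conj _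
  simp only [matIm, Matrix.smul_apply, Matrix.sub_apply, conjTranspose_apply, smul_eq_mul]
  rw [← starRingEnd_apply, this]
  have hI := Complex.I_ne_zero
  have : (2 * I)⁻¹ * ((2 * (M a a).im : ℝ) * I) = ((M a a).im : ℂ) := by
    push_cast
    field_simp
  rw [this, Complex.ofReal_re]

/-- A solution with vanishing real part on the diagonal: the diagonal entries of the solution of
the Dyson equation are purely imaginary. -/
theorem re_eq_zero_of_recursion {S : Matrix (Fin n) (Fin n) ℝ} (hS : ∀ a b, 0 ≤ symVar S a b)
    {η : ℝ} (hη : 0 < η) {x y g h : Idx n → ℝ} (hy : ∀ a, 0 < y a) (hg : ∀ a, 0 < g a)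
    (hh : ∀ a, 0 ≤ h a)
    (hx : ∀ a : Idx n, x a = -(g a * ∑ b, symVar S a b * x b)
      + h a * ∑ b, symVar S a.swap b * x b)
    (hy' : ∀ a : Idx n, y a = g a * (η + ∑ b, symVar S a b * y b)
      + h a * (η + ∑ b, symVar S a.swap b * y b)) : x = 0 := by
  rcases isEmpty_or_nonempty (Idx n) with hE | hE
  · exact Subsingleton.elim _ _
  obtain ⟨a, ha⟩ := Finite.exists_max (fun a => |x a| / y a)
  set θ := |x a| / y a with hθ
  have hle : ∀ b, |x b| ≤ θ * y b := fun b => (div_le_iff₀ (hy b)).1 (ha b)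
  have hθ0 : 0 ≤ θ := div_nonneg (abs_nonneg _) (hy a).le
  have hsum : ∀ c, |∑ b, symVar S c b * x b| ≤ θ * ∑ b, symVar S c b * y b := by
    intro c
    rw [Finset.mul_sum]
    refine (Finset.abs_sum_le_sum_abs _ _).trans (Finset.sum_le_sum fun b _ => ?_)
    rw [abs_mul, abs_of_nonneg (hS c b)]
    nlinarith [hle b, hS c b]
  have h1 : |x a| ≤ θ * (y a - η * (g a + h a)) := by
    have e1 : |x a| ≤ g a * |∑ b, symVar S a b * x b| + h a * |∑ b, symVar S a.swap b * x b| := by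
      conv_lhs => rw [hx a]
      refine (abs_add_le _ _).trans ?_
      rw [abs_neg, abs_mul, abs_mul, abs_of_pos (hg a), abs_of_nonneg (hh a)]
    have e2 := mul_le_mul_of_nonneg_left (hsum a) (hg a).le
    have e3 := mul_le_mul_of_nonneg_left (hsum a.swap) (hh a)
    have e4 := hy' a
    nlinarith
  have h2 : |x a| = θ * y a := by rw [hθ, div_mul_cancel₀ _ (hy a).ne']
  have h3 : θ = 0 := by
    by_contra hne
    have : 0 < θ := lt_of_le_of_ne hθ0 (Ne.symm hne)
    have : 0 < θ * (η * (g a + h a)) := by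
      have := hg a; have := hh a
      positivity
    nlinarith
  ext b
  have := hle b
  rw [h3, zero_mul] at this
  exact abs_nonpos_iff.1 this

theorem exists_dyson_parametrization {S : Matrix (Fin n) (Fin n) ℝ}
    (hS : ∀ a b, 0 ≤ symVar S a b) {z : ℂ} {η : ℝ} (hη : 0 < η) {M : Mat n}
    (hM : IsDysonSolution S z η M) :
    ∃ v u : Idx n → ℝ, (∀ a, 0 < v a) ∧ (∀ a, 0 < u a) ∧ (∀ a : Idx n, u a.swap = u a) ∧
      (∀ a, M a a = I * v a) ∧
      M = diagonal (fun a => I * v a)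
        - diagonal (fun a => (u a : ℂ)) * offDiag n z ∧
      (∀ a : Idx n, v a.swap = u a * (η + ∑ b, symVar S a b * v b)) ∧
      (∀ a : Idx n, u a * ((η + ∑ b, symVar S a b * v b) * (η + ∑ b, symVar S a.swap b * v b)
        + ‖z‖ ^ 2) = 1) := by
  set m : Idx n → ℂ := M.diag with hm
  set y : Idx n → ℝ := fun a => (m a).im with hy
  set x : Idx n → ℝ := fun a => (m a).re with hx
  have hypos : ∀ a, 0 < y a := by
    intro a
    have h1 := (Complex.lt_def.1 (hM.posDef.diag_pos (i := a))).1
    rwa [matIm_diag_re] at h1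
  set α : Idx n → ℂ := fun a => I * η + act S m a with hα
  have hαre : ∀ a, (α a).re = ∑ b, symVar S a b * x b := by
    intro a; simp [hα, act_re, hx]
  have hαim : ∀ a, (α a).im = η + ∑ b, symVar S a b * y b := by
    intro a; simp [hα, act_im, hy]
  have hαpos : ∀ a, 0 < (α a).im := by
    intro a
    rw [hαim]
    exact add_pos_of_pos_of_nonneg hη
      (Finset.sum_nonneg fun b _ => mul_nonneg (hS a b) (hypos b).le)
  have hα0 : ∀ a, α a ≠ 0 := fun a h => by
    have := hαpos a; rw [h] at this; simp at this
  set N : Mat n := diagonal α + offDiag n z with hN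
  have hNeq : spectralMat n z η + selfEnergy S M = N := by
    rw [spectralMat_eq, selfEnergy_eq, hN]
    ext a b
    simp [hα, diagonal_apply, Matrix.one_apply]
    split_ifs <;> ring
  have hdet : IsUnit M.det := (Matrix.isUnit_iff_isUnit_det _).1 hM.isUnit
  have hNM : N * M = -1 := by
    rw [← hNeq, ← hM.equation, Matrix.neg_mul, Matrix.nonsing_inv_mul _ hdet]
  set d : Idx n → ℂ := fun a => α a * α a.swap - (‖z‖ ^ 2 : ℝ) with hd
  set Q : Mat n := offDiag n z - diagonal (α ∘ Sum.swap) with hQ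
  have hQN : Q * N = -diagonal d := by
    rw [hQ, hN, Matrix.sub_mul, Matrix.mul_add, Matrix.mul_add, offDiag_mul_self,
      offDiag_mul_diagonal, diagonal_mul_diagonal]
    have : diagonal d = diagonal (fun a => (α ∘ Sum.swap) a * α a)
        - ((‖z‖ ^ 2 : ℝ) : ℂ) • (1 : Mat n) := by
      ext a b
      simp [hd, diagonal_apply, Matrix.one_apply]
      split_ifs <;> ring
    rw [this]
    abel
  have hQd : Q = diagonal d * M := by
    have : Q * (N * M) = -(diagonal d * M) := by
      rw [← Matrix.mul_assoc, hQN, Matrix.neg_mul]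
    rw [hNM] at this
    simpa using this
  have hd0 : ∀ a, d a ≠ 0 := by
    intro a h0
    have h1 := congrFun (congrFun hQd a) a
    rw [diagonal_mul, h0, zero_mul] at h1
    simp only [hQ, Matrix.sub_apply, offDiag_diag, diagonal_apply_eq, zero_sub,
      Function.comp_apply, neg_eq_zero] at h1
    exact hα0 _ h1
  have hma : ∀ a, d a * m a = -α a.swap := by
    intro a
    have h1 := congrFun (congrFun hQd a) a
    rw [diagonal_mul] at h1
    simp only [hQ, Matrix.sub_apply, offDiag_diag, diagonal_apply_eq, zero_sub,
      Function.comp_apply] at h1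
    exact h1.symm
  have hdn : ∀ a, 0 < ‖d a‖ ^ 2 := fun a => by have := norm_pos_iff.2 (hd0 a); positivity
  have hm2 : ∀ a, ((‖d a‖ ^ 2 : ℝ) : ℂ) * m a
      = -(‖α a.swap‖ ^ 2 : ℝ) * conj (α a) + (‖z‖ ^ 2 : ℝ) * α a.swap := by
    intro a
    have h1 : conj (d a) = conj (α a) * conj (α a.swap) - (‖z‖ ^ 2 : ℝ) := by
      simp [hd]
    rw [← norm_offDiag_sq_mul (d a), ← norm_offDiag_sq_mul (α a.swap)]
    linear_combination (conj (d a)) * hma a - α a.swap * h1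
  have hre : ∀ a, ‖d a‖ ^ 2 * x a = -(‖α a.swap‖ ^ 2) * (α a).re + ‖z‖ ^ 2 * (α a.swap).re := by
    intro a
    have := congrArg Complex.re (hm2 a)
    simpa [hx, -Complex.ofReal_pow, ← Complex.ofReal_neg] using this
  have him : ∀ a, ‖d a‖ ^ 2 * y a = (‖α a.swap‖ ^ 2) * (α a).im + ‖z‖ ^ 2 * (α a.swap).im := by
    intro a
    have := congrArg Complex.im (hm2 a)
    simpa [hy, -Complex.ofReal_pow, ← Complex.ofReal_neg] using this
  have hx0 : x = 0 := by
    refine re_eq_zero_of_recursion hS hη (g := fun a => ‖α a.swap‖ ^ 2 / ‖d a‖ ^ 2)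
      (h := fun a => ‖z‖ ^ 2 / ‖d a‖ ^ 2) hypos (fun a => ?_) (fun a => by positivity)
      (fun a => ?_) (fun a => ?_)
    · have := norm_pos_iff.2 (hα0 a.swap)
      have := hdn a
      positivity
    · have h1 := hre a
      have h2 : ‖d a‖ ≠ 0 := norm_ne_zero_iff.2 (hd0 a)
      rw [hαre, hαre] at h1
      rw [eq_comm, ← mul_left_cancel_iff_of_pos (hdn a), h1]
      field_simp
    · have h1 := him a
      have h2 : ‖d a‖ ≠ 0 := norm_ne_zero_iff.2 (hd0 a)
      rw [hαim, hαim] at h1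
      rw [eq_comm, ← mul_left_cancel_iff_of_pos (hdn a), h1]
      field_simp
  have hmI : ∀ a, m a = I * y a := by
    intro a
    apply Complex.ext
    · simpa [hx] using congrFun hx0 a
    · simp [hy]
  set A : Idx n → ℝ := fun a => η + ∑ b, symVar S a b * y b with hA
  have hApos : ∀ a, 0 < A a := fun a => by rw [hA]; simpa [hαim] using hαpos a
  have hαA : ∀ a, α a = I * A a := by
    intro a
    apply Complex.ext
    · rw [hαre]; simp [hx0]
    · rw [hαim]; simp [hA]
  have hD : ∀ a : Idx n, 0 < A a * A a.swap + ‖z‖ ^ 2 := fun a => by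
    have := hApos a; have := hApos a.swap; positivity
  have hdA : ∀ a, d a = -((A a * A a.swap + ‖z‖ ^ 2 : ℝ) : ℂ) := by
    intro a
    simp only [hd, hαA]
    push_cast
    linear_combination (A a * A a.swap : ℂ) * Complex.I_sq
  set u : Idx n → ℝ := fun a => (A a * A a.swap + ‖z‖ ^ 2)⁻¹ with hu
  have hy2 : ∀ a : Idx n, y a = u a * A a.swap := by
    intro a
    have h1 := hma a
    rw [hdA, hmI, hαA] at h1
    have h2 : I * (((A a * A a.swap + ‖z‖ ^ 2) * y a : ℝ) : ℂ)
        = I * (A a.swap : ℂ) := by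
      push_cast at h1 ⊢
      linear_combination -h1
    have h3 := mul_left_cancel₀ Complex.I_ne_zero h2
    have h4 : (A a * A a.swap + ‖z‖ ^ 2) * y a = A a.swap := by exact_mod_cast h3
    rw [hu]
    have := (hD a).ne'
    field_simp
    linarith
  refine ⟨y, u, hypos, fun a => inv_pos.2 (hD a), fun a => ?_, hmI, ?_, fun a => ?_, fun a => ?_⟩
  · simp [hu, mul_comm]
  · have h1 : M = diagonal (fun a => (d a)⁻¹) * Q := by
      rw [hQd, ← Matrix.mul_assoc, diagonal_mul_diagonal]
      have : (fun a => (d a)⁻¹ * d a) = fun _ => (1 : ℂ) := by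
        funext a; exact inv_mul_cancel₀ (hd0 a)
      rw [this, diagonal_one, Matrix.one_mul]
    have h2 : ∀ a, (d a)⁻¹ = -(u a : ℂ) := by
      intro a
      rw [hdA, hu]
      push_cast
      rw [inv_neg]
    rw [h1, hQ, Matrix.mul_sub, diagonal_mul_diagonal]
    have h3 : (diagonal fun a => (d a)⁻¹ * (α ∘ Sum.swap) a)
        = -diagonal (fun a : Idx n => I * (y a : ℂ)) := by
      rw [diagonal_neg]
      congr 1
      funext a
      simp only [Function.comp_apply, h2, hαA, hy2 a]
      push_cast
      ring
    have h4 : (diagonal fun a => (d a)⁻¹) = -diagonal (fun a => (u a : ℂ)) := by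
      rw [diagonal_neg]
      congr 1
      funext a
      exact h2 a
    rw [h3, h4]
    rw [Matrix.neg_mul]
    abel
  · have := hy2 a.swap
    rw [Sum.swap_swap] at this
    rw [this]
    simp [hu, hA, mul_comm]
  · exact inv_mul_cancel₀ (hD a).ne'

theorem symVar_sum_inl (S : Matrix (Fin n) (Fin n) ℝ) (i : Fin n) (y : Idx n → ℝ) :
    ∑ b, symVar S (Sum.inl i) b * y b = ∑ j, S i j * y (Sum.inr j) := by
  simp [symVar]

theorem symVar_sum_inr (S : Matrix (Fin n) (Fin n) ℝ) (i : Fin n) (y : Idx n → ℝ) :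
    ∑ b, symVar S (Sum.inr i) b * y b = ∑ j, S j i * y (Sum.inl j) := by
  simp [symVar]

theorem spectralRadius_transpose (A : Matrix (Fin n) (Fin n) ℂ) :
    spectralRadius ℂ Aᵀ = spectralRadius ℂ A := by
  have : spectrum ℂ Aᵀ = spectrum ℂ A := by
    ext k
    rw [spectrum.mem_iff, spectrum.mem_iff, ← Matrix.isUnit_transpose (A := _ - A)]
    rw [Matrix.transpose_sub, Algebra.algebraMap_eq_smul_one, Matrix.transpose_smul,
      Matrix.transpose_one]
  simp [spectralRadius, this]

theorem exists_perron_pair (S : Matrix (Fin n) (Fin n) ℝ) (hn : 0 < n)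
    (hpos : ∀ i j, 0 < S i j) (hrad : spectralRadius ℂ (S.map Complex.ofReal) = 1) :
    ∃ g : Idx n → ℝ, (∀ a, 0 < g a) ∧ ∀ a : Idx n, ∑ b, symVar S a b * g b = g a.swap := by
  obtain ⟨r, hr, hr'⟩ := exists_perron_vector S hn hpos hrad
  obtain ⟨l, hl, hl'⟩ := exists_perron_vector Sᵀ hn (fun i j => hpos j i)
    (by rw [Matrix.transpose_map, spectralRadius_transpose, hrad])
  refine ⟨Sum.elim l r, fun a => by rcases a with i | i <;> simp [hr, hl], fun a => ?_⟩
  rcases a with i | i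
  · rw [symVar_sum_inl]
    simpa [mulVec, dotProduct] using congrFun hr' i
  · rw [symVar_sum_inr]
    simpa [mulVec, dotProduct] using congrFun hl' i

theorem rho_eq_of_diag {M : Mat n} {v : Idx n → ℝ} (hM : ∀ a, M a a = I * v a) :
    2 * n * (Real.pi * rho M) = ∑ a, v a := by
  have h1 : (avg (matIm M)).re = (2 * n : ℝ)⁻¹ * ∑ a, v a := by
    unfold avg Matrix.trace
    have : (2 * n : ℂ)⁻¹ = (((2 * n : ℝ)⁻¹ : ℝ) : ℂ) := by push_cast; rfl
    rw [this, Complex.re_ofReal_mul, Complex.re_sum]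
    congr 1
    refine Finset.sum_congr rfl fun a _ => ?_
    rw [diag_apply, matIm_diag_re, hM]
    simp
  rw [rho, h1]
  rcases Nat.eq_zero_or_pos n with rfl | hn
  · simp
  have : (n : ℝ) ≠ 0 := by positivity
  have := Real.pi_ne_zero
  field_simp

set_option maxHeartbeats 2000000 in
theorem exists_regular_data (s_lo s_hi τ : ℝ) (hs_lo : 0 < s_lo) (hs : s_lo < s_hi) (hτ : 1 < τ) :
    ∃ Λ ρ₀ : ℝ, 1 ≤ Λ ∧ 0 < ρ₀ ∧ ρ₀ ≤ 1 ∧ ∀ {n : ℕ}, 0 < n → ∀ S : Matrix (Fin n) (Fin n) ℝ,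
      (∀ i j, s_lo / n ≤ S i j) → (∀ i j, S i j ≤ s_hi / n) →
      spectralRadius ℂ (S.map Complex.ofReal) = 1 → ∀ z : ℂ, ‖z‖ < τ → ∀ η : ℝ, 0 < η →
      ∀ M : Mat n, IsDysonSolution S z η M → rho M + η / rho M ≤ ρ₀ →
      ∃ D : Data n, D.Regular Λ ∧ D.S = S ∧ D.z = z ∧ D.η = η ∧ D.ρ = rho M ∧ D.M = M := by
  have hs_hi : 0 < s_hi := hs_lo.trans hs
  have hpi := Real.pi_pos
  obtain ⟨q, hq⟩ : ∃ x : ℝ, x = s_hi * Real.pi + 1 := ⟨_, rfl⟩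
  have hq0 : 0 < q := by rw [hq]; positivity
  obtain ⟨c₂, hc₂⟩ : ∃ x : ℝ, x = s_lo * Real.pi / (q ^ 2 + τ ^ 2) := ⟨_, rfl⟩
  have hc₂0 : 0 < c₂ := by rw [hc₂]; positivity
  obtain ⟨Λ, hΛ⟩ : ∃ x : ℝ, x = 1 + s_hi + s_lo⁻¹ + c₂⁻¹ + 2 * q + 2 * (q ^ 2 + (q ^ 2 + c₂⁻¹)) := ⟨_, rfl⟩
  have hi1 : 0 < s_lo⁻¹ := inv_pos.2 hs_lo
  have hi2 : 0 < c₂⁻¹ := inv_pos.2 hc₂0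
  have hΛ1 : 1 ≤ Λ := by rw [hΛ]; linarith [sq_nonneg q]
  have hΛ0 : 0 < Λ := by linarith
  refine ⟨Λ, 1 / (2 * Λ), hΛ1, by positivity, ?_, ?_⟩
  · rw [div_le_one (by positivity)]; linarith
  intro n hn S hlo hhi hrad z hz η hη M hM hρ
  have hn' : (0 : ℝ) < n := by exact_mod_cast hn
  have hSpos : ∀ i j, 0 < S i j := fun i j => lt_of_lt_of_le (by positivity) (hlo i j)
  have hsym : ∀ a b, 0 ≤ symVar S a b := by
    intro a b
    rcases a with i | i <;> rcases b with j | j <;> simp [symVar, (hSpos _ _).le]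
  obtain ⟨v, u, hv, hu, hus, hdiag, hMeq, hvs, hdet⟩ := exists_dyson_parametrization hsym hη hM
  obtain ⟨g, hg, hgs⟩ := exists_perron_pair S hn hSpos hrad
  have hrho := rho_eq_of_diag hdiag
  obtain ⟨ρ, hρdef⟩ : ∃ x : ℝ, x = rho M := ⟨_, rfl⟩
  rw [← hρdef] at hρ hrho ⊢
  have hswapsum : ∑ i, v (Sum.inl i) = ∑ i, v (Sum.inr i) := by
    have h1 : ∀ a : Idx n, v a * (η + ∑ b, symVar S a b * v b)
        = v a.swap * (η + ∑ b, symVar S a.swap b * v b) := by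
      intro a
      have e1 := hvs a
      have e2 := hvs a.swap
      rw [Sum.swap_swap, hus] at e2
      rw [e1, e2]; ring
    have h2 : ∑ i, v (Sum.inl i) * (η + ∑ j, S i j * v (Sum.inr j))
        = ∑ i, v (Sum.inr i) * (η + ∑ j, S j i * v (Sum.inl j)) := by
      refine Finset.sum_congr rfl fun i _ => ?_
      have := h1 (Sum.inl i)
      rwa [symVar_sum_inl, Sum.swap_inl, symVar_sum_inr] at this
    have h3 : ∑ i, v (Sum.inl i) * ∑ j, S i j * v (Sum.inr j)
        = ∑ i, v (Sum.inr i) * ∑ j, S j i * v (Sum.inl j) := by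
      simp only [Finset.mul_sum]
      rw [Finset.sum_comm]
      exact Finset.sum_congr rfl fun i _ => Finset.sum_congr rfl fun j _ => by ring
    simp only [mul_add, Finset.sum_add_distrib, ← Finset.sum_mul] at h2
    rw [h3] at h2
    exact mul_right_cancel₀ hη.ne' (add_right_cancel h2)
  have hsumr : ∑ i, v (Sum.inr i) = n * Real.pi * ρ := by
    rw [Fintype.sum_sum_type, hswapsum] at hrho
    linarith
  have hsuml : ∑ i, v (Sum.inl i) = n * Real.pi * ρ := by rw [hswapsum, hsumr]
  have hρ0 : 0 < ρ := by
    have h1 : 0 < ∑ i, v (Sum.inr i) :=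
      Finset.sum_pos (fun i _ => hv _) ⟨⟨0, hn⟩, Finset.mem_univ _⟩
    rw [hsumr] at h1
    exact pos_of_mul_pos_right h1 (by positivity)
  have he0 : 0 < η / ρ := div_pos hη hρ0
  have hρs : ρ + η / ρ ≤ 1 / 2 := hρ.trans (by
    rw [div_le_div_iff₀ (by positivity) (by positivity)]; linarith)
  obtain ⟨δ, hδ⟩ : ∃ x : ℝ, x = ρ ^ 2 + η / ρ := ⟨_, rfl⟩
  have hδ0 : 0 < δ := by rw [hδ]; positivity
  have hδΛ : Λ * δ ≤ 1 / 2 := by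
    have h1 : δ ≤ 1 / (2 * Λ) := le_trans (by rw [hδ]; linarith [mul_le_mul_of_nonneg_left (show ρ ≤ 1 by linarith) hρ0.le, sq ρ]) hρ
    calc Λ * δ ≤ Λ * (1 / (2 * Λ)) := by gcongr
      _ = 1 / 2 := by field_simp
  have hηρ : η ≤ ρ := by
    have : η / ρ ≤ 1 := by linarith
    rwa [div_le_one hρ0] at this
  obtain ⟨A, hA⟩ : ∃ A : Idx n → ℝ, ∀ a, A a = η + ∑ b, symVar S a b * v b := ⟨_, fun _ => rfl⟩
  simp only [← hA] at hdet
  have hflat : ∀ f w : Fin n → ℝ, (∀ j, s_lo / n ≤ f j) → (∀ j, f j ≤ s_hi / n) →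
      (∀ j, 0 < w j) → ∑ j, w j = n * Real.pi * ρ →
      s_lo * Real.pi * ρ ≤ ∑ j, f j * w j ∧ ∑ j, f j * w j ≤ s_hi * Real.pi * ρ := by
    intro f w h1 h2 h3 h4
    constructor
    · calc s_lo * Real.pi * ρ = ∑ j, s_lo / n * w j := by
            rw [← Finset.mul_sum, h4]; field_simp
        _ ≤ _ := Finset.sum_le_sum fun j _ => mul_le_mul_of_nonneg_right (h1 j) (h3 j).le
    · calc _ ≤ ∑ j, s_hi / n * w j :=
            Finset.sum_le_sum fun j _ => mul_le_mul_of_nonneg_right (h2 j) (h3 j).le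
        _ = s_hi * Real.pi * ρ := by
            rw [← Finset.mul_sum, h4]; field_simp
  have hAb : ∀ a, s_lo * Real.pi * ρ ≤ A a ∧ A a ≤ q * ρ := by
    intro a
    have : s_lo * Real.pi * ρ ≤ ∑ b, symVar S a b * v b ∧
        ∑ b, symVar S a b * v b ≤ s_hi * Real.pi * ρ := by
      rcases a with i | i
      · rw [symVar_sum_inl]
        exact hflat _ _ (fun j => hlo i j) (fun j => hhi i j) (fun j => hv _) hsumr
      · rw [symVar_sum_inr]
        exact hflat _ _ (fun j => hlo j i) (fun j => hhi j i) (fun j => hv _) hsuml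
    constructor
    · rw [hA]; linarith [this.1]
    · rw [hA, hq]; linarith [this.2]
  have hApos : ∀ a, 0 < A a := fun a => lt_of_lt_of_le (by positivity) (hAb a).1
  have hAA : ∀ a : Idx n, A a * A a.swap ≤ q ^ 2 * ρ ^ 2 := by
    intro a
    calc A a * A a.swap ≤ (q * ρ) * (q * ρ) :=
          mul_le_mul (hAb a).2 (hAb _).2 (hApos _).le (by positivity)
      _ = q ^ 2 * ρ ^ 2 := by ring
  have hAA0 : ∀ a : Idx n, 0 < A a * A a.swap := fun a => mul_pos (hApos _) (hApos _)
  have hui : ∀ a, (u a)⁻¹ = A a * A a.swap + ‖z‖ ^ 2 := fun a => inv_eq_of_mul_eq_one_right (hdet a)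
  have hulow : ∀ a, (q ^ 2 + τ ^ 2)⁻¹ ≤ u a := by
    intro a
    rw [inv_le_comm₀ (by positivity) (hu a), hui]
    have h1 := hAA a
    have h2 : ‖z‖ ^ 2 ≤ τ ^ 2 := by gcongr
    have h3 : ρ ^ 2 ≤ 1 := pow_le_one₀ hρ0.le (by linarith)
    linarith [mul_le_mul_of_nonneg_left h3 (sq_nonneg q)]
  have hvlow : ∀ a, c₂ * ρ ≤ v a := by
    intro a
    have e := hvs a.swap
    rw [Sum.swap_swap] at e
    rw [e, hc₂, ← hA]
    calc s_lo * Real.pi / (q ^ 2 + τ ^ 2) * ρ = (q ^ 2 + τ ^ 2)⁻¹ * (s_lo * Real.pi * ρ) := by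
          field_simp
      _ ≤ u a.swap * A a.swap :=
          mul_le_mul (hulow _) (hAb _).1 (by positivity) (hu _).le
  have hpair : ∑ i, g (Sum.inl i) * v (Sum.inr i) * ((u (Sum.inl i))⁻¹ - 1)
      = η * ∑ i, g (Sum.inl i) := by
    have h1 : ∀ i, g (Sum.inl i) * v (Sum.inr i) * (u (Sum.inl i))⁻¹
        = g (Sum.inl i) * η + g (Sum.inl i) * ∑ j, S i j * v (Sum.inr j) := by
      intro i
      have e := hvs (Sum.inl i)
      rw [Sum.swap_inl, symVar_sum_inl] at e
      have := (hu (Sum.inl i)).ne'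
      rw [e]; field_simp
    have h2 : ∑ i, g (Sum.inl i) * ∑ j, S i j * v (Sum.inr j)
        = ∑ i, g (Sum.inl i) * v (Sum.inr i) := by
      simp only [Finset.mul_sum]
      rw [Finset.sum_comm]
      refine Finset.sum_congr rfl fun j _ => ?_
      have e := hgs (Sum.inr j)
      rw [symVar_sum_inr, Sum.swap_inr] at e
      rw [← e, Finset.sum_mul]
      exact Finset.sum_congr rfl fun i _ => by ring
    simp only [mul_sub, mul_one, Finset.sum_sub_distrib, h1, Finset.sum_add_distrib, h2]
    rw [← Finset.sum_mul]; ring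
  have hgsum : 0 < ∑ i, g (Sum.inl i) :=
    Finset.sum_pos (fun i _ => hg _) ⟨⟨0, hn⟩, Finset.mem_univ _⟩
  have hgv : c₂ * ρ * ∑ i, g (Sum.inl i) ≤ ∑ i, g (Sum.inl i) * v (Sum.inr i) := by
    rw [Finset.mul_sum]
    exact Finset.sum_le_sum fun i _ => by
      rw [mul_comm]; exact mul_le_mul_of_nonneg_left (hvlow (Sum.inr i)) (hg (Sum.inl i)).le
  have hgv0 : 0 < ∑ i, g (Sum.inl i) * v (Sum.inr i) := lt_of_lt_of_le (by positivity) hgv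
  obtain ⟨Y, hY⟩ : ∃ x : ℝ, x = ‖z‖ ^ 2 - 1 := ⟨_, rfl⟩
  have hpair2 : ∑ i, g (Sum.inl i) * v (Sum.inr i) * (A (Sum.inl i) * A (Sum.inr i))
      + Y * ∑ i, g (Sum.inl i) * v (Sum.inr i) = η * ∑ i, g (Sum.inl i) := by
    rw [← hpair, Finset.mul_sum, ← Finset.sum_add_distrib]
    refine Finset.sum_congr rfl fun i _ => ?_
    rw [hui, Sum.swap_inl, hY]; ring
  have hAAsum : ∑ i, g (Sum.inl i) * v (Sum.inr i) * (A (Sum.inl i) * A (Sum.inr i))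
      ≤ q ^ 2 * ρ ^ 2 * ∑ i, g (Sum.inl i) * v (Sum.inr i) := by
    rw [Finset.mul_sum]
    refine Finset.sum_le_sum fun i _ => ?_
    have := hAA (Sum.inl i)
    rw [Sum.swap_inl] at this
    have h2 : 0 < g (Sum.inl i) * v (Sum.inr i) := mul_pos (hg _) (hv _)
    linarith [mul_le_mul_of_nonneg_left this h2.le]
  have hAAsum0 : 0 ≤ ∑ i, g (Sum.inl i) * v (Sum.inr i) * (A (Sum.inl i) * A (Sum.inr i)) :=
    Finset.sum_nonneg fun i _ => (mul_pos (mul_pos (hg _) (hv _)) (hAA0 (Sum.inl i))).le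
  have hYlow : -(q ^ 2 * ρ ^ 2) ≤ Y := by
    by_contra hcon
    push Not at hcon
    have : 0 < η * ∑ i, g (Sum.inl i) := by positivity
    linarith [mul_lt_mul_of_pos_right hcon hgv0]
  have hYup : Y ≤ c₂⁻¹ * (η / ρ) := by
    by_contra hcon
    push Not at hcon
    have h1 : Y * (c₂ * ρ * ∑ i, g (Sum.inl i)) ≤ η * ∑ i, g (Sum.inl i) := by
      have h0 : 0 < Y := lt_trans (by positivity) hcon
      linarith [mul_le_mul_of_nonneg_left hgv h0.le]
    have h2 : c₂⁻¹ * (η / ρ) * (c₂ * ρ * ∑ i, g (Sum.inl i)) = η * ∑ i, g (Sum.inl i) := by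
      field_simp
    have h3 : 0 < c₂ * ρ * ∑ i, g (Sum.inl i) := by positivity
    linarith [mul_lt_mul_of_pos_right hcon h3]
  have hYabs : |Y| ≤ (q ^ 2 + c₂⁻¹) * δ := by
    have e1 := mul_nonneg (sq_nonneg q) he0.le
    have e2 := mul_nonneg hi2.le he0.le
    have e3 := mul_nonneg (sq_nonneg q) (sq_nonneg ρ)
    have e4 := mul_nonneg hi2.le (sq_nonneg ρ)
    rw [abs_le, hδ]
    constructor <;> linarith
  have hq2Λ : q ^ 2 + (q ^ 2 + c₂⁻¹) ≤ Λ / 2 := by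
    rw [hΛ]; linarith [sq_nonneg q]
  have hzlow : 1 / 2 ≤ ‖z‖ ^ 2 := by
    have h1 := (abs_le.1 hYabs).1
    have h2 : (q ^ 2 + c₂⁻¹) * δ ≤ Λ * δ := by
      apply mul_le_mul_of_nonneg_right _ hδ0.le
      linarith [sq_nonneg q]
    linarith
  have hu2 : ∀ a, u a ≤ 2 := by
    intro a
    have h1 := hdet a
    have h2 := hAA0 a
    have h4 := mul_pos (hu a) h2
    have h5 := mul_le_mul_of_nonneg_left hzlow (hu a).le
    linarith
  have hunear : ∀ a, |u a - 1| ≤ Λ * δ := by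
    intro a
    have h1 : u a * (A a * A a.swap + Y) = 1 - u a := by
      have h1 := hdet a
      rw [hY]; linarith
    rw [abs_sub_comm, ← h1, abs_mul, abs_of_pos (hu a)]
    have h3 : |A a * A a.swap + Y| ≤ (q ^ 2 + (q ^ 2 + c₂⁻¹)) * δ := by
      refine (abs_add_le _ _).trans ?_
      rw [abs_of_pos (hAA0 a)]
      have := hAA a
      have e1 := mul_nonneg (sq_nonneg q) he0.le
      rw [hδ] at hYabs ⊢
      linarith
    calc u a * |A a * A a.swap + Y| ≤ 2 * ((Λ / 2) * δ) := by
          refine mul_le_mul (hu2 a) (h3.trans ?_) (abs_nonneg _) (by norm_num)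
          exact mul_le_mul_of_nonneg_right hq2Λ hδ0.le
      _ = Λ * δ := by ring
  have hinv : Λ⁻¹ ≤ s_lo := by
    rw [inv_le_comm₀ hΛ0 hs_lo, hΛ]; linarith [sq_nonneg q]
  have hinv2 : Λ⁻¹ ≤ c₂ := by
    rw [inv_le_comm₀ hΛ0 hc₂0, hΛ]; linarith [sq_nonneg q]
  refine ⟨⟨S, z, η, ρ, fun a => v a / ρ, u⟩, ?_, rfl, rfl, rfl, rfl, ?_⟩
  · have hdel : (⟨S, z, η, ρ, fun a => v a / ρ, u⟩ : Data n).del = δ := hδ.symm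
    have hzn : |‖z‖ ^ 2 - 1| ≤ Λ * δ := by
      rw [← hY]
      refine hYabs.trans ?_
      apply mul_le_mul_of_nonneg_right _ hδ0.le
      linarith [sq_nonneg q]
    refine ⟨hn, hΛ1, fun i j => ?_, fun i j => ?_, hη, hρ0, fun a => ?_, fun a => ?_, ?_, ?_,
      ?_, hus, fun a => ?_, fun a => ?_, ?_, ?_, g, hg, hgs⟩
    · exact le_trans (by gcongr) (hlo i j)
    · refine (hhi i j).trans ?_
      gcongr
      rw [hΛ]; linarith [sq_nonneg q]
    · rw [le_div_iff₀ hρ0]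
      exact le_trans (by gcongr) (hvlow a)
    · rw [div_le_iff₀ hρ0]
      have e := hvs a.swap
      rw [Sum.swap_swap] at e
      rw [e, ← hA]
      calc u a.swap * A a.swap ≤ 2 * (q * ρ) :=
            mul_le_mul (hu2 _) (hAb _).2 (hApos _).le (by norm_num)
        _ ≤ Λ * ρ := by
            have : 2 * q ≤ Λ := by rw [hΛ]; linarith [sq_nonneg q]
            linarith [mul_le_mul_of_nonneg_right this hρ0.le]
    · rw [hdel]; exact hunear
    · rw [hdel]; exact hzn
    · rw [hdel]; exact hδΛ
    · have : ∑ b, symVar S a b * (v b / ρ) = (∑ b, symVar S a b * v b) / ρ := by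
        rw [Finset.sum_div]
        exact Finset.sum_congr rfl fun b _ => by ring
      simp only [this, hvs a]
      ring
    · have e1 := hvs a
      have e2 := hvs a.swap
      rw [Sum.swap_swap, hus] at e2
      have e3 := hdet a
      simp only
      have : ρ ^ 2 * (v a / ρ * (v a.swap / ρ)) = v a * v a.swap := by field_simp
      rw [this, e1, e2, ← hA, ← hA]
      linear_combination u a * e3
    · simp only [← Finset.sum_div, hsuml]; field_simp
    · simp only [← Finset.sum_div, hsumr]; field_simp
  · rw [hMeq]
    unfold Data.M
    congr 1
    congr 1
    funext a
    push_cast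
    have : (ρ : ℂ) ≠ 0 := by exact_mod_cast hρ0.ne'
    field_simp

noncomputable section
open scoped Matrix.Norms.L2Operator

/-! ### Lower bounds on the stability operator -/

/-- A Doeblin-type contraction estimate for a nonnegative matrix with an approximate
positive eigenvector. -/
theorem doeblin_bound {ι : Type*} [Fintype ι] {P : ι → ι → ℝ} {h k : ι → ℝ} {κ θ Y : ℝ}
    {x y : ι → ℂ} {w : ℂ} (hh : ∀ i, 0 < h i) (hk1 : ∑ j, k j * h j = 1)
    (hmin : ∀ i j, κ * (h i * k j) ≤ P i j) (hκ : 0 ≤ κ)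
    (hrow : ∀ i, ∑ j, P i j * h j ≤ (1 + θ) * h i)
    (hy : ∀ i, (1 - w) * x i - ∑ j, (P i j : ℂ) * x j = y i) (hY : ∀ i, ‖y i‖ ≤ Y * h i)
    (hpos : 0 ≤ κ - θ - ‖w‖) (j : ι) :
    (κ - θ - ‖w‖) * ‖x j‖ ≤ h j * (Y + κ * ‖∑ j, (k j : ℂ) * x j‖) := by
  have : Nonempty ι := ⟨j⟩
  obtain ⟨i, hi⟩ := Finite.exists_max (fun i => ‖x i‖ / h i)
  obtain ⟨m, hm⟩ : ∃ m, m = ‖x i‖ / h i := ⟨_, rfl⟩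
  rw [← hm] at hi
  have hm0 : 0 ≤ m := hm ▸ div_nonneg (norm_nonneg _) (hh i).le
  have hle : ∀ l, ‖x l‖ ≤ m * h l := fun l => (div_le_iff₀ (hh l)).1 (hi l)
  have heq : ‖x i‖ = m * h i := by rw [hm, div_mul_cancel₀ _ (hh i).ne']
  obtain ⟨s, hs⟩ : ∃ s, s = ∑ j, (k j : ℂ) * x j := ⟨_, rfl⟩
  rw [← hs]
  have e1 : (1 - w) * x i = y i + ∑ j, ((P i j - κ * (h i * k j) : ℝ) : ℂ) * x j
      + κ * h i * s := by
    rw [← hy i, hs, Finset.mul_sum]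
    have : ∀ j, ((P i j - κ * (h i * k j) : ℝ) : ℂ) * x j
        = (P i j : ℂ) * x j - κ * h i * (k j * x j) := fun j => by push_cast; ring
    simp only [this, Finset.sum_sub_distrib]
    ring
  have e2 : ‖∑ j, ((P i j - κ * (h i * k j) : ℝ) : ℂ) * x j‖ ≤ m * ((1 + θ - κ) * h i) := by
    calc _ ≤ ∑ j, (P i j - κ * (h i * k j)) * (m * h j) := by
          refine (norm_sum_le _ _).trans (Finset.sum_le_sum fun j _ => ?_)
          rw [norm_mul, norm_real, norm_of_nonneg (sub_nonneg.2 (hmin i j))]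
          exact mul_le_mul_of_nonneg_left (hle j) (sub_nonneg.2 (hmin i j))
      _ = m * (∑ j, P i j * h j - κ * h i * ∑ j, k j * h j) := by
          rw [Finset.mul_sum (a := κ * h i), ← Finset.sum_sub_distrib, Finset.mul_sum]
          exact Finset.sum_congr rfl fun j _ => by ring
      _ ≤ m * ((1 + θ - κ) * h i) := by
          rw [hk1]
          apply mul_le_mul_of_nonneg_left _ hm0
          linarith [hrow i]
  have e3 : (1 - ‖w‖) * ‖x i‖ ≤ ‖(1 - w) * x i‖ := by
    rw [norm_mul]
    apply mul_le_mul_of_nonneg_right _ (norm_nonneg _)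
    have := norm_sub_norm_le (1 : ℂ) w
    simpa using this
  have e4 : ‖(1 - w) * x i‖ ≤ Y * h i + m * ((1 + θ - κ) * h i) + κ * h i * ‖s‖ := by
    rw [e1]
    refine (norm_add_le _ _).trans (add_le_add ((norm_add_le _ _).trans
      (add_le_add (hY i) e2)) ?_)
    rw [norm_mul, norm_mul, norm_real, norm_real, norm_of_nonneg hκ,
      norm_of_nonneg (hh i).le]
  have e5 : (κ - θ - ‖w‖) * m ≤ Y + κ * ‖s‖ := by
    rw [heq] at e3
    have : h i * ((κ - θ - ‖w‖) * m) ≤ h i * (Y + κ * ‖s‖) := by linarith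
    exact le_of_mul_le_mul_left this (hh i)
  calc (κ - θ - ‖w‖) * ‖x j‖ ≤ (κ - θ - ‖w‖) * (m * h j) :=
        mul_le_mul_of_nonneg_left (hle j) hpos
    _ = h j * ((κ - θ - ‖w‖) * m) := by ring
    _ ≤ _ := mul_le_mul_of_nonneg_left e5 (hh j).le

namespace Data

/-- The map `y ↦ diag (M diag(y) M)`. -/
def cM (D : Data n) : (Idx n → ℂ) →ₗ[ℂ] (Idx n → ℂ) where
  toFun y a := -(D.ρ ^ 2 * D.F a ^ 2 : ℝ) * y a + (‖D.z‖ ^ 2 * D.u a ^ 2 : ℝ) * y a.swap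
  map_add' x y := by funext a; simp only [Pi.add_apply]; ring
  map_smul' c y := by
    funext a; simp only [Pi.smul_apply, smul_eq_mul, RingHom.id_apply]; ring

theorem cM_apply (D : Data n) (y : Idx n → ℂ) (a : Idx n) :
    D.cM y a = -(D.ρ ^ 2 * D.F a ^ 2 : ℝ) * y a
      + (‖D.z‖ ^ 2 * D.u a ^ 2 : ℝ) * y a.swap := rfl

/-- The action of the stability operator on diagonals. -/
def K (D : Data n) : (Idx n → ℂ) →ₗ[ℂ] (Idx n → ℂ) :=
  LinearMap.id - D.cM ∘ₗ act D.S

theorem K_apply (D : Data n) (r : Idx n → ℂ) (a : Idx n) :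
    D.K r a = r a - D.cM (act D.S r) a := rfl

/-- The pairing with the leading order of the left eigenvector on the first half. -/
def pairL (D : Data n) (r : Idx n → ℂ) : ℂ :=
  (n : ℂ)⁻¹ * ∑ i, (D.G (Sum.inl i) : ℂ) * r (Sum.inl i)

/-- The pairing with the leading order of the left eigenvector on the second half. -/
def pairR (D : Data n) (r : Idx n → ℂ) : ℂ :=
  (n : ℂ)⁻¹ * ∑ i, (D.G (Sum.inr i) : ℂ) * r (Sum.inr i)

variable {D : Data n} {Λ : ℝ}

namespace Regular

theorem diag_stabOp (h : D.Regular Λ) (R : Mat n) : (stabOp D.S D.M R).diag = D.K R.diag := by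
  funext a
  rw [diag_apply, stabOp_apply, Matrix.sub_apply, selfEnergy_eq,
    h.diag_M_mul_diagonal_mul_M]
  rfl

theorem abs_zu_sub_one_le (h : D.Regular Λ) (a : Idx n) :
    |‖D.z‖ ^ 2 * D.u a ^ 2 - 1| ≤ 5 * Λ * D.del := by
  have h1 := h.z_near
  have h2 := h.u_near a
  have h3 := h.u_pos a
  have h4 := h.u_upper a
  obtain ⟨x, hx⟩ : ∃ x, x = Λ * D.del := ⟨_, rfl⟩
  rw [mul_assoc, ← hx]
  rw [← hx] at h1 h2
  have hx0 : 0 ≤ x := (abs_nonneg _).trans h1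
  have e : ‖D.z‖ ^ 2 * D.u a ^ 2 - 1
      = (‖D.z‖ ^ 2 - 1) * D.u a ^ 2 + (D.u a - 1) * (D.u a + 1) := by ring
  rw [e]
  refine (abs_add_le _ _).trans ?_
  rw [abs_mul, abs_mul, abs_of_nonneg (sq_nonneg (D.u a)),
    abs_of_pos (show 0 < D.u a + 1 by linarith)]
  have e1 : D.u a ^ 2 ≤ 9 / 4 := by nlinarith
  have e2 := mul_le_mul h1 e1 (sq_nonneg _) hx0
  have e3 := mul_le_mul h2 (show D.u a + 1 ≤ 5 / 2 by linarith) (by linarith) hx0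
  linarith

theorem inv_u_le (h : D.Regular Λ) (a : Idx n) : (D.u a)⁻¹ ≤ 1 + 2 * Λ * D.del := by
  have h2 := (abs_le.1 (h.u_near a)).1
  have h3 := h.u_pos a
  have h4 := h.small
  have h5 := mul_pos h.Λ_pos h.del_pos
  rw [inv_le_iff_one_le_mul₀ h3]
  obtain ⟨x, hx⟩ : ∃ x, x = Λ * D.del := ⟨_, rfl⟩
  rw [mul_assoc, ← hx]
  rw [← hx] at h2 h4 h5
  nlinarith

theorem sum_FG_lower (h : D.Regular Λ) (e : Fin n → Idx n) :
    n * (Λ⁻¹ * Λ⁻¹) ≤ ∑ i, D.F (e i) * D.G (e i) := by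
  have : ∑ _i : Fin n, Λ⁻¹ * Λ⁻¹ = n * (Λ⁻¹ * Λ⁻¹) := by simp
  rw [← this]
  exact Finset.sum_le_sum fun i _ => mul_le_mul (h.F_lower _) (h.F_lower _)
    (inv_nonneg.2 h.Λ_pos.le) (h.F_pos _).le

theorem half_bound (h : D.Regular Λ) {e : Fin n → Idx n}
    (he : ∀ i (x : Idx n → ℂ), act D.S x (e i).swap
      = ∑ j, (symVar D.S (e i).swap (e j) : ℂ) * x (e j))
    (he' : ∀ i (x : Idx n → ℝ), ∑ b, symVar D.S (e i).swap b * x b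
      = ∑ j, symVar D.S (e i).swap (e j) * x (e j))
    (hlow : ∀ i j, Λ⁻¹ / n ≤ symVar D.S (e i).swap (e j))
    {r : Idx n → ℂ} {w : ℂ} {Y m : ℝ} (hY : ∀ a, ‖(D.K r - w • r) a‖ ≤ Y)
    (hm : ∀ a, ‖r a‖ ≤ m) (hw : ‖w‖ ≤ (Λ ^ 5)⁻¹ / 4) (hd : D.del ≤ (48 * Λ ^ 10)⁻¹) (j : Fin n) :
    (Λ ^ 5)⁻¹ / 2 * ‖r (e j)‖ ≤ Λ ^ 2 * Y + (Λ ^ 5)⁻¹ / 8 * m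
      + Λ ^ 3 * ‖(n : ℂ)⁻¹ * ∑ i, (D.G (e i) : ℂ) * r (e i)‖ := by
  have hΛ := h.one_le
  have hΛ0 := h.Λ_pos
  have hn := h.n_pos'
  have hδ := h.del_pos
  have hm0 : 0 ≤ m := (norm_nonneg _).trans (hm (e j))
  have hY0 : 0 ≤ Y := (norm_nonneg _).trans (hY (e j))
  obtain ⟨s, hs⟩ : ∃ s, s = ∑ i, D.F (e i) * D.G (e i) := ⟨_, rfl⟩
  have hs1 : n * (Λ⁻¹ * Λ⁻¹) ≤ s := hs ▸ h.sum_FG_lower e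
  have hs0 : 0 < s := lt_of_lt_of_le (by positivity) hs1
  have hns : n / s ≤ Λ ^ 2 := by
    rw [div_le_iff₀ hs0]
    calc (n : ℝ) = Λ ^ 2 * (n * (Λ⁻¹ * Λ⁻¹)) := by field_simp
      _ ≤ _ := by gcongr
  obtain ⟨κ, hκ⟩ : ∃ κ, κ = (Λ ^ 5)⁻¹ := ⟨_, rfl⟩
  have hκ0 : 0 < κ := by rw [hκ]; positivity
  have hκ1 : κ ≤ 1 := by rw [hκ]; exact inv_le_one_of_one_le₀ (one_le_pow₀ hΛ)
  have hδ5 : Λ ^ 5 * D.del ≤ κ / 48 := by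
    calc Λ ^ 5 * D.del ≤ Λ ^ 5 * (48 * Λ ^ 10)⁻¹ := by gcongr
      _ = κ / 48 := by rw [hκ]; field_simp
  have hδ1 : Λ * D.del ≤ κ / 48 := by
    refine le_trans ?_ hδ5
    gcongr
    exact le_self_pow₀ hΛ (by norm_num)
  rw [← hκ] at hw ⊢
  have key := doeblin_bound (P := fun i j => symVar D.S (e i).swap (e j))
    (h := fun i => D.F (e i)) (k := fun i => D.G (e i) / s) (κ := κ) (θ := 2 * Λ * D.del)
    (Y := Λ * (Y + 6 * Λ ^ 3 * D.del * m)) (x := fun i => r (e i))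
    (y := fun i => (1 - w) * r (e i) - ∑ j, (symVar D.S (e i).swap (e j) : ℂ) * r (e j)) (w := w)
    (fun i => h.F_pos _) ?_ ?_ hκ0.le ?_ (fun i => rfl) ?_ ?_ j
  · have e1 : κ / 2 * ‖r (e j)‖ ≤ (κ - 2 * Λ * D.del - ‖w‖) * ‖r (e j)‖ := by
      apply mul_le_mul_of_nonneg_right _ (norm_nonneg _)
      linarith
    have e2 : ‖∑ j, ((D.G (e j) / s : ℝ) : ℂ) * r (e j)‖
        ≤ Λ ^ 2 * ‖(n : ℂ)⁻¹ * ∑ i, (D.G (e i) : ℂ) * r (e i)‖ := by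
      have : ∑ j, ((D.G (e j) / s : ℝ) : ℂ) * r (e j)
          = ((n / s : ℝ) : ℂ) * ((n : ℂ)⁻¹ * ∑ i, (D.G (e i) : ℂ) * r (e i)) := by
        have hnc : (n : ℂ) ≠ 0 := by exact_mod_cast hn.ne'
        rw [← mul_assoc, Finset.mul_sum]
        refine Finset.sum_congr rfl fun i _ => ?_
        push_cast
        field_simp
      rw [this, norm_mul, norm_real, norm_of_nonneg (by positivity)]
      exact mul_le_mul_of_nonneg_right hns (norm_nonneg _)
    obtain ⟨p, hp⟩ : ∃ p, p = ‖(n : ℂ)⁻¹ * ∑ i, (D.G (e i) : ℂ) * r (e i)‖ := ⟨_, rfl⟩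
    have hp0 : 0 ≤ p := hp ▸ norm_nonneg _
    rw [← hp] at e2 ⊢
    refine (e1.trans key).trans ?_
    have e3 : Λ ^ 5 * D.del * m ≤ κ / 48 * m := mul_le_mul_of_nonneg_right hδ5 hm0
    have e4 : κ * ‖∑ j, ((D.G (e j) / s : ℝ) : ℂ) * r (e j)‖ ≤ Λ ^ 2 * p :=
      (mul_le_of_le_one_left (norm_nonneg _) hκ1).trans e2
    calc D.F (e j) * (Λ * (Y + 6 * Λ ^ 3 * D.del * m)
          + κ * ‖∑ j, ((D.G (e j) / s : ℝ) : ℂ) * r (e j)‖)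
        ≤ Λ * (Λ * (Y + 6 * Λ ^ 3 * D.del * m) + Λ ^ 2 * p) := by
          apply mul_le_mul (h.F_upper _) (by linarith) (by positivity) hΛ0.le
      _ = Λ ^ 2 * Y + 6 * (Λ ^ 5 * D.del * m) + Λ ^ 3 * p := by ring
      _ ≤ _ := by linarith
  · have : ∀ i, D.G (e i) / s * D.F (e i) = D.F (e i) * D.G (e i) / s := fun i => by ring
    simp only [this]
    rw [← Finset.sum_div, ← hs, div_self hs0.ne']
  · intro i l
    refine le_trans ?_ (hlow i l)
    have e1 : D.F (e i) ≤ Λ := h.F_upper _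
    have e2 : D.G (e l) ≤ Λ := h.F_upper _
    calc κ * (D.F (e i) * (D.G (e l) / s)) ≤ κ * (Λ * (Λ * (Λ ^ 2 / n))) := by
          have e3 : D.G (e l) / s ≤ Λ * (Λ ^ 2 / n) := by
            rw [div_eq_mul_inv]
            refine mul_le_mul e2 ?_ (by positivity) hΛ0.le
            rw [le_div_iff₀ hn]
            calc s⁻¹ * n = n / s := by ring
              _ ≤ _ := hns
          have := (h.F_pos (e i)).le
          gcongr
          exact div_nonneg (h.G_pos _).le hs0.le
      _ = Λ⁻¹ / n := by rw [hκ]; field_simp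
  · intro i
    have e1 := h.F_eq (e i).swap
    rw [Sum.swap_swap, h.u_swap] at e1
    have e2 := he' i D.F
    have e3 := h.inv_u_le (e i)
    have e4 : ∑ j, symVar D.S (e i).swap (e j) * D.F (e j)
        = D.F (e i) * (D.u (e i))⁻¹ - D.η / D.ρ := by
      rw [← e2, e1]
      have := (h.u_pos (e i)).ne'
      field_simp
      ring
    rw [e4]
    have := mul_le_mul_of_nonneg_left e3 (h.F_pos (e i)).le
    linarith [h.η_div_pos]
  · intro i
    have e1 : (1 - w) * r (e i) - ∑ j, (symVar D.S (e i).swap (e j) : ℂ) * r (e j)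
        = (D.K r - w • r) (e i) + (-(D.ρ ^ 2 * D.F (e i) ^ 2 : ℝ) * act D.S r (e i)
          + ((‖D.z‖ ^ 2 * D.u (e i) ^ 2 - 1 : ℝ) : ℂ) * act D.S r (e i).swap) := by
      rw [← he i r, Pi.sub_apply, Pi.smul_apply, smul_eq_mul, K_apply, cM_apply]
      push_cast
      ring
    have e2 : ‖-((D.ρ ^ 2 * D.F (e i) ^ 2 : ℝ) : ℂ) * act D.S r (e i)‖
        ≤ D.del * Λ ^ 2 * (Λ * m) := by
      rw [norm_mul, norm_neg, norm_real, norm_of_nonneg (by positivity)]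
      refine mul_le_mul ?_ (h.norm_act_le hm _) (norm_nonneg _) (by positivity)
      have := h.ρ_sq_le
      have h1 := h.F_upper (e i)
      have h2 := (h.F_pos (e i)).le
      gcongr
    have e3 : ‖((‖D.z‖ ^ 2 * D.u (e i) ^ 2 - 1 : ℝ) : ℂ) * act D.S r (e i).swap‖
        ≤ 5 * Λ * D.del * (Λ * m) := by
      rw [norm_mul, norm_real, Real.norm_eq_abs]
      exact mul_le_mul (h.abs_zu_sub_one_le _) (h.norm_act_le hm _) (norm_nonneg _)
        (by positivity)
    rw [e1]
    refine (norm_add_le _ _).trans ?_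
    have e4 : 5 * Λ * D.del * (Λ * m) ≤ 5 * Λ ^ 3 * D.del * m := by
      have : 0 ≤ 5 * D.del * m := by positivity
      have h1 : Λ ^ 2 ≤ Λ ^ 3 := pow_le_pow_right₀ hΛ (by norm_num)
      calc 5 * Λ * D.del * (Λ * m) = Λ ^ 2 * (5 * D.del * m) := by ring
        _ ≤ Λ ^ 3 * (5 * D.del * m) := by gcongr
        _ = _ := by ring
    have e5 : ‖(D.K r - w • r) (e i)‖ + ‖-((D.ρ ^ 2 * D.F (e i) ^ 2 : ℝ) : ℂ) * act D.S r (e i)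
        + ((‖D.z‖ ^ 2 * D.u (e i) ^ 2 - 1 : ℝ) : ℂ) * act D.S r (e i).swap‖
        ≤ Y + 6 * Λ ^ 3 * D.del * m := by
      have := norm_add_le (-((D.ρ ^ 2 * D.F (e i) ^ 2 : ℝ) : ℂ) * act D.S r (e i))
        (((‖D.z‖ ^ 2 * D.u (e i) ^ 2 - 1 : ℝ) : ℂ) * act D.S r (e i).swap)
      linarith [hY (e i)]
    refine e5.trans ?_
    have e6 : 1 ≤ Λ * D.F (e i) := by
      have := mul_le_mul_of_nonneg_left (h.F_lower (e i)) hΛ0.le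
      rwa [mul_inv_cancel₀ hΛ0.ne'] at this
    calc Y + 6 * Λ ^ 3 * D.del * m ≤ (Y + 6 * Λ ^ 3 * D.del * m) * (Λ * D.F (e i)) :=
          le_mul_of_one_le_right (by positivity) e6
      _ = _ := by ring
  · linarith

/-- The stability operator is bounded below, uniformly, away from the unstable directions. -/
theorem norm_le_of_K (h : D.Regular Λ) {r : Idx n → ℂ} {w : ℂ} {Y p : ℝ}
    (hw : ‖w‖ ≤ (Λ ^ 5)⁻¹ / 4) (hd : D.del ≤ (48 * Λ ^ 10)⁻¹)
    (hY : ∀ a, ‖(D.K r - w • r) a‖ ≤ Y) (hpL : ‖D.pairL r‖ ≤ p) (hpR : ‖D.pairR r‖ ≤ p)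
    (a : Idx n) : ‖r a‖ ≤ 3 * Λ ^ 8 * (Y + p) := by
  have hΛ := h.one_le
  have hΛ0 := h.Λ_pos
  have : Nonempty (Idx n) := ⟨a⟩
  obtain ⟨b, hb⟩ := Finite.exists_max (fun a => ‖r a‖)
  have hY0 : 0 ≤ Y := (norm_nonneg _).trans (hY a)
  have hp0 : 0 ≤ p := (norm_nonneg _).trans hpL
  have key : (Λ ^ 5)⁻¹ / 2 * ‖r b‖ ≤ Λ ^ 2 * Y + (Λ ^ 5)⁻¹ / 8 * ‖r b‖ + Λ ^ 3 * p := by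
    rcases b with i | i
    · refine (h.half_bound (e := Sum.inl) (fun i x => ?_) (fun i x => ?_) (fun i j => ?_) hY hb hw
        hd i).trans ?_
      · rw [act_apply]; simp [symVar]
      · simp [symVar]
      · exact h.S_lower j i
      · have : Λ ^ 3 * ‖D.pairL r‖ ≤ Λ ^ 3 * p := by gcongr
        unfold pairL at this
        linarith
    · refine (h.half_bound (e := Sum.inr) (fun i x => ?_) (fun i x => ?_) (fun i j => ?_) hY hb hw
        hd i).trans ?_
      · rw [act_apply]; simp [symVar]
      · simp [symVar]
      · exact h.S_lower i j
      · have : Λ ^ 3 * ‖D.pairR r‖ ≤ Λ ^ 3 * p := by gcongr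
        unfold pairR at this
        linarith
  refine (hb a).trans ?_
  have e1 : (Λ ^ 5)⁻¹ * ‖r b‖ ≤ 3 * (Λ ^ 3 * (Y + p)) := by
    have : Λ ^ 2 * Y ≤ Λ ^ 3 * Y := by
      gcongr
      norm_num
    have h3 : 0 ≤ Λ ^ 3 * (Y + p) := by positivity
    linarith
  calc ‖r b‖ = Λ ^ 5 * ((Λ ^ 5)⁻¹ * ‖r b‖) := by field_simp
    _ ≤ Λ ^ 5 * (3 * (Λ ^ 3 * (Y + p))) := by gcongr
    _ = _ := by ring

end Regular

end Data

namespace Data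

variable {D : Data n} {Λ : ℝ}

/-- A Perron-Frobenius eigenvector that is close to the profile `F`. -/
structure PerronNear (D : Data n) (C : ℝ) (g : Idx n → ℝ) : Prop where
  eigen : ∀ a : Idx n, ∑ b, symVar D.S a b * g b = g a.swap
  near : ∀ a, |g a - D.F a| ≤ C * D.del

namespace Regular

theorem act_perron {g : Idx n → ℝ} (hg : ∀ a : Idx n, ∑ b, symVar D.S a b * g b = g a.swap)
    (q₁ q₂ : ℂ) (a : Idx n) :
    act D.S (fun b => (Sum.elim (fun _ => q₁) (fun _ => q₂) b : ℂ) * g b) a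
      = (Sum.elim (fun _ => q₁) (fun _ => q₂) a.swap : ℂ) * g a.swap := by
  have h1 := congrArg (fun x : ℝ => (x : ℂ)) (hg a)
  rw [act_apply]
  rcases a with i | i
  · simp [symVar] at h1 ⊢
    rw [← h1, Finset.mul_sum]
    exact Finset.sum_congr rfl fun j _ => by ring
  · simp [symVar] at h1 ⊢
    rw [← h1, Finset.mul_sum]
    exact Finset.sum_congr rfl fun j _ => by ring

theorem norm_K_perron_le (h : D.Regular Λ) {g : Idx n → ℝ}
    (hg : ∀ a : Idx n, ∑ b, symVar D.S a b * g b = g a.swap) {m : ℝ} (hm : ∀ a, |g a| ≤ m)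
    (a : Idx n) : ‖D.K (fun b => (g b : ℂ)) a‖ ≤ 6 * Λ ^ 2 * D.del * m := by
  have h1 : ∀ a, act D.S (fun b => (g b : ℂ)) a = g a.swap := by
    intro a
    have := act_perron hg 1 1 a
    simpa using this
  have hm0 : 0 ≤ m := (abs_nonneg _).trans (hm a)
  have e1 : D.K (fun b => (g b : ℂ)) a
      = (((D.ρ ^ 2 * D.F a ^ 2) * g a.swap - (‖D.z‖ ^ 2 * D.u a ^ 2 - 1) * g a : ℝ) : ℂ) := by
    rw [K_apply, cM_apply, h1, h1, Sum.swap_swap]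
    push_cast; ring
  rw [e1, norm_real]
  refine (norm_sub_le _ _).trans ?_
  rw [Real.norm_eq_abs, Real.norm_eq_abs, abs_mul (D.ρ ^ 2 * D.F a ^ 2), abs_mul _ (g a),
    abs_of_nonneg (by positivity : 0 ≤ D.ρ ^ 2 * D.F a ^ 2)]
  have hδ := h.del_pos
  have e2 : D.ρ ^ 2 * D.F a ^ 2 * |g a.swap| ≤ D.del * Λ ^ 2 * m := by
    have := h.ρ_sq_le
    have h1 := h.F_upper a
    have h2 := (h.F_pos a).le
    have h3 := hm a.swap
    gcongr
  have e3 : |‖D.z‖ ^ 2 * D.u a ^ 2 - 1| * |g a| ≤ 5 * Λ * D.del * m :=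
    mul_le_mul (h.abs_zu_sub_one_le a) (hm a) (abs_nonneg _)
      (by have := h.Λ_pos; positivity)
  have e4 : Λ * (D.del * m) ≤ Λ ^ 2 * (D.del * m) := by
    have := le_self_pow₀ h.one_le (two_ne_zero)
    gcongr
  linarith

theorem K_F (h : D.Regular Λ) (a : Idx n) :
    ‖D.K (fun b => (D.F b : ℂ)) a‖ ≤ 12 * Λ ^ 4 * D.del := by
  have hΛ0 := h.Λ_pos
  have hΛ := h.one_le
  have hδ := h.del_pos
  have hu := (h.u_pos a).ne'
  have e1 : D.K (fun b => (D.F b : ℂ)) a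
      = (((D.ρ ^ 2 * D.F a ^ 2) * (D.G a / D.u a - D.η / D.ρ)
        + (‖D.z‖ ^ 2 * D.u a ^ 2) * (D.η / D.ρ) + D.F a * (1 - ‖D.z‖ ^ 2 * D.u a) : ℝ) : ℂ) := by
    rw [K_apply, cM_apply, h.act_F, h.act_F, h.u_swap]
    unfold Data.G
    rw [Sum.swap_swap]
    have : (D.u a : ℂ) ≠ 0 := by exact_mod_cast hu
    have : (D.ρ : ℂ) ≠ 0 := by exact_mod_cast h.ρ_pos.ne'
    push_cast
    field_simp
    ring
  have hdet : 1 - ‖D.z‖ ^ 2 * D.u a = D.ρ ^ 2 * (D.F a * D.G a) / D.u a := by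
    have := h.det_eq a
    rw [eq_div_iff hu, Data.G]
    linarith
  rw [e1, hdet, norm_real, Real.norm_eq_abs]
  have hρ := h.ρ_sq_le
  have hη := Regular.η_div_le D
  have hη0 := h.η_div_pos
  have hF0 := h.F_pos a
  have hG0 := h.G_pos a
  have hF := h.F_upper a
  have hG : D.G a ≤ Λ := h.F_upper _
  have hu0 := h.u_pos a
  have hui : 1 / D.u a ≤ 2 := by
    rw [div_le_iff₀ hu0]; linarith [h.u_lower a]
  have hGu : D.G a / D.u a ≤ 2 * Λ := by
    calc D.G a / D.u a = D.G a * (1 / D.u a) := by ring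
      _ ≤ Λ * 2 := by gcongr
      _ = _ := by ring
  have hGu0 : 0 ≤ D.G a / D.u a := by positivity
  have t1 : |(D.ρ ^ 2 * D.F a ^ 2) * (D.G a / D.u a - D.η / D.ρ)| ≤ D.del * Λ ^ 2 * (3 * Λ) := by
    rw [abs_mul, abs_of_nonneg (by positivity)]
    have : |D.G a / D.u a - D.η / D.ρ| ≤ 3 * Λ := by
      rw [abs_le]; constructor <;> linarith [h.del_le]
    gcongr
  have t2 : |(‖D.z‖ ^ 2 * D.u a ^ 2) * (D.η / D.ρ)| ≤ 4 * D.del := by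
    rw [abs_of_nonneg (by positivity)]
    have e1 := h.z_sq_upper
    have e2 : D.u a ^ 2 ≤ 9 / 4 := by nlinarith [h.u_upper a]
    calc ‖D.z‖ ^ 2 * D.u a ^ 2 * (D.η / D.ρ) ≤ (3 / 2) * (9 / 4) * D.del := by gcongr
      _ ≤ _ := by linarith
  have t3 : |D.F a * (D.ρ ^ 2 * (D.F a * D.G a) / D.u a)| ≤ Λ * (D.del * (Λ * (2 * Λ))) := by
    rw [abs_of_nonneg (by positivity)]
    have : D.ρ ^ 2 * (D.F a * D.G a) / D.u a = D.ρ ^ 2 * (D.F a * (D.G a / D.u a)) := by ring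
    rw [this]
    gcongr
  have s1 := abs_add_le ((D.ρ ^ 2 * D.F a ^ 2) * (D.G a / D.u a - D.η / D.ρ)
    + (‖D.z‖ ^ 2 * D.u a ^ 2) * (D.η / D.ρ)) (D.F a * (D.ρ ^ 2 * (D.F a * D.G a) / D.u a))
  have s2 := abs_add_le ((D.ρ ^ 2 * D.F a ^ 2) * (D.G a / D.u a - D.η / D.ρ))
    ((‖D.z‖ ^ 2 * D.u a ^ 2) * (D.η / D.ρ))
  have s3 : Λ ^ 3 * D.del ≤ Λ ^ 4 * D.del := by
    gcongr
    norm_num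
  have s4 : D.del ≤ Λ ^ 4 * D.del := le_mul_of_one_le_left hδ.le (one_le_pow₀ hΛ)
  linarith

theorem exists_perronNear (h : D.Regular Λ) (hd : D.del ≤ (100 * Λ ^ 20)⁻¹) :
    ∃ g, D.PerronNear (108 * Λ ^ 12) g := by
  have hΛ0 := h.Λ_pos
  have hΛ := h.one_le
  have hδ := h.del_pos
  have hn := h.n_pos'
  obtain ⟨g₀, hg₀, hg₀'⟩ := h.perron
  have hpair : ∀ e : Fin n → Idx n, 0 < ∑ i, D.G (e i) * g₀ (e i) := fun e =>
    Finset.sum_pos (fun i _ => mul_pos (h.G_pos _) (hg₀ _)) ⟨⟨0, h.n_pos⟩, Finset.mem_univ _⟩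
  obtain ⟨α₁, hα₁⟩ : ∃ x, x = (∑ i, D.G (Sum.inl i) * D.F (Sum.inl i))
    / ∑ i, D.G (Sum.inl i) * g₀ (Sum.inl i) := ⟨_, rfl⟩
  obtain ⟨α₂, hα₂⟩ : ∃ x, x = (∑ i, D.G (Sum.inr i) * D.F (Sum.inr i))
    / ∑ i, D.G (Sum.inr i) * g₀ (Sum.inr i) := ⟨_, rfl⟩
  obtain ⟨g, hg⟩ : ∃ g : Idx n → ℝ,
      g = fun a => (Sum.elim (fun _ => α₁) (fun _ => α₂) a : ℝ) * g₀ a := ⟨_, rfl⟩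
  have heig : ∀ a : Idx n, ∑ b, symVar D.S a b * g b = g a.swap := by
    intro a
    have h1 := hg₀' a
    rcases a with i | i
    · simp [symVar, hg] at h1 ⊢
      rw [← h1, Finset.mul_sum]
      exact Finset.sum_congr rfl fun j _ => by ring
    · simp [symVar, hg] at h1 ⊢
      rw [← h1, Finset.mul_sum]
      exact Finset.sum_congr rfl fun j _ => by ring
  obtain ⟨x, hx⟩ : ∃ x : Idx n → ℂ, x = fun a => ((g a : ℂ) - D.F a) := ⟨_, rfl⟩
  have hxn : ∀ a, ‖x a‖ = |g a - D.F a| := by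
    intro a
    rw [hx]; dsimp only
    rw [← Complex.ofReal_sub, norm_real, Real.norm_eq_abs]
  have hpL : D.pairL x = 0 := by
    have h1 : ∑ i, D.G (Sum.inl i) * (g (Sum.inl i) - D.F (Sum.inl i)) = 0 := by
      have h2 : α₁ * ∑ i, D.G (Sum.inl i) * g₀ (Sum.inl i)
          = ∑ i, D.G (Sum.inl i) * D.F (Sum.inl i) := by
        rw [hα₁, div_mul_cancel₀ _ (hpair _).ne']
      simp only [hg, Sum.elim_inl, mul_sub, Finset.sum_sub_distrib]
      rw [← h2, Finset.mul_sum, sub_eq_zero]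
      exact Finset.sum_congr rfl fun j _ => by ring
    have h3 := congrArg (fun x : ℝ => (x : ℂ)) h1
    push_cast at h3
    rw [pairL, hx, h3, mul_zero]
  have hpR : D.pairR x = 0 := by
    have h1 : ∑ i, D.G (Sum.inr i) * (g (Sum.inr i) - D.F (Sum.inr i)) = 0 := by
      have h2 : α₂ * ∑ i, D.G (Sum.inr i) * g₀ (Sum.inr i)
          = ∑ i, D.G (Sum.inr i) * D.F (Sum.inr i) := by
        rw [hα₂, div_mul_cancel₀ _ (hpair _).ne']
      simp only [hg, Sum.elim_inr, mul_sub, Finset.sum_sub_distrib]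
      rw [← h2, Finset.mul_sum, sub_eq_zero]
      exact Finset.sum_congr rfl fun j _ => by ring
    have h3 := congrArg (fun x : ℝ => (x : ℂ)) h1
    push_cast at h3
    rw [pairR, hx, h3, mul_zero]
  have : Nonempty (Idx n) := ⟨Sum.inl ⟨0, h.n_pos⟩⟩
  obtain ⟨b, hb⟩ := Finite.exists_max (fun a => ‖x a‖)
  obtain ⟨m, hm⟩ : ∃ m, m = ‖x b‖ := ⟨_, rfl⟩
  rw [← hm] at hb
  have hgm : ∀ a, |g a| ≤ Λ + m := by
    intro a
    have h1 := hb a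
    rw [hxn] at h1
    have h2 := abs_add_le (g a - D.F a) (D.F a)
    rw [sub_add_cancel, abs_of_pos (h.F_pos a)] at h2
    linarith [h.F_upper a]
  have hm0 : 0 ≤ m := hm ▸ norm_nonneg _
  have hKx : ∀ a, ‖(D.K x - (0 : ℂ) • x) a‖ ≤ 18 * Λ ^ 4 * D.del + 6 * Λ ^ 2 * D.del * m := by
    intro a
    have e : x = (fun b => (g b : ℂ)) - fun b => (D.F b : ℂ) := hx
    rw [zero_smul, sub_zero]
    conv_lhs => rw [e]
    rw [map_sub, Pi.sub_apply]
    refine (norm_sub_le _ _).trans ?_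
    have e1 := h.norm_K_perron_le heig hgm a
    have e2 := h.K_F a
    have e3 : Λ ^ 3 * D.del ≤ Λ ^ 4 * D.del := by
      gcongr
      norm_num
    linarith
  have hd' : D.del ≤ (48 * Λ ^ 10)⁻¹ := by
    refine hd.trans ?_
    gcongr
    · norm_num
    · norm_num
  have key := h.norm_le_of_K (r := x) (w := 0) (p := 0) (by simp; positivity) hd' hKx
    (by rw [hpL, norm_zero]) (by rw [hpR, norm_zero]) b
  rw [← hm] at key
  have hδ2 : Λ ^ 10 * D.del ≤ 1 / 100 := by
    calc Λ ^ 10 * D.del ≤ Λ ^ 10 * (100 * Λ ^ 20)⁻¹ := by gcongr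
      _ = (Λ ^ 10)⁻¹ / 100 := by field_simp
      _ ≤ 1 / 100 := by
        gcongr
        exact inv_le_one_of_one_le₀ (one_le_pow₀ hΛ)
  have hfin : m ≤ 108 * Λ ^ 12 * D.del := by
    have e1 : Λ ^ 10 * D.del * m ≤ 1 / 100 * m := mul_le_mul_of_nonneg_right hδ2 hm0
    have e2 : 3 * Λ ^ 8 * (18 * Λ ^ 4 * D.del + 6 * Λ ^ 2 * D.del * m + 0)
      = 54 * Λ ^ 12 * D.del + 18 * (Λ ^ 10 * D.del * m) := by ring
    have e3 : 0 ≤ Λ ^ 12 * D.del := by positivity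
    linarith
  exact ⟨g, heig, fun a => by rw [← hxn]; exact (hb a).trans hfin⟩

end Regular

end Data

/-- The half of `[2n]` to which an index belongs. -/
def side : Idx n → Fin 2 := Sum.elim (fun _ => 0) (fun _ => 1)

@[simp] theorem side_inl (i : Fin n) : side (Sum.inl i : Idx n) = 0 := rfl

@[simp] theorem side_inr (i : Fin n) : side (Sum.inr i : Idx n) = 1 := rfl

theorem symVar_mul_side (S : Matrix (Fin n) (Fin n) ℝ) (f : Fin 2 → ℝ) (a b : Idx n) :
    symVar S a b * f (side b) = symVar S a b * f (side a.swap) := by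
  rcases a with i | i <;> rcases b with j | j <;> simp [symVar]

theorem sum_swap {A : Type*} [AddCommMonoid A] (f : Idx n → A) : ∑ a : Idx n, f a.swap = ∑ a, f a :=
  Equiv.sum_comp (Equiv.sumComm (Fin n) (Fin n)) f

namespace Data

/-- The real matrix of the action of the stability operator on diagonals. -/
def KR (D : Data n) : Matrix (Idx n) (Idx n) ℝ :=
  1 + diagonal (fun a => D.ρ ^ 2 * D.F a ^ 2) * symVar D.S
    - diagonal (fun a => ‖D.z‖ ^ 2 * D.u a ^ 2) * (symVar D.S).submatrix Sum.swap id

theorem KR_mulVec (D : Data n) (r : Idx n → ℝ) (a : Idx n) :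
    (D.KR *ᵥ r) a = r a + D.ρ ^ 2 * D.F a ^ 2 * (symVar D.S *ᵥ r) a
      - ‖D.z‖ ^ 2 * D.u a ^ 2 * (symVar D.S *ᵥ r) a.swap := by
  unfold KR
  rw [Matrix.sub_mulVec, Matrix.add_mulVec, Matrix.one_mulVec, ← mulVec_mulVec,
    ← mulVec_mulVec, Pi.sub_apply, Pi.add_apply, mulVec_diagonal,
    mulVec_diagonal]
  rfl

theorem act_ofReal (S : Matrix (Fin n) (Fin n) ℝ) (r : Idx n → ℝ) (a : Idx n) :
    act S (fun b => (r b : ℂ)) a = ((symVar S *ᵥ r) a : ℝ) := by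
  rw [act_apply, mulVec, dotProduct]
  push_cast; rfl

theorem K_ofReal (D : Data n) (r : Idx n → ℝ) (a : Idx n) :
    D.K (fun b => (r b : ℂ)) a = ((D.KR *ᵥ r) a : ℝ) := by
  rw [K_apply, cM_apply, act_ofReal, act_ofReal, KR_mulVec]
  push_cast; ring

/-- The normalization of the Perron-Frobenius eigenvectors. -/
def perronMass (g : Idx n → ℝ) : ℝ := ∑ i, g (Sum.inl i) * g (Sum.inr i)

/-- The spectral projection of the leading order onto the Perron-Frobenius eigenvectors. -/
def perronPair (g : Idx n → ℝ) (j : Fin 2) (r : Idx n → ℝ) : ℝ :=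
  (perronMass g)⁻¹ * ∑ a : Idx n, if side a = j then g a.swap * r a else 0

/-- The coefficient in the splitting of the eigenvalues. -/
def kap (g : Idx n → ℝ) : ℝ :=
  (perronMass g)⁻¹ * ∑ i, (g (Sum.inl i) * g (Sum.inr i)) ^ 2

theorem sum_side_mul (j : Fin 2) (f : Idx n → ℝ) (hf : ∀ a, f a.swap = f a) :
    (∑ a : Idx n, if side a = j then f a else 0) = ∑ i, f (Sum.inl i) := by
  rw [Fintype.sum_sum_type]
  fin_cases j
  · simp
  · simp only [side_inl, side_inr]
    simpa using Finset.sum_congr rfl fun i _ => (hf (Sum.inl i))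

theorem perronPair_add (g : Idx n → ℝ) (j : Fin 2) (r r' : Idx n → ℝ) :
    perronPair g j (fun a => r a + r' a) = perronPair g j r + perronPair g j r' := by
  unfold perronPair
  rw [← mul_add, ← Finset.sum_add_distrib]
  congr 1
  refine Finset.sum_congr rfl fun a _ => ?_
  split_ifs <;> ring

theorem perronPair_mul (g : Idx n → ℝ) (j : Fin 2) (c : ℝ) (r : Idx n → ℝ) :
    perronPair g j (fun a => c * r a) = c * perronPair g j r := by
  unfold perronPair
  rw [mul_left_comm c, Finset.mul_sum Finset.univ _ c]
  congr 1
  refine Finset.sum_congr rfl fun a _ => ?_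
  split_ifs <;> ring

theorem perronPair_sub (g : Idx n → ℝ) (j : Fin 2) (r r' : Idx n → ℝ) :
    perronPair g j (fun a => r a - r' a) = perronPair g j r - perronPair g j r' := by
  have h1 := perronPair_mul g j (-1) r'
  have h2 := perronPair_add g j r (fun a => -1 * r' a)
  rw [h1] at h2
  rw [sub_eq_add_neg, ← neg_one_mul (perronPair g j r'), ← h2]
  congr 1; funext a; ring

theorem perronPair_swap {S : Matrix (Fin n) (Fin n) ℝ} {g : Idx n → ℝ}
    (hg : ∀ a : Idx n, ∑ b, symVar S a b * g b = g a.swap) (j : Fin 2) (r : Idx n → ℝ) :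
    perronPair g j (fun a => (symVar S *ᵥ r) a.swap) = perronPair g j r := by
  unfold perronPair
  congr 1
  rw [← sum_swap]
  simp only [Sum.swap_swap]
  have h1 : ∀ a : Idx n, (if side a.swap = j then g a * (symVar S *ᵥ r) a else 0)
      = ∑ b, r b * (symVar S b a * (if side b = j then 1 else 0) * g a) := by
    intro a
    have h2 : ∀ b, symVar S b a * (if side b = j then (1 : ℝ) else 0)
        = symVar S a b * (if side a.swap = j then 1 else 0) := by
      intro b
      rw [symVar_comm]
      exact symVar_mul_side S (fun k => if k = j then 1 else 0) a b
    simp_rw [h2, mulVec, dotProduct]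
    split_ifs
    · rw [Finset.mul_sum]; exact Finset.sum_congr rfl fun b _ => by ring
    · simp
  simp_rw [h1]
  rw [Finset.sum_comm]
  refine Finset.sum_congr rfl fun b _ => ?_
  rw [← Finset.mul_sum]
  split_ifs
  · simp only [mul_one, hg]; ring
  · simp

variable {D : Data n} {Λ : ℝ}

theorem PerronNear.bounds (h : D.Regular Λ) {g : Idx n → ℝ} (hg : D.PerronNear (108 * Λ ^ 12) g)
    (hd : D.del ≤ (1000 * Λ ^ 20)⁻¹) (a : Idx n) : Λ⁻¹ / 2 ≤ g a ∧ g a ≤ 2 * Λ := by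
  have hΛ0 := h.Λ_pos
  have hΛ := h.one_le
  have h1 := abs_le.1 (hg.near a)
  have h2 : 108 * Λ ^ 12 * D.del ≤ Λ⁻¹ / 2 := by
    calc 108 * Λ ^ 12 * D.del ≤ 108 * Λ ^ 12 * (1000 * Λ ^ 20)⁻¹ := by gcongr
      _ = (108 / 1000) * (Λ ^ 8)⁻¹ := by field_simp
      _ ≤ (1 / 2) * Λ⁻¹ := mul_le_mul (by norm_num)
        (inv_anti₀ hΛ0 (le_self_pow₀ hΛ (by norm_num))) (by positivity) (by norm_num)
      _ = _ := by ring
  have h3 : Λ⁻¹ ≤ Λ := (inv_le_one_of_one_le₀ hΛ).trans hΛ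
  constructor
  · linarith [h.F_lower a]
  · linarith [h.F_upper a]

namespace Regular

theorem perronMass_pos (h : D.Regular Λ) {g : Idx n → ℝ} (hg : ∀ a, 0 < g a) :
    0 < perronMass g :=
  Finset.sum_pos (fun _ _ => mul_pos (hg _) (hg _)) ⟨⟨0, h.n_pos⟩, Finset.mem_univ _⟩

theorem perronPair_self (h : D.Regular Λ) {g : Idx n → ℝ} (hg : ∀ a, 0 < g a) (q : Fin 2 → ℝ)
    (j : Fin 2) : perronPair g j (fun a => q (side a) * g a) = q j := by
  have h1 : (∑ a : Idx n, if side a = j then g a.swap * (q (side a) * g a) else 0)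
      = q j * perronMass g := by
    have h2 := sum_side_mul (n := n) j (fun a => q j * (g a * g a.swap))
      (fun a => by rw [Sum.swap_swap]; ring)
    rw [perronMass, Finset.mul_sum]
    refine Eq.trans (Finset.sum_congr rfl fun a _ => ?_) h2
    split_ifs with h3
    · rw [h3]; ring
    · rfl
  have hW := (h.perronMass_pos hg).ne'
  unfold perronPair
  rw [h1]
  field_simp

theorem abs_perronPair_le (h : D.Regular Λ) {g : Idx n → ℝ} (hg : ∀ a, 0 < g a) {y : Idx n → ℝ}
    {c : ℝ} (hy : ∀ a, |y a| ≤ c * g a) (j : Fin 2) : |perronPair g j y| ≤ c := by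
  have hW := h.perronMass_pos hg
  have h1 := h.perronPair_self hg (fun _ => c) j
  rw [← h1]
  unfold perronPair
  rw [abs_mul, abs_of_pos (inv_pos.2 hW)]
  gcongr
  refine (Finset.abs_sum_le_sum_abs _ _).trans (Finset.sum_le_sum fun a _ => ?_)
  split_ifs
  · rw [abs_mul, abs_of_pos (hg _)]
    exact mul_le_mul_of_nonneg_left (hy a) (hg _).le
  · simp

theorem kap_bounds (h : D.Regular Λ) {g : Idx n → ℝ} (hg : ∀ a, Λ⁻¹ / 2 ≤ g a ∧ g a ≤ 2 * Λ) :
    Λ⁻¹ ^ 2 / 4 ≤ kap g ∧ kap g ≤ 4 * Λ ^ 2 := by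
  have hΛ0 := h.Λ_pos
  have hg0 : ∀ a, 0 < g a := fun a => lt_of_lt_of_le (by positivity) (hg a).1
  have hW := h.perronMass_pos hg0
  unfold kap
  rw [inv_mul_eq_div, le_div_iff₀ hW, div_le_iff₀ hW]
  unfold perronMass
  rw [Finset.mul_sum, Finset.mul_sum]
  constructor
  · refine Finset.sum_le_sum fun i _ => ?_
    rw [pow_two (g _ * g _)]
    refine mul_le_mul_of_nonneg_right ?_ (mul_pos (hg0 _) (hg0 _)).le
    calc Λ⁻¹ ^ 2 / 4 = (Λ⁻¹ / 2) * (Λ⁻¹ / 2) := by ring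
      _ ≤ _ := mul_le_mul (hg _).1 (hg _).1 (by positivity) (hg0 _).le
  · refine Finset.sum_le_sum fun i _ => ?_
    rw [pow_two (g _ * g _)]
    refine mul_le_mul_of_nonneg_right ?_ (mul_pos (hg0 _) (hg0 _)).le
    calc g (Sum.inl i) * g (Sum.inr i) ≤ (2 * Λ) * (2 * Λ) :=
          mul_le_mul (hg _).2 (hg _).2 (hg0 _).le (by positivity)
      _ = _ := by ring

theorem kap_eq {g : Idx n → ℝ} (j : Fin 2) :
    perronPair g j (fun a => g a * g a.swap * g a) = kap g := by
  have h2 := sum_side_mul (n := n) j (fun a => (g a * g a.swap) ^ 2)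
      (fun a => by rw [Sum.swap_swap]; ring)
  unfold perronPair kap
  congr 1
  refine Eq.trans (Finset.sum_congr rfl fun a _ => ?_) h2
  split_ifs <;> ring

/-- The correction to the leading order of the off-diagonal coefficient. -/
def tauCoef (D : Data n) (a : Idx n) : ℝ :=
  D.F a * D.G a * (1 + (‖D.z‖ ^ 2)⁻¹ * (D.u a)⁻¹)

theorem z_inv_le (h : D.Regular Λ) : (‖D.z‖ ^ 2)⁻¹ ≤ 2 := by
  have := h.z_sq_lower
  calc (‖D.z‖ ^ 2)⁻¹ ≤ (1 / 2)⁻¹ := by gcongr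
    _ = 2 := by norm_num

theorem u_inv_le (h : D.Regular Λ) (a : Idx n) : (D.u a)⁻¹ ≤ 2 := by
  have := h.u_lower a
  calc (D.u a)⁻¹ ≤ (1 / 2)⁻¹ := by gcongr
    _ = 2 := by norm_num

theorem tauCoef_eq (h : D.Regular Λ) (a : Idx n) :
    (‖D.z‖ ^ 2)⁻¹ - ‖D.z‖ ^ 2 * D.u a ^ 2 = D.ρ ^ 2 * tauCoef D a := by
  have hz : ‖D.z‖ ≠ 0 := by
    intro h0
    have := h.z_sq_lower
    rw [h0] at this; norm_num at this
  have hu := (h.u_pos a).ne'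
  have h1 := h.det_eq a
  have h2 : D.ρ ^ 2 * (D.F a * D.G a) = D.u a - D.u a ^ 2 * ‖D.z‖ ^ 2 := by
    unfold Data.G; linarith
  unfold tauCoef
  rw [mul_comm (D.F a * D.G a), mul_left_comm, h2]
  field_simp
  ring

theorem tauCoef_bounds (h : D.Regular Λ) (a : Idx n) :
    0 ≤ tauCoef D a ∧ tauCoef D a ≤ 5 * Λ ^ 2 ∧
      |tauCoef D a - 2 * (D.F a * D.G a)| ≤ 8 * Λ ^ 4 * D.del := by
  have hF := h.F_pos a
  have hG := h.G_pos a
  have hF' := h.F_upper a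
  have hG' : D.G a ≤ Λ := h.F_upper _
  have hu := h.u_pos a
  have hui := h.u_inv_le a
  have hzi := h.z_inv_le
  have hΛ0 := h.Λ_pos
  have hz0 : 0 < ‖D.z‖ ^ 2 := by linarith [h.z_sq_lower]
  refine ⟨?_, ?_, ?_⟩
  · unfold tauCoef; positivity
  · unfold tauCoef
    calc _ ≤ Λ * Λ * (1 + 2 * 2) := by gcongr
      _ = _ := by ring
  · have h1 : 1 - ‖D.z‖ ^ 2 * D.u a = D.ρ ^ 2 * (D.F a * D.G a) * (D.u a)⁻¹ := by
      have := h.det_eq a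
      rw [← div_eq_mul_inv, eq_div_iff hu.ne', Data.G]
      linarith
    have e : tauCoef D a - 2 * (D.F a * D.G a)
        = D.F a * D.G a * (D.ρ ^ 2 * (D.F a * D.G a) * (D.u a)⁻¹
          * ((‖D.z‖ ^ 2)⁻¹ * (D.u a)⁻¹)) := by
      rw [← h1]
      unfold tauCoef
      have hz : ‖D.z‖ ≠ 0 := fun h0 => by simp [h0] at hz0
      field_simp
      ring
    rw [e, abs_of_nonneg (by positivity)]
    have := h.ρ_sq_le
    have hδ := h.del_pos
    calc _ ≤ Λ * Λ * (D.del * (Λ * Λ) * 2 * (2 * 2)) := by gcongr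
      _ = _ := by ring

/-- The second order part of the stability operator on diagonals. -/
def secondOrder (D : Data n) (r : Idx n → ℝ) (a : Idx n) : ℝ :=
  D.F a ^ 2 * (symVar D.S *ᵥ r) a + tauCoef D a * (symVar D.S *ᵥ r) a.swap

theorem KR_eq (h : D.Regular Λ) (r : Idx n → ℝ) (a : Idx n) :
    (D.KR *ᵥ r) a = r a - (‖D.z‖ ^ 2)⁻¹ * (symVar D.S *ᵥ r) a.swap
      + D.ρ ^ 2 * secondOrder D r a := by
  have h1 := h.tauCoef_eq a
  rw [KR_mulVec]
  unfold secondOrder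
  linear_combination (symVar D.S *ᵥ r) a.swap * h1

theorem abs_symVar_mulVec_le (h : D.Regular Λ) {r : Idx n → ℝ} {c : ℝ} (hr : ∀ b, |r b| ≤ c)
    (a : Idx n) : |(symVar D.S *ᵥ r) a| ≤ Λ * c := by
  have := h.norm_act_le (r := fun b => (r b : ℂ)) (c := c) (by simpa using hr) a
  rwa [act_ofReal, norm_real, Real.norm_eq_abs] at this

theorem abs_secondOrder_le (h : D.Regular Λ) {r : Idx n → ℝ} {c : ℝ} (hr : ∀ b, |r b| ≤ c)
    (a : Idx n) : |secondOrder D r a| ≤ 6 * Λ ^ 3 * c := by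
  have hc : 0 ≤ c := (abs_nonneg _).trans (hr a)
  have h1 := h.abs_symVar_mulVec_le hr a
  have h2 := h.abs_symVar_mulVec_le hr a.swap
  have h3 := h.tauCoef_bounds a
  have h4 := h.F_upper a
  have h5 := (h.F_pos a).le
  have hΛ0 := h.Λ_pos
  unfold secondOrder
  refine (abs_add_le _ _).trans ?_
  rw [abs_mul, abs_mul, abs_of_nonneg (sq_nonneg (D.F a)), abs_of_nonneg h3.1]
  calc _ ≤ Λ ^ 2 * (Λ * c) + 5 * Λ ^ 2 * (Λ * c) := by
        gcongr
        exact h3.2.1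
    _ = _ := by ring

end Regular

end Data

namespace Data

variable {D : Data n} {Λ : ℝ}

namespace Regular

theorem mulVec_lift {g : Idx n → ℝ}
    (hg : ∀ a : Idx n, ∑ b, symVar D.S a b * g b = g a.swap) (q : Fin 2 → ℝ) (a : Idx n) :
    (symVar D.S *ᵥ fun b => q (side b) * g b) a = q (side a.swap) * g a.swap := by
  rw [← hg a, mulVec, dotProduct, Finset.mul_sum]
  refine Finset.sum_congr rfl fun b _ => ?_
  have := symVar_mul_side D.S q a b
  linear_combination g b * this

theorem abs_perronPair_secondOrder_lift (h : D.Regular Λ) {g : Idx n → ℝ}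
    (hg : D.PerronNear (108 * Λ ^ 12) g) (hd : D.del ≤ (1000 * Λ ^ 20)⁻¹) {q : Fin 2 → ℝ} {Q : ℝ}
    (hQ : ∀ j, |q j| ≤ Q) (j : Fin 2) :
    |perronPair g j (secondOrder D fun b => q (side b) * g b) - kap g * (q j + (q 0 + q 1))|
      ≤ 1980 * Λ ^ 15 * D.del * Q := by
  have hΛ0 := h.Λ_pos
  have hΛ := h.one_le
  have hδ := h.del_pos
  have hb := hg.bounds h hd
  have hg0 : ∀ a, 0 < g a := fun a => lt_of_lt_of_le (by positivity) (hb a).1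
  have hQ0 : 0 ≤ Q := (abs_nonneg _).trans (hQ 0)
  have hswap : ∀ a : Idx n, q (side a) + q (side a.swap) = q 0 + q 1 := by
    rintro (i | i)
    · simp
    · simp [add_comm]
  have e1 : kap g * (q j + (q 0 + q 1))
      = perronPair g j (fun a => (q j + (q 0 + q 1)) * (g a * g a.swap * g a)) := by
    rw [perronPair_mul, kap_eq, mul_comm]
  have e2 : perronPair g j (fun a => (q j + (q 0 + q 1)) * (g a * g a.swap * g a))
      = perronPair g j (fun a => (q (side a) + (q 0 + q 1)) * (g a * g a.swap * g a)) := by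
    unfold perronPair
    congr 1
    refine Finset.sum_congr rfl fun a _ => ?_
    split_ifs with hj
    · simp only [hj]
    · rfl
  rw [e1, e2, ← perronPair_sub]
  refine h.abs_perronPair_le hg0 (fun a => ?_) j
  rw [secondOrder, mulVec_lift hg.eigen, mulVec_lift hg.eigen, Sum.swap_swap, ← hswap a]
  have e3 : D.F a ^ 2 * (q (side a.swap) * g a.swap) + tauCoef D a * (q (side a) * g a)
      - (q (side a) + (q (side a) + q (side a.swap))) * (g a * g a.swap * g a)
      = q (side a.swap) * (g a.swap * ((D.F a - g a) * (D.F a + g a)))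
        + q (side a) * ((tauCoef D a - 2 * (D.F a * D.G a)) + 2 * ((D.F a - g a) * D.G a)
          + 2 * (g a * (D.G a - g a.swap))) * g a := by ring
  have hga := hb a
  have hgs := hb a.swap
  have hF := h.F_upper a
  have hF0 := h.F_pos a
  have hG : D.G a ≤ Λ := h.F_upper _
  have hG0 := h.G_pos a
  have n1 : |D.F a - g a| ≤ 108 * Λ ^ 12 * D.del := by
    rw [abs_sub_comm]; exact hg.near a
  have n2 : |D.G a - g a.swap| ≤ 108 * Λ ^ 12 * D.del := by
    rw [abs_sub_comm]; exact hg.near a.swap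
  have hc0 : 0 ≤ 108 * Λ ^ 12 * D.del := by positivity
  have t1 : |q (side a.swap) * (g a.swap * ((D.F a - g a) * (D.F a + g a)))|
      ≤ 1296 * Λ ^ 15 * D.del * Q * g a := by
    rw [abs_mul, abs_mul, abs_mul, abs_of_pos (hg0 _), abs_of_pos (add_pos hF0 (hg0 a))]
    calc _ ≤ Q * ((2 * Λ) * ((108 * Λ ^ 12 * D.del) * (Λ + 2 * Λ))) := by
          have := hQ (side a.swap)
          have h2 := hgs.2
          have h3 := hga.2
          have h4 := (hg0 a).le
          have h5 := (hg0 a.swap).le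
          gcongr
      _ = 1296 * Λ ^ 15 * D.del * Q * (Λ⁻¹ / 2) := by field_simp; ring
      _ ≤ _ := by
        have := hga.1
        gcongr
  have t2 : |q (side a) * ((tauCoef D a - 2 * (D.F a * D.G a)) + 2 * ((D.F a - g a) * D.G a)
          + 2 * (g a * (D.G a - g a.swap))) * g a| ≤ Q * (656 * Λ ^ 13 * D.del) * g a := by
    rw [abs_mul, abs_mul, abs_of_pos (hg0 a)]
    have h3 := (h.tauCoef_bounds a).2.2
    have s1 := abs_add_three (tauCoef D a - 2 * (D.F a * D.G a)) (2 * ((D.F a - g a) * D.G a))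
      (2 * (g a * (D.G a - g a.swap)))
    rw [abs_mul, abs_mul, abs_mul, abs_mul, abs_of_pos hG0, abs_of_pos (hg0 a), abs_two] at s1
    have s2 : |D.F a - g a| * D.G a ≤ 108 * Λ ^ 12 * D.del * Λ := by gcongr
    have s3 : g a * |D.G a - g a.swap| ≤ 2 * Λ * (108 * Λ ^ 12 * D.del) := by
      have := hga.2
      gcongr
    have s4 : Λ ^ 4 * D.del ≤ Λ ^ 13 * D.del := by
      gcongr
      norm_num
    have s5 : |(tauCoef D a - 2 * (D.F a * D.G a)) + 2 * ((D.F a - g a) * D.G a)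
          + 2 * (g a * (D.G a - g a.swap))| ≤ 656 * Λ ^ 13 * D.del := by linarith
    have := hQ (side a)
    have h4 := (hg0 a).le
    gcongr
  rw [e3]
  refine (abs_add_le _ _).trans ((add_le_add t1 t2).trans ?_)
  have s : Λ ^ 13 * (D.del * Q * g a) ≤ Λ ^ 15 * (D.del * Q * g a) := by
    have h4 := (hg0 a).le
    gcongr
    norm_num
  have s' : 0 ≤ Λ ^ 15 * (D.del * Q * g a) := by
    have h4 := (hg0 a).le
    positivity
  linarith

theorem bordered_estimate (h : D.Regular Λ) {g : Idx n → ℝ} (hg : D.PerronNear (108 * Λ ^ 12) g)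
    (hd : D.del ≤ (1000 * Λ ^ 20)⁻¹) {w : ℝ} (hw : |w| ≤ (Λ ^ 5)⁻¹ / 4) {r : Idx n → ℝ}
    {c q : Fin 2 → ℝ} (hr : ∀ a, (D.KR *ᵥ r) a - w * r a + c (side a) * g a = 0)
    (hq : ∀ j, perronPair g j r = q j) {Q : ℝ} (hQ : ∀ j, |q j| ≤ Q) :
    (∀ a, |r a - q (side a) * g a| ≤ 360 * Λ ^ 14 * D.ρ ^ 2 * Q) ∧
      ∀ j, |c j + (1 - (‖D.z‖ ^ 2)⁻¹ - w) * q j + D.ρ ^ 2 * (kap g * (q j + (q 0 + q 1)))|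
        ≤ 6300 * Λ ^ 18 * D.ρ ^ 2 * D.del * Q := by
  have hΛ0 := h.Λ_pos
  have hΛ := h.one_le
  have hδ := h.del_pos
  have hn := h.n_pos'
  have hρδ := h.ρ_sq_le
  have hb := hg.bounds h hd
  have hg0 : ∀ a, 0 < g a := fun a => lt_of_lt_of_le (by positivity) (hb a).1
  have hQ0 : 0 ≤ Q := (abs_nonneg _).trans (hQ 0)
  have hone : ∀ k : ℕ, 1 ≤ Λ ^ k := fun k => one_le_pow₀ hΛ
  obtain ⟨t, ht⟩ : ∃ t, t = (‖D.z‖ ^ 2)⁻¹ := ⟨_, rfl⟩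
  obtain ⟨y, hy⟩ : ∃ y : Idx n → ℝ, y = fun b => q (side b) * g b := ⟨_, rfl⟩
  obtain ⟨x, hx⟩ : ∃ x : Idx n → ℝ, x = fun a => r a - y a := ⟨_, rfl⟩
  have hrx : r = x + y := by funext a; simp [hx]
  have hpx : ∀ j, perronPair g j x = 0 := fun j => by
    rw [hx, perronPair_sub, hq, hy, h.perronPair_self hg0, sub_self]
  have hsy : ∀ a, (symVar D.S *ᵥ y) a.swap = y a := fun a => by
    rw [hy, mulVec_lift hg.eigen, Sum.swap_swap]
  have hsec : ∀ a, secondOrder D r a = secondOrder D x a + secondOrder D y a := fun a => by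
    unfold secondOrder
    rw [hrx, mulVec_add, Pi.add_apply, Pi.add_apply]; ring
  -- the equation in terms of `x`
  have heq : ∀ a, (1 - w) * x a - t * (symVar D.S *ᵥ x) a.swap
      + (c (side a) + (1 - t - w) * q (side a)) * g a
      + D.ρ ^ 2 * (secondOrder D x a + secondOrder D y a) = 0 := by
    intro a
    have h1 := hr a
    rw [h.KR_eq, hsec, ← ht, hrx, mulVec_add, Pi.add_apply, Pi.add_apply, hsy] at h1
    have h2 : y a = q (side a) * g a := by rw [hy]
    rw [h2] at h1
    linarith
  have hproj : ∀ j, c j + (1 - t - w) * q j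
      = -(D.ρ ^ 2 * (perronPair g j (secondOrder D x) + perronPair g j (secondOrder D y))) := by
    intro j
    have h1 : perronPair g j (fun a => (1 - w) * x a - t * (symVar D.S *ᵥ x) a.swap
      + (c (side a) + (1 - t - w) * q (side a)) * g a
      + D.ρ ^ 2 * (secondOrder D x a + secondOrder D y a)) = 0 := by
      simp_rw [heq]; simp [perronPair]
    rw [perronPair_add g j (fun a => (1 - w) * x a - t * (symVar D.S *ᵥ x) a.swap
      + (c (side a) + (1 - t - w) * q (side a)) * g a), perronPair_mul,
      perronPair_add g j (secondOrder D x),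
      perronPair_add g j (fun a => (1 - w) * x a - t * (symVar D.S *ᵥ x) a.swap),
      perronPair_sub, perronPair_mul, perronPair_mul, perronPair_swap hg.eigen, hpx,
      h.perronPair_self hg0 (fun k => c k + (1 - t - w) * q k)] at h1
    linarith
  have : Nonempty (Idx n) := ⟨Sum.inl ⟨0, h.n_pos⟩⟩
  obtain ⟨b, hbm⟩ := Finite.exists_max (fun a => |x a|)
  obtain ⟨m, hm⟩ : ∃ m, m = |x b| := ⟨_, rfl⟩
  rw [← hm] at hbm
  have hm0 : 0 ≤ m := hm ▸ abs_nonneg _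
  have hyb : ∀ a, |y a| ≤ 2 * Λ * Q := fun a => by
    rw [hy, abs_mul, abs_of_pos (hg0 a), mul_comm (2 * Λ)]
    exact mul_le_mul (hQ _) (hb a).2 (hg0 a).le hQ0
  have hsx := fun a => h.abs_secondOrder_le hbm a
  have hsyb := fun a => h.abs_secondOrder_le hyb a
  have hup : ∀ a, ∀ k : ℝ, 0 ≤ k → k ≤ 2 * Λ * k * g a := by
    intro a k hk
    calc k = 2 * Λ * k * (Λ⁻¹ / 2) := by field_simp
      _ ≤ _ := by
        have := (hb a).1
        gcongr
  have hpsx : ∀ j, |perronPair g j (secondOrder D x)| ≤ 12 * Λ ^ 4 * m := fun j => by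
    refine h.abs_perronPair_le hg0 (fun a => ?_) j
    refine (hsx a).trans ((hup a _ (by positivity)).trans (le_of_eq (by ring)))
  have hpsy : ∀ j, |perronPair g j (secondOrder D y)| ≤ 24 * Λ ^ 5 * Q := fun j => by
    refine h.abs_perronPair_le hg0 (fun a => ?_) j
    refine (hsyb a).trans ((hup a _ (by positivity)).trans (le_of_eq (by ring)))
  have hcb : ∀ j, |c j + (1 - t - w) * q j| ≤ D.ρ ^ 2 * (12 * Λ ^ 4 * m + 24 * Λ ^ 5 * Q) := by
    intro j
    rw [hproj, abs_neg, abs_mul, abs_of_nonneg (sq_nonneg D.ρ)]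
    gcongr
    exact (abs_add_le _ _).trans (add_le_add (hpsx j) (hpsy j))
  have hKx : ∀ a, ‖(D.K (fun b => (x b : ℂ)) - (w : ℂ) • fun b => (x b : ℂ)) a‖
      ≤ D.ρ ^ 2 * (24 * Λ ^ 5 * m + 60 * Λ ^ 6 * Q) := by
    intro a
    have e1 : (D.K (fun b => (x b : ℂ)) - (w : ℂ) • fun b => (x b : ℂ)) a
        = ((-((c (side a) + (1 - t - w) * q (side a)) * g a
          + D.ρ ^ 2 * secondOrder D y a) : ℝ) : ℂ) := by
      rw [Pi.sub_apply, Pi.smul_apply, K_ofReal, smul_eq_mul, ← Complex.ofReal_mul,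
        ← Complex.ofReal_sub, h.KR_eq, ← ht]
      congr 1
      linarith [heq a]
    rw [e1, norm_real, Real.norm_eq_abs, abs_neg]
    refine (abs_add_le _ _).trans ?_
    rw [abs_mul, abs_mul, abs_of_nonneg (sq_nonneg D.ρ), abs_of_pos (hg0 a)]
    have e2 : |c (side a) + (1 - t - w) * q (side a)| * g a
        ≤ D.ρ ^ 2 * (12 * Λ ^ 4 * m + 24 * Λ ^ 5 * Q) * (2 * Λ) :=
      mul_le_mul (hcb _) (hb a).2 (hg0 a).le (by positivity)
    have e3 : D.ρ ^ 2 * |secondOrder D y a| ≤ D.ρ ^ 2 * (6 * Λ ^ 3 * (2 * Λ * Q)) :=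
      mul_le_mul_of_nonneg_left (hsyb a) (sq_nonneg _)
    have e4 : Λ ^ 4 * (D.ρ ^ 2 * Q) ≤ Λ ^ 6 * (D.ρ ^ 2 * Q) := by
      gcongr
      norm_num
    linarith
  have hpair : ∀ e : Fin n → Idx n, (∑ i, g (e i).swap * x (e i) = 0) →
      ‖(n : ℂ)⁻¹ * ∑ i, (D.G (e i) : ℂ) * (x (e i) : ℂ)‖ ≤ 108 * Λ ^ 12 * D.del * m := by
    intro e he
    have e1 : (n : ℂ)⁻¹ * ∑ i, (D.G (e i) : ℂ) * (x (e i) : ℂ)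
        = (((n : ℝ)⁻¹ * ∑ i, (D.G (e i) - g (e i).swap) * x (e i) : ℝ) : ℂ) := by
      simp only [sub_mul, Finset.sum_sub_distrib, he, sub_zero]
      push_cast; rfl
    rw [e1, norm_real, Real.norm_eq_abs, abs_mul, abs_of_pos (inv_pos.2 hn)]
    calc (n : ℝ)⁻¹ * |∑ i, (D.G (e i) - g (e i).swap) * x (e i)|
        ≤ (n : ℝ)⁻¹ * ∑ _i : Fin n, 108 * Λ ^ 12 * D.del * m := by
          gcongr
          refine (Finset.abs_sum_le_sum_abs _ _).trans (Finset.sum_le_sum fun i _ => ?_)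
          rw [abs_mul]
          refine mul_le_mul ?_ (hbm _) (abs_nonneg _) (by positivity)
          rw [abs_sub_comm]
          exact hg.near (e i).swap
      _ = 108 * Λ ^ 12 * D.del * m := by
        simp only [Finset.sum_const, Finset.card_univ, Fintype.card_fin, nsmul_eq_mul]
        field_simp
  have hW := (inv_pos.2 (h.perronMass_pos hg0)).ne'
  have hz0 : ∑ i, g (Sum.inl i : Idx n).swap * x (Sum.inl i) = 0 := by
    have := hpx 0
    simpa [perronPair, Fintype.sum_sum_type, (h.perronMass_pos hg0).ne'] using this
  have hz1 : ∑ i, g (Sum.inr i : Idx n).swap * x (Sum.inr i) = 0 := by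
    have := hpx 1
    simpa [perronPair, Fintype.sum_sum_type, (h.perronMass_pos hg0).ne'] using this
  have hd' : D.del ≤ (48 * Λ ^ 10)⁻¹ := by
    refine hd.trans ?_
    gcongr
    · norm_num
    · norm_num
  have key := h.norm_le_of_K (r := fun b => (x b : ℂ)) (w := (w : ℂ)) (by simpa using hw) hd' hKx
    (hpair Sum.inl hz0) (hpair Sum.inr hz1) b
  rw [norm_real, Real.norm_eq_abs, ← hm] at key
  have hfin : m ≤ 360 * Λ ^ 14 * D.ρ ^ 2 * Q := by
    have hδ2 : Λ ^ 20 * D.del ≤ 1 / 1000 := by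
      calc Λ ^ 20 * D.del ≤ Λ ^ 20 * (1000 * Λ ^ 20)⁻¹ := by gcongr
        _ = 1 / 1000 := by field_simp
    have e0 : Λ ^ 20 * D.del * m ≤ 1 / 1000 * m := mul_le_mul_of_nonneg_right hδ2 hm0
    have e1 : Λ ^ 13 * D.ρ ^ 2 * m ≤ Λ ^ 20 * D.del * m := by
      gcongr
      norm_num
    have e2 : 3 * Λ ^ 8 * (D.ρ ^ 2 * (24 * Λ ^ 5 * m + 60 * Λ ^ 6 * Q) + 108 * Λ ^ 12 * D.del * m)
      = 72 * (Λ ^ 13 * D.ρ ^ 2 * m) + 180 * Λ ^ 14 * D.ρ ^ 2 * Q + 324 * (Λ ^ 20 * D.del * m) := by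
        ring
    linarith
  refine ⟨fun a => ?_, fun j => ?_⟩
  · have := hbm a
    rw [hx, hy] at this
    exact this.trans hfin
  · rw [← ht, hproj]
    have e1 := h.abs_perronPair_secondOrder_lift hg hd hQ j
    rw [← hy] at e1
    have e2 : |D.ρ ^ 2 * perronPair g j (secondOrder D x)|
        ≤ 4320 * Λ ^ 18 * D.ρ ^ 2 * D.del * Q := by
      rw [abs_mul, abs_of_nonneg (sq_nonneg D.ρ)]
      calc _ ≤ D.ρ ^ 2 * (12 * Λ ^ 4 * (360 * Λ ^ 14 * D.del * Q)) := by
            gcongr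
            refine (hpsx j).trans ?_
            gcongr
            refine hfin.trans ?_
            gcongr
        _ = _ := by ring
    have e3 : |D.ρ ^ 2 * (perronPair g j (secondOrder D y) - kap g * (q j + (q 0 + q 1)))|
        ≤ D.ρ ^ 2 * (1980 * Λ ^ 15 * D.del * Q) := by
      rw [abs_mul, abs_of_nonneg (sq_nonneg D.ρ)]
      gcongr
    have e4 : Λ ^ 15 * (D.ρ ^ 2 * D.del * Q) ≤ Λ ^ 18 * (D.ρ ^ 2 * D.del * Q) := by
      gcongr
      norm_num
    have e5 : -(D.ρ ^ 2 * (perronPair g j (secondOrder D x) + perronPair g j (secondOrder D y)))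
        + D.ρ ^ 2 * (kap g * (q j + (q 0 + q 1)))
        = -(D.ρ ^ 2 * perronPair g j (secondOrder D x))
          - D.ρ ^ 2 * (perronPair g j (secondOrder D y) - kap g * (q j + (q 0 + q 1))) := by ring
    rw [e5]
    refine (abs_sub _ _).trans ?_
    rw [abs_neg]
    linarith

end Regular

end Data

namespace Data

/-- The shifted stability operator bordered by the Perron-Frobenius eigenvectors. -/
def bordered (D : Data n) (g : Idx n → ℝ) (w : ℝ) :
    Matrix (Idx n ⊕ Fin 2) (Idx n ⊕ Fin 2) ℝ :=
  Matrix.fromBlocks (D.KR - w • 1) (Matrix.of fun a j => if side a = j then g a else 0)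
    (Matrix.of fun j a => (perronMass g)⁻¹ * if side a = j then g a.swap else 0) 0

theorem bordered_mulVec_inl (D : Data n) (g : Idx n → ℝ) (w : ℝ) (v : Idx n ⊕ Fin 2 → ℝ)
    (a : Idx n) : (D.bordered g w *ᵥ v) (Sum.inl a)
      = (D.KR *ᵥ (v ∘ Sum.inl)) a - w * v (Sum.inl a) + v (Sum.inr (side a)) * g a := by
  unfold bordered
  rw [Matrix.fromBlocks_mulVec, Sum.elim_inl, Pi.add_apply, Matrix.sub_mulVec, Matrix.smul_mulVec,
    Matrix.one_mulVec]
  congr 1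
  simp [mulVec, dotProduct, mul_comm]

theorem bordered_mulVec_inr (D : Data n) (g : Idx n → ℝ) (w : ℝ) (v : Idx n ⊕ Fin 2 → ℝ)
    (j : Fin 2) : (D.bordered g w *ᵥ v) (Sum.inr j) = perronPair g j (v ∘ Sum.inl) := by
  unfold bordered
  rw [Matrix.fromBlocks_mulVec, Sum.elim_inr, Matrix.zero_mulVec, add_zero, mulVec,
    dotProduct, perronPair, Finset.mul_sum]
  refine Finset.sum_congr rfl fun a _ => ?_
  simp only [Matrix.of_apply, mul_assoc, ite_mul, zero_mul]

theorem continuous_bordered (D : Data n) (g : Idx n → ℝ) : Continuous (D.bordered g) := by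
  unfold bordered
  fun_prop

variable {D : Data n} {Λ : ℝ}

namespace Regular

theorem bordered_det_ne_zero (h : D.Regular Λ) {g : Idx n → ℝ} (hg : D.PerronNear (108 * Λ ^ 12) g)
    (hd : D.del ≤ (1000 * Λ ^ 20)⁻¹) {w : ℝ} (hw : |w| ≤ (Λ ^ 5)⁻¹ / 4) :
    (D.bordered g w).det ≠ 0 := by
  intro h0
  obtain ⟨v, hv, hv0⟩ := Matrix.exists_mulVec_eq_zero_iff.2 h0
  obtain ⟨h1, h2⟩ := h.bordered_estimate hg hd hw (r := v ∘ Sum.inl) (c := v ∘ Sum.inr) (q := 0)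
    (Q := 0) (fun a => by
      have := congrFun hv0 (Sum.inl a)
      rwa [bordered_mulVec_inl] at this)
    (fun j => by
      have := congrFun hv0 (Sum.inr j)
      rwa [bordered_mulVec_inr] at this) (by simp)
  apply hv
  funext x
  rcases x with a | j
  · have := h1 a
    simpa using this
  · have := h2 j
    simpa using this

theorem exists_schur (h : D.Regular Λ) {g : Idx n → ℝ} (hg : D.PerronNear (108 * Λ ^ 12) g)
    (hd : D.del ≤ (1000 * Λ ^ 20)⁻¹) : ∃ Φ : ℝ → Matrix (Fin 2) (Fin 2) ℝ,
      ContinuousOn Φ {w | |w| ≤ (Λ ^ 5)⁻¹ / 4} ∧ ∀ w, |w| ≤ (Λ ^ 5)⁻¹ / 4 → ∀ q : Fin 2 → ℝ,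
        ∃ r : Idx n → ℝ, (∀ a, (D.KR *ᵥ r) a - w * r a + (Φ w *ᵥ q) (side a) * g a = 0) ∧
          ∀ j, perronPair g j r = q j := by
  refine ⟨fun w => ((D.bordered g w).det⁻¹ • (D.bordered g w).adjugate).submatrix Sum.inr Sum.inr,
    ?_, fun w hw q => ?_⟩
  · have hc := D.continuous_bordered g
    have h1 : ContinuousOn (fun w => (D.bordered g w).det⁻¹ • (D.bordered g w).adjugate)
        {w | |w| ≤ (Λ ^ 5)⁻¹ / 4} :=
      (ContinuousOn.inv₀ hc.matrix_det.continuousOn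
        fun w hw => h.bordered_det_ne_zero hg hd hw).smul hc.matrix_adjugate.continuousOn
    exact (continuous_id.matrix_submatrix _ _).comp_continuousOn h1
  · obtain ⟨v, hv⟩ : ∃ v, v = ((D.bordered g w).det⁻¹ • (D.bordered g w).adjugate)
      *ᵥ Sum.elim (0 : Idx n → ℝ) q := ⟨_, rfl⟩
    have h1 : D.bordered g w *ᵥ v = Sum.elim (0 : Idx n → ℝ) q := by
      rw [hv, mulVec_mulVec, Matrix.mul_smul, Matrix.mul_adjugate, smul_smul,
        inv_mul_cancel₀ (h.bordered_det_ne_zero hg hd hw), one_smul, Matrix.one_mulVec]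
    refine ⟨v ∘ Sum.inl, fun a => ?_, fun j => ?_⟩
    · have h2 := congrFun h1 (Sum.inl a)
      rw [bordered_mulVec_inl] at h2
      have h3 : ∀ j, v (Sum.inr j) = ((((D.bordered g w).det⁻¹ •
          (D.bordered g w).adjugate).submatrix Sum.inr Sum.inr) *ᵥ q) j := by
        intro j
        rw [hv]
        simp [mulVec, dotProduct]
      rw [h3] at h2
      exact h2
    · have h2 := congrFun h1 (Sum.inr j)
      rwa [bordered_mulVec_inr] at h2

theorem del_pow_le (h : D.Regular Λ) (hd : D.del ≤ (10 ^ 6 * Λ ^ 20)⁻¹) {k : ℕ} (hk : k ≤ 20) :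
    D.del * Λ ^ k ≤ (10 ^ 6)⁻¹ := by
  have hΛ0 := h.Λ_pos
  have hΛ := h.one_le
  calc D.del * Λ ^ k ≤ (10 ^ 6 * Λ ^ 20)⁻¹ * Λ ^ 20 := by
        gcongr
    _ = _ := by field_simp

theorem exists_eigen (h : D.Regular Λ) {g : Idx n → ℝ} (hg : D.PerronNear (108 * Λ ^ 12) g)
    (hd : D.del ≤ (10 ^ 6 * Λ ^ 20)⁻¹) {s : ℝ} (hs : s = 1 ∨ s = -1) :
    ∃ (w : ℝ) (r : Idx n → ℝ), (∀ a, (D.KR *ᵥ r) a = w * r a) ∧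
      |w - (1 - (‖D.z‖ ^ 2)⁻¹ + D.ρ ^ 2 * ((2 + s) * kap g))| ≤ 24000 * Λ ^ 18 * D.ρ ^ 2 * D.del ∧
      ∀ a, |r a - ![1, s] (side a) * D.F a| ≤ 127000 * Λ ^ 21 * D.del := by
  have hΛ0 := h.Λ_pos
  have hΛ := h.one_le
  have hδ := h.del_pos
  have hρδ := h.ρ_sq_le
  have hρ2 : 0 < D.ρ ^ 2 := pow_pos h.ρ_pos 2
  have hd1 : D.del ≤ (1000 * Λ ^ 20)⁻¹ := by
    refine hd.trans ?_
    gcongr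
    norm_num
  have hb := hg.bounds h hd1
  obtain ⟨κ, hκ⟩ : ∃ κ, κ = kap g := ⟨_, rfl⟩
  obtain ⟨hκl, hκu⟩ := h.kap_bounds hb
  rw [← hκ] at hκl hκu ⊢
  have hκl' : 1 ≤ 4 * Λ ^ 2 * κ := by
    calc (1 : ℝ) = 4 * Λ ^ 2 * (Λ⁻¹ ^ 2 / 4) := by field_simp
      _ ≤ _ := by gcongr
  have hκ0 : 0 < κ := lt_of_lt_of_le (by positivity) hκl
  obtain ⟨t, ht⟩ : ∃ t, t = (‖D.z‖ ^ 2)⁻¹ := ⟨_, rfl⟩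
  have h1t : |1 - t| ≤ 2 * Λ * D.del := by
    have hz0 : 0 < ‖D.z‖ ^ 2 := by linarith [h.z_sq_lower]
    have : 1 - t = t * (‖D.z‖ ^ 2 - 1) := by rw [ht, mul_sub, inv_mul_cancel₀ hz0.ne', mul_one]
    rw [this, abs_mul, mul_assoc]
    have ht2 : |t| ≤ 2 := by rw [ht, abs_of_pos (inv_pos.2 hz0)]; exact h.z_inv_le
    exact mul_le_mul ht2 h.z_near (abs_nonneg _) (by norm_num)
  rw [← ht]
  obtain ⟨k, hk⟩ : ∃ k, k = D.ρ ^ 2 * κ := ⟨_, rfl⟩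
  have hk0 : 0 < k := hk ▸ mul_pos hρ2 hκ0
  have hs2 : |s| = 1 := by rcases hs with rfl | rfl <;> simp
  have hw : ∀ θ ∈ Set.Icc (0 : ℝ) 2, |1 - t + k * (2 + s * θ)| ≤ (Λ ^ 5)⁻¹ / 4 := by
    intro θ hθ
    have e1 : |2 + s * θ| ≤ 4 := by
      refine (abs_add_le _ _).trans ?_
      rw [abs_mul, hs2, abs_two, abs_of_nonneg hθ.1]
      linarith [hθ.2]
    have e2 : |1 - t + k * (2 + s * θ)| ≤ 18 * Λ ^ 2 * D.del := by
      refine (abs_add_le _ _).trans ?_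
      rw [abs_mul, abs_of_pos hk0]
      have e3 : k * |2 + s * θ| ≤ D.del * (4 * Λ ^ 2) * 4 := by
        rw [hk]
        gcongr
      have e4 : Λ * D.del ≤ Λ ^ 2 * D.del := by
        have := le_self_pow₀ hΛ (two_ne_zero)
        gcongr
      linarith
    refine e2.trans ?_
    have e5 := h.del_pow_le hd (k := 7) (by norm_num)
    rw [le_div_iff₀ (by norm_num), inv_eq_one_div, le_div_iff₀ (by positivity)]
    calc 18 * Λ ^ 2 * D.del * 4 * Λ ^ 5 = 72 * (D.del * Λ ^ 7) := by ring
      _ ≤ 72 * (10 ^ 6)⁻¹ := by gcongr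
      _ ≤ 1 := by norm_num
  obtain ⟨Φ, hΦc, hΦ⟩ := h.exists_schur hg hd1
  have hc2 : 6300 * Λ ^ 18 * D.ρ ^ 2 * D.del ≤ k / 10 := by
    have e5 := h.del_pow_le hd (k := 20) (by norm_num)
    calc 6300 * Λ ^ 18 * D.ρ ^ 2 * D.del
        ≤ 6300 * Λ ^ 18 * D.ρ ^ 2 * D.del * (4 * Λ ^ 2 * κ) := le_mul_of_one_le_right (by positivity) hκl'
      _ = 25200 * (D.del * Λ ^ 20) * k := by rw [hk]; ring
      _ ≤ 25200 * (10 ^ 6)⁻¹ * k := by gcongr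
      _ ≤ k / 10 := by linarith
  -- the entries of the Schur complement
  have hent : ∀ θ ∈ Set.Icc (0 : ℝ) 2, ∀ i j : Fin 2, |Φ (1 - t + k * (2 + s * θ)) i j
      - ((if i = j then k * (2 + s * θ) else 0) - k * ((if i = j then 1 else 0) + 1))| ≤ k / 10 := by
    intro θ hθ i j
    obtain ⟨r, hr1, hr2⟩ := hΦ _ (hw θ hθ) (Pi.single j 1)
    have h3 := (h.bordered_estimate hg hd1 (hw θ hθ) hr1 hr2 (Q := 1) (fun j' => by
      rw [Pi.single_apply]; split_ifs <;> simp)).2 i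
    rw [mulVec_single_one, Matrix.col_apply, ← ht, ← hκ, mul_one] at h3
    refine le_trans (le_of_eq ?_) (h3.trans hc2)
    congr 1
    have e1 : (Pi.single j 1 : Fin 2 → ℝ) 0 + (Pi.single j 1 : Fin 2 → ℝ) 1 = 1 := by
      fin_cases j <;> simp
    rw [e1, Pi.single_apply, hk]
    split_ifs <;> ring
  have hdiag : ∀ θ ∈ Set.Icc (0 : ℝ) 2, ∀ i, |Φ (1 - t + k * (2 + s * θ)) i i - k * (s * θ)|
      ≤ k / 10 := by
    intro θ hθ i
    have := hent θ hθ i i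
    rw [if_pos rfl, if_pos rfl] at this
    refine le_trans (le_of_eq ?_) this
    congr 1; ring
  have hoff : ∀ θ ∈ Set.Icc (0 : ℝ) 2, ∀ i j, i ≠ j → |Φ (1 - t + k * (2 + s * θ)) i j + k|
      ≤ k / 10 := by
    intro θ hθ i j hij
    have := hent θ hθ i j
    rw [if_neg hij, if_neg hij] at this
    refine le_trans (le_of_eq ?_) this
    congr 1; ring
  have hkk : 0 < k * k := mul_pos hk0 hk0
  have hf0 : (Φ (1 - t + k * (2 + s * 0))).det < 0 := by
    have m0 : (0 : ℝ) ∈ Set.Icc (0 : ℝ) 2 := by norm_num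
    have e00 := hdiag 0 m0 0
    have e11 := hdiag 0 m0 1
    have e01 := abs_le.1 (hoff 0 m0 0 1 (by decide))
    have e10 := abs_le.1 (hoff 0 m0 1 0 (by decide))
    rw [Matrix.det_fin_two]
    generalize Φ (1 - t + k * (2 + s * 0)) = A at e00 e01 e10 e11 ⊢
    rw [mul_zero, mul_zero, sub_zero] at e00 e11
    have a1 : A 0 0 * A 1 1 ≤ (k / 10) * (k / 10) := by
      refine (le_abs_self _).trans ?_
      rw [abs_mul]
      gcongr
    have a2 : (9 * k / 10) * (9 * k / 10) ≤ (-A 0 1) * (-A 1 0) :=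
      mul_le_mul (by linarith) (by linarith) (by linarith) (by linarith)
    linarith
  have hf2 : 0 < (Φ (1 - t + k * (2 + s * 2))).det := by
    have m0 : (2 : ℝ) ∈ Set.Icc (0 : ℝ) 2 := by norm_num
    have e00 := abs_le.1 (hdiag 2 m0 0)
    have e11 := abs_le.1 (hdiag 2 m0 1)
    have e01 := abs_le.1 (hoff 2 m0 0 1 (by decide))
    have e10 := abs_le.1 (hoff 2 m0 1 0 (by decide))
    rw [Matrix.det_fin_two]
    generalize Φ (1 - t + k * (2 + s * 2)) = A at e00 e01 e10 e11 ⊢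
    have a1 : (-A 0 1) * (-A 1 0) ≤ (11 * k / 10) * (11 * k / 10) :=
      mul_le_mul (by linarith) (by linarith) (by linarith) (by linarith)
    have a2 : (19 * k / 10) * (19 * k / 10) ≤ (s * A 0 0) * (s * A 1 1) := by
      have b1 : 19 * k / 10 ≤ s * A 0 0 := by rcases hs with rfl | rfl <;> linarith
      have b2 : 19 * k / 10 ≤ s * A 1 1 := by rcases hs with rfl | rfl <;> linarith
      exact mul_le_mul b1 b2 (by linarith) (by linarith)
    have a3 : (s * A 0 0) * (s * A 1 1) = A 0 0 * A 1 1 := by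
      rcases hs with rfl | rfl <;> ring
    linarith
  have hcont : ContinuousOn (fun θ : ℝ => (Φ (1 - t + k * (2 + s * θ))).det) (Set.Icc 0 2) := by
    refine (continuous_id.matrix_det).comp_continuousOn
      (hΦc.comp (by fun_prop) fun θ hθ => hw θ hθ)
  obtain ⟨θ, hθ, hθ0⟩ := intermediate_value_Icc (by norm_num) hcont ⟨hf0.le, hf2.le⟩
  obtain ⟨q, hq, hq0⟩ := Matrix.exists_mulVec_eq_zero_iff.2 hθ0
  obtain ⟨c, hc⟩ : ∃ c, c = 6300 * Λ ^ 18 * D.ρ ^ 2 * D.del := ⟨_, rfl⟩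
  rw [← hc] at hc2
  have hest : ∀ q : Fin 2 → ℝ, Φ (1 - t + k * (2 + s * θ)) *ᵥ q = 0 → ∀ Q, (∀ j, |q j| ≤ Q) →
      k * |q 0 - s * q 1| ≤ 2 * (c * Q) ∧ k * |q 1 - s * θ * q 0| ≤ c * Q ∧
      ∃ r : Idx n → ℝ, (∀ a, (D.KR *ᵥ r) a = (1 - t + k * (2 + s * θ)) * r a) ∧
        ∀ a, |r a - q (side a) * g a| ≤ 360 * Λ ^ 14 * D.ρ ^ 2 * Q := by
    intro q hq Q hQ
    obtain ⟨r, hr1, hr2⟩ := hΦ _ (hw θ hθ) q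
    rw [hq] at hr1
    obtain ⟨h1, h2⟩ := h.bordered_estimate hg hd1 (hw θ hθ) hr1 hr2 hQ
    simp only [Pi.zero_apply, zero_add, ← ht, ← hκ] at h2
    have h20 := h2 0
    have h21 := h2 1
    rw [← hc] at h20 h21
    have e0 : (1 - t - (1 - t + k * (2 + s * θ))) * q 0 + D.ρ ^ 2 * (κ * (q 0 + (q 0 + q 1)))
        = k * (q 1 - s * θ * q 0) := by rw [hk]; ring
    have e1 : ((1 - t - (1 - t + k * (2 + s * θ))) * q 0 + D.ρ ^ 2 * (κ * (q 0 + (q 0 + q 1))))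
        - s * ((1 - t - (1 - t + k * (2 + s * θ))) * q 1 + D.ρ ^ 2 * (κ * (q 1 + (q 0 + q 1))))
        = -(s * (1 + θ)) * (k * (q 0 - s * q 1)) := by
      rw [hk]; rcases hs with rfl | rfl <;> ring
    refine ⟨?_, ?_, r, fun a => ?_, h1⟩
    · have e2 := abs_sub ((1 - t - (1 - t + k * (2 + s * θ))) * q 0
        + D.ρ ^ 2 * (κ * (q 0 + (q 0 + q 1))))
        (s * ((1 - t - (1 - t + k * (2 + s * θ))) * q 1 + D.ρ ^ 2 * (κ * (q 1 + (q 0 + q 1)))))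
      rw [e1, abs_mul s, hs2, one_mul, abs_mul, abs_neg, abs_mul, hs2, one_mul, abs_mul,
        abs_of_pos hk0, abs_of_nonneg (by linarith [hθ.1])] at e2
      have e3 : 0 ≤ θ * (k * |q 0 - s * q 1|) := mul_nonneg hθ.1 (by positivity)
      linarith
    · rw [e0, abs_mul, abs_of_pos hk0] at h20
      exact h20
    · have := hr1 a
      simp only [Pi.zero_apply, zero_mul, add_zero] at this
      linarith
  have hc0 : 0 ≤ c := hc ▸ by positivity
  have hsq : ∀ x : ℝ, |s * x| = |x| := fun x => by rw [abs_mul, hs2, one_mul]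
  have hq00 : q 0 ≠ 0 := by
    intro h00
    have h1 := (hest q hq0 |q 1| (by
      intro j
      fin_cases j
      · simp [h00]
      · simp)).1
    rw [h00, zero_sub, abs_neg, hsq] at h1
    have h2 : c * |q 1| ≤ k / 10 * |q 1| := by gcongr
    have h3 : |q 1| = 0 := by
      by_contra h4
      have : 0 < k * |q 1| := mul_pos hk0 (lt_of_le_of_ne (abs_nonneg _) (Ne.symm h4))
      linarith
    apply hq
    funext j
    fin_cases j
    · exact h00
    · exact abs_eq_zero.1 h3
  obtain ⟨p, hp⟩ : ∃ p, p = q 1 / q 0 := ⟨_, rfl⟩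
  have hqp : Φ (1 - t + k * (2 + s * θ)) *ᵥ ![1, p] = 0 := by
    have : ![1, p] = (q 0)⁻¹ • q := by
      funext j
      fin_cases j
      · simp [hq00]
      · simp [hp, div_eq_inv_mul]
    rw [this, mulVec_smul, hq0, smul_zero]
  have hp54 : |p| ≤ 5 / 4 := by
    by_contra hlt
    push Not at hlt
    have h1 := (hest ![1, p] hqp |p| (by
      intro j
      fin_cases j
      · simp; linarith
      · simp)).1
    simp only [Matrix.cons_val_zero, Matrix.cons_val_one] at h1
    have h2 : c * |p| ≤ k / 10 * |p| := by gcongr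
    have h3 : |1 - s * p| ≤ |p| / 5 := by
      refine le_of_mul_le_mul_left ?_ hk0
      linarith
    have h4 := abs_sub_abs_le_abs_sub (s * p) 1
    rw [hsq, abs_one, abs_sub_comm] at h4
    linarith
  obtain ⟨h1, h2, r, hr, hra⟩ := hest ![1, p] hqp (5 / 4) (by
      intro j
      fin_cases j
      · simp; norm_num
      · simpa using hp54)
  simp only [Matrix.cons_val_zero, Matrix.cons_val_one, mul_one] at h1 h2
  have hps : |1 - s * p| = |p - s| := by
    rcases hs with rfl | rfl
    · rw [one_mul, abs_sub_comm]
    · rw [neg_one_mul, sub_neg_eq_add, sub_neg_eq_add, add_comm]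
  rw [hps] at h1
  have hck : c ≤ 25200 * Λ ^ 20 * D.del * k := by
    calc c ≤ c * (4 * Λ ^ 2 * κ) := le_mul_of_one_le_right hc0 hκl'
      _ = _ := by rw [hc, hk]; ring
  have hps' : |p - s| ≤ 63000 * Λ ^ 20 * D.del := by
    refine le_of_mul_le_mul_left ?_ hk0
    linarith
  refine ⟨_, r, hr, ?_, fun a => ?_⟩
  · have e1 : 1 - t + k * (2 + s * θ) - (1 - t + D.ρ ^ 2 * ((2 + s) * κ))
        = k * (p - s) - k * (p - s * θ) := by rw [hk]; ring
    rw [e1]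
    refine (abs_sub _ _).trans ?_
    rw [abs_mul, abs_mul, abs_of_pos hk0]
    have : 0 ≤ Λ ^ 18 * D.ρ ^ 2 * D.del := by positivity
    linarith
  · have hqs : |(![1, p] : Fin 2 → ℝ) (side a) - (![1, s] : Fin 2 → ℝ) (side a)|
        ≤ 63000 * Λ ^ 20 * D.del := by
      rcases a with i | i
      · simp; positivity
      · simpa using hps'
    have hs1 : |(![1, s] : Fin 2 → ℝ) (side a)| = 1 := by
      rcases a with i | i
      · simp
      · simpa using hs2
    have e1 : r a - (![1, s] : Fin 2 → ℝ) (side a) * D.F a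
        = (r a - (![1, p] : Fin 2 → ℝ) (side a) * g a)
          + ((![1, p] : Fin 2 → ℝ) (side a) - (![1, s] : Fin 2 → ℝ) (side a)) * g a
          + (![1, s] : Fin 2 → ℝ) (side a) * (g a - D.F a) := by ring
    rw [e1]
    refine (abs_add_three _ _ _).trans ?_
    have hga0 : 0 < g a := lt_of_lt_of_le (by positivity) (hb a).1
    rw [abs_mul, abs_mul, hs1, one_mul, abs_of_pos hga0]
    have e2 : |(![1, p] : Fin 2 → ℝ) (side a) - (![1, s] : Fin 2 → ℝ) (side a)| * g a
        ≤ 63000 * Λ ^ 20 * D.del * (2 * Λ) :=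
      mul_le_mul hqs (hb a).2 hga0.le (by positivity)
    have e3 : 360 * Λ ^ 14 * D.ρ ^ 2 * (5 / 4) ≤ 360 * Λ ^ 21 * D.del * (5 / 4) := by
      gcongr
      norm_num
    have e4 : 108 * Λ ^ 12 * D.del ≤ 108 * Λ ^ 21 * D.del := by
      gcongr
      norm_num
    have e5 := hra a
    have e6 := hg.near a
    have e7 : 0 ≤ Λ ^ 21 * D.del := by positivity
    linarith

end Regular

end Data

namespace Data

variable {D : Data n} {Λ : ℝ}

namespace Regular

theorem abs_inv_u_sq_sub_one_le (h : D.Regular Λ) (a : Idx n) :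
    |(D.u a ^ 2)⁻¹ - 1| ≤ 10 * Λ * D.del := by
  have hu := h.u_pos a
  have e1 : (D.u a ^ 2)⁻¹ - 1 = (1 - D.u a) * ((1 + D.u a) * ((D.u a)⁻¹ * (D.u a)⁻¹)) := by
    field_simp; ring
  rw [e1, abs_mul, abs_sub_comm, abs_of_nonneg (a := (1 + D.u a) * _) (by positivity)]
  calc _ ≤ Λ * D.del * ((1 + 3 / 2) * (2 * 2)) := by
        have h1 := h.u_near a
        have h2 := h.u_upper a
        have h3 := h.u_inv_le a
        have h4 := h.Λ_pos
        have h5 := h.del_pos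
        gcongr
    _ = _ := by ring

theorem sum_inl_act (h : D.Regular Λ) {g : Idx n → ℝ}
    (hg : ∀ a : Idx n, ∑ b, symVar D.S a b * g b = g a.swap) :
    (‖D.z‖ ^ 2 - 1) * ∑ i, g (Sum.inl i) * D.F (Sum.inr i)
      = (D.η / D.ρ) * ∑ i, g (Sum.inl i)
        - D.ρ ^ 2 * ∑ i, g (Sum.inl i) * D.F (Sum.inr i)
          * (D.F (Sum.inl i) * D.F (Sum.inr i) * (D.u (Sum.inl i) ^ 2)⁻¹) := by
  have h1 : ∑ i, g (Sum.inl i) * ∑ b, symVar D.S (Sum.inl i) b * D.F b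
      = ∑ i, g (Sum.inl i) * D.F (Sum.inr i) := by
    simp only [Fintype.sum_sum_type, symVar, Matrix.fromBlocks_apply₁₁, Matrix.zero_apply,
      zero_mul, Finset.sum_const_zero, zero_add, Matrix.fromBlocks_apply₁₂, Finset.mul_sum]
    rw [Finset.sum_comm]
    refine Finset.sum_congr rfl fun j _ => ?_
    have := hg (Sum.inr j)
    simp [Fintype.sum_sum_type, symVar] at this
    rw [← this, Finset.sum_mul]
    exact Finset.sum_congr rfl fun i _ => by ring
  have h2 : ∀ i, (‖D.z‖ ^ 2 - 1) * (g (Sum.inl i) * D.F (Sum.inr i))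
      = (D.η / D.ρ) * g (Sum.inl i)
        - D.ρ ^ 2 * (g (Sum.inl i) * D.F (Sum.inr i)
          * (D.F (Sum.inl i) * D.F (Sum.inr i) * (D.u (Sum.inl i) ^ 2)⁻¹))
        + (g (Sum.inl i) * ∑ b, symVar D.S (Sum.inl i) b * D.F b
          - g (Sum.inl i) * D.F (Sum.inr i)) := by
    intro i
    have hu := (h.u_pos (Sum.inl i)).ne'
    have e1 := h.F_eq (Sum.inl i)
    have e2 := h.det_eq (Sum.inl i)
    rw [Sum.swap_inl] at e1 e2
    have e3 : D.F (Sum.inr i) * (D.u (Sum.inl i))⁻¹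
        = D.η / D.ρ + ∑ b, symVar D.S (Sum.inl i) b * D.F b := by
      rw [← div_eq_mul_inv, div_eq_iff hu, mul_comm]; exact e1
    have e4 : ‖D.z‖ ^ 2 + D.ρ ^ 2 * (D.F (Sum.inl i) * D.F (Sum.inr i) * (D.u (Sum.inl i) ^ 2)⁻¹)
        = (D.u (Sum.inl i))⁻¹ := by
      field_simp
      linarith
    linear_combination g (Sum.inl i) * e3 + g (Sum.inl i) * D.F (Sum.inr i) * e4
  rw [Finset.mul_sum, Finset.sum_congr rfl fun i _ => h2 i]
  simp only [Finset.sum_add_distrib, Finset.sum_sub_distrib, ← Finset.mul_sum]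
  rw [h1]
  ring

theorem one_sub_z_inv (h : D.Regular Λ) {g : Idx n → ℝ} (hg : D.PerronNear (108 * Λ ^ 12) g)
    (hd : D.del ≤ (10 ^ 6 * Λ ^ 20)⁻¹) : ∃ α : ℝ, Λ⁻¹ / 2 ≤ α ∧ α ≤ 2 * Λ ∧
      |1 - (‖D.z‖ ^ 2)⁻¹ - (D.η / D.ρ * α - D.ρ ^ 2 * kap g)| ≤ 9700 * Λ ^ 17 * D.ρ ^ 2 * D.del := by
  have hΛ0 := h.Λ_pos
  have hΛ := h.one_le
  have hδ := h.del_pos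
  have hn := h.n_pos'
  have hd1 : D.del ≤ (1000 * Λ ^ 20)⁻¹ := by
    refine hd.trans ?_
    gcongr
    norm_num
  have hb := hg.bounds h hd1
  have hg0 : ∀ a, 0 < g a := fun a => lt_of_lt_of_le (by positivity) (hb a).1
  obtain ⟨hκl, hκu⟩ := h.kap_bounds hb
  have hκ0 : 0 < kap g := lt_of_lt_of_le (by positivity) hκl
  have hκW : kap g * perronMass g = ∑ i, (g (Sum.inl i) * g (Sum.inr i)) ^ 2 := by
    unfold kap
    rw [mul_comm, mul_inv_cancel_left₀ (h.perronMass_pos hg0).ne']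
  generalize kap g = κ at hκl hκu hκ0 hκW ⊢
  obtain ⟨t, ht⟩ : ∃ t, t = (‖D.z‖ ^ 2)⁻¹ := ⟨_, rfl⟩
  have hz0 : 0 < ‖D.z‖ ^ 2 := by linarith [h.z_sq_lower]
  have ht0 : 0 < t := ht ▸ inv_pos.2 hz0
  have ht2 : t ≤ 2 := ht ▸ h.z_inv_le
  have htl : 1 / 2 ≤ t := by
    rw [ht, le_inv_comm₀ (by norm_num) hz0]; linarith [h.z_sq_upper]
  have h1t : 1 - t = t * (‖D.z‖ ^ 2 - 1) := by
    rw [ht, mul_sub, inv_mul_cancel₀ hz0.ne', mul_one]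
  have h1t' : |t - 1| ≤ 2 * Λ * D.del := by
    rw [abs_sub_comm, h1t, abs_mul, mul_assoc, abs_of_pos ht0]
    exact mul_le_mul ht2 h.z_near (abs_nonneg _) (by norm_num)
  rw [← ht]
  have hid := h.sum_inl_act hg.eigen
  obtain ⟨Y, hY⟩ : ∃ Y, Y = ∑ i, g (Sum.inl i) * D.F (Sum.inr i) := ⟨_, rfl⟩
  obtain ⟨N, hN⟩ : ∃ N, N = ∑ i, g (Sum.inl i) * D.F (Sum.inr i)
          * (D.F (Sum.inl i) * D.F (Sum.inr i) * (D.u (Sum.inl i) ^ 2)⁻¹) := ⟨_, rfl⟩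
  have hYl : n * (Λ⁻¹ ^ 2 / 2) ≤ Y := by
    have : ∑ _i : Fin n, (Λ⁻¹ ^ 2 / 2) ≤ Y := by
      rw [hY]
      refine Finset.sum_le_sum fun i _ => ?_
      calc Λ⁻¹ ^ 2 / 2 = (Λ⁻¹ / 2) * Λ⁻¹ := by ring
        _ ≤ _ := mul_le_mul (hb _).1 (h.F_lower _) (by positivity) (hg0 _).le
    simpa using this
  have hY0 : 0 < Y := lt_of_lt_of_le (by positivity) hYl
  have hα1 : Λ⁻¹ * Y ≤ ∑ i, g (Sum.inl i) := by
    rw [hY, Finset.mul_sum]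
    refine Finset.sum_le_sum fun i _ => ?_
    calc Λ⁻¹ * (g (Sum.inl i) * D.F (Sum.inr i)) ≤ Λ⁻¹ * (g (Sum.inl i) * Λ) := by
          have := (hg0 (Sum.inl i)).le
          have := h.F_upper (Sum.inr i)
          gcongr
      _ = _ := by field_simp
  have hα2 : ∑ i, g (Sum.inl i) ≤ Λ * Y := by
    rw [hY, Finset.mul_sum]
    refine Finset.sum_le_sum fun i _ => ?_
    calc g (Sum.inl i) = Λ * (g (Sum.inl i) * Λ⁻¹) := by field_simp
      _ ≤ Λ * (g (Sum.inl i) * D.F (Sum.inr i)) := by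
          have := (hg0 (Sum.inl i)).le
          have := h.F_lower (Sum.inr i)
          gcongr
  rw [← hY, ← hN] at hid
  have hNκ : |N - κ * Y| ≤ n * (2400 * Λ ^ 15 * D.del) := by
    have e1 : N - κ * Y = ∑ i, ((g (Sum.inl i) * D.F (Sum.inr i)
          * (D.F (Sum.inl i) * D.F (Sum.inr i) * (D.u (Sum.inl i) ^ 2)⁻¹)
          - (g (Sum.inl i) * g (Sum.inr i)) ^ 2)
          + κ * (g (Sum.inl i) * g (Sum.inr i) - g (Sum.inl i) * D.F (Sum.inr i))) := by
      rw [Finset.sum_add_distrib, Finset.sum_sub_distrib, ← Finset.mul_sum,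
        Finset.sum_sub_distrib, ← hN, ← hY, ← hκW, perronMass]
      ring
    rw [e1]
    have e2 : (n : ℝ) * (2400 * Λ ^ 15 * D.del) = ∑ _i : Fin n, 2400 * Λ ^ 15 * D.del := by simp
    rw [e2]
    refine (Finset.abs_sum_le_sum_abs _ _).trans (Finset.sum_le_sum fun i _ => ?_)
    have b1 := hb (Sum.inl i)
    have b2 := hb (Sum.inr i)
    have p1 := hg0 (Sum.inl i)
    have p2 := hg0 (Sum.inr i)
    have n1 := hg.near (Sum.inl i)
    have n2 := hg.near (Sum.inr i)
    have u1 := h.abs_inv_u_sq_sub_one_le (Sum.inl i)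
    have f1 := h.F_upper (Sum.inl i)
    have f2 := h.F_upper (Sum.inr i)
    have q1 := h.F_pos (Sum.inl i)
    have q2 := h.F_pos (Sum.inr i)
    generalize D.F (Sum.inl i) = F₁ at *
    generalize D.F (Sum.inr i) = F₂ at *
    generalize g (Sum.inl i) = g₁ at *
    generalize g (Sum.inr i) = g₂ at *
    generalize (D.u (Sum.inl i) ^ 2)⁻¹ = v at *
    have e3 : g₁ * F₂ * (F₁ * F₂ * v) - (g₁ * g₂) ^ 2 + κ * (g₁ * g₂ - g₁ * F₂)
        = g₁ * F₂ * (F₁ * F₂) * (v - 1) + -(g₁ * (F₂ * F₂) * (g₁ - F₁))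
          + ((κ * g₁ - g₁ * g₁ * (F₂ + g₂)) * (g₂ - F₂)) := by ring
    rw [e3]
    refine (abs_add_three _ _ _).trans ?_
    rw [abs_neg, abs_mul _ (v - 1), abs_mul _ (g₁ - F₁), abs_mul _ (g₂ - F₂),
      abs_of_pos (show 0 < g₁ * F₂ * (F₁ * F₂) by positivity),
      abs_of_pos (show 0 < g₁ * (F₂ * F₂) by positivity)]
    have t1 : g₁ * F₂ * (F₁ * F₂) * |v - 1| ≤ (2 * Λ) * Λ * (Λ * Λ) * (10 * Λ * D.del) := by
      gcongr
      · exact b1.2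
    have t2 : g₁ * (F₂ * F₂) * |g₁ - F₁| ≤ (2 * Λ) * (Λ * Λ) * (108 * Λ ^ 12 * D.del) := by
      gcongr
      · exact b1.2
    have t3 : |κ * g₁ - g₁ * g₁ * (F₂ + g₂)| ≤ 12 * Λ ^ 3 := by
      have s1 : κ * g₁ ≤ 4 * Λ ^ 2 * (2 * Λ) := by
        gcongr
        exact b1.2
      have s2 : g₁ * g₁ * (F₂ + g₂) ≤ (2 * Λ) * (2 * Λ) * (Λ + 2 * Λ) := by
        gcongr
        · exact b1.2
        · exact b1.2
        · exact b2.2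
      have s3 : 0 ≤ κ * g₁ := by positivity
      have s4 : 0 ≤ g₁ * g₁ * (F₂ + g₂) := by positivity
      have s5 : 0 ≤ Λ ^ 3 := by positivity
      rw [abs_le]
      constructor <;> linarith
    have t4 : |κ * g₁ - g₁ * g₁ * (F₂ + g₂)| * |g₂ - F₂| ≤ 12 * Λ ^ 3 * (108 * Λ ^ 12 * D.del) := by
      gcongr
    have t5 : Λ ^ 5 * D.del ≤ Λ ^ 15 * D.del := by
      gcongr
      norm_num
    have t6 : 0 ≤ Λ ^ 15 * D.del := by positivity
    linarith
  have hNκ' : |N / Y - κ| ≤ 4800 * Λ ^ 17 * D.del := by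
    have : N / Y - κ = (N - κ * Y) / Y := by field_simp
    rw [this, abs_div, abs_of_pos hY0, div_le_iff₀ hY0]
    refine hNκ.trans ?_
    calc (n : ℝ) * (2400 * Λ ^ 15 * D.del) = 4800 * Λ ^ 17 * D.del * (n * (Λ⁻¹ ^ 2 / 2)) := by
          field_simp; ring
      _ ≤ _ := by gcongr
  have hz : ‖D.z‖ ^ 2 - 1 = D.η / D.ρ * ((∑ i, g (Sum.inl i)) / Y) - D.ρ ^ 2 * (N / Y) := by
    field_simp at hid ⊢
    linarith
  refine ⟨t * ((∑ i, g (Sum.inl i)) / Y), ?_, ?_, ?_⟩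
  · have : Λ⁻¹ ≤ (∑ i, g (Sum.inl i)) / Y := by rwa [le_div_iff₀ hY0]
    calc Λ⁻¹ / 2 = 1 / 2 * Λ⁻¹ := by ring
      _ ≤ _ := by gcongr
  · have : (∑ i, g (Sum.inl i)) / Y ≤ Λ := by rwa [div_le_iff₀ hY0]
    exact mul_le_mul ht2 this (div_nonneg (Finset.sum_nonneg fun i _ => (hg0 _).le) hY0.le)
      (by norm_num)
  · rw [h1t, hz]
    have e1 : t * (D.η / D.ρ * ((∑ i, g (Sum.inl i)) / Y) - D.ρ ^ 2 * (N / Y))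
        - (D.η / D.ρ * (t * ((∑ i, g (Sum.inl i)) / Y)) - D.ρ ^ 2 * κ)
        = -(D.ρ ^ 2 * (t * (N / Y - κ) + (t - 1) * κ)) := by ring
    rw [e1, abs_neg, abs_mul, abs_of_nonneg (sq_nonneg D.ρ)]
    have e2 : |t * (N / Y - κ) + (t - 1) * κ| ≤ 9700 * Λ ^ 17 * D.del := by
      refine (abs_add_le _ _).trans ?_
      rw [abs_mul, abs_mul, abs_of_pos ht0, abs_of_pos hκ0]
      have s1 : t * |N / Y - κ| ≤ 2 * (4800 * Λ ^ 17 * D.del) := by gcongr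
      have s2 : |t - 1| * κ ≤ 2 * Λ * D.del * (4 * Λ ^ 2) := by gcongr
      have s3 : Λ ^ 3 * D.del ≤ Λ ^ 17 * D.del := by
        gcongr
        norm_num
      have s4 : 0 ≤ Λ ^ 17 * D.del := by positivity
      linarith
    calc _ ≤ D.ρ ^ 2 * (9700 * Λ ^ 17 * D.del) := by gcongr
      _ = _ := by ring

/-- The two small eigenvalues of the action of the stability operator on diagonals. -/
theorem exists_eigenpairs (h : D.Regular Λ) (hd : D.del ≤ (10 ^ 6 * Λ ^ 20)⁻¹) :
    ∃ (β βs : ℝ) (r rs : Idx n → ℝ), |βs| < β ∧ (Λ ^ 2)⁻¹ / 4 * D.del ≤ β ∧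
      β ≤ 10 * Λ ^ 2 * D.del ∧
      (∀ a, (D.KR *ᵥ r) a = β * r a) ∧ (∀ a, (D.KR *ᵥ rs) a = βs * rs a) ∧
      (∀ a, |r a - D.F a| ≤ 127000 * Λ ^ 21 * D.del) ∧
      ∀ a, |rs a - (![1, -1] : Fin 2 → ℝ) (side a) * D.F a| ≤ 127000 * Λ ^ 21 * D.del := by
  have hΛ0 := h.Λ_pos
  have hΛ := h.one_le
  have hδ := h.del_pos
  have hρ2 : 0 < D.ρ ^ 2 := pow_pos h.ρ_pos 2
  have hd1 : D.del ≤ (100 * Λ ^ 20)⁻¹ := by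
    refine hd.trans ?_
    gcongr
    norm_num
  have hd2 : D.del ≤ (1000 * Λ ^ 20)⁻¹ := by
    refine hd.trans ?_
    gcongr
    norm_num
  obtain ⟨g, hg⟩ := h.exists_perronNear hd1
  obtain ⟨hκl, hκu⟩ := h.kap_bounds (hg.bounds h hd2)
  obtain ⟨α, hα1, hα2, hα⟩ := h.one_sub_z_inv hg hd
  obtain ⟨β, r, hr, hβ, hr'⟩ := h.exists_eigen hg hd (s := 1) (Or.inl rfl)
  obtain ⟨βs, rs, hrs, hβs, hrs'⟩ := h.exists_eigen hg hd (s := -1) (Or.inr rfl)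
  generalize kap g = κ at hκl hκu hα hβ hβs
  have hκl' : 1 ≤ 4 * Λ ^ 2 * κ := by
    calc (1 : ℝ) = 4 * Λ ^ 2 * (Λ⁻¹ ^ 2 / 4) := by field_simp
      _ ≤ _ := by gcongr
  have hκ0 : 0 < κ := lt_of_lt_of_le (by positivity) hκl
  have hc : 34000 * Λ ^ 18 * D.ρ ^ 2 * D.del ≤ D.ρ ^ 2 * κ / 4 := by
    have e5 := h.del_pow_le hd (k := 20) (by norm_num)
    calc 34000 * Λ ^ 18 * D.ρ ^ 2 * D.del
        ≤ 34000 * Λ ^ 18 * D.ρ ^ 2 * D.del * (4 * Λ ^ 2 * κ) :=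
          le_mul_of_one_le_right (by positivity) hκl'
      _ = 136000 * (D.del * Λ ^ 20) * (D.ρ ^ 2 * κ) := by ring
      _ ≤ 136000 * (10 ^ 6)⁻¹ * (D.ρ ^ 2 * κ) := by gcongr
      _ ≤ _ := by
        have : 0 < D.ρ ^ 2 * κ := by positivity
        linarith
  have hc' : Λ ^ 17 * (D.ρ ^ 2 * D.del) ≤ Λ ^ 18 * (D.ρ ^ 2 * D.del) := by
    gcongr
    norm_num
  have hk0 : 0 < D.ρ ^ 2 * κ := by positivity
  have hη0 := h.η_div_pos
  have hα0 : 0 < D.η / D.ρ * α := mul_pos hη0 (lt_of_lt_of_le (by positivity) hα1)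
  rw [abs_le] at hα hβ hβs
  refine ⟨β, βs, r, rs, ?_, ?_, ?_, hr, hrs, fun a => ?_, hrs'⟩
  · rw [abs_lt]
    constructor <;> linarith
  · have e1 : (Λ ^ 2)⁻¹ / 4 * D.ρ ^ 2 ≤ D.ρ ^ 2 * κ := by
      rw [mul_comm]
      gcongr
      rwa [← inv_pow]
    have e2 : (Λ ^ 2)⁻¹ / 4 * (D.η / D.ρ) ≤ D.η / D.ρ * α := by
      rw [mul_comm]
      gcongr
      refine le_trans ?_ hα1
      have : (Λ ^ 2)⁻¹ ≤ Λ⁻¹ := inv_anti₀ hΛ0 (le_self_pow₀ hΛ two_ne_zero)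
      have := inv_pos.2 hΛ0
      linarith
    have e3 : (Λ ^ 2)⁻¹ / 4 * D.del
        = (Λ ^ 2)⁻¹ / 4 * D.ρ ^ 2 + (Λ ^ 2)⁻¹ / 4 * (D.η / D.ρ) := by unfold del; ring
    linarith
  · have e1 : D.ρ ^ 2 * κ ≤ D.ρ ^ 2 * (4 * Λ ^ 2) := by gcongr
    have e2 : D.η / D.ρ * α ≤ D.η / D.ρ * (2 * Λ ^ 2) := by
      gcongr
      refine hα2.trans ?_
      have := le_self_pow₀ hΛ two_ne_zero
      gcongr
    have e3 : 10 * Λ ^ 2 * D.del = 10 * Λ ^ 2 * D.ρ ^ 2 + 10 * Λ ^ 2 * (D.η / D.ρ) := by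
      unfold del; ring
    have e4 : 0 ≤ Λ ^ 2 * (D.η / D.ρ) := by positivity
    have e5 : 0 ≤ Λ ^ 2 * D.ρ ^ 2 := by positivity
    linarith
  · have := hr' a
    rcases a with i | i <;> simpa using this

end Regular

end Data

/-- The matrix `diag(p) + diag(q) Z` with the off-diagonal matrix `Z`. -/
def diagOff (z : ℂ) (p q : Idx n → ℂ) : Mat n :=
  diagonal p + diagonal q * offDiag n z

theorem diagonal_eq_diagOff (z : ℂ) (p : Idx n → ℂ) : diagonal p = diagOff z p 0 := by
  have : (diagonal (0 : Idx n → ℂ) : Mat n) = 0 := diagonal_zero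
  rw [diagOff, this, zero_mul, add_zero]

theorem diagOff_mul (z : ℂ) (p q p' q' : Idx n → ℂ) :
    diagOff z p q * diagOff z p' q'
      = diagOff z (fun a => p a * p' a + ((‖z‖ ^ 2 : ℝ) : ℂ) * (q a * q' a.swap))
        (fun a => p a * q' a + q a * p' a.swap) := by
  have h1 : offDiag n z * diagonal p' = diagonal (p' ∘ Sum.swap) * offDiag n z :=
    offDiag_mul_diagonal z p'
  have h2 : offDiag n z * (diagonal q' * offDiag n z)
      = diagonal (q' ∘ Sum.swap) * (((‖z‖ ^ 2 : ℝ) : ℂ) • 1) := by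
    rw [← Matrix.mul_assoc, offDiag_mul_diagonal, Matrix.mul_assoc, offDiag_mul_self]
  unfold diagOff
  rw [Matrix.add_mul, Matrix.mul_add, Matrix.mul_add, Matrix.mul_assoc _ (offDiag n z),
    Matrix.mul_assoc _ (offDiag n z), h1, h2, ← Matrix.mul_assoc, ← Matrix.mul_assoc,
    diagonal_mul_diagonal, diagonal_mul_diagonal, diagonal_mul_diagonal,
    Matrix.mul_smul, Matrix.mul_one, Matrix.mul_smul, diagonal_mul_diagonal]
  ext a b
  simp only [Matrix.add_apply, diagonal_mul, Matrix.smul_apply, diagonal_apply,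
    Function.comp_apply, smul_eq_mul]
  split_ifs <;> ring

theorem diagOff_sub (z : ℂ) (p q p' q' : Idx n → ℂ) :
    diagOff z p q - diagOff z p' q' = diagOff z (fun a => p a - p' a) (fun a => q a - q' a) := by
  ext a b
  simp only [diagOff, Matrix.add_apply, Matrix.sub_apply, diagonal_mul,
    diagonal_apply]
  split_ifs <;> ring

theorem diagOff_add (z : ℂ) (p q p' q' : Idx n → ℂ) :
    diagOff z p q + diagOff z p' q' = diagOff z (fun a => p a + p' a) (fun a => q a + q' a) := by
  ext a b
  simp only [diagOff, Matrix.add_apply, diagonal_mul, diagonal_apply]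
  split_ifs <;> ring

theorem diagOff_smul (z : ℂ) (c : ℂ) (p q : Idx n → ℂ) :
    c • diagOff z p q = diagOff z (fun a => c * p a) (fun a => c * q a) := by
  ext a b
  simp only [diagOff, Matrix.add_apply, diagonal_mul, diagonal_apply,
    Matrix.smul_apply, smul_eq_mul]
  split_ifs <;> ring

theorem diagOff_conjTranspose (z : ℂ) (p q : Idx n → ℂ) :
    (diagOff z p q)ᴴ = diagOff z (fun a => conj (p a)) (fun a => conj (q a.swap)) := by
  unfold diagOff
  rw [conjTranspose_add, conjTranspose_mul, offDiag_conjTranspose,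
    diagonal_conjTranspose, diagonal_conjTranspose, offDiag_mul_diagonal]
  rfl

theorem diagOff_diag (z : ℂ) (p q : Idx n → ℂ) : (diagOff z p q).diag = p := by
  funext a
  simp [diagOff, diagonal_mul, offDiag_diag]

theorem norm_diagOff_le {z : ℂ} (hz : ‖z‖ ≤ 2) {p q : Idx n → ℂ} {c e : ℝ} (hc : 0 ≤ c)
    (he : 0 ≤ e) (hp : ∀ a, ‖p a‖ ≤ c) (hq : ∀ a, ‖q a‖ ≤ e) : ‖diagOff z p q‖ ≤ c + e * 2 := by
  refine (norm_add_le _ _).trans (add_le_add (norm_diagonal_le hc hp) ?_)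
  refine (norm_mul_le _ _).trans ?_
  have h1 := norm_diagonal_le he hq
  have h2 := (norm_offDiag_le (n := n) z).trans hz
  gcongr

namespace Data

variable {D : Data n} {Λ : ℝ}

theorem M_eq_diagOff (D : Data n) :
    D.M = diagOff D.z (fun a => I * D.ρ * D.F a) (fun a => -(D.u a : ℂ)) := by
  unfold Data.M diagOff
  rw [← diagonal_neg, neg_mul, sub_eq_add_neg]

namespace Regular

theorem M_mul_diagonal_mul_M (h : D.Regular Λ) (y : Idx n → ℂ) :
    D.M * diagonal y * D.M = diagOff D.z (D.cM y)
      (fun a => -(I * D.ρ * D.u a * (D.F a * y a + D.G a * y a.swap))) := by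
  rw [M_eq_diagOff, diagonal_eq_diagOff D.z, diagOff_mul, diagOff_mul]
  congr 1
  · funext a
    rw [cM_apply, h.u_swap]
    simp only [Pi.zero_apply]
    push_cast
    linear_combination (D.ρ ^ 2 * D.F a ^ 2 * y a : ℂ) * Complex.I_sq
  · funext a
    simp only [Pi.zero_apply, Data.G]
    ring

theorem M_inv (h : D.Regular Λ) : D.M⁻¹
    = diagOff D.z (fun a => -(I * D.ρ * (D.G a / D.u a))) (fun _ => -1) := by
  refine Matrix.inv_eq_right_inv ?_
  rw [M_eq_diagOff, diagOff_mul, ← diagonal_one, diagonal_eq_diagOff D.z]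
  congr 1
  · funext a
    have hu : (D.u a : ℂ) ≠ 0 := by exact_mod_cast (h.u_pos a).ne'
    have h1 := congrArg (fun x : ℝ => (x : ℂ)) (h.det_eq a)
    push_cast at h1 ⊢
    unfold Data.G
    field_simp
    linear_combination h1 - (D.ρ ^ 2 * D.F a * D.F a.swap : ℂ) * Complex.I_sq
  · funext a
    have hu : (D.u a : ℂ) ≠ 0 := by exact_mod_cast (h.u_pos a).ne'
    simp only [Data.G, Sum.swap_swap, h.u_swap, Pi.zero_apply]
    field_simp
    ring

theorem matIm_M (h : D.Regular Λ) : matIm D.M = diagonal (fun a => (D.ρ * D.F a : ℂ)) := by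
  unfold matIm
  rw [M_eq_diagOff, diagOff_conjTranspose, diagOff_sub, diagOff_smul, diagonal_eq_diagOff D.z]
  congr 1
  · funext a
    simp only [map_mul, Complex.conj_I, conj_ofReal]
    have := Complex.I_ne_zero
    field_simp
    ring
  · funext a
    simp [h.u_swap]

theorem matRe_M (h : D.Regular Λ) : matRe D.M = diagOff D.z 0 (fun a => -(D.u a : ℂ)) := by
  unfold matRe
  rw [M_eq_diagOff, diagOff_conjTranspose, diagOff_add, diagOff_smul]
  congr 1
  · funext a
    simp only [map_mul, Complex.conj_I, conj_ofReal, Pi.zero_apply]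
    ring
  · funext a
    simp only [h.u_swap, map_neg, conj_ofReal]
    ring

theorem matIm_M_inv (h : D.Regular Λ) :
    matIm D.M⁻¹ = diagonal (fun a => -(D.ρ * (D.G a / D.u a)) : Idx n → ℂ) := by
  unfold matIm
  rw [h.M_inv, diagOff_conjTranspose, diagOff_sub, diagOff_smul, diagonal_eq_diagOff D.z]
  congr 1
  · funext a
    simp only [map_mul, map_neg, map_div₀, Complex.conj_I, conj_ofReal]
    have := Complex.I_ne_zero
    field_simp
    ring
  · funext a
    simp

theorem rho_M (h : D.Regular Λ) : rho D.M = D.ρ := by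
  have h1 : (∑ a, (D.F a : ℂ)) = ((2 * n * Real.pi : ℝ) : ℂ) := by
    rw [← Complex.ofReal_sum, Fintype.sum_sum_type, h.sum_inl, h.sum_inr]
    congr 1; ring
  have hn := h.n_pos'.ne'
  unfold rho avg
  rw [h.matIm_M, trace_diagonal, ← Finset.mul_sum, h1]
  have e : ((2 * n : ℂ))⁻¹ * (D.ρ * ((2 * n * Real.pi : ℝ) : ℂ)) = ((D.ρ * Real.pi : ℝ) : ℂ) := by
    have : (n : ℂ) ≠ 0 := by exact_mod_cast hn
    push_cast
    field_simp
  rw [e, Complex.ofReal_re]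
  have := Real.pi_ne_zero
  field_simp

/-- The leading order of the right eigenvector. -/
theorem right_target (h : D.Regular Λ) :
    ((rho D.M)⁻¹ : ℂ) • matIm D.M
      - (2 * I * (rho D.M)⁻¹ : ℂ) • (matIm D.M * matIm (D.M⁻¹) * matRe D.M)
      = diagOff D.z (fun a => (D.F a : ℂ))
        (fun a => -(I * D.ρ * (2 * (D.F a * D.G a)))) := by
  have hρ : (D.ρ : ℂ) ≠ 0 := by exact_mod_cast h.ρ_pos.ne'
  rw [h.rho_M, h.matIm_M, h.matIm_M_inv, h.matRe_M, diagonal_eq_diagOff D.z,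
    diagonal_eq_diagOff D.z, diagOff_mul, diagOff_mul, diagOff_smul, diagOff_smul, diagOff_sub]
  congr 1
  · funext a
    simp
    field_simp
  · funext a
    have hu : (D.u a : ℂ) ≠ 0 := by exact_mod_cast (h.u_pos a).ne'
    simp
    field_simp

theorem right_star_target (h : D.Regular Λ) : ((rho D.M)⁻¹ : ℂ) • (Eminus * matIm D.M)
    = diagonal (fun a => (((![1, -1] : Fin 2 → ℝ) (side a) * D.F a : ℝ) : ℂ)) := by
  have hρ : (D.ρ : ℂ) ≠ 0 := by exact_mod_cast h.ρ_pos.ne'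
  rw [h.rho_M, h.matIm_M, Eminus_eq, diagonal_mul_diagonal, ← diagonal_smul]
  congr 1
  funext a
  rcases a with i | i
  · simp
    field_simp
  · simp
    field_simp

theorem left_target (h : D.Regular Λ) : -((rho D.M)⁻¹ : ℂ) • matIm (D.M⁻¹)
    = diagonal (fun a => (D.G a / D.u a : ℂ)) := by
  have hρ : (D.ρ : ℂ) ≠ 0 := by exact_mod_cast h.ρ_pos.ne'
  rw [h.rho_M, h.matIm_M_inv, ← diagonal_smul]
  congr 1
  funext a
  simp
  field_simp

theorem left_star_target (h : D.Regular Λ) : -((rho D.M)⁻¹ : ℂ) • (Eminus * matIm (D.M⁻¹))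
    = diagonal (fun a => (((![1, -1] : Fin 2 → ℝ) (side a) : ℝ) : ℂ)
      * (D.G a / D.u a : ℂ)) := by
  have hρ : (D.ρ : ℂ) ≠ 0 := by exact_mod_cast h.ρ_pos.ne'
  rw [h.rho_M, h.matIm_M_inv, Eminus_eq, diagonal_mul_diagonal, ← diagonal_smul]
  congr 1
  funext a
  rcases a with i | i
  · simp
    field_simp
  · simp
    field_simp

theorem eigen_right {β : ℝ} {r : Idx n → ℝ}
    (hr : ∀ a, (D.KR *ᵥ r) a = β * r a) :
    D.cM (fun a => ((symVar D.S *ᵥ r) a : ℂ)) = fun a => (1 - β : ℂ) * r a := by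
  funext a
  have h1 := D.K_ofReal r a
  rw [hr, K_apply] at h1
  have h2 : act D.S (fun b => (r b : ℂ)) = fun a => ((symVar D.S *ᵥ r) a : ℂ) := by
    funext a; exact act_ofReal D.S r a
  rw [h2] at h1
  push_cast at h1
  linear_combination -h1

theorem stabOp_eigen (h : D.Regular Λ) {β : ℝ} {r : Idx n → ℝ}
    (hr : ∀ a, (D.KR *ᵥ r) a = β * r a) :
    stabOp D.S D.M (D.M * diagonal (fun a => ((symVar D.S *ᵥ r) a : ℂ)) * D.M)
      = (β : ℂ) • (D.M * diagonal (fun a => ((symVar D.S *ᵥ r) a : ℂ)) * D.M) := by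
  have h2 : act D.S (fun b => (r b : ℂ)) = fun a => ((symVar D.S *ᵥ r) a : ℂ) := by
    funext a; exact act_ofReal D.S r a
  have h3 : (fun a => (1 - β : ℂ) * r a) = (1 - β : ℂ) • fun a => (r a : ℂ) := rfl
  rw [stabOp_apply, selfEnergy_eq, h.M_mul_diagonal_mul_M, diagOff_diag, eigen_right hr, h3,
    map_smul, h2, diagonal_smul, Matrix.mul_smul, Matrix.smul_mul,
    h.M_mul_diagonal_mul_M, eigen_right hr, h3]
  module

theorem hsAdjoint_eigen (h : D.Regular Λ) {β : ℝ} {r : Idx n → ℝ}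
    (hr : ∀ a, (D.KR *ᵥ r) a = β * r a) :
    hsAdjoint (stabOp D.S D.M) (diagonal (fun a => ((symVar D.S *ᵥ r) a : ℂ)))
      = (β : ℂ) • diagonal (fun a => ((symVar D.S *ᵥ r) a : ℂ)) := by
  have h2 : act D.S (fun b => (r b : ℂ)) = fun a => ((symVar D.S *ᵥ r) a : ℂ) := by
    funext a; exact act_ofReal D.S r a
  have h3 : (fun a => (1 - β : ℂ) * r a) = (1 - β : ℂ) • fun a => (r a : ℂ) := rfl
  have h4 : D.Mᴴ * diagonal (fun a => ((symVar D.S *ᵥ r) a : ℂ)) * D.Mᴴ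
      = (D.M * diagonal (fun a => ((symVar D.S *ᵥ r) a : ℂ)) * D.M)ᴴ := by
    rw [conjTranspose_mul, conjTranspose_mul, diagonal_conjTranspose,
      Matrix.mul_assoc]
    congr 3
    funext a
    simp
  have h5 : (fun a => conj ((1 - β : ℂ) * r a)) = (1 - β : ℂ) • fun a => (r a : ℂ) := by
    funext a; simp
  rw [hsAdjoint_stabOp, h4, h.M_mul_diagonal_mul_M, diagOff_conjTranspose, selfEnergy_eq,
    diagOff_diag, eigen_right hr, h5, map_smul, h2, diagonal_smul, sub_smul, one_smul,
    sub_sub_cancel]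

theorem mulVec_side_F (h : D.Regular Λ) (s : Fin 2 → ℝ) (a : Idx n) :
    (symVar D.S *ᵥ fun b => s (side b) * D.F b) a
      = s (side a.swap) * (D.G a / D.u a - D.η / D.ρ) := by
  have h1 : (symVar D.S *ᵥ D.F) a = D.G a / D.u a - D.η / D.ρ := by
    have h0 := h.act_F a
    rw [act_ofReal] at h0
    exact_mod_cast h0
  rw [← h1, mulVec, mulVec, dotProduct, dotProduct, Finset.mul_sum]
  refine Finset.sum_congr rfl fun b _ => ?_
  have := symVar_mul_side D.S s a b
  linear_combination D.F b * this

theorem abs_mulVec_sub_le (h : D.Regular Λ) {s : Fin 2 → ℝ} (hs : ∀ j, |s j| ≤ 1) {r : Idx n → ℝ}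
    {c : ℝ} (hr : ∀ a, |r a - s (side a) * D.F a| ≤ c * D.del) (a : Idx n) :
    |(symVar D.S *ᵥ r) a - s (side a.swap) * (D.G a / D.u a)| ≤ (Λ * c + 1) * D.del := by
  have h1 := h.abs_symVar_mulVec_le hr a
  have h2 : (fun b => r b - s (side b) * D.F b) = r - fun b => s (side b) * D.F b := rfl
  rw [h2, mulVec_sub, Pi.sub_apply, h.mulVec_side_F] at h1
  have h3 : |s (side a.swap) * (D.η / D.ρ)| ≤ 1 * D.del := by
    rw [abs_mul, abs_of_pos h.η_div_pos]
    exact mul_le_mul (hs _) (Regular.η_div_le D) h.η_div_pos.le zero_le_one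
  have h4 : (symVar D.S *ᵥ r) a - s (side a.swap) * (D.G a / D.u a)
      = ((symVar D.S *ᵥ r) a - s (side a.swap) * (D.G a / D.u a - D.η / D.ρ))
        - s (side a.swap) * (D.η / D.ρ) := by ring
  rw [h4]
  refine (abs_sub _ _).trans ?_
  linarith

theorem norm_left_sub_le (h : D.Regular Λ) {s : Fin 2 → ℝ} (hs : ∀ j, |s j| ≤ 1) {r : Idx n → ℝ}
    {c : ℝ} (hc : 0 ≤ c) (hr : ∀ a, |r a - s (side a) * D.F a| ≤ c * D.del) :
    ‖(diagonal (fun a => ((symVar D.S *ᵥ r) a : ℂ)) : Mat n)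
      - diagonal (fun a => ((s (side a.swap) : ℝ) : ℂ) * (D.G a / D.u a : ℂ))‖
      ≤ (Λ * c + 1) * D.del := by
  have := h.del_pos
  have := h.Λ_pos
  rw [diagonal_sub]
  refine norm_diagonal_le (by positivity) fun a => ?_
  have e := h.abs_mulVec_sub_le hs hr a
  rw [← Real.norm_eq_abs, ← norm_real] at e
  push_cast at e
  exact e

theorem norm_right_sub_le (h : D.Regular Λ) {s : Fin 2 → ℝ} (hs : ∀ j, |s j| ≤ 1) {r : Idx n → ℝ}
    {c β : ℝ} (hc : 0 ≤ c) (hc' : c * D.del ≤ Λ) (hβ : |β| ≤ 10 * Λ ^ 2 * D.del)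
    (hKr : ∀ a, (D.KR *ᵥ r) a = β * r a)
    (hr : ∀ a, |r a - s (side a) * D.F a| ≤ c * D.del) :
    ‖D.M * diagonal (fun a => ((symVar D.S *ᵥ r) a : ℂ)) * D.M
      - diagOff D.z (fun a => ((s (side a) * D.F a : ℝ) : ℂ))
        (fun a => -(I * D.ρ * (((s (side a) + s (side a.swap)) * (D.F a * D.G a) : ℝ))))‖
      ≤ (c + 20 * Λ ^ 3 + 6 * Λ * (Λ * c + 1)) * D.del := by
  have hδ := h.del_pos
  have hΛ0 := h.Λ_pos
  have e0 := h.abs_mulVec_sub_le hs hr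
  rw [h.M_mul_diagonal_mul_M, eigen_right hKr, diagOff_sub]
  refine (norm_diagOff_le h.z_upper (c := (c + 20 * Λ ^ 3) * D.del)
    (e := 3 * Λ * ((Λ * c + 1) * D.del)) (by positivity) (by positivity) (fun a => ?_)
    (fun a => ?_)).trans (le_of_eq (by ring))
  · have e1 : (1 - β : ℂ) * r a - ((s (side a) * D.F a : ℝ) : ℂ)
        = (((r a - s (side a) * D.F a) - β * r a : ℝ) : ℂ) := by push_cast; ring
    rw [e1, norm_real, Real.norm_eq_abs]
    refine (abs_sub _ _).trans ?_
    have e2 : |r a| ≤ 2 * Λ := by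
      have e3 := abs_add_le (r a - s (side a) * D.F a) (s (side a) * D.F a)
      rw [sub_add_cancel, abs_mul, abs_of_pos (h.F_pos a)] at e3
      have e4 : |s (side a)| * D.F a ≤ 1 * Λ :=
        mul_le_mul (hs _) (h.F_upper a) (h.F_pos a).le zero_le_one
      linarith [hr a]
    have e3 : |β * r a| ≤ 10 * Λ ^ 2 * D.del * (2 * Λ) := by
      rw [abs_mul]
      exact mul_le_mul hβ e2 (abs_nonneg _) (by positivity)
    linarith [hr a]
  · have e1 : -(I * D.ρ * D.u a * (D.F a * ((symVar D.S *ᵥ r) a : ℂ)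
          + D.G a * ((symVar D.S *ᵥ r) a.swap : ℂ)))
        - -(I * D.ρ * (((s (side a) + s (side a.swap)) * (D.F a * D.G a) : ℝ) : ℂ))
        = -I * ((D.ρ * (D.u a * (D.F a * ((symVar D.S *ᵥ r) a
            - s (side a.swap) * (D.G a / D.u a))
          + D.G a * ((symVar D.S *ᵥ r) a.swap - s (side a) * (D.F a / D.u a)))) : ℝ) : ℂ) := by
      have hu : (D.u a : ℂ) ≠ 0 := by exact_mod_cast (h.u_pos a).ne'
      push_cast
      field_simp
      ring
    rw [e1, norm_mul, norm_neg, norm_I, one_mul, norm_real, Real.norm_eq_abs,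
      abs_mul, abs_mul, abs_of_pos h.ρ_pos, abs_of_pos (h.u_pos a)]
    have e2 : |D.F a * ((symVar D.S *ᵥ r) a - s (side a.swap) * (D.G a / D.u a))
          + D.G a * ((symVar D.S *ᵥ r) a.swap - s (side a) * (D.F a / D.u a))|
        ≤ Λ * ((Λ * c + 1) * D.del) + Λ * ((Λ * c + 1) * D.del) := by
      refine (abs_add_le _ _).trans ?_
      rw [abs_mul, abs_mul, abs_of_pos (h.F_pos a), abs_of_pos (h.G_pos a)]
      have e3 := e0 a
      have e4 := e0 a.swap
      rw [Sum.swap_swap, h.u_swap] at e4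
      have e5 : D.G a.swap = D.F a := by simp [Data.G]
      rw [e5] at e4
      have e6 : D.G a ≤ Λ := h.F_upper _
      have e7 := h.F_upper a
      have e8 := (h.G_pos a).le
      have e9 := (h.F_pos a).le
      gcongr
    calc _ ≤ 1 * ((3 / 2) * (Λ * ((Λ * c + 1) * D.del) + Λ * ((Λ * c + 1) * D.del))) := by
          have e3 := h.ρ_le_one
          have e4 := h.u_upper a
          have e5 := (h.u_pos a).le
          have e6 := h.ρ_pos.le
          gcongr
      _ = _ := by ring

end Regular

end Data

/-- The sign of the half of `[2n]` to which an index belongs. -/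
def sgn (a : Idx n) : ℝ := (![1, -1] : Fin 2 → ℝ) (side a)

@[simp] theorem sgn_inl (i : Fin n) : sgn (Sum.inl i : Idx n) = 1 := rfl

@[simp] theorem sgn_inr (i : Fin n) : sgn (Sum.inr i : Idx n) = -1 := rfl

theorem sgn_swap (a : Idx n) : sgn a.swap = -sgn a := by rcases a with i | i <;> simp

theorem abs_sgn (a : Idx n) : |sgn a| = 1 := by rcases a with i | i <;> simp

/-- The pairing of diagonals. -/
def dpair (l r : Idx n → ℂ) : ℂ := (2 * n : ℂ)⁻¹ * ∑ a, conj (l a) * r a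

theorem hs_diagonal_eq (l : Idx n → ℂ) (R : Mat n) :
    hs (diagonal l) R = dpair l R.diag := by
  rw [hs_diagonal_left]; rfl

theorem norm_average_le (hn : 0 < n) {f : Idx n → ℂ} {c : ℝ} (hf : ∀ a, ‖f a‖ ≤ c) :
    ‖(2 * n : ℂ)⁻¹ * ∑ a, f a‖ ≤ c := by
  have hn' : (0 : ℝ) < n := by exact_mod_cast hn
  have h1 : ‖(2 * n : ℂ)⁻¹‖ = (2 * n : ℝ)⁻¹ := by
    rw [norm_inv, norm_mul]; simp
  rw [norm_mul, h1, inv_mul_le_iff₀ (by positivity)]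
  refine (norm_sum_le _ _).trans ((Finset.sum_le_sum fun a _ => hf a).trans (le_of_eq ?_))
  simp only [Finset.sum_const, Finset.card_univ, Fintype.card_sum, Fintype.card_fin, nsmul_eq_mul]
  push_cast; ring

theorem norm_dpair_le (hn : 0 < n) {l r : Idx n → ℂ} {c e : ℝ} (hl : ∀ a, ‖l a‖ ≤ c)
    (hr : ∀ a, ‖r a‖ ≤ e) : ‖dpair l r‖ ≤ c * e := by
  refine norm_average_le hn fun a => ?_
  rw [norm_mul, RCLike.norm_conj]
  exact mul_le_mul (hl a) (hr a) (norm_nonneg _) ((norm_nonneg _).trans (hl a))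

namespace Data

variable {D : Data n} {Λ : ℝ}

namespace Regular

/-- Boundedness of the inverse of the action of the stability operator on diagonals, on the
complement of the unstable directions. -/
theorem norm_le_of_dpair (h : D.Regular Λ) {l ls : Idx n → ℂ} {c : ℝ}
    (hl : ∀ a, ‖l a - D.G a‖ ≤ c) (hls : ∀ a, ‖ls a - sgn a * D.G a‖ ≤ c)
    (hc : 12 * Λ ^ 8 * c ≤ 1) {r : Idx n → ℂ} {w : ℂ} {Y p : ℝ}
    (hw : ‖w‖ ≤ (Λ ^ 5)⁻¹ / 4) (hd : D.del ≤ (48 * Λ ^ 10)⁻¹)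
    (hY : ∀ a, ‖(D.K r - w • r) a‖ ≤ Y) (hp : ‖dpair l r‖ ≤ p) (hps : ‖dpair ls r‖ ≤ p)
    (a : Idx n) : ‖r a‖ ≤ 6 * Λ ^ 8 * (Y + 2 * p) := by
  have hΛ0 := h.Λ_pos
  have hn := h.n_pos
  have hn0 : (n : ℂ) ≠ 0 := by exact_mod_cast hn.ne'
  have : Nonempty (Idx n) := ⟨a⟩
  obtain ⟨b, hb⟩ := Finite.exists_max (fun a => ‖r a‖)
  have hm0 := norm_nonneg (r b)
  have e1 : ∀ a, ‖(conj (l a) + conj (ls a) - (1 + sgn a) * D.G a) * r a‖ ≤ 2 * c * ‖r b‖ := by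
    intro a
    have : conj (l a) + conj (ls a) - (1 + sgn a) * D.G a
        = conj (l a - D.G a) + conj (ls a - sgn a * D.G a) := by
      simp only [map_sub, map_mul, conj_ofReal]; ring
    rw [norm_mul, this]
    refine mul_le_mul ((norm_add_le _ _).trans ?_) (hb a) (norm_nonneg _) ?_
    · rw [RCLike.norm_conj, RCLike.norm_conj]
      linarith [hl a, hls a]
    · linarith [(norm_nonneg _).trans (hl a)]
  have e2 : ∀ a, ‖(conj (l a) - conj (ls a) - (1 - sgn a) * D.G a) * r a‖ ≤ 2 * c * ‖r b‖ := by
    intro a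
    have : conj (l a) - conj (ls a) - (1 - sgn a) * D.G a
        = conj (l a - D.G a) - conj (ls a - sgn a * D.G a) := by
      simp only [map_sub, map_mul, conj_ofReal]; ring
    rw [norm_mul, this]
    refine mul_le_mul ((norm_sub_le _ _).trans ?_) (hb a) (norm_nonneg _) ?_
    · rw [RCLike.norm_conj, RCLike.norm_conj]
      linarith [hl a, hls a]
    · linarith [(norm_nonneg _).trans (hl a)]
  have eL : D.pairL r = dpair l r + dpair ls r - (2 * n : ℂ)⁻¹ * ∑ a,
      (conj (l a) + conj (ls a) - (1 + sgn a) * D.G a) * r a := by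
    have : (2 * n : ℂ)⁻¹ * ∑ a : Idx n, (1 + sgn a) * D.G a * r a = D.pairL r := by
      rw [pairL, Fintype.sum_sum_type]
      simp only [sgn_inl, sgn_inr, Complex.ofReal_neg, Complex.ofReal_one, add_neg_cancel, zero_mul,
        Finset.sum_const_zero, add_zero, mul_assoc, ← Finset.mul_sum]
      field_simp
      ring
    rw [← this]
    unfold dpair
    simp only [sub_mul, add_mul, Finset.sum_sub_distrib, Finset.sum_add_distrib]
    ring
  have eR : D.pairR r = dpair l r - dpair ls r - (2 * n : ℂ)⁻¹ * ∑ a,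
      (conj (l a) - conj (ls a) - (1 - sgn a) * D.G a) * r a := by
    have : (2 * n : ℂ)⁻¹ * ∑ a : Idx n, (1 - sgn a) * D.G a * r a = D.pairR r := by
      rw [pairR, Fintype.sum_sum_type]
      simp only [sgn_inl, sgn_inr, Complex.ofReal_neg, Complex.ofReal_one, sub_self, zero_mul,
        Finset.sum_const_zero, zero_add, mul_assoc, ← Finset.mul_sum, sub_neg_eq_add]
      field_simp
      ring
    rw [← this]
    unfold dpair
    simp only [sub_mul, Finset.sum_sub_distrib]
    ring
  have hL : ‖D.pairL r‖ ≤ 2 * p + 2 * c * ‖r b‖ := by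
    rw [eL]
    refine (norm_sub_le _ _).trans (add_le_add ((norm_add_le _ _).trans ?_) (norm_average_le hn e1))
    linarith
  have hR : ‖D.pairR r‖ ≤ 2 * p + 2 * c * ‖r b‖ := by
    rw [eR]
    refine (norm_sub_le _ _).trans (add_le_add ((norm_sub_le _ _).trans ?_) (norm_average_le hn e2))
    linarith
  have key := h.norm_le_of_K hw hd hY hL hR b
  have e3 : 12 * Λ ^ 8 * c * ‖r b‖ ≤ 1 * ‖r b‖ := by gcongr
  refine (hb a).trans ?_
  linarith

end Regular

/-- Left and right eigenvectors of the stability operator for the two small eigenvalues, close to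
their leading order. The left eigenvectors are the diagonal matrices of `l` and `ls`. -/
structure Pair (Γ : ℝ) (D : Data n) (β βs : ℂ) (B Bs : Mat n) (l ls : Idx n → ℂ) : Prop where
  Γ_pos : 0 < Γ
  ne : β ≠ βs
  lower : Γ⁻¹ * D.del ≤ ‖β‖
  upper : ‖β‖ ≤ Γ * D.del
  star_upper : ‖βs‖ ≤ Γ * D.del
  right : stabOp D.S D.M B = β • B
  right_star : stabOp D.S D.M Bs = βs • Bs
  left : hsAdjoint (stabOp D.S D.M) (diagonal l) = conj β • diagonal l
  left_star : hsAdjoint (stabOp D.S D.M) (diagonal ls) = conj βs • diagonal ls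
  l_near : ∀ a, ‖l a - D.G a‖ ≤ Γ * D.del
  ls_near : ∀ a, ‖ls a - sgn a * D.G a‖ ≤ Γ * D.del
  B_near : ‖B - diagOff D.z (fun a => (D.F a : ℂ))
    (fun a => -(I * D.ρ * (2 * (D.F a * D.G a))))‖ ≤ Γ * D.del
  Bs_near : ‖Bs - diagonal (fun a => ((sgn a * D.F a : ℝ) : ℂ))‖ ≤ Γ * D.del

theorem hs_left_stabOp {S : Matrix (Fin n) (Fin n) ℝ} {M V : Mat n} {β : ℂ}
    (hV : hsAdjoint (stabOp S M) V = conj β • V) (R : Mat n) :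
    hs V (stabOp S M R) = β * hs V R := by
  rw [← hs_hsAdjoint, hV, hs_smul_left, Complex.conj_conj]

theorem Pair.eigenvalue_eq (h : D.Regular Λ) {Γ : ℝ} {β βs : ℂ} {B Bs : Mat n} {l ls : Idx n → ℂ}
    (hP : D.Pair Γ β βs B Bs l ls) (hd : D.del ≤ (48 * Λ ^ 10)⁻¹) (hΓ : 12 * Λ ^ 8 * (Γ * D.del) ≤ 1)
    {w : ℂ} (hw : ‖w‖ ≤ (Λ ^ 5)⁻¹ / 4) {R : Mat n} (hR : stabOp D.S D.M R = w • R)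
    (h1 : hs (diagonal l) R = 0) (h2 : hs (diagonal ls) R = 0) : R = 0 := by
  have hΛ0 := h.Λ_pos
  have hdiag : R.diag = 0 := by
    funext a
    have h3 : D.K R.diag - w • R.diag = 0 := by
      rw [← h.diag_stabOp, hR, diag_smul, sub_self]
    have := h.norm_le_of_dpair hP.l_near hP.ls_near hΓ (r := R.diag) (w := w) (Y := 0) (p := 0) hw hd
      (by rw [h3]; simp) (by rw [← hs_diagonal_eq, h1, norm_zero])
      (by rw [← hs_diagonal_eq, h2, norm_zero]) a
    simpa using this
  rw [stabOp_apply, selfEnergy_eq, hdiag, map_zero] at hR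
  have h0 : (diagonal (0 : Idx n → ℂ) : Mat n) = 0 := diagonal_zero
  rw [h0, Matrix.mul_zero, Matrix.zero_mul, sub_zero] at hR
  have hw1 : w ≠ 1 := by
    rintro rfl
    have : (Λ ^ 5)⁻¹ ≤ 1 := inv_le_one_of_one_le₀ (one_le_pow₀ h.one_le)
    rw [norm_one] at hw
    linarith
  have h4 : (1 - w) • R = 0 := by rw [sub_smul, one_smul, ← hR, sub_self]
  exact (smul_eq_zero.1 h4).resolve_left (sub_ne_zero.2 hw1.symm)

theorem Pair.eigenvalue_mem (h : D.Regular Λ) {Γ : ℝ} {β βs : ℂ} {B Bs : Mat n} {l ls : Idx n → ℂ}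
    (hP : D.Pair Γ β βs B Bs l ls) (hd : D.del ≤ (48 * Λ ^ 10)⁻¹) (hΓ : 12 * Λ ^ 8 * (Γ * D.del) ≤ 1)
    {w : ℂ} (hw : ‖w‖ ≤ (Λ ^ 5)⁻¹ / 4) {R : Mat n} (hR : stabOp D.S D.M R = w • R) (hR0 : R ≠ 0) :
    w = β ∨ w = βs := by
  by_contra hcon
  push Not at hcon
  apply hR0
  have key : ∀ {V : Mat n} {b : ℂ}, hsAdjoint (stabOp D.S D.M) V = conj b • V → w ≠ b →
      hs V R = 0 := by
    intro V b hV hb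
    have h1 := hs_left_stabOp hV R
    rw [hR, hs_smul_right] at h1
    have h2 : (w - b) * hs V R = 0 := by rw [sub_mul, h1, sub_self]
    exact (mul_eq_zero.1 h2).resolve_left (sub_ne_zero.2 hb)
  exact hP.eigenvalue_eq h hd hΓ hw hR (key hP.left hcon.1) (key hP.left_star hcon.2)

namespace Regular

theorem G_div_u_sub_G (h : D.Regular Λ) (a : Idx n) : |D.G a / D.u a - D.G a| ≤ 2 * Λ ^ 2 * D.del := by
  have hu := h.u_pos a
  have hG := h.G_pos a
  have e : D.G a / D.u a - D.G a = D.G a * ((1 - D.u a) * (D.u a)⁻¹) := by field_simp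
  rw [e, abs_mul, abs_mul, abs_of_pos hG, abs_of_pos (inv_pos.2 hu), abs_sub_comm]
  have h1 : D.G a ≤ Λ := h.F_upper _
  have h2 := h.u_near a
  have h3 := h.u_inv_le a
  have h4 := h.Λ_pos
  have h5 := h.del_pos
  calc _ ≤ Λ * (Λ * D.del * 2) := by gcongr
    _ = _ := by ring

theorem exists_unstablePair (h : D.Regular Λ) (hd : D.del ≤ (10 ^ 9 * Λ ^ 40)⁻¹) :
    ∃ (β βs : ℂ) (B Bs L Ls : Mat n), (Λ ^ 2)⁻¹ / 4 * D.del ≤ ‖β‖ ∧ ‖β‖ ≤ 10 * Λ ^ 2 * D.del ∧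
      ∀ C₀ : ℝ, 10 ^ 7 * Λ ^ 23 ≤ C₀ →
        IsUnstablePair D.S D.η D.M ((Λ ^ 5)⁻¹ / 4) C₀ β βs B Bs L Ls := by
  have hΛ0 := h.Λ_pos
  have hΛ := h.one_le
  have hδ := h.del_pos
  have hd1 : D.del ≤ (10 ^ 6 * Λ ^ 20)⁻¹ := by
    refine hd.trans ?_
    gcongr <;> norm_num
  have hd2 : D.del ≤ (48 * Λ ^ 10)⁻¹ := by
    refine hd.trans ?_
    gcongr
    · norm_num
    · norm_num
  have hone : ∀ k : ℕ, 1 ≤ Λ ^ k := fun k => one_le_pow₀ hΛ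
  have hpow : ∀ k : ℕ, k ≤ 40 → D.del * Λ ^ k ≤ (10 ^ 9)⁻¹ := by
    intro k hk
    calc D.del * Λ ^ k ≤ (10 ^ 9 * Λ ^ 40)⁻¹ * Λ ^ 40 := by gcongr
      _ = _ := by field_simp
  obtain ⟨β, βs, r, rs, hββ, hβl, hβu, hr, hrs, hrn, hrsn⟩ := h.exists_eigenpairs hd1
  have hβ0 : 0 < β := (abs_nonneg _).trans_lt hββ
  obtain ⟨c, hc⟩ : ∃ c, c = 127000 * Λ ^ 21 := ⟨_, rfl⟩
  rw [← hc] at hrn hrsn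
  have hc0 : 0 ≤ c := hc ▸ by positivity
  have hcδ : c * D.del ≤ Λ := by
    have := hpow 21 (by norm_num)
    rw [hc]; linarith
  have hs1 : ∀ j, |(![1, 1] : Fin 2 → ℝ) j| ≤ 1 := by intro j; fin_cases j <;> simp
  have hs2 : ∀ j, |(![1, -1] : Fin 2 → ℝ) j| ≤ 1 := by intro j; fin_cases j <;> simp
  have hs1' : ∀ a : Idx n, (![1, 1] : Fin 2 → ℝ) (side a) = 1 := by
    intro a; rcases a with i | i <;> simp
  have hrn' : ∀ a, |r a - (![1, 1] : Fin 2 → ℝ) (side a) * D.F a| ≤ c * D.del := by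
    intro a; rw [hs1', one_mul]; exact hrn a
  have hC1 : Λ * c + 1 ≤ 127001 * Λ ^ 22 := by
    have e : Λ * c = 127000 * Λ ^ 22 := by rw [hc]; ring
    linarith [hone 22]
  have hC2 : c + 20 * Λ ^ 3 + 6 * Λ * (Λ * c + 1) ≤ 10 ^ 6 * Λ ^ 23 := by
    have e1 : 6 * Λ * (Λ * c + 1) ≤ 6 * Λ * (127001 * Λ ^ 22) := by gcongr
    have e2 : Λ ^ 21 ≤ Λ ^ 23 := pow_le_pow_right₀ hΛ (by norm_num)
    have e3 : Λ ^ 3 ≤ Λ ^ 23 := pow_le_pow_right₀ hΛ (by norm_num)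
    have e4 := hone 23
    rw [hc] at e1 ⊢
    linarith
  have hl := h.norm_left_sub_le hs1 hc0 hrn'
  have hls := h.norm_left_sub_le hs2 hc0 hrsn
  have hB := h.norm_right_sub_le hs1 hc0 hcδ (by rw [abs_of_pos hβ0]; exact hβu) hr hrn'
  have hBs := h.norm_right_sub_le hs2 hc0 hcδ (hββ.le.trans hβu) hrs hrsn
  obtain ⟨B, hBe⟩ : ∃ B, B = D.M * diagonal (fun a => ((symVar D.S *ᵥ r) a : ℂ)) * D.M :=
    ⟨_, rfl⟩
  obtain ⟨Bs, hBse⟩ : ∃ B, B = D.M * diagonal (fun a => ((symVar D.S *ᵥ rs) a : ℂ)) * D.M :=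
    ⟨_, rfl⟩
  have eB := h.stabOp_eigen hr
  have eBs := h.stabOp_eigen hrs
  have eL := h.hsAdjoint_eigen hr
  have eLs := h.hsAdjoint_eigen hrs
  have dB : B.diag = fun a => (1 - β : ℂ) * r a := by
    rw [hBe, h.M_mul_diagonal_mul_M, diagOff_diag, eigen_right hr]
  have dBs : Bs.diag = fun a => (1 - βs : ℂ) * rs a := by
    rw [hBse, h.M_mul_diagonal_mul_M, diagOff_diag, eigen_right hrs]
  rw [← hBe] at eB hB
  rw [← hBse] at eBs hBs
  obtain ⟨l, hle⟩ : ∃ l : Idx n → ℂ, l = fun a => ((symVar D.S *ᵥ r) a : ℂ) := ⟨_, rfl⟩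
  obtain ⟨ls, hlse⟩ : ∃ l : Idx n → ℂ, l = fun a => ((symVar D.S *ᵥ rs) a : ℂ) := ⟨_, rfl⟩
  rw [← hle] at eL hl
  rw [← hlse] at eLs hls
  have tB : (diagOff D.z (fun a => (((![1, 1] : Fin 2 → ℝ) (side a) * D.F a : ℝ) : ℂ))
        (fun a => -(I * D.ρ * ((((![1, 1] : Fin 2 → ℝ) (side a)
          + (![1, 1] : Fin 2 → ℝ) (side a.swap)) * (D.F a * D.G a) : ℝ)))))
      = diagOff D.z (fun a => (D.F a : ℂ)) (fun a => -(I * D.ρ * (2 * (D.F a * D.G a)))) := by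
    congr 1
    · funext a; rw [hs1', one_mul]
    · funext a; rw [hs1', hs1']; push_cast; ring
  have tBs : (diagOff D.z (fun a => (((![1, -1] : Fin 2 → ℝ) (side a) * D.F a : ℝ) : ℂ))
        (fun a => -(I * D.ρ * ((((![1, -1] : Fin 2 → ℝ) (side a)
          + (![1, -1] : Fin 2 → ℝ) (side a.swap)) * (D.F a * D.G a) : ℝ)))))
      = diagonal (fun a => ((sgn a * D.F a : ℝ) : ℂ)) := by
    rw [diagonal_eq_diagOff D.z]
    congr 1
    funext a
    have := sgn_swap a
    unfold sgn at this
    rw [this]; simp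
  rw [tB] at hB
  rw [tBs] at hBs
  have tl : (diagonal (fun a : Idx n => (((![1, 1] : Fin 2 → ℝ) (side a.swap) : ℝ) : ℂ)
      * (D.G a / D.u a : ℂ)) : Mat n) = diagonal (fun a => (D.G a / D.u a : ℂ)) := by
    congr 1; funext a; rw [hs1']; simp
  have tls : (diagonal (fun a : Idx n => (((![1, -1] : Fin 2 → ℝ) (side a.swap) : ℝ) : ℂ)
      * (D.G a / D.u a : ℂ)) : Mat n)
      = -diagonal (fun a => ((sgn a : ℝ) : ℂ) * (D.G a / D.u a : ℂ)) := by
    rw [diagonal_neg]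
    congr 1; funext a
    have := sgn_swap a
    unfold sgn at this ⊢
    rw [this]; push_cast; ring
  rw [tl] at hl
  rw [tls] at hls
  have hls' : ‖(diagonal (fun a => -ls a) : Mat n)
      - diagonal (fun a => ((sgn a : ℝ) : ℂ) * (D.G a / D.u a : ℂ))‖
      ≤ (Λ * c + 1) * D.del := by
    refine le_trans (le_of_eq ?_) hls
    rw [← diagonal_neg, ← norm_neg]
    congr 1
    abel
  have hpow23 : 10 ^ 6 * Λ ^ 23 * D.del ≤ 1 / 1000 := by linarith [hpow 23 (by norm_num)]
  have hGu : ∀ a, ‖(D.G a / D.u a : ℂ) - D.G a‖ ≤ 2 * Λ ^ 2 * D.del := by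
    intro a
    have := h.G_div_u_sub_G a
    rw [← Real.norm_eq_abs, ← norm_real] at this
    push_cast at this
    exact this
  have hC3 : (Λ * c + 1) * D.del + 2 * Λ ^ 2 * D.del ≤ 10 ^ 6 * Λ ^ 23 * D.del := by
    have e1 : (Λ * c + 1) * D.del ≤ 127001 * Λ ^ 22 * D.del := by gcongr
    have e2 : Λ ^ 22 * D.del ≤ Λ ^ 23 * D.del := by
      gcongr
      norm_num
    have e3 : Λ ^ 2 * D.del ≤ Λ ^ 23 * D.del := by
      gcongr
      norm_num
    have e4 : 0 ≤ Λ ^ 23 * D.del := by positivity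
    linarith
  have hP : D.Pair (10 ^ 6 * Λ ^ 23) β βs B Bs l (fun a => -ls a) := by
    refine ⟨by positivity, ?_, ?_, ?_, ?_, eB, eBs, ?_, ?_, fun a => ?_, fun a => ?_, ?_, ?_⟩
    · intro h0
      have : β = βs := by exact_mod_cast h0
      rw [this] at hββ
      exact absurd (le_abs_self βs) (not_le.2 hββ)
    · rw [norm_real, norm_of_nonneg hβ0.le]
      refine le_trans ?_ hβl
      gcongr
      rw [div_eq_mul_inv, ← mul_inv]
      have e1 : Λ ^ 2 ≤ Λ ^ 23 := pow_le_pow_right₀ hΛ (by norm_num)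
      have e2 := hone 23
      refine inv_anti₀ (by positivity) ?_
      linarith
    · rw [norm_real, norm_of_nonneg hβ0.le]
      refine hβu.trans ?_
      gcongr
      · norm_num
      · norm_num
    · rw [norm_real, Real.norm_eq_abs]
      refine (hββ.le.trans hβu).trans ?_
      gcongr
      · norm_num
      · norm_num
    · rw [conj_ofReal]; exact eL
    · have : (diagonal (fun a => -ls a) : Mat n) = (-1 : ℂ) • diagonal ls := by
        rw [← diagonal_neg, neg_one_smul]
      rw [conj_ofReal, this]
      have e2 : hsAdjoint (stabOp D.S D.M) ((-1 : ℂ) • diagonal ls)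
          = (-1 : ℂ) • hsAdjoint (stabOp D.S D.M) (diagonal ls) := by
        rw [hsAdjoint_stabOp, hsAdjoint_stabOp, Matrix.mul_smul, Matrix.smul_mul, map_smul,
          smul_sub]
      rw [e2, eLs, smul_comm]
    · have e1 := (norm_entry_le _ a a).trans hl
      rw [Matrix.sub_apply, diagonal_apply_eq, diagonal_apply_eq] at e1
      have e2 := norm_add_le (l a - (D.G a / D.u a : ℂ)) ((D.G a / D.u a : ℂ) - D.G a)
      rw [sub_add_sub_cancel] at e2
      linarith [hGu a]
    · have e1 := (norm_entry_le _ a a).trans hls'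
      rw [Matrix.sub_apply, diagonal_apply_eq, diagonal_apply_eq] at e1
      have e2 := norm_add_le (-ls a - ((sgn a : ℝ) : ℂ) * (D.G a / D.u a : ℂ))
        (((sgn a : ℝ) : ℂ) * ((D.G a / D.u a : ℂ) - D.G a))
      rw [mul_sub, sub_add_sub_cancel, ← mul_sub, norm_mul, norm_real, Real.norm_eq_abs,
        abs_sgn, one_mul] at e2
      linarith [hGu a]
    · refine hB.trans ?_
      gcongr
    · refine hBs.trans ?_
      gcongr
  have hP1 : 12 * Λ ^ 8 * (10 ^ 6 * Λ ^ 23 * D.del) ≤ 1 := by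
    have := hpow 31 (by norm_num)
    have e : 12 * Λ ^ 8 * (10 ^ 6 * Λ ^ 23 * D.del) = 12 * 10 ^ 6 * (D.del * Λ ^ 31) := by ring
    rw [e]; linarith
  have hβε : β < (Λ ^ 5)⁻¹ / 4 := by
    rw [lt_div_iff₀ (by norm_num), inv_eq_one_div, lt_div_iff₀ (by positivity)]
    have e1 : β * 4 * Λ ^ 5 ≤ 10 * Λ ^ 2 * D.del * 4 * Λ ^ 5 := by gcongr
    have := hpow 7 (by norm_num)
    linarith
  have hne : ∀ {b : ℝ} {V : Mat n} {x s : Idx n → ℝ}, |b| ≤ β → V.diag = (fun a => (1 - b : ℂ) * x a) →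
      (∀ a, |x a - s a * D.F a| ≤ c * D.del) → (∀ a, |s a| = 1) → V ≠ 0 := by
    intro b V x s hb hV hx hs hV0
    rw [hV0, diag_zero] at hV
    have h1 := congrFun hV (Sum.inl ⟨0, h.n_pos⟩)
    obtain ⟨a, ha⟩ : ∃ a : Idx n, a = Sum.inl ⟨0, h.n_pos⟩ := ⟨_, rfl⟩
    rw [← ha] at h1
    have hb1 : (1 - b : ℂ) ≠ 0 := by
      have h2 : b < 1 := by
        have h3 : (Λ ^ 5)⁻¹ ≤ 1 := inv_le_one_of_one_le₀ (hone 5)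
        linarith [le_abs_self b]
      rw [sub_ne_zero]
      exact_mod_cast h2.ne'
    have h2 : (x a : ℂ) = 0 := (mul_eq_zero.1 h1.symm).resolve_left hb1
    have h3 : x a = 0 := by exact_mod_cast h2
    have h4 := hx a
    rw [h3, zero_sub, abs_neg, abs_mul, hs, one_mul, abs_of_pos (h.F_pos a)] at h4
    have h5 := h.F_lower a
    have h6 : c * D.del < Λ⁻¹ := by
      rw [inv_eq_one_div, lt_div_iff₀ hΛ0, hc]
      have := hpow 22 (by norm_num)
      linarith
    linarith
  refine ⟨β, βs, B, Bs, diagonal l, diagonal (fun a => -ls a), ?_, ?_,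
    fun C₀ hC₀ => ?_⟩
  · rwa [norm_real, norm_of_nonneg hβ0.le]
  · rwa [norm_real, norm_of_nonneg hβ0.le]
  have hC₀' : 10 ^ 6 * Λ ^ 23 ≤ C₀ := by
    refine le_trans ?_ hC₀
    gcongr
    · norm_num
    · norm_num
  have hdel : D.ρ ^ 2 + D.η / D.ρ = D.del := rfl
  refine ⟨?_, ?_, eB, eBs, hP.left, hP.left_star, ?_, ?_, ?_, ?_⟩
  · ext w
    simp only [Set.mem_inter_iff, Metric.mem_ball, dist_zero_right, Set.mem_insert_iff,
      Set.mem_singleton_iff]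
    constructor
    · rintro ⟨h1, h2⟩
      obtain ⟨R, hR⟩ := (Module.End.hasEigenvalue_iff_mem_spectrum.2 h1).exists_hasEigenvector
      exact hP.eigenvalue_mem h hd2 hP1 h2.le hR.apply_eq_smul hR.2
    · rintro (rfl | rfl)
      · refine ⟨?_, ?_⟩
        · refine Module.End.hasEigenvalue_iff_mem_spectrum.1
            (Module.End.hasEigenvalue_of_hasEigenvector (x := B) ⟨?_, ?_⟩)
          · exact Module.End.mem_eigenspace_iff.2 eB
          · exact hne (s := fun _ => 1) (le_of_eq (abs_of_pos hβ0)) dB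
              (fun a => by rw [one_mul]; exact hrn a) (fun _ => abs_one)
        · rw [norm_real, norm_of_nonneg hβ0.le]; exact hβε
      · refine ⟨?_, ?_⟩
        · refine Module.End.hasEigenvalue_iff_mem_spectrum.1
            (Module.End.hasEigenvalue_of_hasEigenvector (x := Bs) ⟨?_, ?_⟩)
          · exact Module.End.mem_eigenspace_iff.2 eBs
          · exact hne (s := sgn) hββ.le dBs hrsn abs_sgn
        · rw [norm_real, Real.norm_eq_abs]; exact hββ.trans hβε
  · rw [norm_real, norm_real, Real.norm_eq_abs, norm_of_nonneg hβ0.le]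
    exact hββ
  · rw [opNorm_eq, h.right_target, h.rho_M, hdel]
    refine hP.B_near.trans ?_
    gcongr
  · rw [opNorm_eq, h.right_star_target, h.rho_M, hdel]
    refine hP.Bs_near.trans ?_
    gcongr
  · rw [opNorm_eq, h.left_target, h.rho_M, hdel]
    refine hl.trans ?_
    have : 0 ≤ 2 * Λ ^ 2 * D.del := by positivity
    refine le_trans (by linarith) (mul_le_mul_of_nonneg_right hC₀' hδ.le)
  · rw [opNorm_eq, h.left_star_target, h.rho_M, hdel]
    refine hls'.trans ?_
    have : 0 ≤ 2 * Λ ^ 2 * D.del := by positivity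
    refine le_trans (by linarith) (mul_le_mul_of_nonneg_right hC₀' hδ.le)

end Regular

end Data

namespace Data

variable {D : Data n} {Λ Γ : ℝ}

theorem Regular.mono (h : D.Regular Λ) (hΓ : Λ ≤ Γ) (hd : Γ * D.del ≤ 1 / 2) : D.Regular Γ where
  n_pos := h.n_pos
  one_le := h.one_le.trans hΓ
  S_lower i j := by
    refine le_trans ?_ (h.S_lower i j)
    have := inv_anti₀ h.Λ_pos hΓ
    gcongr
  S_upper i j := by
    refine (h.S_upper i j).trans ?_
    gcongr
  η_pos := h.η_pos
  ρ_pos := h.ρ_pos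
  F_lower a := (inv_anti₀ h.Λ_pos hΓ).trans (h.F_lower a)
  F_upper a := (h.F_upper a).trans hΓ
  u_near a := (h.u_near a).trans (mul_le_mul_of_nonneg_right hΓ h.del_pos.le)
  z_near := h.z_near.trans (mul_le_mul_of_nonneg_right hΓ h.del_pos.le)
  small := hd
  u_swap := h.u_swap
  F_eq := h.F_eq
  det_eq := h.det_eq
  sum_inl := h.sum_inl
  sum_inr := h.sum_inr
  perron := h.perron

theorem Pair.mono {Γ' : ℝ} {β βs : ℂ} {B Bs : Mat n} {l ls : Idx n → ℂ}
    (hP : D.Pair Γ β βs B Bs l ls) (hd : 0 ≤ D.del) (hΓ : Γ ≤ Γ') :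
    D.Pair Γ' β βs B Bs l ls := by
  have h1 : Γ * D.del ≤ Γ' * D.del := mul_le_mul_of_nonneg_right hΓ hd
  exact ⟨hP.Γ_pos.trans_le hΓ, hP.ne,
    (mul_le_mul_of_nonneg_right (inv_anti₀ hP.Γ_pos hΓ) hd).trans hP.lower,
    hP.upper.trans h1, hP.star_upper.trans h1, hP.right, hP.right_star, hP.left, hP.left_star,
    fun a => (hP.l_near a).trans h1, fun a => (hP.ls_near a).trans h1, hP.B_near.trans h1,
    hP.Bs_near.trans h1⟩

/-- The variance profile, the solution, and the unstable directions, in the regime where the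
error parameter is small. -/
structure Setup (Γ : ℝ) (D : Data n) (β βs : ℂ) (B Bs : Mat n) (l ls : Idx n → ℂ) : Prop where
  reg : D.Regular Γ
  pair : D.Pair Γ β βs B Bs l ls
  small : 10 ^ 4 * Γ ^ 20 * D.del ≤ 1

theorem eq_diagonal_of_hsAdjoint_eigen {S : Matrix (Fin n) (Fin n) ℝ} {M L : Mat n} {b : ℂ}
    (hL : hsAdjoint (stabOp S M) L = b • L) (hb : b ≠ 1) : diagonal L.diag = L := by
  rw [hsAdjoint_stabOp, selfEnergy_eq] at hL
  have h1 : (1 - b) • L = diagonal (act S (Mᴴ * L * Mᴴ).diag) := by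
    rw [sub_smul, one_smul, ← hL, sub_sub_cancel]
  have h2 : L = (1 - b)⁻¹ • diagonal (act S (Mᴴ * L * Mᴴ).diag) := by
    rw [← h1, smul_smul, inv_mul_cancel₀ (sub_ne_zero.2 hb.symm), one_smul]
  rw [h2, ← diagonal_smul, diag_diagonal]

theorem Regular.pair_of_isUnstablePair (h : D.Regular Λ) (hd : D.del ≤ (10 ^ 9 * Λ ^ 40)⁻¹)
    {C₀ : ℝ} (hC₀ : 0 ≤ C₀) {β βs : ℂ} {B Bs L Ls : Mat n}
    (hU : IsUnstablePair D.S D.η D.M ((Λ ^ 5)⁻¹ / 4) C₀ β βs B Bs L Ls) :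
    D.Pair (C₀ + 10 * Λ ^ 2) β βs B Bs L.diag Ls.diag ∧ diagonal L.diag = L ∧
      diagonal Ls.diag = Ls := by
  have hΛ0 := h.Λ_pos
  have hΛ := h.one_le
  have hδ := h.del_pos
  obtain ⟨β', βs', B', Bs', L', Ls', hl, hu, hU'⟩ := h.exists_unstablePair hd
  have hU' := hU' _ le_rfl
  have hββ : β' = β := by
    have e : ({β, βs} : Set ℂ) = {β', βs'} := hU.spectrum_eq.symm.trans hU'.spectrum_eq
    have h1 : β' ∈ ({β, βs} : Set ℂ) := by rw [e]; simp
    rcases h1 with h1 | h1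
    · exact h1
    · have h2 : β ∈ ({β', βs'} : Set ℂ) := by rw [← e]; simp
      rcases h2 with h2 | h2
      · exact h2.symm
      · have h3 : βs = β' := (Set.mem_singleton_iff.1 h1).symm
        have h4 : β = βs' := h2
        have h5 := hU.norm_lt
        rw [h3, h4] at h5
        exact absurd h5 (not_lt.2 hU'.norm_lt.le)
  rw [hββ] at hl hu
  have hβ1 : ‖β‖ < 1 := by
    have h1 : β ∈ ({β, βs} : Set ℂ) := by simp
    rw [← hU.spectrum_eq] at h1
    have h2 := h1.2
    rw [Metric.mem_ball, dist_zero_right] at h2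
    have : (Λ ^ 5)⁻¹ ≤ 1 := inv_le_one_of_one_le₀ (one_le_pow₀ hΛ)
    linarith
  have hne : ∀ b : ℂ, ‖b‖ < 1 → conj b ≠ 1 := by
    intro b hb h1
    rw [← RCLike.norm_conj, h1, norm_one] at hb
    exact lt_irrefl _ hb
  have hL := eq_diagonal_of_hsAdjoint_eigen hU.left (hne _ hβ1)
  have hLs := eq_diagonal_of_hsAdjoint_eigen hU.left_star (hne _ (hU.norm_lt.trans hβ1))
  have e1 := hU.expand_right
  have e2 := hU.expand_right_star
  have e3 := hU.expand_left
  have e4 := hU.expand_left_star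
  have hdel : D.ρ ^ 2 + D.η / D.ρ = D.del := rfl
  rw [opNorm_eq, h.right_target, h.rho_M, hdel] at e1
  rw [opNorm_eq, h.right_star_target, h.rho_M, hdel] at e2
  rw [opNorm_eq, h.left_target, h.rho_M, hdel] at e3
  rw [opNorm_eq, h.left_star_target, h.rho_M, hdel] at e4
  have hGu : ∀ a, ‖(D.G a / D.u a : ℂ) - D.G a‖ ≤ 2 * Λ ^ 2 * D.del := by
    intro a
    have := h.G_div_u_sub_G a
    rw [← Real.norm_eq_abs, ← norm_real] at this
    push_cast at this
    exact this
  have hC : C₀ * D.del ≤ (C₀ + 10 * Λ ^ 2) * D.del := by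
    gcongr
    have : 0 ≤ Λ ^ 2 := by positivity
    linarith
  have hup : 10 * Λ ^ 2 * D.del ≤ (C₀ + 10 * Λ ^ 2) * D.del := by
    gcongr
    linarith
  have hΛδ : 0 ≤ Λ ^ 2 * D.del := by positivity
  refine ⟨⟨by positivity, ?_, ?_, hu.trans hup, hU.norm_lt.le.trans (hu.trans hup), hU.right,
    hU.right_star, by rw [hL]; exact hU.left, by rw [hLs]; exact hU.left_star, fun a => ?_,
    fun a => ?_, e1.trans hC, e2.trans hC⟩, hL, hLs⟩
  · intro h0
    exact absurd hU.norm_lt (by rw [h0]; exact lt_irrefl _)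
  · refine le_trans ?_ hl
    gcongr
    rw [div_eq_mul_inv, ← mul_inv]
    refine inv_anti₀ (by positivity) ?_
    have : 0 ≤ Λ ^ 2 := by positivity
    linarith
  · have e5 := (norm_entry_le _ a a).trans e3
    rw [Matrix.sub_apply, diagonal_apply_eq] at e5
    have e6 := norm_add_le (L a a - (D.G a / D.u a : ℂ)) ((D.G a / D.u a : ℂ) - D.G a)
    rw [sub_add_sub_cancel] at e6
    rw [diag_apply]
    linarith [hGu a]
  · have e5 := (norm_entry_le _ a a).trans e4
    rw [Matrix.sub_apply, diagonal_apply_eq] at e5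
    change ‖Ls a a - ((sgn a : ℝ) : ℂ) * (D.G a / D.u a : ℂ)‖ ≤ _ at e5
    have e6 := norm_add_le (Ls a a - ((sgn a : ℝ) : ℂ) * (D.G a / D.u a : ℂ))
      (((sgn a : ℝ) : ℂ) * ((D.G a / D.u a : ℂ) - D.G a))
    rw [mul_sub, sub_add_sub_cancel, ← mul_sub, norm_mul, norm_real, Real.norm_eq_abs,
      abs_sgn, one_mul] at e6
    rw [diag_apply]
    linarith [hGu a]

namespace Setup

variable {β βs : ℂ} {B Bs : Mat n} {l ls : Idx n → ℂ}

theorem Γ_pos (s : D.Setup Γ β βs B Bs l ls) : 0 < Γ := s.reg.Λ_pos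

theorem one_le (s : D.Setup Γ β βs B Bs l ls) : 1 ≤ Γ := s.reg.one_le

theorem pow_mul_del_le (s : D.Setup Γ β βs B Bs l ls) {k : ℕ} (hk : k ≤ 20) :
    Γ ^ k * D.del ≤ 1 / 10 ^ 4 := by
  have h1 := s.small
  have h2 : Γ ^ k * D.del ≤ Γ ^ 20 * D.del := by
    have := s.one_le
    have := s.reg.del_pos
    gcongr
  linarith

theorem del_le_inv (s : D.Setup Γ β βs B Bs l ls) : D.del ≤ (48 * Γ ^ 10)⁻¹ := by
  have h1 := s.pow_mul_del_le (k := 10) (by norm_num)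
  have := s.Γ_pos
  rw [inv_eq_one_div, le_div_iff₀ (by positivity)]
  linarith

theorem Γδ_le (s : D.Setup Γ β βs B Bs l ls) : 12 * Γ ^ 8 * (Γ * D.del) ≤ 1 := by
  have h1 := s.pow_mul_del_le (k := 9) (by norm_num)
  have e : 12 * Γ ^ 8 * (Γ * D.del) = 12 * (Γ ^ 9 * D.del) := by ring
  rw [e]; linarith

theorem F_le (s : D.Setup Γ β βs B Bs l ls) (a : Idx n) : ‖(D.F a : ℂ)‖ ≤ Γ := by
  rw [norm_real, norm_of_nonneg (s.reg.F_pos a).le]; exact s.reg.F_upper a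

theorem G_le (s : D.Setup Γ β βs B Bs l ls) (a : Idx n) : ‖(D.G a : ℂ)‖ ≤ Γ := s.F_le _

theorem Γδ_le_Γ (s : D.Setup Γ β βs B Bs l ls) : Γ * D.del ≤ Γ := by
  have h1 := s.pow_mul_del_le (k := 1) (by norm_num)
  have := s.one_le
  rw [pow_one] at h1
  linarith

theorem l_le (s : D.Setup Γ β βs B Bs l ls) (a : Idx n) : ‖l a‖ ≤ 2 * Γ := by
  have h1 := norm_add_le (l a - D.G a) (D.G a)
  rw [sub_add_cancel] at h1
  linarith [s.pair.l_near a, s.G_le a, s.Γδ_le_Γ]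

theorem ls_le (s : D.Setup Γ β βs B Bs l ls) (a : Idx n) : ‖ls a‖ ≤ 2 * Γ := by
  have h1 := norm_add_le (ls a - sgn a * D.G a) (sgn a * D.G a)
  rw [sub_add_cancel, norm_mul, norm_real, Real.norm_eq_abs, abs_sgn, one_mul] at h1
  linarith [s.pair.ls_near a, s.G_le a, s.Γδ_le_Γ]

theorem norm_φ_le (s : D.Setup Γ β βs B Bs l ls) (a : Idx n) :
    ‖(-(I * D.ρ * (2 * (D.F a * D.G a))) : ℂ)‖ ≤ 2 * Γ ^ 2 := by
  have h1 := s.F_le a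
  have h2 := s.G_le a
  have h3 := s.reg.ρ_le_one
  have h4 := s.reg.ρ_pos
  have h5 := s.Γ_pos
  rw [norm_neg, norm_mul, norm_mul, norm_mul, norm_mul, norm_I, one_mul,
    norm_real, norm_of_nonneg h4.le, RCLike.norm_ofNat]
  calc _ ≤ 1 * (2 * (Γ * Γ)) := by gcongr
    _ = _ := by ring

theorem norm_B_le (s : D.Setup Γ β βs B Bs l ls) : ‖B‖ ≤ 6 * Γ ^ 2 := by
  have h1 := s.pair.B_near
  have h5 := s.one_le
  have h2 := norm_diagOff_le s.reg.z_upper (by positivity) (by positivity) s.F_le s.norm_φ_le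
  have h3 := norm_le_norm_add_norm_sub (diagOff D.z (fun a => (D.F a : ℂ))
    (fun a => -(I * D.ρ * (2 * (D.F a * D.G a))))) B
  rw [norm_sub_rev] at h3
  have h4 := s.Γδ_le_Γ
  have h6 : Γ ≤ Γ ^ 2 := le_self_pow₀ h5 two_ne_zero
  linarith

theorem norm_Bs_le (s : D.Setup Γ β βs B Bs l ls) : ‖Bs‖ ≤ 2 * Γ := by
  have h1 := s.pair.Bs_near
  have h2 : ‖(diagonal (fun a => ((sgn a * D.F a : ℝ) : ℂ)) : Mat n)‖ ≤ Γ := by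
    refine norm_diagonal_le s.Γ_pos.le fun a => ?_
    rw [norm_real, Real.norm_eq_abs, abs_mul, abs_sgn, one_mul, abs_of_pos (s.reg.F_pos a)]
    exact s.reg.F_upper a
  have h3 := norm_le_norm_add_norm_sub (diagonal (fun a => ((sgn a * D.F a : ℝ) : ℂ))) Bs
  rw [norm_sub_rev] at h3
  have h4 := s.Γδ_le_Γ
  linarith

theorem hs_left (s : D.Setup Γ β βs B Bs l ls) (R : Mat n) :
    hs (diagonal l) (stabOp D.S D.M R) = β * hs (diagonal l) R :=
  hs_left_stabOp s.pair.left R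

theorem hs_left_star (s : D.Setup Γ β βs B Bs l ls) (R : Mat n) :
    hs (diagonal ls) (stabOp D.S D.M R) = βs * hs (diagonal ls) R :=
  hs_left_stabOp s.pair.left_star R

theorem hs_l_Bs (s : D.Setup Γ β βs B Bs l ls) : hs (diagonal l) Bs = 0 := by
  have h1 := s.hs_left Bs
  rw [s.pair.right_star, hs_smul_right] at h1
  have h2 : (β - βs) * hs (diagonal l) Bs = 0 := by rw [sub_mul, h1, sub_self]
  exact (mul_eq_zero.1 h2).resolve_left (sub_ne_zero.2 s.pair.ne)

theorem hs_ls_B (s : D.Setup Γ β βs B Bs l ls) : hs (diagonal ls) B = 0 := by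
  have h1 := s.hs_left_star B
  rw [s.pair.right, hs_smul_right] at h1
  have h2 : (β - βs) * hs (diagonal ls) B = 0 := by rw [sub_mul, h1, sub_self]
  exact (mul_eq_zero.1 h2).resolve_left (sub_ne_zero.2 s.pair.ne)

theorem diag_B_near (s : D.Setup Γ β βs B Bs l ls) (a : Idx n) : ‖B a a - D.F a‖ ≤ Γ * D.del := by
  have h1 := (norm_entry_le _ a a).trans s.pair.B_near
  rw [Matrix.sub_apply, ← diag_apply (diagOff _ _ _), diagOff_diag] at h1
  exact h1

theorem diag_Bs_near (s : D.Setup Γ β βs B Bs l ls) (a : Idx n) :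
    ‖Bs a a - sgn a * D.F a‖ ≤ Γ * D.del := by
  have h1 := (norm_entry_le _ a a).trans s.pair.Bs_near
  rw [Matrix.sub_apply, diagonal_apply_eq] at h1
  push_cast at h1
  exact h1

/-- The leading order of the pairing of left and right eigenvectors. -/
def mass (D : Data n) : ℝ := (2 * n : ℝ)⁻¹ * ∑ a, D.F a * D.G a

theorem average_ge (h : D.Regular Γ) {f : Idx n → ℝ} {c : ℝ} (hf : ∀ a, c ≤ f a) :
    c ≤ (2 * n : ℝ)⁻¹ * ∑ a, f a := by
  have hn := h.n_pos'
  rw [le_inv_mul_iff₀ (by positivity)]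
  refine le_trans (le_of_eq ?_) (Finset.sum_le_sum fun a _ => hf a)
  simp only [Finset.sum_const, Finset.card_univ, Fintype.card_sum, Fintype.card_fin, nsmul_eq_mul]
  push_cast; ring

theorem inv_sq_le_FG (h : D.Regular Γ) (a : Idx n) : (Γ ^ 2)⁻¹ ≤ D.F a * D.G a := by
  have h1 := inv_pos.2 h.Λ_pos
  calc (Γ ^ 2)⁻¹ = Γ⁻¹ * Γ⁻¹ := by rw [pow_two, mul_inv]
    _ ≤ _ := mul_le_mul (h.F_lower a) (h.F_lower _) h1.le (h.F_pos a).le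

theorem mass_lower (h : D.Regular Γ) : (Γ ^ 2)⁻¹ ≤ mass D := average_ge h (inv_sq_le_FG h)

theorem norm_dpair_sub_mass_le (h : D.Regular Γ) (hΓ : Γ * D.del ≤ Γ) {k b : Idx n → ℂ}
    {σ : Idx n → ℝ} (hσ : ∀ a, |σ a| = 1) (hk : ∀ a, ‖k a - σ a * D.G a‖ ≤ Γ * D.del)
    (hb : ∀ a, ‖b a - σ a * D.F a‖ ≤ Γ * D.del) :
    ‖dpair k b - mass D‖ ≤ 3 * Γ ^ 2 * D.del := by
  have hδ := h.del_pos
  have hΓ0 := h.Λ_pos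
  have e : dpair k b - mass D
      = (2 * n : ℂ)⁻¹ * ∑ a, (conj (k a) * (b a - σ a * D.F a)
        + conj (k a - σ a * D.G a) * (σ a * D.F a)) := by
    unfold dpair mass
    push_cast
    rw [← mul_sub, ← Finset.sum_sub_distrib]
    congr 1
    refine Finset.sum_congr rfl fun a _ => ?_
    have h1 : (σ a : ℂ) * σ a = 1 := by
      have := abs_mul_abs_self (σ a)
      rw [hσ, one_mul] at this
      exact_mod_cast this.symm
    simp only [map_sub, map_mul, conj_ofReal]
    linear_combination (D.F a * D.G a : ℂ) * h1
  rw [e]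
  refine norm_average_le h.n_pos fun a => (norm_add_le _ _).trans ?_
  have h1 : ‖k a‖ ≤ 2 * Γ := by
    have h1 := norm_add_le (k a - σ a * D.G a) (σ a * D.G a)
    rw [sub_add_cancel, norm_mul, norm_real, norm_real, Real.norm_eq_abs, hσ,
      one_mul, norm_of_nonneg (h.G_pos a).le] at h1
    have h2 : D.G a ≤ Γ := h.F_upper _
    linarith [hk a]
  rw [norm_mul, norm_mul, norm_mul, RCLike.norm_conj, RCLike.norm_conj, norm_real,
    norm_real, Real.norm_eq_abs, hσ, one_mul, norm_of_nonneg (h.F_pos a).le]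
  calc _ ≤ 2 * Γ * (Γ * D.del) + Γ * D.del * Γ := by
        have h2 := hb a
        have h3 := hk a
        have h4 := h.F_upper a
        have h5 := (h.F_pos a).le
        gcongr
    _ = _ := by ring

theorem hs_l_B_sub (s : D.Setup Γ β βs B Bs l ls) :
    ‖hs (diagonal l) B - mass D‖ ≤ 3 * Γ ^ 2 * D.del := by
  rw [hs_diagonal_eq]
  exact norm_dpair_sub_mass_le s.reg s.Γδ_le_Γ (σ := fun _ => 1) (fun _ => abs_one)
    (fun a => by simpa using s.pair.l_near a) (fun a => by simpa using s.diag_B_near a)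

theorem hs_ls_Bs_sub (s : D.Setup Γ β βs B Bs l ls) :
    ‖hs (diagonal ls) Bs - mass D‖ ≤ 3 * Γ ^ 2 * D.del := by
  rw [hs_diagonal_eq]
  exact norm_dpair_sub_mass_le s.reg s.Γδ_le_Γ (σ := sgn) abs_sgn s.pair.ls_near s.diag_Bs_near

theorem half_mass_le_of (s : D.Setup Γ β βs B Bs l ls) {x : ℂ}
    (hx : ‖x - mass D‖ ≤ 3 * Γ ^ 2 * D.del) : (2 * Γ ^ 2)⁻¹ ≤ ‖x‖ := by
  have h1 := mass_lower s.reg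
  have hΓ0 := s.Γ_pos
  have h2 : 3 * Γ ^ 2 * D.del ≤ (2 * Γ ^ 2)⁻¹ := by
    rw [inv_eq_one_div, le_div_iff₀ (by positivity)]
    have := s.pow_mul_del_le (k := 4) (by norm_num)
    have e : 3 * Γ ^ 2 * D.del * (2 * Γ ^ 2) = 6 * (Γ ^ 4 * D.del) := by ring
    rw [e]; linarith
  have h3 := norm_le_norm_add_norm_sub x (mass D : ℂ)
  rw [norm_real, norm_of_nonneg ((by positivity : (0 : ℝ) ≤ (Γ ^ 2)⁻¹).trans h1)] at h3
  rw [mul_inv] at h2 ⊢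
  linarith

theorem hs_l_B_lower (s : D.Setup Γ β βs B Bs l ls) :
    (2 * Γ ^ 2)⁻¹ ≤ ‖hs (diagonal l) B‖ := s.half_mass_le_of s.hs_l_B_sub

theorem hs_ls_Bs_lower (s : D.Setup Γ β βs B Bs l ls) :
    (2 * Γ ^ 2)⁻¹ ≤ ‖hs (diagonal ls) Bs‖ := s.half_mass_le_of s.hs_ls_Bs_sub

theorem hs_l_B_ne (s : D.Setup Γ β βs B Bs l ls) : hs (diagonal l) B ≠ 0 := by
  have := s.Γ_pos
  exact norm_pos_iff.1 (lt_of_lt_of_le (by positivity) s.hs_l_B_lower)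

theorem hs_ls_Bs_ne (s : D.Setup Γ β βs B Bs l ls) : hs (diagonal ls) Bs ≠ 0 := by
  have := s.Γ_pos
  exact norm_pos_iff.1 (lt_of_lt_of_le (by positivity) s.hs_ls_Bs_lower)

theorem β_ne (s : D.Setup Γ β βs B Bs l ls) : β ≠ 0 :=
  norm_pos_iff.1 (lt_of_lt_of_le (mul_pos (inv_pos.2 s.Γ_pos) s.reg.del_pos) s.pair.lower)

end Setup

end Data

namespace Data

variable {D : Data n} {Γ : ℝ}

theorem Regular.stabOp_sgn (h : D.Regular Γ) :
    stabOp D.S D.M (diagonal (fun a => ((sgn a * D.F a : ℝ) : ℂ)))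
      = -(((D.η / D.ρ : ℝ) : ℂ) • (D.M * diagonal (fun a => (sgn a : ℂ)) * D.M)) := by
  have h1 : act D.S (fun a => ((sgn a * D.F a : ℝ) : ℂ))
      = fun a => (-(sgn a) * (D.G a / D.u a) : ℂ) + (D.η / D.ρ : ℝ) * sgn a := by
    funext a
    rw [act_ofReal]
    have := h.mulVec_side_F ![1, -1] a
    have e : (fun b : Idx n => (![1, -1] : Fin 2 → ℝ) (side b) * D.F b)
      = fun b => sgn b * D.F b := rfl
    rw [e] at this
    have e2 : (![1, -1] : Fin 2 → ℝ) (side a.swap) = -sgn a := sgn_swap a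
    rw [this, e2]
    push_cast; ring
  rw [stabOp_apply, selfEnergy_eq, diag_diagonal, h1, h.M_mul_diagonal_mul_M,
    h.M_mul_diagonal_mul_M, diagonal_eq_diagOff D.z, diagOff_smul, diagOff_sub,
    ← neg_one_smul ℂ, diagOff_smul]
  congr 1
  · funext a
    have hu : (D.u a : ℂ) ≠ 0 := by exact_mod_cast (h.u_pos a).ne'
    have h2 := congrArg (fun x : ℝ => (x : ℂ)) (h.det_eq a)
    have h3 : (D.G a.swap : ℂ) = D.F a := by simp [Data.G]
    have h4 : (D.F a.swap : ℂ) = D.G a := rfl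
    rw [cM_apply, cM_apply, sgn_swap, h.u_swap, h3]
    push_cast at h2 ⊢
    rw [h4] at h2
    field_simp
    linear_combination (-sgn a * D.F a : ℂ) * h2
  · funext a
    have hu : (D.u a : ℂ) ≠ 0 := by exact_mod_cast (h.u_pos a).ne'
    have h3 : (D.G a.swap : ℂ) = D.F a := by simp [Data.G]
    rw [sgn_swap, h.u_swap, h3]
    push_cast
    simp only [Pi.zero_apply]
    field_simp
    ring

namespace Setup

variable {β βs : ℂ} {B Bs : Mat n} {l ls : Idx n → ℂ}

theorem βs_ne (s : D.Setup Γ β βs B Bs l ls) : βs ≠ 0 := by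
  intro h0
  have h := s.reg
  have hΓ0 := s.Γ_pos
  have hδ := h.del_pos
  have h1 := s.hs_left_star (diagonal (fun a => ((sgn a * D.F a : ℝ) : ℂ)))
  rw [h0, zero_mul, h.stabOp_sgn, hs_neg_right, hs_smul_right, neg_eq_zero] at h1
  have h2 : ((D.η / D.ρ : ℝ) : ℂ) ≠ 0 := by exact_mod_cast h.η_div_pos.ne'
  have h3 := (mul_eq_zero.1 h1).resolve_left h2
  rw [hs_diagonal_eq, h.M_mul_diagonal_mul_M, diagOff_diag] at h3
  have h4 : dpair ls (D.cM fun a => (sgn a : ℂ))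
      + (((2 * n : ℝ)⁻¹ * ∑ a, (D.ρ ^ 2 * D.F a ^ 2 + ‖D.z‖ ^ 2 * D.u a ^ 2) * D.G a : ℝ) : ℂ)
      = (2 * n : ℂ)⁻¹ * ∑ a, conj (ls a - sgn a * D.G a)
        * ((-(sgn a * (D.ρ ^ 2 * D.F a ^ 2 + ‖D.z‖ ^ 2 * D.u a ^ 2)) : ℝ) : ℂ) := by
    unfold dpair
    push_cast
    rw [← mul_add, ← Finset.sum_add_distrib]
    congr 1
    refine Finset.sum_congr rfl fun a _ => ?_
    have e1 : (sgn a : ℂ) * sgn a = 1 := by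
      have := abs_mul_abs_self (sgn a)
      rw [abs_sgn, one_mul] at this
      exact_mod_cast this.symm
    rw [cM_apply, sgn_swap]
    simp only [map_sub, map_mul, conj_ofReal]
    push_cast
    linear_combination (-(D.ρ ^ 2 * D.F a ^ 2 + ‖D.z‖ ^ 2 * D.u a ^ 2) * D.G a : ℂ) * e1
  have hbd : ∀ a, D.ρ ^ 2 * D.F a ^ 2 + ‖D.z‖ ^ 2 * D.u a ^ 2 ≤ 5 * Γ ^ 2 := by
    intro a
    have e1 := h.z_sq_upper
    have e2 : D.u a ^ 2 ≤ 9 / 4 := by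
      have := h.u_upper a
      have := h.u_pos a
      nlinarith
    have e3 : D.ρ ^ 2 * D.F a ^ 2 ≤ 1 ^ 2 * Γ ^ 2 := by
      have := h.ρ_le_one
      have := h.F_upper a
      have := (h.F_pos a).le
      have := h.ρ_pos.le
      gcongr
    have e4 : ‖D.z‖ ^ 2 * D.u a ^ 2 ≤ 3 / 2 * (9 / 4) := by gcongr
    have e5 : 1 ≤ Γ ^ 2 := one_le_pow₀ s.one_le
    linarith
  rw [h3, zero_add] at h4
  have h5 : ‖(((2 * n : ℝ)⁻¹ * ∑ a, (D.ρ ^ 2 * D.F a ^ 2 + ‖D.z‖ ^ 2 * D.u a ^ 2) * D.G a : ℝ) : ℂ)‖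
      ≤ Γ * D.del * (5 * Γ ^ 2) := by
    rw [h4]
    refine norm_average_le h.n_pos fun a => ?_
    rw [norm_mul, RCLike.norm_conj, norm_real, norm_neg, Real.norm_eq_abs, abs_mul, abs_sgn,
      one_mul, abs_of_nonneg (by positivity)]
    exact mul_le_mul (s.pair.ls_near a) (hbd a) (by positivity) (by positivity)
  have h6 : Γ⁻¹ / 8 ≤ (2 * n : ℝ)⁻¹ * ∑ a, (D.ρ ^ 2 * D.F a ^ 2 + ‖D.z‖ ^ 2 * D.u a ^ 2) * D.G a := by
    refine average_ge h fun a => ?_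
    have e1 : Γ⁻¹ ≤ D.G a := h.F_lower _
    have e2 : (1 / 2) ^ 2 ≤ D.u a ^ 2 := by
      have := h.u_lower a
      gcongr
    have e3 : 1 / 2 * (1 / 2) ^ 2 ≤ ‖D.z‖ ^ 2 * D.u a ^ 2 := by
      have := h.z_sq_lower
      gcongr
    calc Γ⁻¹ / 8 = (0 + 1 / 2 * (1 / 2) ^ 2) * Γ⁻¹ := by ring
      _ ≤ _ := by
        gcongr
        positivity
  rw [norm_real] at h5
  have h7 := (le_abs_self _).trans h5
  have h8 : Γ * D.del * (5 * Γ ^ 2) < Γ⁻¹ / 8 := by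
    rw [lt_div_iff₀ (by norm_num), inv_eq_one_div, lt_div_iff₀ hΓ0]
    have := s.pow_mul_del_le (k := 4) (by norm_num)
    have e : Γ * D.del * (5 * Γ ^ 2) * 8 * Γ = 40 * (Γ ^ 4 * D.del) := by ring
    rw [e]; linarith
  linarith

/-- The projection onto the unstable directions. -/
def unstable (B Bs : Mat n) (l ls : Idx n → ℂ) (R : Mat n) : Mat n :=
  (hs (diagonal l) R / hs (diagonal l) B) • B
    + (hs (diagonal ls) R / hs (diagonal ls) Bs) • Bs

theorem hs_l_unstable (s : D.Setup Γ β βs B Bs l ls) (R : Mat n) :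
    hs (diagonal l) (unstable B Bs l ls R) = hs (diagonal l) R := by
  rw [unstable, hs_add_right, hs_smul_right, hs_smul_right, s.hs_l_Bs, mul_zero, add_zero,
    div_mul_cancel₀ _ s.hs_l_B_ne]

theorem hs_ls_unstable (s : D.Setup Γ β βs B Bs l ls) (R : Mat n) :
    hs (diagonal ls) (unstable B Bs l ls R) = hs (diagonal ls) R := by
  rw [unstable, hs_add_right, hs_smul_right, hs_smul_right, s.hs_ls_B, mul_zero, zero_add,
    div_mul_cancel₀ _ s.hs_ls_Bs_ne]

theorem unstable_stabOp (s : D.Setup Γ β βs B Bs l ls) (R : Mat n) :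
    unstable B Bs l ls (stabOp D.S D.M R) = stabOp D.S D.M (unstable B Bs l ls R) := by
  unfold unstable
  rw [map_add, map_smul, map_smul, s.pair.right, s.pair.right_star, s.hs_left, s.hs_left_star,
    smul_smul, smul_smul]
  congr 2 <;> ring

theorem norm_small_le (s : D.Setup Γ β βs B Bs l ls) {b : ℂ} (hb : ‖b‖ ≤ Γ * D.del) :
    ‖b‖ ≤ (Γ ^ 5)⁻¹ / 4 := by
  refine hb.trans ?_
  have := s.Γ_pos
  rw [le_div_iff₀ (by norm_num), inv_eq_one_div, le_div_iff₀ (by positivity)]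
  have := s.pow_mul_del_le (k := 6) (by norm_num)
  have e : Γ * D.del * 4 * Γ ^ 5 = 4 * (Γ ^ 6 * D.del) := by ring
  rw [e]; linarith

theorem isUnit_stabOp (s : D.Setup Γ β βs B Bs l ls) : IsUnit (stabOp D.S D.M) := by
  rw [LinearMap.isUnit_iff_ker_eq_bot, LinearMap.ker_eq_bot']
  intro R hR
  by_contra hR0
  have h1 := s.pair.eigenvalue_mem s.reg s.del_le_inv s.Γδ_le (w := 0) (R := R)
    (by rw [norm_zero]; have := s.Γ_pos; positivity) (by rw [hR, zero_smul]) hR0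
  rcases h1 with h1 | h1
  · exact s.β_ne h1.symm
  · exact s.βs_ne h1.symm

theorem stabOp_injective (s : D.Setup Γ β βs B Bs l ls) {R R' : Mat n}
    (h : stabOp D.S D.M R = stabOp D.S D.M R') : R = R' := by
  have h1 := s.isUnit_stabOp
  rw [LinearMap.isUnit_iff_ker_eq_bot] at h1
  exact LinearMap.ker_eq_bot.1 h1 h

theorem maxGenEigenspace_invariant {V : Type*} [AddCommGroup V] [Module ℂ V] (T : Module.End ℂ V)
    (A : Set ℂ) {x : V} (hx : x ∈ ⨆ μ ∈ A, T.maxGenEigenspace μ) :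
    T x ∈ ⨆ μ ∈ A, T.maxGenEigenspace μ := by
  have h1 : (⨆ μ ∈ A, T.maxGenEigenspace μ) ≤ (⨆ μ ∈ A, T.maxGenEigenspace μ).comap T := by
    refine iSup₂_le fun μ hμ y hy => ?_
    exact Submodule.mem_iSup_of_mem μ (Submodule.mem_iSup_of_mem hμ
      (T.mapsTo_maxGenEigenspace_of_comm (Commute.refl T) μ hy))
  exact h1 hx

theorem hs_eq_zero_of_mem {T : Module.End ℂ (Mat n)} {V : Mat n} {b : ℂ}
    (hV : ∀ R, hs V (T R) = b * hs V R) {A : Set ℂ} (hb : b ∉ A) {x : Mat n}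
    (hx : x ∈ ⨆ μ ∈ A, T.maxGenEigenspace μ) : hs V x = 0 := by
  have h1 : (⨆ μ ∈ A, T.maxGenEigenspace μ) ≤ LinearMap.ker (hsLin V) := by
    refine iSup₂_le fun μ hμ y hy => ?_
    rw [Module.End.mem_maxGenEigenspace] at hy
    obtain ⟨k, hk⟩ := hy
    have h2 : ∀ (k : ℕ) (R : Mat n), hs V (((T - μ • 1) ^ k) R) = (b - μ) ^ k * hs V R := by
      intro k
      induction k with
      | zero => intro R; simp
      | succ k ih =>
        intro R
        rw [pow_succ, Module.End.mul_apply, ih]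
        have : hs V ((T - μ • 1) R) = (b - μ) * hs V R := by
          rw [LinearMap.sub_apply, LinearMap.smul_apply, Module.End.one_apply, hs_sub_right, hV,
            hs_smul_right, sub_mul]
        rw [this]; ring
    have h3 := h2 k y
    rw [hk, hs_zero_right] at h3
    have h4 : b - μ ≠ 0 := sub_ne_zero.2 fun h0 => hb (h0 ▸ hμ)
    exact (mul_eq_zero.1 h3.symm).resolve_left (pow_ne_zero _ h4)
  exact h1 hx

theorem spectralProj_eq (s : D.Setup Γ β βs B Bs l ls) (R : Mat n) :
    spectralProj (stabOp D.S D.M) (spectrum ℂ (stabOp D.S D.M) \ {β, βs}) R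
      = R - unstable B Bs l ls R := by
  obtain ⟨T, hT⟩ : ∃ T, T = stabOp D.S D.M := ⟨_, rfl⟩
  obtain ⟨A, hA⟩ : ∃ A, A = spectrum ℂ T \ {β, βs} := ⟨_, rfl⟩
  rw [← hT, ← hA]
  have hc := isCompl_genEigenspaces T A
  have hβ : β ∉ A := by rw [hA]; simp
  have hβs : βs ∉ A := by rw [hA]; simp
  have hQ : spectralProj T A R ∈ ⨆ μ ∈ A, T.maxGenEigenspace μ :=
    Submodule.projection_apply_mem hc R
  have hR : R - spectralProj T A R ∈ ⨆ μ ∈ Aᶜ, T.maxGenEigenspace μ := by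
    rw [← Submodule.ker_projection hc, LinearMap.mem_ker, map_sub, sub_eq_zero]
    exact (Submodule.projection_apply_of_mem_left hc hQ).symm
  have heig : ∀ {V : Mat n} {b : ℂ}, T V = b • V → b ∉ A → V ∈ ⨆ μ ∈ Aᶜ, T.maxGenEigenspace μ := by
    intro V b hV hb
    refine Submodule.mem_iSup_of_mem b (Submodule.mem_iSup_of_mem hb ?_)
    rw [Module.End.mem_maxGenEigenspace]
    exact ⟨1, by rw [pow_one, LinearMap.sub_apply, hV]; simp⟩
  have hB : B ∈ ⨆ μ ∈ Aᶜ, T.maxGenEigenspace μ := heig (by rw [hT]; exact s.pair.right) hβ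
  have hBs : Bs ∈ ⨆ μ ∈ Aᶜ, T.maxGenEigenspace μ := heig (by rw [hT]; exact s.pair.right_star) hβs
  have hl : ∀ R, hs (diagonal l) (T R) = β * hs (diagonal l) R := by
    rw [hT]; exact s.hs_left
  have hls : ∀ R, hs (diagonal ls) (T R) = βs * hs (diagonal ls) R := by
    rw [hT]; exact s.hs_left_star
  -- the subspace of the remainder
  let U : Submodule ℂ (Mat n) := (⨆ μ ∈ Aᶜ, T.maxGenEigenspace μ)
    ⊓ (LinearMap.ker (hsLin (diagonal l)) ⊓ LinearMap.ker (hsLin (diagonal ls)))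
  have hU : ∀ x ∈ U, T x ∈ U := by
    rintro x ⟨h1, h2, h3⟩
    refine ⟨maxGenEigenspace_invariant T _ h1, ?_, ?_⟩
    · change hs _ x = 0 at h2
      change hs _ (T x) = 0
      rw [hl, h2, mul_zero]
    · change hs _ x = 0 at h3
      change hs _ (T x) = 0
      rw [hls, h3, mul_zero]
  have hU0 : U = ⊥ := by
    by_contra hne
    have : Nontrivial U := Submodule.nontrivial_iff_ne_bot.2 hne
    obtain ⟨w, hw⟩ := Module.End.exists_eigenvalue (T.restrict hU)
    obtain ⟨⟨x, hx⟩, hxw⟩ := hw.exists_hasEigenvector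
    have h1 : T x = w • x := congrArg Subtype.val hxw.apply_eq_smul
    have h2 : x ≠ 0 := fun h0 => hxw.2 (Subtype.ext h0)
    have h3 : w ∈ spectrum ℂ T := Module.End.hasEigenvalue_iff_mem_spectrum.1
      (Module.End.hasEigenvalue_of_hasEigenvector ⟨Module.End.mem_eigenspace_iff.2 h1, h2⟩)
    by_cases hwA : w ∈ A
    · have h4 : x ∈ ⨆ μ ∈ A, T.maxGenEigenspace μ := by
        refine Submodule.mem_iSup_of_mem w (Submodule.mem_iSup_of_mem hwA ?_)
        rw [Module.End.mem_maxGenEigenspace]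
        exact ⟨1, by rw [pow_one, LinearMap.sub_apply, h1]; simp⟩
      exact h2 (Submodule.disjoint_def.1 hc.disjoint x h4 hx.1)
    · have h4 : w = β ∨ w = βs := by
        by_contra h5
        push Not at h5
        exact hwA (hA ▸ ⟨h3, by simp [h5.1, h5.2]⟩)
      have h5 : ‖w‖ ≤ (Γ ^ 5)⁻¹ / 4 := by
        rcases h4 with rfl | rfl
        · exact s.norm_small_le s.pair.upper
        · exact s.norm_small_le s.pair.star_upper
      refine h2 (s.pair.eigenvalue_eq s.reg s.del_le_inv s.Γδ_le h5 (by rw [← hT]; exact h1)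
        hx.2.1 hx.2.2)
  have hmem : R - spectralProj T A R - unstable B Bs l ls R ∈ U := by
    refine ⟨Submodule.sub_mem _ hR (Submodule.add_mem _ (Submodule.smul_mem _ _ hB)
      (Submodule.smul_mem _ _ hBs)), ?_, ?_⟩
    · change hs _ _ = 0
      rw [hs_sub_right, hs_sub_right, hs_eq_zero_of_mem hl hβ hQ, s.hs_l_unstable, sub_zero,
        sub_self]
    · change hs _ _ = 0
      rw [hs_sub_right, hs_sub_right, hs_eq_zero_of_mem hls hβs hQ, s.hs_ls_unstable, sub_zero,
        sub_self]
  rw [hU0, Submodule.mem_bot] at hmem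
  rw [sub_right_comm, sub_eq_zero] at hmem
  exact hmem.symm

theorem stabOp_invQ (s : D.Setup Γ β βs B Bs l ls) (R : Mat n) :
    stabOp D.S D.M (invQ D.S D.M β βs R) = R - unstable B Bs l ls R := by
  rw [invQ, Module.End.mul_apply, ← Module.End.mul_apply, Ring.mul_inverse_cancel _ s.isUnit_stabOp,
    Module.End.one_apply, s.spectralProj_eq]

theorem invQ_eq (s : D.Setup Γ β βs B Bs l ls) {R Y : Mat n}
    (hY : stabOp D.S D.M Y = R - unstable B Bs l ls R) : invQ D.S D.M β βs R = Y :=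
  s.stabOp_injective (by rw [s.stabOp_invQ, hY])

theorem hs_l_invQ (s : D.Setup Γ β βs B Bs l ls) (R : Mat n) :
    hs (diagonal l) (invQ D.S D.M β βs R) = 0 := by
  have h1 := s.hs_left (invQ D.S D.M β βs R)
  rw [s.stabOp_invQ, hs_sub_right, s.hs_l_unstable, sub_self] at h1
  exact (mul_eq_zero.1 h1.symm).resolve_left s.β_ne

theorem hs_ls_invQ (s : D.Setup Γ β βs B Bs l ls) (R : Mat n) :
    hs (diagonal ls) (invQ D.S D.M β βs R) = 0 := by
  have h1 := s.hs_left_star (invQ D.S D.M β βs R)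
  rw [s.stabOp_invQ, hs_sub_right, s.hs_ls_unstable, sub_self] at h1
  exact (mul_eq_zero.1 h1.symm).resolve_left s.βs_ne

/-- Every matrix is the sum of its unstable part and of `𝓑⁻¹ 𝒬` applied to its image. -/
theorem invQ_stabOp (s : D.Setup Γ β βs B Bs l ls) (R : Mat n) :
    invQ D.S D.M β βs (stabOp D.S D.M R) = R - unstable B Bs l ls R :=
  s.invQ_eq (by rw [map_sub, s.unstable_stabOp])

end Setup

end Data

theorem offDiag_apply_eq_zero (z : ℂ) {a b : Idx n} (h : b ≠ a.swap) : offDiag n z a b = 0 := by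
  rcases a with i | i <;> rcases b with j | j <;> simp [offDiag, Matrix.one_apply] at h ⊢
  · intro h1; exact absurd h1.symm h
  · intro h1; exact absurd h1.symm h

theorem offDiag_mul_apply (z : ℂ) (Y : Mat n) (a b : Idx n) :
    (offDiag n z * Y) a b = offDiag n z a a.swap * Y a.swap b := by
  rw [Matrix.mul_apply]
  refine Finset.sum_eq_single a.swap (fun c _ hc => ?_) (by simp)
  rw [offDiag_apply_eq_zero z hc, zero_mul]

theorem norm_Eminus_le : ‖(Eminus : Mat n)‖ ≤ 1 := by
  rw [Eminus_eq]
  refine norm_diagonal_le zero_le_one fun a => ?_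
  rcases a with i | i <;> simp

theorem Eminus_eq_sgn : (Eminus : Mat n) = diagonal (fun a => (sgn a : ℂ)) := by
  rw [Eminus_eq]
  congr 1
  funext a
  rcases a with i | i <;> simp

namespace Data

variable {D : Data n} {Γ : ℝ}

/-- The quadratic nonlinearity `M 𝒮[X] Y`. -/
def quad (D : Data n) (X Y : Mat n) : Mat n := D.M * selfEnergy D.S X * Y

theorem quad_add_left (D : Data n) (X X' Y : Mat n) :
    D.quad (X + X') Y = D.quad X Y + D.quad X' Y := by
  simp only [quad, map_add, Matrix.mul_add, Matrix.add_mul]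

theorem quad_add_right (D : Data n) (X Y Y' : Mat n) :
    D.quad X (Y + Y') = D.quad X Y + D.quad X Y' := by
  simp only [quad, Matrix.mul_add]

theorem quad_smul_left (D : Data n) (c : ℂ) (X Y : Mat n) :
    D.quad (c • X) Y = c • D.quad X Y := by
  simp only [quad, map_smul, Matrix.mul_smul, Matrix.smul_mul]

theorem quad_smul_right (D : Data n) (c : ℂ) (X Y : Mat n) :
    D.quad X (c • Y) = c • D.quad X Y := by
  simp only [quad, Matrix.mul_smul]

namespace Regular

theorem norm_quad_le (h : D.Regular Γ) {X Y : Mat n} {d : ℝ} (hd : 0 ≤ d) (hX : ∀ a, ‖X a a‖ ≤ d) :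
    ‖D.quad X Y‖ ≤ 4 * Γ ^ 2 * d * ‖Y‖ := by
  have h0 := h.Λ_pos
  unfold quad
  refine (norm_mul_le _ _).trans ?_
  gcongr
  refine (norm_mul_le _ _).trans ?_
  calc _ ≤ 4 * Γ * (Γ * d) := by
        gcongr
        · exact h.norm_M_le
        · exact h.norm_selfEnergy_le hd hX
    _ = _ := by ring

theorem norm_M_mul_apply_le (h : D.Regular Γ) {Y : Mat n} {e : ℝ} (hY : ∀ a b, ‖Y a b‖ ≤ e)
    (a b : Idx n) : ‖(D.M * Y) a b‖ ≤ 4 * Γ * e := by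
  have h0 := h.Λ_pos
  have h1 := h.one_le
  have he : 0 ≤ e := (norm_nonneg _).trans (hY a b)
  unfold Data.M
  rw [Matrix.sub_mul, Matrix.sub_apply, diagonal_mul, Matrix.mul_assoc, diagonal_mul,
    offDiag_mul_apply]
  refine (norm_sub_le _ _).trans ?_
  rw [norm_mul, norm_mul, norm_mul, norm_mul, norm_mul, norm_I, one_mul, norm_real,
    norm_real, norm_real, norm_of_nonneg h.ρ_pos.le,
    norm_of_nonneg (h.F_pos a).le, norm_of_nonneg (h.u_pos a).le]
  have e1 : ‖offDiag n D.z a a.swap‖ ≤ 2 :=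
    (norm_entry_le _ _ _).trans ((norm_offDiag_le D.z).trans h.z_upper)
  calc D.ρ * D.F a * ‖Y a b‖ + D.u a * (‖offDiag n D.z a a.swap‖ * ‖Y a.swap b‖)
      ≤ 1 * Γ * e + 3 / 2 * (2 * e) := by
        have e2 := h.ρ_le_one
        have e3 := h.F_upper a
        have e4 := h.u_upper a
        have e5 := hY a b
        have e6 := hY a.swap b
        have e7 := h.ρ_pos.le
        have e8 := (h.F_pos a).le
        have e9 := (h.u_pos a).le
        gcongr
    _ ≤ 4 * Γ * e := by
        have : 1 * e ≤ Γ * e := by gcongr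
        linarith

theorem norm_quad_apply_le (h : D.Regular Γ) {X Y : Mat n} {d e : ℝ} (hX : ∀ a, ‖X a a‖ ≤ d)
    (hY : ∀ a b, ‖Y a b‖ ≤ e) (a b : Idx n) : ‖D.quad X Y a b‖ ≤ 4 * Γ ^ 2 * d * e := by
  have h0 := h.Λ_pos
  have hd : 0 ≤ d := (norm_nonneg _).trans (hX a)
  unfold quad
  rw [Matrix.mul_assoc]
  refine (h.norm_M_mul_apply_le (e := Γ * d * e) (fun a b => ?_) a b).trans (le_of_eq (by ring))
  rw [selfEnergy_eq, diagonal_mul, norm_mul]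
  exact mul_le_mul (h.norm_act_le hX a) (hY a b) (norm_nonneg _) (by positivity)

theorem hs_Eminus_M (h : D.Regular Γ) : hs Eminus D.M = 0 := by
  rw [Eminus_eq_sgn, hs_diagonal_eq, M_eq_diagOff, diagOff_diag, dpair, Fintype.sum_sum_type]
  have h1 := congrArg (fun x : ℝ => (x : ℂ)) (h.sum_inl.trans h.sum_inr.symm)
  push_cast at h1
  simp only [sgn_inl, sgn_inr, Complex.ofReal_one, Complex.ofReal_neg, ← Finset.mul_sum, map_one,
    map_neg]
  rw [h1]
  ring

end Regular

namespace Setup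

variable {β βs : ℂ} {B Bs : Mat n} {l ls : Idx n → ℂ}

theorem norm_hs_l_le (s : D.Setup Γ β βs B Bs l ls) {R : Mat n} {m : ℝ} (hR : ∀ a, ‖R a a‖ ≤ m) :
    ‖hs (diagonal l) R‖ ≤ 2 * Γ * m := by
  rw [hs_diagonal_eq]
  exact norm_dpair_le s.reg.n_pos s.l_le hR

theorem norm_hs_ls_le (s : D.Setup Γ β βs B Bs l ls) {R : Mat n} {m : ℝ} (hR : ∀ a, ‖R a a‖ ≤ m) :
    ‖hs (diagonal ls) R‖ ≤ 2 * Γ * m := by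
  rw [hs_diagonal_eq]
  exact norm_dpair_le s.reg.n_pos s.ls_le hR

theorem norm_div_le {x y : ℂ} {a b : ℝ} (ha : 0 < a) (hx : ‖x‖ ≤ b) (hy : a⁻¹ ≤ ‖y‖) :
    ‖x / y‖ ≤ a * b := by
  have hy0 : 0 < ‖y‖ := (inv_pos.2 ha).trans_le hy
  rw [norm_div, div_le_iff₀ hy0]
  have hb : 0 ≤ b := (norm_nonneg _).trans hx
  calc ‖x‖ ≤ a * b * a⁻¹ := by rw [mul_comm a, mul_assoc, mul_inv_cancel₀ ha.ne', mul_one]; exact hx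
    _ ≤ _ := by gcongr

theorem norm_unstable_le (s : D.Setup Γ β βs B Bs l ls) {R : Mat n} {m : ℝ}
    (hR : ∀ a, ‖R a a‖ ≤ m) : ‖unstable B Bs l ls R‖ ≤ 32 * Γ ^ 5 * m := by
  have h0 := s.Γ_pos
  have hm : 0 ≤ m := (norm_nonneg _).trans (hR (Sum.inl ⟨0, s.reg.n_pos⟩))
  have h1 := norm_div_le (by positivity) (s.norm_hs_l_le hR) s.hs_l_B_lower
  have h2 := norm_div_le (by positivity) (s.norm_hs_ls_le hR) s.hs_ls_Bs_lower
  unfold unstable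
  refine (norm_add_le _ _).trans ?_
  rw [norm_smul, norm_smul]
  calc _ ≤ 2 * Γ ^ 2 * (2 * Γ * m) * (6 * Γ ^ 2) + 2 * Γ ^ 2 * (2 * Γ * m) * (2 * Γ) := by
        have h3 := s.norm_B_le
        have h4 := s.norm_Bs_le
        gcongr
    _ ≤ _ := by
        have : Γ ^ 4 * m ≤ Γ ^ 5 * m := by
          have := s.one_le
          gcongr
          norm_num
        linarith

theorem diag_le_of_stabOp (s : D.Setup Γ β βs B Bs l ls) {Y : Mat n} {l' ls' : Idx n → ℂ}
    (hl : ∀ a, ‖l' a - D.G a‖ ≤ Γ * D.del) (hls : ∀ a, ‖ls' a - sgn a * D.G a‖ ≤ Γ * D.del)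
    (h1 : hs (diagonal l') Y = 0) (h2 : hs (diagonal ls') Y = 0) {m : ℝ}
    (hm : ∀ a, ‖stabOp D.S D.M Y a a‖ ≤ m) (a : Idx n) : ‖Y a a‖ ≤ 6 * Γ ^ 8 * m := by
  have h0 := s.Γ_pos
  have h3 := s.reg.norm_le_of_dpair hl hls s.Γδ_le (r := Y.diag) (w := 0) (Y := m) (p := 0)
    (by rw [norm_zero]; positivity) s.del_le_inv (fun a => by
      rw [zero_smul, sub_zero, ← s.reg.diag_stabOp]; exact hm a)
    (by rw [← hs_diagonal_eq, h1, norm_zero]) (by rw [← hs_diagonal_eq, h2, norm_zero]) a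
  rwa [mul_zero, add_zero] at h3

theorem norm_sub_le_of_diag (h : D.Regular Γ) {Y : Mat n} {d : ℝ} (hd : 0 ≤ d)
    (hY : ∀ a, ‖Y a a‖ ≤ d) : ‖Y - stabOp D.S D.M Y‖ ≤ 16 * Γ ^ 3 * d := by
  have h0 := h.Λ_pos
  rw [stabOp_apply, sub_sub_cancel]
  refine (norm_mul_le _ _).trans ?_
  calc _ ≤ 4 * Γ * (Γ * d) * (4 * Γ) := by
        gcongr
        · refine (norm_mul_le _ _).trans ?_
          gcongr
          · exact h.norm_M_le
          · exact h.norm_selfEnergy_le hd hY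
        · exact h.norm_M_le
    _ = _ := by ring

theorem diag_invQ_le (s : D.Setup Γ β βs B Bs l ls) {R : Mat n} {m : ℝ} (hR : ∀ a, ‖R a a‖ ≤ m)
    (a : Idx n) : ‖invQ D.S D.M β βs R a a‖ ≤ 198 * Γ ^ 13 * m := by
  have h0 := s.Γ_pos
  have hm : 0 ≤ m := (norm_nonneg _).trans (hR a)
  have h1 := s.norm_unstable_le hR
  refine (s.diag_le_of_stabOp s.pair.l_near s.pair.ls_near (s.hs_l_invQ R) (s.hs_ls_invQ R)
    (m := 33 * Γ ^ 5 * m) (fun a => ?_) a).trans (le_of_eq (by ring))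
  rw [s.stabOp_invQ, Matrix.sub_apply]
  refine (norm_sub_le _ _).trans ?_
  have h2 := (norm_entry_le _ a a).trans h1
  have h3 : 1 * m ≤ Γ ^ 5 * m := by
    have : 1 ≤ Γ ^ 5 := one_le_pow₀ s.one_le
    gcongr
  linarith [hR a]

theorem norm_invQ_sub_le (s : D.Setup Γ β βs B Bs l ls) {R : Mat n} {m : ℝ}
    (hR : ∀ a, ‖R a a‖ ≤ m) : ‖invQ D.S D.M β βs R - R‖ ≤ 3200 * Γ ^ 16 * m := by
  have h0 := s.Γ_pos
  have hm : 0 ≤ m := (norm_nonneg _).trans (hR (Sum.inl ⟨0, s.reg.n_pos⟩))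
  have h1 := s.norm_unstable_le hR
  have h2 := norm_sub_le_of_diag s.reg (by positivity) (s.diag_invQ_le hR)
  rw [s.stabOp_invQ] at h2
  have e : invQ D.S D.M β βs R - R
      = (invQ D.S D.M β βs R - (R - unstable B Bs l ls R)) - unstable B Bs l ls R := by abel
  rw [e]
  refine (norm_sub_le _ _).trans ?_
  have h3 : Γ ^ 5 * m ≤ Γ ^ 16 * m := by
    have := s.one_le
    gcongr
    norm_num
  linarith

theorem norm_invQ_le (s : D.Setup Γ β βs B Bs l ls) (R : Mat n) :
    ‖invQ D.S D.M β βs R‖ ≤ 3201 * Γ ^ 16 * ‖R‖ := by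
  have h1 := s.norm_invQ_sub_le (fun a => norm_entry_le R a a)
  have h2 := norm_le_norm_add_norm_sub R (invQ D.S D.M β βs R)
  rw [norm_sub_rev] at h2
  have h3 : 1 * ‖R‖ ≤ Γ ^ 16 * ‖R‖ := by
    have : 1 ≤ Γ ^ 16 := one_le_pow₀ s.one_le
    gcongr
  linarith

theorem invQ_eigen (s : D.Setup Γ β βs B Bs l ls) {b : ℂ} (hb : b = β ∨ b = βs) {X : Mat n}
    (hX : stabOp D.S D.M X = b • X) : invQ D.S D.M β βs X = 0 := by
  refine s.invQ_eq ?_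
  rw [map_zero]
  refine (s.pair.eigenvalue_eq s.reg s.del_le_inv s.Γδ_le (w := b) ?_ ?_ ?_ ?_).symm
  · rcases hb with rfl | rfl
    · exact s.norm_small_le s.pair.upper
    · exact s.norm_small_le s.pair.star_upper
  · rw [map_sub, ← s.unstable_stabOp, hX, smul_sub]
    congr 1
    simp only [unstable, hs_smul_right, smul_add, smul_smul, mul_div_assoc]
  · rw [hs_sub_right, s.hs_l_unstable, sub_self]
  · rw [hs_sub_right, s.hs_ls_unstable, sub_self]

/-- The adjoint of a left eigenvector gives rise to a right eigenvector. -/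
theorem stabOp_conj_left {S : Matrix (Fin n) (Fin n) ℝ} {M : Mat n} {l : Idx n → ℂ} {b : ℂ}
    (hl : hsAdjoint (stabOp S M) (diagonal l) = conj b • diagonal l) :
    stabOp S M (M * (diagonal l)ᴴ * M) = b • (M * (diagonal l)ᴴ * M) := by
  rw [hsAdjoint_stabOp] at hl
  have h1 : selfEnergy S (Mᴴ * diagonal l * Mᴴ)
      = (1 - conj b) • diagonal l := by
    rw [sub_smul, one_smul, ← hl, sub_sub_cancel]
  have h2 : selfEnergy S (M * (diagonal l)ᴴ * M) = (1 - b) • (diagonal l)ᴴ := by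
    have h3 := congrArg Matrix.conjTranspose h1
    have h4 : ∀ R : Mat n, (selfEnergy S R)ᴴ = selfEnergy S Rᴴ := by
      intro R
      rw [selfEnergy_eq, selfEnergy_eq, diagonal_conjTranspose]
      congr 1
      funext a
      simp [act_apply, diag_apply]
    rw [h4, conjTranspose_smul, conjTranspose_mul, conjTranspose_mul,
      conjTranspose_conjTranspose, ← Matrix.mul_assoc] at h3
    rw [h3]
    congr 1
    simp
  rw [stabOp_apply, h2, Matrix.mul_smul, Matrix.smul_mul, sub_smul, one_smul, sub_sub_cancel]

theorem norm_hsAdjoint_invQ_le (s : D.Setup Γ β βs B Bs l ls) (V : Mat n) :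
    ‖hsAdjoint (invQ D.S D.M β βs) V‖ ≤ 52000 * Γ ^ 19 * ‖V‖ := by
  have h0 := s.Γ_pos
  have h1 := s.one_le
  obtain ⟨Z, hZ⟩ : ∃ Z, Z = hsAdjoint (invQ D.S D.M β βs) V := ⟨_, rfl⟩
  obtain ⟨V', hV'⟩ : ∃ V', V' = V - ((conj (hs V B / hs (diagonal l) B)) • diagonal l
    + (conj (hs V Bs / hs (diagonal ls) Bs)) • diagonal ls) := ⟨_, rfl⟩
  have hZR : ∀ R, hs Z R = hs V (invQ D.S D.M β βs R) := fun R => by rw [hZ, hs_hsAdjoint]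
  have hTZ : hsAdjoint (stabOp D.S D.M) Z = V' := by
    refine hs_ext fun R => ?_
    rw [hs_hsAdjoint, hZR, s.invQ_stabOp, hV', hs_sub_left, hs_add_left, hs_smul_left, hs_smul_left,
      Complex.conj_conj, Complex.conj_conj, hs_sub_right, unstable, hs_add_right, hs_smul_right,
      hs_smul_right]
    ring
  have hV'n : ‖V'‖ ≤ 33 * Γ ^ 5 * ‖V‖ := by
    have e1 := norm_div_le (x := hs V B) (b := ‖V‖ * (6 * Γ ^ 2)) (by positivity)
      ((norm_hs_le V B).trans (mul_le_mul_of_nonneg_left s.norm_B_le (norm_nonneg _))) s.hs_l_B_lower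
    have e2 := norm_div_le (x := hs V Bs) (b := ‖V‖ * (2 * Γ)) (by positivity)
      ((norm_hs_le V Bs).trans (mul_le_mul_of_nonneg_left s.norm_Bs_le (norm_nonneg _)))
      s.hs_ls_Bs_lower
    have e3 := norm_diagonal_le (by positivity) s.l_le
    have e4 := norm_diagonal_le (by positivity) s.ls_le
    rw [hV']
    refine (norm_sub_le _ _).trans ?_
    have e5 := norm_add_le ((conj (hs V B / hs (diagonal l) B)) • (diagonal l : Mat n))
      ((conj (hs V Bs / hs (diagonal ls) Bs)) • diagonal ls)
    rw [norm_smul, norm_smul, RCLike.norm_conj, RCLike.norm_conj] at e5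
    have e6 : ‖hs V B / hs (diagonal l) B‖ * ‖(diagonal l : Mat n)‖
        ≤ 2 * Γ ^ 2 * (‖V‖ * (6 * Γ ^ 2)) * (2 * Γ) := by gcongr
    have e7 : ‖hs V Bs / hs (diagonal ls) Bs‖ * ‖(diagonal ls : Mat n)‖
        ≤ 2 * Γ ^ 2 * (‖V‖ * (2 * Γ)) * (2 * Γ) := by gcongr
    have e8 : Γ ^ 4 * ‖V‖ ≤ Γ ^ 5 * ‖V‖ := by
      gcongr
      norm_num
    have e9 : 1 * ‖V‖ ≤ Γ ^ 5 * ‖V‖ := by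
      have : 1 ≤ Γ ^ 5 := one_le_pow₀ h1
      gcongr
    linarith
  -- the conjugate of the intermediate matrix solves the stability equation
  obtain ⟨Y, hY⟩ : ∃ Y, Y = D.M * Zᴴ * D.M := ⟨_, rfl⟩
  have hYc : Yᴴ = D.Mᴴ * Z * D.Mᴴ := by
    rw [hY, conjTranspose_mul, conjTranspose_mul, conjTranspose_conjTranspose,
      Matrix.mul_assoc]
  have hSE : ∀ R : Mat n, (selfEnergy D.S R)ᴴ = selfEnergy D.S Rᴴ := by
    intro R
    rw [selfEnergy_eq, selfEnergy_eq, diagonal_conjTranspose]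
    congr 1
    funext a
    simp [act_apply, diag_apply]
  have hZe : Z = V' + selfEnergy D.S Yᴴ := by
    rw [← hTZ, hsAdjoint_stabOp, hYc, sub_add_cancel]
  have hTY : stabOp D.S D.M Y = D.M * V'ᴴ * D.M := by
    have e1 : Zᴴ = V'ᴴ + selfEnergy D.S Y := by
      conv_lhs => rw [hZe]
      rw [conjTranspose_add, hSE, conjTranspose_conjTranspose]
    have e2 : Y = D.M * (V'ᴴ + selfEnergy D.S Y) * D.M := by rw [← e1]; exact hY
    rw [stabOp_apply]
    nth_rewrite 1 [e2]
    noncomm_ring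
  have hpair : ∀ {k : Idx n → ℂ} {b : ℂ}, (b = β ∨ b = βs) →
      hsAdjoint (stabOp D.S D.M) (diagonal k) = conj b • diagonal k →
      hs (diagonal fun a => conj (k a)) Yᴴ = 0 := by
    intro k b hb hk
    have e1 : (diagonal fun a => conj (k a) : Mat n) = (diagonal k)ᴴ := by
      rw [diagonal_conjTranspose]; rfl
    rw [hYc, e1, hs_mul_right, hs_mul_left, conjTranspose_conjTranspose, ← Matrix.mul_assoc,
      ← hs_conj, hZR, s.invQ_eigen hb (stabOp_conj_left hk), hs_zero_right, map_zero]
  have hpair' : ∀ {k : Idx n → ℂ} {b : ℂ}, (b = β ∨ b = βs) →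
      hsAdjoint (stabOp D.S D.M) (diagonal k) = conj b • diagonal k →
      hs (diagonal k) Y = 0 := by
    intro k b hb hk
    have e1 := congrArg conj (hpair hb hk)
    rw [map_zero] at e1
    rw [← e1, hs_diagonal_eq, hs_diagonal_eq, dpair, dpair, map_mul, map_sum]
    congr 1
    · simp [Complex.conj_ofNat]
    · refine Finset.sum_congr rfl fun a _ => ?_
      simp
  have hYd := s.diag_le_of_stabOp s.pair.l_near s.pair.ls_near
    (hpair' (Or.inl rfl) s.pair.left) (hpair' (Or.inr rfl) s.pair.left_star)
    (fun a => norm_entry_le _ a a)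
  have hTYn : ‖stabOp D.S D.M Y‖ ≤ 528 * Γ ^ 7 * ‖V‖ := by
    rw [hTY]
    refine (norm_mul_le _ _).trans ?_
    calc _ ≤ 4 * Γ * (33 * Γ ^ 5 * ‖V‖) * (4 * Γ) := by
          gcongr
          · refine (norm_mul_le _ _).trans ?_
            gcongr
            · exact s.reg.norm_M_le
            · rw [l2_opNorm_conjTranspose]; exact hV'n
          · exact s.reg.norm_M_le
      _ = _ := by ring
  have hS : ‖selfEnergy D.S Yᴴ‖ ≤ Γ * (6 * Γ ^ 8 * (528 * Γ ^ 7 * ‖V‖)) := by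
    refine s.reg.norm_selfEnergy_le (by positivity) fun a => ?_
    rw [conjTranspose_apply, norm_star]
    refine (hYd a).trans ?_
    gcongr
  rw [← hZ, hZe]
  refine (norm_add_le _ _).trans ?_
  have e1 : Γ ^ 5 * ‖V‖ ≤ Γ ^ 19 * ‖V‖ := by
    gcongr
    norm_num
  have e2 : Γ ^ 16 * ‖V‖ ≤ Γ ^ 19 * ‖V‖ := by
    gcongr
    norm_num
  have e3 : 0 ≤ Γ ^ 19 * ‖V‖ := by positivity
  have e4 : Γ * (6 * Γ ^ 8 * (528 * Γ ^ 7 * ‖V‖)) = 3168 * (Γ ^ 16 * ‖V‖) := by ring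
  linarith

theorem hs_matR₁ (S : Matrix (Fin n) (Fin n) ℝ) (M : Mat n) (β βs : ℂ) (R : Mat n) :
    hs (matR₁ S M β βs) R = hs Eminus (invQ S M β βs (M * R)) := by
  rw [matR₁, ← hs_hsAdjoint, hs_mul_left]

theorem norm_matR₁_le (s : D.Setup Γ β βs B Bs l ls) :
    ‖matR₁ D.S D.M β βs‖ ≤ 208000 * Γ ^ 20 := by
  have h0 := s.Γ_pos
  rw [matR₁]
  refine (norm_mul_le _ _).trans ?_
  rw [l2_opNorm_conjTranspose]
  calc _ ≤ 4 * Γ * (52000 * Γ ^ 19 * 1) := by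
        gcongr
        · exact s.reg.norm_M_le
        · refine (s.norm_hsAdjoint_invQ_le _).trans ?_
          gcongr
          exact norm_Eminus_le
    _ = _ := by ring

/-- The matrix representing the linear functional of the error in the coefficient of the linear
term of the cubic equation. -/
theorem exists_matR₂ (s : D.Setup Γ β βs B Bs l ls) : ∃ R₂ : Mat n, ‖R₂‖ ≤ 10 ^ 8 * Γ ^ 25 ∧
    ∀ R, hs R₂ R = hs (diagonal l) (D.quad B (invQ D.S D.M β βs (D.M * R)))
      + hs (diagonal l) (D.quad (invQ D.S D.M β βs (D.M * R)) B) := by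
  have h0 := s.Γ_pos
  have hL := norm_diagonal_le (by positivity) s.l_le
  obtain ⟨W, hW⟩ : ∃ W, W = (D.M * selfEnergy D.S B)ᴴ * diagonal l
    + selfEnergy D.S (D.Mᴴ * (diagonal l * Bᴴ)) := ⟨_, rfl⟩
  have hWn : ‖W‖ ≤ 96 * Γ ^ 5 := by
    have e1 : ‖(D.M * selfEnergy D.S B)ᴴ * diagonal l‖ ≤ 4 * Γ * (Γ * (6 * Γ ^ 2)) * (2 * Γ) := by
      refine (norm_mul_le _ _).trans ?_
      rw [l2_opNorm_conjTranspose]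
      gcongr
      refine (norm_mul_le _ _).trans ?_
      gcongr
      · exact s.reg.norm_M_le
      · exact (s.reg.norm_selfEnergy_le_norm B).trans (by gcongr; exact s.norm_B_le)
    have e2 : ‖selfEnergy D.S (D.Mᴴ * (diagonal l * Bᴴ))‖
        ≤ Γ * (4 * Γ * (2 * Γ * (6 * Γ ^ 2))) := by
      refine (s.reg.norm_selfEnergy_le_norm _).trans ?_
      gcongr
      refine (norm_mul_le _ _).trans ?_
      rw [l2_opNorm_conjTranspose]
      gcongr
      · exact s.reg.norm_M_le
      · refine (norm_mul_le _ _).trans ?_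
        rw [l2_opNorm_conjTranspose]
        gcongr
        exact s.norm_B_le
    rw [hW]
    refine (norm_add_le _ _).trans ?_
    linarith
  refine ⟨D.Mᴴ * hsAdjoint (invQ D.S D.M β βs) W, ?_, fun R => ?_⟩
  · refine (norm_mul_le _ _).trans ?_
    rw [l2_opNorm_conjTranspose]
    calc _ ≤ 4 * Γ * (52000 * Γ ^ 19 * (96 * Γ ^ 5)) := by
          gcongr
          · exact s.reg.norm_M_le
          · refine (s.norm_hsAdjoint_invQ_le _).trans ?_
            gcongr
      _ ≤ _ := by
        have : 0 ≤ Γ ^ 25 := by positivity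
        linarith
  · rw [← hs_mul_left, hs_hsAdjoint, hW, hs_add_left, quad, quad, hs_selfEnergy, ← hs_mul_left,
      ← hs_mul_left _ D.M, ← hs_mul_right]

theorem hs_Eminus_B (s : D.Setup Γ β βs B Bs l ls) : ‖hs Eminus B‖ ≤ Γ * D.del := by
  have h1 : hs (Eminus : Mat n) B = (2 * n : ℂ)⁻¹ * ∑ a, (sgn a : ℂ) * (B a a - D.F a) := by
    have h2 := congrArg (fun x : ℝ => (x : ℂ)) (s.reg.sum_inl.trans s.reg.sum_inr.symm)
    push_cast at h2
    have h3 : ∑ a : Idx n, (sgn a : ℂ) * D.F a = 0 := by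
      rw [Fintype.sum_sum_type]
      simp only [sgn_inl, sgn_inr, Complex.ofReal_one, Complex.ofReal_neg, one_mul, neg_mul,
        Finset.sum_neg_distrib]
      rw [h2, add_neg_cancel]
    simp only [mul_sub, Finset.sum_sub_distrib, h3, sub_zero]
    rw [Eminus_eq_sgn, hs_diagonal_eq, dpair]
    simp only [conj_ofReal, diag_apply]
  rw [h1]
  refine norm_average_le s.reg.n_pos fun a => ?_
  rw [norm_mul, norm_real, Real.norm_eq_abs, abs_sgn, one_mul]
  exact s.diag_B_near a

theorem hs_Eminus_Bs (s : D.Setup Γ β βs B Bs l ls) : 1 ≤ ‖hs Eminus Bs‖ := by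
  have hn := s.reg.n_pos'
  have h1 : hs (Eminus : Mat n) Bs - Real.pi
      = (2 * n : ℂ)⁻¹ * ∑ a, (sgn a : ℂ) * (Bs a a - sgn a * D.F a) := by
    have h2 : (∑ a, (D.F a : ℂ)) = ((2 * n * Real.pi : ℝ) : ℂ) := by
      rw [← Complex.ofReal_sum, Fintype.sum_sum_type, s.reg.sum_inl, s.reg.sum_inr]
      congr 1; ring
    have h3 : ∑ a : Idx n, (sgn a : ℂ) * (sgn a * D.F a) = ((2 * n * Real.pi : ℝ) : ℂ) := by
      rw [← h2]
      refine Finset.sum_congr rfl fun a _ => ?_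
      rcases a with i | i <;> simp
    simp only [mul_sub, Finset.sum_sub_distrib, h3]
    rw [Eminus_eq_sgn, hs_diagonal_eq, dpair]
    simp only [conj_ofReal, diag_apply]
    have : (n : ℂ) ≠ 0 := by exact_mod_cast hn.ne'
    push_cast
    field_simp
  have h4 : ‖hs (Eminus : Mat n) Bs - Real.pi‖ ≤ Γ * D.del := by
    rw [h1]
    refine norm_average_le s.reg.n_pos fun a => ?_
    rw [norm_mul, norm_real, Real.norm_eq_abs, abs_sgn, one_mul]
    exact s.diag_Bs_near a
  have h5 := norm_le_norm_add_norm_sub (hs (Eminus : Mat n) Bs) (Real.pi : ℂ)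
  rw [norm_real, norm_of_nonneg Real.pi_pos.le] at h5
  have h6 := s.pow_mul_del_le (k := 1) (by norm_num)
  rw [pow_one] at h6
  linarith [Real.pi_gt_three]

end Setup

end Data

theorem norm_mul_sub_mul_le (A A' B B' : Mat n) :
    ‖A * B - A' * B'‖ ≤ ‖A - A'‖ * ‖B‖ + ‖A'‖ * ‖B - B'‖ := by
  have e : A * B - A' * B' = (A - A') * B + A' * (B - B') := by noncomm_ring
  rw [e]
  exact (norm_add_le _ _).trans (add_le_add (norm_mul_le _ _) (norm_mul_le _ _))

namespace Data

variable {D : Data n} {Γ : ℝ}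

/-- The product of the profile and the swapped profile. -/
def lead (D : Data n) (a : Idx n) : ℝ := D.F a * D.G a

/-- The leading order of the coefficient of the cubic term. -/
def cubicMass (D : Data n) : ℝ := (2 * n : ℝ)⁻¹ * ∑ a, D.lead a ^ 2

/-- The size `ρ + η / ρ` of the regime. -/
def rad (D : Data n) : ℝ := D.ρ + D.η / D.ρ

theorem G_swap (D : Data n) (a : Idx n) : D.G a.swap = D.F a := by simp [Data.G]

theorem lead_swap (D : Data n) (a : Idx n) : D.lead a.swap = D.lead a := by
  rw [lead, G_swap, lead, mul_comm]; rfl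

namespace Regular

theorem ρ_le_rad (h : D.Regular Γ) : D.ρ ≤ D.rad := by
  have := h.η_div_pos
  unfold rad; linarith

theorem del_le_rad (h : D.Regular Γ) : D.del ≤ D.rad := by
  have := h.ρ_le_one
  have h1 := h.ρ_pos
  unfold rad del
  nlinarith

theorem lead_pos (h : D.Regular Γ) (a : Idx n) : 0 < D.lead a := mul_pos (h.F_pos a) (h.G_pos a)

theorem lead_le (h : D.Regular Γ) (a : Idx n) : D.lead a ≤ Γ ^ 2 := by
  rw [pow_two]
  exact mul_le_mul (h.F_upper a) (h.F_upper _) (h.G_pos a).le h.Λ_pos.le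

theorem norm_lead_le (h : D.Regular Γ) (a : Idx n) : ‖(D.lead a : ℂ)‖ ≤ Γ ^ 2 := by
  rw [norm_real, norm_of_nonneg (h.lead_pos a).le]; exact h.lead_le a

theorem cubicMass_lower (h : D.Regular Γ) : (Γ ^ 4)⁻¹ ≤ D.cubicMass := by
  refine Setup.average_ge h fun a => ?_
  have h1 := Setup.inv_sq_le_FG h a
  have h2 := h.Λ_pos
  calc (Γ ^ 4)⁻¹ = (Γ ^ 2)⁻¹ ^ 2 := by rw [← inv_pow, ← inv_pow]; ring
    _ ≤ _ := by unfold lead; gcongr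

theorem norm_M_sub_le (h : D.Regular Γ) :
    ‖D.M - diagOff D.z (fun a => I * D.ρ * D.F a) (fun _ => -1)‖ ≤ 2 * Γ * D.del := by
  have hΓ := h.Λ_pos
  have hδ := h.del_pos
  rw [M_eq_diagOff, diagOff_sub]
  refine (norm_diagOff_le h.z_upper le_rfl (by positivity) (c := 0) (e := Γ * D.del)
    (fun a => by simp) fun a => ?_).trans (le_of_eq (by ring))
  have e : (-(D.u a : ℂ) - -1) = ((-(D.u a - 1) : ℝ) : ℂ) := by push_cast; ring
  rw [e, norm_real, norm_neg]
  exact h.u_near a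

end Regular

namespace Setup

variable {β βs : ℂ} {B Bs : Mat n} {l ls : Idx n → ℂ}

theorem norm_selfEnergy_B_sub_le (s : D.Setup Γ β βs B Bs l ls) :
    ‖selfEnergy D.S B - diagonal (fun a => (D.G a : ℂ))‖ ≤ 4 * Γ ^ 2 * D.del := by
  have hΓ := s.Γ_pos
  have h1 := s.one_le
  have hδ := s.reg.del_pos
  have e1 : act D.S B.diag = act D.S (fun a => B a a - D.F a) + act D.S (fun a => (D.F a : ℂ)) := by
    funext a
    simp only [Pi.add_apply, act_apply, ← Finset.sum_add_distrib, diag_apply]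
    exact Finset.sum_congr rfl fun b _ => by ring
  rw [selfEnergy_eq, diagonal_sub]
  refine norm_diagonal_le (by positivity) fun a => ?_
  rw [e1, Pi.add_apply, s.reg.act_F]
  have h2 := s.reg.norm_act_le s.diag_B_near a
  have e2 : act D.S (fun a => B a a - D.F a) a + (D.G a / D.u a - (D.η / D.ρ : ℝ)) - D.G a
      = act D.S (fun a => B a a - D.F a) a + ((D.G a / D.u a - D.G a : ℝ) : ℂ)
        - ((D.η / D.ρ : ℝ) : ℂ) := by push_cast; ring
  rw [e2]
  refine (norm_sub_le _ _).trans ?_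
  have h3 := norm_add_le (act D.S (fun a => B a a - D.F a) a) ((D.G a / D.u a - D.G a : ℝ) : ℂ)
  rw [norm_real, Real.norm_eq_abs] at h3
  rw [norm_real, norm_of_nonneg s.reg.η_div_pos.le]
  have h4 := s.reg.G_div_u_sub_G a
  have h5 := Regular.η_div_le D
  have h6 : 1 * D.del ≤ Γ ^ 2 * D.del := by
    have : 1 ≤ Γ ^ 2 := one_le_pow₀ h1
    gcongr
  linarith

theorem norm_M_mul_selfEnergy_B_sub_le (s : D.Setup Γ β βs B Bs l ls) :
    ‖D.M * selfEnergy D.S B - diagOff D.z (fun a => I * D.ρ * D.lead a)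
      (fun a => -(D.F a : ℂ))‖ ≤ 24 * Γ ^ 4 * D.del := by
  have hΓ := s.Γ_pos
  have h1 := s.one_le
  have hδ := s.reg.del_pos
  have e : diagOff D.z (fun a => I * D.ρ * D.lead a) (fun a => -(D.F a : ℂ))
      = diagOff D.z (fun a => I * D.ρ * D.F a) (fun _ => -1)
        * diagonal (fun a => (D.G a : ℂ)) := by
    rw [diagonal_eq_diagOff D.z, diagOff_mul]
    congr 1
    · funext a
      simp [lead, mul_assoc]
    · funext a
      simp [G_swap]
  have h2 : ‖diagOff D.z (fun a => I * D.ρ * D.F a) (fun _ => -1)‖ ≤ 3 * Γ := by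
    refine (norm_diagOff_le s.reg.z_upper s.Γ_pos.le zero_le_one (fun a => ?_)
      (fun a => by simp)).trans (by linarith)
    rw [norm_mul, norm_mul, norm_I, one_mul, norm_real,
      norm_of_nonneg s.reg.ρ_pos.le]
    calc _ ≤ 1 * Γ := by
          have := s.reg.ρ_le_one
          have := s.F_le a
          gcongr
      _ = Γ := one_mul _
  rw [e]
  refine (norm_mul_sub_mul_le _ _ _ _).trans ?_
  have h3 := s.reg.norm_M_sub_le
  have h4 := (s.reg.norm_selfEnergy_le_norm B).trans (mul_le_mul_of_nonneg_left s.norm_B_le hΓ.le)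
  have h5 := s.norm_selfEnergy_B_sub_le
  calc _ ≤ 2 * Γ * D.del * (Γ * (6 * Γ ^ 2)) + 3 * Γ * (4 * Γ ^ 2 * D.del) := by gcongr
    _ ≤ _ := by
      have : Γ ^ 3 * D.del ≤ Γ ^ 4 * D.del := by
        gcongr
        norm_num
      linarith

theorem norm_z_sq_sub_le (s : D.Setup Γ β βs B Bs l ls) :
    ‖((‖D.z‖ ^ 2 : ℝ) : ℂ) - 1‖ ≤ Γ * D.del := by
  rw [← Complex.ofReal_one, ← Complex.ofReal_sub, norm_real]
  exact s.reg.z_near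

theorem norm_quad_B_B_sub_le (s : D.Setup Γ β βs B Bs l ls) :
    ‖D.quad B B - diagOff D.z (fun a => 3 * I * D.ρ * (D.F a * D.lead a))
      (fun a => -(D.lead a : ℂ))‖ ≤ 160 * Γ ^ 6 * D.del := by
  have hΓ := s.Γ_pos
  have h1 := s.one_le
  have hδ := s.reg.del_pos
  have h2 := norm_mul_sub_mul_le (D.M * selfEnergy D.S B)
    (diagOff D.z (fun a => I * D.ρ * D.lead a) (fun a => -(D.F a : ℂ))) B
    (diagOff D.z (fun a => (D.F a : ℂ)) (fun a => -(I * D.ρ * (2 * (D.F a * D.G a)))))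
  have h3 : ‖diagOff D.z (fun a => I * D.ρ * D.lead a) (fun a => -(D.F a : ℂ))‖
      ≤ 3 * Γ ^ 2 := by
    refine (norm_diagOff_le s.reg.z_upper (c := Γ ^ 2) (e := Γ) (by positivity) hΓ.le
      (fun a => ?_) (fun a => by rw [norm_neg]; exact s.F_le a)).trans ?_
    · rw [norm_mul, norm_mul, norm_I, one_mul, norm_real,
        norm_of_nonneg s.reg.ρ_pos.le]
      calc _ ≤ 1 * Γ ^ 2 := by
            have := s.reg.ρ_le_one
            have := s.reg.norm_lead_le a
            gcongr
        _ = _ := one_mul _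
    · have : Γ ≤ Γ ^ 2 := le_self_pow₀ h1 two_ne_zero
      linarith
  have h4 : ‖diagOff D.z (fun a => I * D.ρ * D.lead a) (fun a => -(D.F a : ℂ))
      * diagOff D.z (fun a => (D.F a : ℂ)) (fun a => -(I * D.ρ * (2 * (D.F a * D.G a))))
      - diagOff D.z (fun a => 3 * I * D.ρ * (D.F a * D.lead a))
        (fun a => -(D.lead a : ℂ))‖ ≤ 2 * Γ ^ 4 * D.del + 2 * Γ ^ 4 * D.del * 2 := by
    rw [diagOff_mul, diagOff_sub]
    refine norm_diagOff_le s.reg.z_upper (by positivity) (by positivity) (fun a => ?_) fun a => ?_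
    · have e : I * D.ρ * D.lead a * D.F a + ((‖D.z‖ ^ 2 : ℝ) : ℂ) * (-(D.F a : ℂ)
          * -(I * D.ρ * (2 * (D.F a.swap * D.G a.swap))))
          - 3 * I * D.ρ * (D.F a * D.lead a)
          = (((‖D.z‖ ^ 2 : ℝ) : ℂ) - 1) * (I * D.ρ * (2 * (D.F a * D.lead a))) := by
        have e1 : (D.F a.swap : ℂ) * D.G a.swap = D.lead a := by
          rw [← D.lead_swap a, lead]; push_cast; ring
        rw [e1]; ring
      rw [e, norm_mul, norm_mul, norm_mul, norm_mul, norm_mul, norm_I, one_mul,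
        norm_real D.ρ, norm_of_nonneg s.reg.ρ_pos.le, RCLike.norm_ofNat]
      calc _ ≤ Γ * D.del * (1 * (2 * (Γ * Γ ^ 2))) := by
            have h4 := s.norm_z_sq_sub_le
            have h5 := s.reg.ρ_le_one
            have h6 := s.reg.ρ_pos.le
            have h7 := s.F_le a
            have h8 := s.reg.norm_lead_le a
            gcongr
        _ = _ := by ring
    · have e : I * D.ρ * D.lead a * -(I * D.ρ * (2 * (D.F a * D.G a)))
          + -(D.F a : ℂ) * D.F a.swap - -(D.lead a : ℂ)
          = ((2 * D.ρ ^ 2 * D.lead a ^ 2 : ℝ) : ℂ) := by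
        have e1 : (D.F a.swap : ℂ) = D.G a := rfl
        have e2 : (D.F a : ℂ) * D.G a = D.lead a := by rw [lead]; push_cast; ring
        have e3 : -(D.F a : ℂ) * D.G a = -D.lead a := by rw [← e2]; ring
        rw [e1, e2, e3]
        push_cast
        linear_combination (-2 * D.ρ ^ 2 * D.lead a ^ 2 : ℂ) * Complex.I_sq
      rw [e, norm_real, norm_of_nonneg (by positivity)]
      calc _ ≤ 2 * D.del * (Γ ^ 2) ^ 2 := by
            have h5 := s.reg.ρ_sq_le
            have h6 := s.reg.lead_le a
            have h7 := (s.reg.lead_pos a).le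
            gcongr
        _ = _ := by ring
  have h5 := norm_add_le (D.M * selfEnergy D.S B * B
    - diagOff D.z (fun a => I * D.ρ * D.lead a) (fun a => -(D.F a : ℂ))
      * diagOff D.z (fun a => (D.F a : ℂ)) (fun a => -(I * D.ρ * (2 * (D.F a * D.G a)))))
    (diagOff D.z (fun a => I * D.ρ * D.lead a) (fun a => -(D.F a : ℂ))
      * diagOff D.z (fun a => (D.F a : ℂ)) (fun a => -(I * D.ρ * (2 * (D.F a * D.G a))))
      - diagOff D.z (fun a => 3 * I * D.ρ * (D.F a * D.lead a))
        (fun a => -(D.lead a : ℂ)))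
  rw [sub_add_sub_cancel] at h5
  have h6 : ‖D.M * selfEnergy D.S B
      - diagOff D.z (fun a => I * D.ρ * D.lead a) (fun a => -(D.F a : ℂ))‖ * ‖B‖
      ≤ 24 * Γ ^ 4 * D.del * (6 * Γ ^ 2) := by
    have h6 := s.norm_M_mul_selfEnergy_B_sub_le
    have h7 := s.norm_B_le
    gcongr
  have h7 : ‖diagOff D.z (fun a => I * D.ρ * D.lead a) (fun a => -(D.F a : ℂ))‖
      * ‖B - diagOff D.z (fun a => (D.F a : ℂ))
        (fun a => -(I * D.ρ * (2 * (D.F a * D.G a))))‖ ≤ 3 * Γ ^ 2 * (Γ * D.del) := by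
    have h7 := s.pair.B_near
    gcongr
  have h8 : Γ ^ 3 * D.del ≤ Γ ^ 6 * D.del := by gcongr; norm_num
  have h9 : Γ ^ 4 * D.del ≤ Γ ^ 6 * D.del := by gcongr; norm_num
  have h12 : 0 ≤ Γ ^ 6 * D.del := by positivity
  have h10 : 24 * Γ ^ 4 * D.del * (6 * Γ ^ 2) = 144 * (Γ ^ 6 * D.del) := by ring
  have h11 : 3 * Γ ^ 2 * (Γ * D.del) = 3 * (Γ ^ 3 * D.del) := by ring
  unfold quad
  linarith

theorem norm_dpair_l_sub_le (s : D.Setup Γ β βs B Bs l ls) {c : ℝ} {f : Idx n → ℂ}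
    (hf : ∀ a, ‖f a‖ ≤ c) :
    ‖dpair l f - (2 * n : ℂ)⁻¹ * ∑ a, D.G a * f a‖ ≤ Γ * D.del * c := by
  have e : dpair l f - (2 * n : ℂ)⁻¹ * ∑ a, D.G a * f a = dpair (fun a => l a - D.G a) f := by
    unfold dpair
    rw [← mul_sub, ← Finset.sum_sub_distrib]
    congr 1
    refine Finset.sum_congr rfl fun a _ => ?_
    rw [map_sub, conj_ofReal]; ring
  rw [e]
  exact norm_dpair_le s.reg.n_pos s.pair.l_near hf

theorem average_lead_eq (D : Data n) (c : ℂ) :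
    (2 * n : ℂ)⁻¹ * ∑ a : Idx n, (D.G a * (c * (D.F a * D.lead a)) : ℂ) = c * D.cubicMass := by
  unfold cubicMass
  push_cast
  have e : ∀ a : Idx n, (D.G a * (c * (D.F a * D.lead a)) : ℂ) = c * D.lead a ^ 2 := fun a => by
    rw [lead]; push_cast; ring
  rw [Finset.sum_congr rfl fun a _ => e a, ← Finset.mul_sum]
  ring

theorem norm_F_lead_le (s : D.Setup Γ β βs B Bs l ls) (a : Idx n) :
    ‖(D.F a * D.lead a : ℂ)‖ ≤ Γ ^ 3 := by
  rw [norm_mul, pow_succ' Γ 2]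
  exact mul_le_mul (s.F_le a) (s.reg.norm_lead_le a) (norm_nonneg _) s.Γ_pos.le

/-- The coefficient of the quadratic term of the cubic equation. -/
theorem hs_l_quad_B_B_sub (s : D.Setup Γ β βs B Bs l ls) :
    ‖hs (diagonal l) (D.quad B B) - 3 * I * D.ρ * D.cubicMass‖
      ≤ 323 * Γ ^ 7 * D.del := by
  have hΓ := s.Γ_pos
  have h1 := s.one_le
  have hδ := s.reg.del_pos
  have h2 := s.norm_hs_l_le (fun a => (norm_entry_le _ a a).trans s.norm_quad_B_B_sub_le)
  have h3 := s.norm_dpair_l_sub_le (f := fun a => 3 * I * D.ρ * (D.F a * D.lead a))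
    (c := 3 * Γ ^ 3) fun a => by
      rw [norm_mul, norm_mul, norm_mul, norm_I, mul_one, RCLike.norm_ofNat,
        norm_real, norm_of_nonneg s.reg.ρ_pos.le]
      calc _ ≤ 3 * 1 * Γ ^ 3 := by
            have h4 := s.norm_F_lead_le a
            have h5 := s.reg.ρ_le_one
            gcongr
        _ = _ := by ring
  rw [average_lead_eq] at h3
  rw [hs_sub_right, hs_diagonal_eq _ (diagOff _ _ _), diagOff_diag] at h2
  have h4 := (norm_add_le _ _).trans (add_le_add h2 h3)
  rw [sub_add_sub_cancel] at h4
  refine h4.trans ?_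
  have h5 : Γ ^ 4 * D.del ≤ Γ ^ 7 * D.del := by gcongr; norm_num
  linarith

theorem invQ_of_diag_eq_zero (s : D.Setup Γ β βs B Bs l ls) {R : Mat n} (hR : ∀ a, R a a = 0) :
    invQ D.S D.M β βs R = R := by
  have h1 := s.norm_invQ_sub_le (R := R) (m := 0) (fun a => by rw [hR, norm_zero])
  rw [mul_zero] at h1
  exact sub_eq_zero.1 (norm_eq_zero.1 (le_antisymm h1 (norm_nonneg _)))

theorem norm_invQ_quad_B_B_sub_le (s : D.Setup Γ β βs B Bs l ls) :
    ‖invQ D.S D.M β βs (D.quad B B) - diagOff D.z 0 (fun a => -(D.lead a : ℂ))‖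
      ≤ 10 ^ 6 * Γ ^ 22 * D.rad := by
  have hΓ := s.Γ_pos
  have h1 := s.one_le
  have hδ := s.reg.del_le_rad
  have hδ0 := s.reg.del_pos
  have hρ := s.reg.ρ_le_rad
  have hr := hδ0.trans_le hδ
  have e : invQ D.S D.M β βs (D.quad B B) - diagOff D.z 0 (fun a => -(D.lead a : ℂ))
      = invQ D.S D.M β βs (D.quad B B - diagOff D.z 0 (fun a => -(D.lead a : ℂ))) := by
    rw [map_sub, s.invQ_of_diag_eq_zero (R := diagOff _ _ _) fun a => ?_]
    exact congrFun (diagOff_diag D.z 0 (fun a => -(D.lead a : ℂ))) a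
  rw [e]
  refine (s.norm_invQ_le _).trans ?_
  have h2 : ‖diagOff D.z (fun a => 3 * I * D.ρ * (D.F a * D.lead a))
      (fun a => -(D.lead a : ℂ)) - diagOff D.z 0 (fun a => -(D.lead a : ℂ))‖
      ≤ 3 * D.ρ * Γ ^ 3 + 0 * 2 := by
    rw [diagOff_sub]
    refine norm_diagOff_le s.reg.z_upper ?_ le_rfl (fun a => ?_) fun a => by simp
    · have := s.reg.ρ_pos
      positivity
    · rw [Pi.zero_apply, sub_zero, norm_mul, norm_mul, norm_mul, norm_I, mul_one,
        RCLike.norm_ofNat, norm_real, norm_of_nonneg s.reg.ρ_pos.le]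
      have h4 := s.norm_F_lead_le a
      have h5 := s.reg.ρ_pos
      gcongr
  have h3 := (norm_add_le _ _).trans (add_le_add s.norm_quad_B_B_sub_le h2)
  rw [sub_add_sub_cancel] at h3
  have h4 : Γ ^ 3 * D.ρ ≤ Γ ^ 6 * D.rad := by
    have := s.reg.ρ_pos.le
    gcongr
    norm_num
  have h5 : Γ ^ 6 * D.del ≤ Γ ^ 6 * D.rad := by gcongr
  have h6 : ‖D.quad B B - diagOff D.z 0 (fun a => -(D.lead a : ℂ))‖ ≤ 163 * (Γ ^ 6 * D.rad) := by
    linarith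
  calc _ ≤ 3201 * Γ ^ 16 * (163 * (Γ ^ 6 * D.rad)) := by gcongr
    _ = 521763 * (Γ ^ 22 * D.rad) := by ring
    _ ≤ _ := by
      have : 0 ≤ Γ ^ 22 * D.rad := by positivity
      linarith

theorem norm_invQ_quad_B_B_diag_le (s : D.Setup Γ β βs B Bs l ls) (a : Idx n) :
    ‖invQ D.S D.M β βs (D.quad B B) a a‖ ≤ 10 ^ 6 * Γ ^ 22 * D.rad := by
  have h1 := (norm_entry_le _ a a).trans s.norm_invQ_quad_B_B_sub_le
  have h2 := congrFun (diagOff_diag D.z 0 (fun a => -(D.lead a : ℂ))) a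
  rw [diag_apply, Pi.zero_apply] at h2
  rwa [Matrix.sub_apply, h2, sub_zero] at h1

theorem norm_invQ_quad_B_B_le (s : D.Setup Γ β βs B Bs l ls) :
    ‖invQ D.S D.M β βs (D.quad B B)‖ ≤ 10 ^ 6 * Γ ^ 22 := by
  have hΓ := s.Γ_pos
  refine (s.norm_invQ_le _).trans ?_
  have h1 := s.reg.norm_quad_le (Y := B) (by positivity)
    fun a => (norm_entry_le B a a).trans s.norm_B_le
  calc _ ≤ 3201 * Γ ^ 16 * (4 * Γ ^ 2 * (6 * Γ ^ 2) * (6 * Γ ^ 2)) := by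
        refine mul_le_mul_of_nonneg_left (h1.trans ?_) (by positivity)
        have := s.norm_B_le
        gcongr
    _ ≤ _ := by
      have : 0 ≤ Γ ^ 22 := by positivity
      linarith

theorem hs_Eminus_invQ_quad_B_B_le (s : D.Setup Γ β βs B Bs l ls) :
    ‖hs Eminus (invQ D.S D.M β βs (D.quad B B))‖ ≤ 10 ^ 6 * Γ ^ 22 * D.rad := by
  rw [Eminus_eq_sgn, hs_diagonal_eq]
  refine (norm_dpair_le s.reg.n_pos (c := 1) (fun a => ?_) s.norm_invQ_quad_B_B_diag_le).trans
    (le_of_eq (one_mul _))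
  rw [norm_real, Real.norm_eq_abs, abs_sgn]

/-- The coefficient of the cubic term of the cubic equation. -/
theorem hs_l_quad_invQ_sub (s : D.Setup Γ β βs B Bs l ls) :
    ‖hs (diagonal l) (D.quad B (invQ D.S D.M β βs (D.quad B B)))
      + hs (diagonal l) (D.quad (invQ D.S D.M β βs (D.quad B B)) B) - D.cubicMass‖
      ≤ 10 ^ 8 * Γ ^ 27 * D.rad := by
  have hΓ := s.Γ_pos
  have h1 := s.one_le
  have hδ := s.reg.del_le_rad
  have hδ0 := s.reg.del_pos
  have hr := hδ0.trans_le hδ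
  obtain ⟨Y, hY⟩ : ∃ Y, Y = invQ D.S D.M β βs (D.quad B B) := ⟨_, rfl⟩
  obtain ⟨Y₀, hY₀⟩ : ∃ Y₀, Y₀ = diagOff D.z 0 (fun a => -(D.lead a : ℂ)) := ⟨_, rfl⟩
  have hYs := s.norm_invQ_quad_B_B_sub_le
  have hYd := s.norm_invQ_quad_B_B_diag_le
  rw [← hY, ← hY₀] at hYs
  rw [← hY] at hYd ⊢
  have hY₀n : ‖Y₀‖ ≤ 2 * Γ ^ 2 := by
    rw [hY₀]
    refine (norm_diagOff_le s.reg.z_upper le_rfl (sq_nonneg Γ) (fun a => by simp) (fun a => ?_)).trans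
      (le_of_eq (by rw [zero_add, mul_comm]))
    rw [norm_neg]; exact s.reg.norm_lead_le a
  have hqY : ‖hs (diagonal l) (D.quad Y B)‖ ≤ 48 * 10 ^ 6 * (Γ ^ 27 * D.rad) := by
    have h2 := s.reg.norm_quad_le (Y := B) (by positivity) hYd
    have h3 := s.norm_hs_l_le (fun a => (norm_entry_le _ a a).trans h2)
    refine h3.trans ?_
    calc _ ≤ 2 * Γ * (4 * Γ ^ 2 * (10 ^ 6 * Γ ^ 22 * D.rad) * (6 * Γ ^ 2)) := by
          have := s.norm_B_le
          gcongr
      _ = _ := by ring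
  have hqB : ‖hs (diagonal l) (D.quad B (Y - Y₀))‖ ≤ 48 * 10 ^ 6 * (Γ ^ 27 * D.rad) := by
    have h2 := s.reg.norm_quad_le (Y := Y - Y₀) (by positivity)
      fun a => (norm_entry_le B a a).trans s.norm_B_le
    have h3 := s.norm_hs_l_le (fun a => (norm_entry_le _ a a).trans h2)
    refine h3.trans ?_
    calc _ ≤ 2 * Γ * (4 * Γ ^ 2 * (6 * Γ ^ 2) * (10 ^ 6 * Γ ^ 22 * D.rad)) := by gcongr
      _ = _ := by ring
  have hN : ‖hs (diagonal l) (D.quad B Y₀ - diagOff D.z (fun a => I * D.ρ * D.lead a)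
      (fun a => -(D.F a : ℂ)) * Y₀)‖ ≤ 96 * (Γ ^ 7 * D.del) := by
    have h2 : ‖D.quad B Y₀ - diagOff D.z (fun a => I * D.ρ * D.lead a)
      (fun a => -(D.F a : ℂ)) * Y₀‖ ≤ 24 * Γ ^ 4 * D.del * (2 * Γ ^ 2) := by
      unfold quad
      rw [← Matrix.sub_mul]
      refine (norm_mul_le _ _).trans ?_
      have := s.norm_M_mul_selfEnergy_B_sub_le
      gcongr
    refine (s.norm_hs_l_le (fun a => (norm_entry_le _ a a).trans h2)).trans (le_of_eq (by ring))
  have hL : ‖hs (diagonal l) (diagOff D.z (fun a => I * D.ρ * D.lead a)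
      (fun a => -(D.F a : ℂ)) * Y₀) - ((‖D.z‖ ^ 2 : ℝ) : ℂ) * D.cubicMass‖ ≤ 2 * (Γ ^ 4 * D.del) := by
    rw [hY₀, diagOff_mul, hs_diagonal_eq, diagOff_diag, ← average_lead_eq]
    have e : (fun a => I * D.ρ * D.lead a * (0 : Idx n → ℂ) a
        + ((‖D.z‖ ^ 2 : ℝ) : ℂ) * (-(D.F a : ℂ) * -(D.lead a.swap : ℂ)))
        = fun a => ((‖D.z‖ ^ 2 : ℝ) : ℂ) * (D.F a * D.lead a) := by
      funext a
      rw [lead_swap, Pi.zero_apply]; ring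
    rw [e]
    refine (s.norm_dpair_l_sub_le (c := 2 * Γ ^ 3) fun a => ?_).trans (le_of_eq (by ring))
    rw [norm_mul, norm_real, norm_of_nonneg (sq_nonneg _)]
    have h2 := s.norm_F_lead_le a
    have h3 := s.reg.z_sq_upper
    gcongr
    linarith
  have hz : ‖((‖D.z‖ ^ 2 : ℝ) : ℂ) * D.cubicMass - D.cubicMass‖ ≤ Γ ^ 5 * D.del := by
    have e : ((‖D.z‖ ^ 2 : ℝ) : ℂ) * D.cubicMass - D.cubicMass
        = (((‖D.z‖ ^ 2 : ℝ) : ℂ) - 1) * D.cubicMass := by ring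
    have h2 : ‖(D.cubicMass : ℂ)‖ ≤ Γ ^ 4 := by
      unfold cubicMass
      push_cast
      refine norm_average_le s.reg.n_pos fun a => ?_
      rw [norm_pow]
      calc _ ≤ (Γ ^ 2) ^ 2 := by
            have := s.reg.norm_lead_le a
            gcongr
        _ = _ := by ring
    rw [e, norm_mul]
    calc _ ≤ Γ * D.del * Γ ^ 4 := by
          have := s.norm_z_sq_sub_le
          gcongr
      _ = _ := by ring
  have e : hs (diagonal l) (D.quad B Y) + hs (diagonal l) (D.quad Y B) - D.cubicMass
      = hs (diagonal l) (D.quad Y B) + hs (diagonal l) (D.quad B (Y - Y₀))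
        + hs (diagonal l) (D.quad B Y₀ - diagOff D.z (fun a => I * D.ρ * D.lead a)
          (fun a => -(D.F a : ℂ)) * Y₀)
        + (hs (diagonal l) (diagOff D.z (fun a => I * D.ρ * D.lead a)
      (fun a => -(D.F a : ℂ)) * Y₀) - ((‖D.z‖ ^ 2 : ℝ) : ℂ) * D.cubicMass)
        + (((‖D.z‖ ^ 2 : ℝ) : ℂ) * D.cubicMass - D.cubicMass) := by
    have e1 : D.quad B (Y - Y₀) = D.quad B Y - D.quad B Y₀ := by simp only [quad, Matrix.mul_sub]
    rw [e1, hs_sub_right, hs_sub_right]; ring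
  rw [e]
  refine (norm_add_le _ _).trans (add_le_add ((norm_add_le _ _).trans (add_le_add
    ((norm_add_le _ _).trans (add_le_add ((norm_add_le _ _).trans (add_le_add hqY hqB)) hN)) hL))
    hz) |>.trans ?_
  have p1 : Γ ^ 7 * D.del ≤ Γ ^ 27 * D.rad := by gcongr; norm_num
  have p2 : Γ ^ 4 * D.del ≤ Γ ^ 27 * D.rad := by gcongr; norm_num
  have p3 : Γ ^ 5 * D.del ≤ Γ ^ 27 * D.rad := by gcongr; norm_num
  have p4 : 0 ≤ Γ ^ 27 * D.rad := by positivity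
  linarith

end Setup

end Data

/-! ### The normalized Euclidean norm -/

theorem vnorm_nonneg (x : Vec n) : 0 ≤ vnorm x := Real.sqrt_nonneg _

theorem vnorm_eq (x : Vec n) : vnorm x = Real.sqrt (2 * n : ℝ)⁻¹ * ‖WithLp.toLp 2 x‖ := by
  rw [vnorm, EuclideanSpace.norm_eq, Real.sqrt_mul (by positivity)]

theorem vnorm_mulVec_le (A : Mat n) (x : Vec n) : vnorm (A *ᵥ x) ≤ ‖A‖ * vnorm x := by
  rw [vnorm_eq, vnorm_eq, mul_left_comm]
  exact mul_le_mul_of_nonneg_left (l2_opNorm_mulVec A _) (Real.sqrt_nonneg _)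

theorem norm_scal_le (x y : Vec n) : ‖scal x y‖ ≤ vnorm x * vnorm y := by
  have h1 : scal x y = (2 * n : ℂ)⁻¹ * inner ℂ (WithLp.toLp 2 x) (WithLp.toLp 2 y) := by
    rw [scal, PiLp.inner_apply]
    simp [mul_comm]
  have h2 : ‖(2 * n : ℂ)⁻¹‖ = (2 * n : ℝ)⁻¹ := by
    rw [norm_inv, norm_mul]; simp
  rw [h1, vnorm_eq, vnorm_eq, norm_mul, h2]
  have h3 : Real.sqrt (2 * n : ℝ)⁻¹ * Real.sqrt (2 * n : ℝ)⁻¹ = (2 * n : ℝ)⁻¹ :=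
    Real.mul_self_sqrt (by positivity)
  calc _ ≤ (2 * n : ℝ)⁻¹ * (‖WithLp.toLp 2 x‖ * ‖WithLp.toLp 2 y‖) :=
        mul_le_mul_of_nonneg_left (norm_inner_le_norm _ _) (by positivity)
    _ = _ := by linear_combination (-(‖WithLp.toLp 2 x‖ * ‖WithLp.toLp 2 y‖)) * h3

theorem eq_zero_of_vnorm_eq_zero (hn : 0 < n) {x : Vec n} (hx : vnorm x = 0) : x = 0 := by
  rw [vnorm_eq, mul_eq_zero] at hx
  have hn' : (0 : ℝ) < n := by exact_mod_cast hn
  rcases hx with hx | hx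
  · exact absurd hx (Real.sqrt_pos.2 (by positivity)).ne'
  · rw [norm_eq_zero] at hx
    exact (WithLp.toLp_eq_zero 2).1 hx

theorem scal_mulVec_left (T R : Mat n) (u v : Vec n) :
    scal u ((Tᴴ * R) *ᵥ v) = scal (T *ᵥ u) (R *ᵥ v) := by
  have h : ∀ x y : Vec n, scal x y = (2 * n : ℂ)⁻¹ * (star x ⬝ᵥ y) := fun x y => rfl
  rw [h, h, ← mulVec_mulVec, Matrix.star_mulVec, dotProduct_mulVec]

theorem scal_add_right (x y y' : Vec n) : scal x (y + y') = scal x y + scal x y' := by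
  simp [scal, mul_add, Finset.sum_add_distrib]

theorem scal_smul_right (c : ℂ) (x y : Vec n) : scal x (c • y) = c * scal x y := by
  simp only [scal, Pi.smul_apply, smul_eq_mul, mul_left_comm _ c, ← Finset.mul_sum]

theorem scal_comm (x y : Vec n) : scal x y = conj (scal y x) := by
  simp [scal, map_sum, mul_comm, Complex.conj_ofNat]

theorem vnorm_add_le (x y : Vec n) : vnorm (x + y) ≤ vnorm x + vnorm y := by
  rw [vnorm_eq, vnorm_eq, vnorm_eq, ← mul_add]
  exact mul_le_mul_of_nonneg_left (norm_add_le _ _) (Real.sqrt_nonneg _)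

theorem vnorm_smul (c : ℂ) (x : Vec n) : vnorm (c • x) = ‖c‖ * vnorm x := by
  rw [vnorm_eq, vnorm_eq, WithLp.toLp_smul, norm_smul]
  ring

theorem vnorm_stdVec (hn : 0 < n) (a : Idx n) : vnorm (stdVec a) = 1 := by
  have hn' : (0 : ℝ) < n := by exact_mod_cast hn
  have h1 : ∑ b, ‖(stdVec a : Vec n) b‖ ^ 2 = 2 * n := by
    rw [Finset.sum_eq_single a]
    · simp only [stdVec, Pi.single_eq_same]
      rw [norm_real, norm_of_nonneg (Real.sqrt_nonneg _), Real.sq_sqrt (by positivity)]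
    · intro b _ hb
      simp [stdVec, hb]
    · simp
  rw [vnorm, h1, inv_mul_cancel₀ (by positivity), Real.sqrt_one]

theorem scal_stdVec (hn : 0 < n) (R : Mat n) (a b : Idx n) :
    scal (stdVec a) (R *ᵥ stdVec b) = R a b := by
  have hn' : (n : ℂ) ≠ 0 := by exact_mod_cast hn.ne'
  have h1 : (Real.sqrt (2 * n) : ℂ) * Real.sqrt (2 * n) = 2 * n := by
    rw [← Complex.ofReal_mul, Real.mul_self_sqrt (by positivity)]
    push_cast; ring
  rw [scal, Finset.sum_eq_single a]
  · rw [stdVec, stdVec, Pi.single_eq_same, conj_ofReal, mulVec_single]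
    simp only [Pi.smul_apply, Matrix.col_apply, MulOpposite.smul_eq_mul_unop, MulOpposite.unop_op]
    rw [mul_left_comm (Real.sqrt (2 * n) : ℂ), h1]
    field_simp
  · intro c _ hc
    simp [stdVec, hc]
  · simp

/-! ### Norms defined by families of test vectors -/

/-- The largest quotient `‖R u‖ / ‖u‖` for test vectors `u`. -/
def imageNorm (I : Set (Vec n)) (R : Mat n) : ℝ :=
  sSup {r | ∃ u ∈ I, r = vnorm (R *ᵥ u) / vnorm u}

section

variable {I : Set (Vec n)} {R : Mat n}

theorem scal_quotient_le (R : Mat n) (u v : Vec n) :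
    ‖scal u (R *ᵥ v)‖ / (vnorm u * vnorm v) ≤ ‖R‖ := by
  have hu := vnorm_nonneg u
  have hv := vnorm_nonneg v
  refine div_le_of_le_mul₀ (mul_nonneg hu hv) (norm_nonneg _) ((norm_scal_le _ _).trans ?_)
  have := vnorm_mulVec_le R v
  calc _ ≤ vnorm u * (‖R‖ * vnorm v) := by gcongr
    _ = _ := by ring

theorem testNorm_nonneg (I : Set (Vec n)) (R : Mat n) : 0 ≤ testNorm I R := by
  refine Real.sSup_nonneg ?_
  rintro r ⟨u, _, v, _, rfl⟩
  exact div_nonneg (norm_nonneg _) (mul_nonneg (vnorm_nonneg _) (vnorm_nonneg _))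

theorem testNorm_le {c : ℝ} (hc : 0 ≤ c)
    (h : ∀ u ∈ I, ∀ v ∈ I, ‖scal u (R *ᵥ v)‖ ≤ c * (vnorm u * vnorm v)) : testNorm I R ≤ c := by
  refine Real.sSup_le ?_ hc
  rintro r ⟨u, hu, v, hv, rfl⟩
  exact div_le_of_le_mul₀ (mul_nonneg (vnorm_nonneg _) (vnorm_nonneg _)) hc (h u hu v hv)

theorem norm_scal_le_testNorm (hn : 0 < n) {u v : Vec n} (hu : u ∈ I) (hv : v ∈ I) :
    ‖scal u (R *ᵥ v)‖ ≤ testNorm I R * (vnorm u * vnorm v) := by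
  have hu0 := vnorm_nonneg u
  have hv0 := vnorm_nonneg v
  rcases (mul_nonneg hu0 hv0).eq_or_lt with h | h
  · rcases mul_eq_zero.1 h.symm with h1 | h1
    · rw [eq_zero_of_vnorm_eq_zero hn h1]
      simp only [scal, Pi.zero_apply, map_zero, zero_mul, Finset.sum_const_zero, mul_zero, norm_zero]
      exact mul_nonneg (testNorm_nonneg _ _) (mul_nonneg (vnorm_nonneg _) hv0)
    · rw [eq_zero_of_vnorm_eq_zero hn h1, mulVec_zero]
      simp only [scal, Pi.zero_apply, Finset.sum_const_zero, mul_zero, norm_zero]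
      exact mul_nonneg (testNorm_nonneg _ _) (mul_nonneg hu0 (vnorm_nonneg _))
  · rw [← div_le_iff₀ h]
    refine le_csSup ⟨‖R‖, ?_⟩ ⟨u, hu, v, hv, rfl⟩
    rintro r ⟨u, _, v, _, rfl⟩
    exact scal_quotient_le R u v

theorem imageNorm_nonneg (I : Set (Vec n)) (R : Mat n) : 0 ≤ imageNorm I R := by
  refine Real.sSup_nonneg ?_
  rintro r ⟨u, _, rfl⟩
  exact div_nonneg (vnorm_nonneg _) (vnorm_nonneg _)

theorem imageNorm_le {c : ℝ} (hc : 0 ≤ c) (h : ∀ u ∈ I, vnorm (R *ᵥ u) ≤ c * vnorm u) :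
    imageNorm I R ≤ c := by
  refine Real.sSup_le ?_ hc
  rintro r ⟨u, hu, rfl⟩
  exact div_le_of_le_mul₀ (vnorm_nonneg _) hc (h u hu)

theorem vnorm_mulVec_le_imageNorm (hn : 0 < n) {u : Vec n} (hu : u ∈ I) :
    vnorm (R *ᵥ u) ≤ imageNorm I R * vnorm u := by
  rcases (vnorm_nonneg u).eq_or_lt with h | h
  · have h1 := eq_zero_of_vnorm_eq_zero hn h.symm
    rw [h1, mulVec_zero]
    have h2 : vnorm (0 : Vec n) = 0 := by rw [← h1]; exact h.symm
    rw [h2, mul_zero]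
  · rw [← div_le_iff₀ h]
    refine le_csSup ⟨‖R‖, ?_⟩ ⟨u, hu, rfl⟩
    rintro r ⟨u, _, rfl⟩
    exact div_le_of_le_mul₀ (vnorm_nonneg _) (norm_nonneg _) (vnorm_mulVec_le R u)

/-- The norm `‖·‖_*` for an arbitrary sequence of sets of test vectors. -/
def towerNorm (J : ℕ → Set (Vec n)) (K : ℕ) (R : Mat n) : ℝ :=
  (∑ k ∈ Finset.range K, (2 * n : ℝ) ^ (-(k : ℝ) / (2 * K)) * testNorm (J k) R)
    + (2 * n : ℝ) ^ (-(1 / 2) : ℝ) * imageNorm (J K) R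

end

section
variable {J : ℕ → Set (Vec n)} {K : ℕ}

theorem towerNorm_nonneg (J : ℕ → Set (Vec n)) (K : ℕ) (R : Mat n) : 0 ≤ towerNorm J K R := by
  refine add_nonneg (Finset.sum_nonneg fun k _ => ?_) ?_
  · exact mul_nonneg (by positivity) (testNorm_nonneg _ _)
  · exact mul_nonneg (by positivity) (imageNorm_nonneg _ _)

theorem testNorm_le_towerNorm (R : Mat n) {k : ℕ} (hk : k < K) :
    (2 * n : ℝ) ^ (-(k : ℝ) / (2 * K)) * testNorm (J k) R ≤ towerNorm J K R := by
  have h1 : (2 * n : ℝ) ^ (-(k : ℝ) / (2 * K)) * testNorm (J k) R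
      ≤ ∑ k ∈ Finset.range K, (2 * n : ℝ) ^ (-(k : ℝ) / (2 * K)) * testNorm (J k) R :=
    Finset.single_le_sum (f := fun k : ℕ => (2 * n : ℝ) ^ (-(k : ℝ) / (2 * K)) * testNorm (J k) R)
      (fun i _ => mul_nonneg (by positivity) (testNorm_nonneg _ _)) (Finset.mem_range.2 hk)
  have h2 : 0 ≤ (2 * n : ℝ) ^ (-(1 / 2) : ℝ) * imageNorm (J K) R :=
    mul_nonneg (by positivity) (imageNorm_nonneg _ _)
  unfold towerNorm
  linarith

theorem imageNorm_le_towerNorm (R : Mat n) :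
    (2 * n : ℝ) ^ (-(1 / 2) : ℝ) * imageNorm (J K) R ≤ towerNorm J K R :=
  le_add_of_nonneg_left (Finset.sum_nonneg fun k _ =>
    mul_nonneg (by positivity) (testNorm_nonneg _ _))

/-- Bounds on the contributions of each level sum up. -/
theorem towerNorm_le_of {c : ℝ}
    (h1 : ∀ k < K, (2 * n : ℝ) ^ (-(k : ℝ) / (2 * K)) * testNorm (J k) R ≤ c)
    (h2 : (2 * n : ℝ) ^ (-(1 / 2) : ℝ) * imageNorm (J K) R ≤ c) :
    towerNorm J K R ≤ (K + 1) * c := by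
  have h3 : ∑ k ∈ Finset.range K, (2 * n : ℝ) ^ (-(k : ℝ) / (2 * K)) * testNorm (J k) R
      ≤ ∑ _k ∈ Finset.range K, c := Finset.sum_le_sum fun k hk => h1 k (Finset.mem_range.1 hk)
  rw [Finset.sum_const, Finset.card_range, nsmul_eq_mul] at h3
  unfold towerNorm
  linarith

theorem one_le_two_mul (hn : 0 < n) : (1 : ℝ) ≤ 2 * n := by
  have : (1 : ℝ) ≤ n := by exact_mod_cast hn
  linarith

theorem rpow_le_one (hn : 0 < n) {t : ℝ} (ht : t ≤ 0) : (2 * n : ℝ) ^ t ≤ 1 :=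
  Real.rpow_le_one_of_one_le_of_nonpos (one_le_two_mul hn) ht

theorem towerNorm_le_norm (hn : 0 < n) (J : ℕ → Set (Vec n)) (K : ℕ) (R : Mat n) :
    towerNorm J K R ≤ (K + 1) * ‖R‖ := by
  refine towerNorm_le_of (fun k _ => ?_) ?_
  · have h1 : testNorm (J k) R ≤ ‖R‖ := testNorm_le (norm_nonneg _) fun u _ v _ => by
      refine (norm_scal_le _ _).trans ?_
      have h := vnorm_mulVec_le R v
      have hu := vnorm_nonneg u
      calc _ ≤ vnorm u * (‖R‖ * vnorm v) := by gcongr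
        _ = _ := by ring
    calc _ ≤ 1 * ‖R‖ := by
          refine mul_le_mul (rpow_le_one hn ?_) h1 (testNorm_nonneg _ _) zero_le_one
          exact div_nonpos_of_nonpos_of_nonneg (by simp) (by positivity)
      _ = _ := one_mul _
  · have h1 : imageNorm (J K) R ≤ ‖R‖ :=
      imageNorm_le (norm_nonneg _) fun u _ => vnorm_mulVec_le R u
    calc _ ≤ 1 * ‖R‖ :=
          mul_le_mul (rpow_le_one hn (by norm_num)) h1 (imageNorm_nonneg _ _) zero_le_one
      _ = _ := one_mul _

theorem towerNorm_add_le (hn : 0 < n) (J : ℕ → Set (Vec n)) (K : ℕ) (R R' : Mat n) :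
    towerNorm J K (R + R') ≤ towerNorm J K R + towerNorm J K R' := by
  have h1 : ∀ k, testNorm (J k) (R + R') ≤ testNorm (J k) R + testNorm (J k) R' := fun k =>
    testNorm_le (add_nonneg (testNorm_nonneg _ _) (testNorm_nonneg _ _)) fun u hu v hv => by
      rw [Matrix.add_mulVec, scal_add_right, add_mul]
      exact (norm_add_le _ _).trans (add_le_add (norm_scal_le_testNorm hn hu hv)
        (norm_scal_le_testNorm hn hu hv))
  have h2 : imageNorm (J K) (R + R') ≤ imageNorm (J K) R + imageNorm (J K) R' :=
    imageNorm_le (add_nonneg (imageNorm_nonneg _ _) (imageNorm_nonneg _ _)) fun u hu => by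
      rw [Matrix.add_mulVec, add_mul]
      exact (vnorm_add_le _ _).trans (add_le_add (vnorm_mulVec_le_imageNorm hn hu)
        (vnorm_mulVec_le_imageNorm hn hu))
  have h3 : ∑ k ∈ Finset.range K, (2 * n : ℝ) ^ (-(k : ℝ) / (2 * K)) * testNorm (J k) (R + R')
      ≤ ∑ k ∈ Finset.range K, ((2 * n : ℝ) ^ (-(k : ℝ) / (2 * K)) * testNorm (J k) R
        + (2 * n : ℝ) ^ (-(k : ℝ) / (2 * K)) * testNorm (J k) R') := by
    refine Finset.sum_le_sum fun k _ => ?_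
    rw [← mul_add]
    exact mul_le_mul_of_nonneg_left (h1 k) (by positivity)
  rw [Finset.sum_add_distrib] at h3
  have h4 : (2 * n : ℝ) ^ (-(1 / 2) : ℝ) * imageNorm (J K) (R + R')
      ≤ (2 * n : ℝ) ^ (-(1 / 2) : ℝ) * (imageNorm (J K) R + imageNorm (J K) R') :=
    mul_le_mul_of_nonneg_left h2 (by positivity)
  rw [mul_add] at h4
  unfold towerNorm
  linarith

theorem towerNorm_smul_le (hn : 0 < n) (J : ℕ → Set (Vec n)) (K : ℕ) (c : ℂ) (R : Mat n) :
    towerNorm J K (c • R) ≤ ‖c‖ * towerNorm J K R := by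
  have hc := norm_nonneg c
  have h1 : ∀ k, testNorm (J k) (c • R) ≤ ‖c‖ * testNorm (J k) R := fun k =>
    testNorm_le (mul_nonneg hc (testNorm_nonneg _ _)) fun u hu v hv => by
      rw [Matrix.smul_mulVec, scal_smul_right, norm_mul, mul_assoc]
      exact mul_le_mul_of_nonneg_left (norm_scal_le_testNorm hn hu hv) hc
  have h2 : imageNorm (J K) (c • R) ≤ ‖c‖ * imageNorm (J K) R :=
    imageNorm_le (mul_nonneg hc (imageNorm_nonneg _ _)) fun u hu => by
      rw [Matrix.smul_mulVec, vnorm_smul, mul_assoc]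
      exact mul_le_mul_of_nonneg_left (vnorm_mulVec_le_imageNorm hn hu) hc
  unfold towerNorm
  rw [mul_add, Finset.mul_sum]
  refine add_le_add (Finset.sum_le_sum fun k _ => ?_) ?_
  · rw [mul_left_comm]
    exact mul_le_mul_of_nonneg_left (h1 k) (by positivity)
  · rw [mul_left_comm]
    exact mul_le_mul_of_nonneg_left h2 (by positivity)

theorem towerNorm_neg_le (hn : 0 < n) (J : ℕ → Set (Vec n)) (K : ℕ) (R : Mat n) :
    towerNorm J K (-R) ≤ towerNorm J K R := by
  have := towerNorm_smul_le hn J K (-1) R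
  rwa [neg_one_smul, norm_neg, norm_one, one_mul] at this

theorem towerNorm_sub_le (hn : 0 < n) (J : ℕ → Set (Vec n)) (K : ℕ) (R R' : Mat n) :
    towerNorm J K (R - R') ≤ towerNorm J K R + towerNorm J K R' := by
  rw [sub_eq_add_neg]
  exact (towerNorm_add_le hn J K _ _).trans (add_le_add le_rfl (towerNorm_neg_le hn J K _))

theorem norm_entry_le_towerNorm (hn : 0 < n) (hJ : ∀ a, stdVec a ∈ J 0) (hK : 0 < K) (R : Mat n)
    (a b : Idx n) : ‖R a b‖ ≤ towerNorm J K R := by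
  have h1 := norm_scal_le_testNorm (R := R) hn (hJ a) (hJ b)
  rw [scal_stdVec hn, vnorm_stdVec hn, vnorm_stdVec hn, mul_one, mul_one] at h1
  have h2 := testNorm_le_towerNorm (J := J) R hK
  simp only [Nat.cast_zero, neg_zero, zero_div, Real.rpow_zero, one_mul] at h2
  exact h1.trans h2

end

/-! ### Vectors controlled by test vectors -/

/-- Every linear functional bounded by the norm on `I` is bounded by `c` at `w`. -/
def Controlled (I : Set (Vec n)) (c : ℝ) (w : Vec n) : Prop :=
  ∀ f : Vec n →ₗ[ℂ] ℂ, (∀ u ∈ I, ‖f u‖ ≤ vnorm u) → ‖f w‖ ≤ c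

/-- The matrix `T` maps test vectors of each level to vectors controlled by the test vectors that
are `k` levels higher. -/
def Attains (J : ℕ → Set (Vec n)) (k : ℕ) (c : ℝ) (T : Mat n) : Prop :=
  ∀ j, ∀ u ∈ J j, Controlled (J (j + k)) (c * vnorm u) (T *ᵥ u)

namespace Attains

variable {J : ℕ → Set (Vec n)} {k k' : ℕ} {c c' : ℝ} {T T' : Mat n}

theorem mono (h : Attains J k c T) (hJ : Monotone J) (hk : k ≤ k') (hc : c ≤ c') :
    Attains J k' c' T := fun j u hu f hf =>
  (h j u hu f fun v hv => hf v (hJ (by omega) hv)).trans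
    (mul_le_mul_of_nonneg_right hc (vnorm_nonneg u))

theorem one (J : ℕ → Set (Vec n)) : Attains J 0 1 (1 : Mat n) := fun j u hu f hf => by
  rw [Matrix.one_mulVec, one_mul]
  exact hf u hu

theorem add (h : Attains J k c T) (h' : Attains J k c' T') : Attains J k (c + c') (T + T') :=
  fun j u hu f hf => by
    rw [Matrix.add_mulVec, map_add, add_mul]
    exact (norm_add_le _ _).trans (add_le_add (h j u hu f hf) (h' j u hu f hf))

theorem smul (h : Attains J k c T) (b : ℂ) : Attains J k (‖b‖ * c) (b • T) := fun j u hu f hf => by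
  rw [Matrix.smul_mulVec, map_smul, norm_smul, mul_assoc]
  exact mul_le_mul_of_nonneg_left (h j u hu f hf) (norm_nonneg b)

theorem sub (h : Attains J k c T) (h' : Attains J k c' T') : Attains J k (c + c') (T - T') := by
  have h1 := h.add (h'.smul (-1))
  rwa [norm_neg, norm_one, one_mul, neg_one_smul, ← sub_eq_add_neg] at h1

theorem mul (h : Attains J k c T) (h' : Attains J k' c' T') (hc : 0 < c) :
    Attains J (k' + k) (c * c') (T * T') := fun j u hu f hf => by
  rw [← mulVec_mulVec]
  have h1 := h' j u hu ((c : ℂ)⁻¹ • (f ∘ₗ mulVecLin T)) fun v hv => by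
    have h2 := h (j + k') v hv f fun w hw => hf w (by rwa [← add_assoc])
    rw [LinearMap.smul_apply, norm_smul, norm_inv, norm_real, norm_of_nonneg hc.le,
      inv_mul_le_iff₀ hc]
    exact h2
  rw [LinearMap.smul_apply, norm_smul, norm_inv, norm_real, norm_of_nonneg hc.le,
    inv_mul_le_iff₀ hc, ← mul_assoc] at h1
  exact h1

end Attains

/-- Multiplication by the adjoint of an attained matrix costs a power of the dimension. -/
theorem towerNorm_mul_le (hn : 0 < n) {J : ℕ → Set (Vec n)} (hJ : Monotone J) {K : ℕ} (hK : 0 < K)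
    {k₀ : ℕ} {c : ℝ} {T : Mat n} (hc : 0 < c) (hT : Attains J k₀ c T) (hTn : ‖T‖ ≤ c) (R : Mat n) :
    towerNorm J K (Tᴴ * R) ≤ c * (K + 1) * (2 * n : ℝ) ^ ((k₀ : ℝ) / (2 * K)) * towerNorm J K R := by
  have hn2 := one_le_two_mul hn
  have hn0 : (0 : ℝ) < 2 * n := zero_lt_one.trans_le hn2
  have hK' : (0 : ℝ) < K := by exact_mod_cast hK
  have hR := towerNorm_nonneg J K R
  refine (towerNorm_le_of (c := c * (2 * n : ℝ) ^ ((k₀ : ℝ) / (2 * K)) * towerNorm J K R)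
    (fun k hk => ?_) ?_).trans (le_of_eq (by ring))
  · rcases lt_or_ge (k + k₀) K with h | h
    · have h1 : testNorm (J k) (Tᴴ * R) ≤ c * testNorm (J (k + k₀)) R := by
        refine testNorm_le (mul_nonneg hc.le (testNorm_nonneg _ _)) fun u hu v hv => ?_
        rw [scal_mulVec_left]
        obtain ⟨m, hm⟩ : ∃ m, m = testNorm (J (k + k₀)) R * vnorm v := ⟨_, rfl⟩
        have hm0 : 0 ≤ m := by rw [hm]; exact mul_nonneg (testNorm_nonneg _ _) (vnorm_nonneg _)
        have key : ∀ e > 0, ‖scal (T *ᵥ u) (R *ᵥ v)‖ ≤ (m + e) * (c * vnorm u) := by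
          intro e he
          have hme : 0 < m + e := by linarith
          have h2 := hT k u hu (((m + e : ℝ) : ℂ)⁻¹ •
            { toFun := fun w => scal (R *ᵥ v) w
              map_add' := scal_add_right _
              map_smul' := fun b w => scal_smul_right b _ w }) fun w hw => by
            rw [LinearMap.smul_apply, norm_smul, norm_inv, norm_real,
              norm_of_nonneg hme.le, inv_mul_le_iff₀ hme]
            have h3 := norm_scal_le_testNorm (R := R) hn hw (hJ (Nat.le_add_right k k₀) hv)
            rw [scal_comm, RCLike.norm_conj] at h3
            refine h3.trans ?_
            have h4 := vnorm_nonneg w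
            calc _ = m * vnorm w := by rw [hm]; ring
              _ ≤ _ := by gcongr; linarith
          rw [LinearMap.smul_apply, norm_smul, norm_inv, norm_real,
              norm_of_nonneg hme.le, inv_mul_le_iff₀ hme] at h2
          rw [scal_comm, RCLike.norm_conj]
          exact h2
        have h5 : ‖scal (T *ᵥ u) (R *ᵥ v)‖ ≤ m * (c * vnorm u) := by
          have h6 : Filter.Tendsto (fun e : ℝ => (m + e) * (c * vnorm u)) (nhdsWithin 0 (Set.Ioi 0))
              (nhds ((m + 0) * (c * vnorm u))) := by
            refine Filter.Tendsto.mono_left ?_ nhdsWithin_le_nhds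
            exact Continuous.tendsto (by fun_prop) 0
          rw [add_zero] at h6
          exact ge_of_tendsto h6 (Filter.eventually_of_mem self_mem_nhdsWithin key)
        rw [hm] at h5
        linarith
      have h2 := testNorm_le_towerNorm (J := J) R h
      have h3 : (2 * n : ℝ) ^ (-(k : ℝ) / (2 * K)) = (2 * n : ℝ) ^ ((k₀ : ℝ) / (2 * K))
          * (2 * n : ℝ) ^ (-((k + k₀ : ℕ) : ℝ) / (2 * K)) := by
        rw [← Real.rpow_add hn0]
        congr 1
        push_cast; ring
      rw [h3]
      calc _ ≤ (2 * n : ℝ) ^ ((k₀ : ℝ) / (2 * K)) * (2 * n : ℝ) ^ (-((k + k₀ : ℕ) : ℝ) / (2 * K))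
            * (c * testNorm (J (k + k₀)) R) := by gcongr
        _ = c * (2 * n : ℝ) ^ ((k₀ : ℝ) / (2 * K))
            * ((2 * n : ℝ) ^ (-((k + k₀ : ℕ) : ℝ) / (2 * K)) * testNorm (J (k + k₀)) R) := by ring
        _ ≤ _ := by gcongr
    · have h1 : testNorm (J k) (Tᴴ * R) ≤ c * imageNorm (J K) R := by
        refine testNorm_le (mul_nonneg hc.le (imageNorm_nonneg _ _)) fun u hu v hv => ?_
        rw [scal_mulVec_left]
        have h2 := vnorm_mulVec_le T u
        have h3 := vnorm_mulVec_le_imageNorm (R := R) hn (hJ hk.le hv)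
        have hu0 := vnorm_nonneg u
        calc _ ≤ vnorm (T *ᵥ u) * vnorm (R *ᵥ v) := norm_scal_le _ _
          _ ≤ (c * vnorm u) * (imageNorm (J K) R * vnorm v) := by
              refine mul_le_mul (h2.trans (by gcongr)) h3 (vnorm_nonneg _) (by positivity)
          _ = _ := by ring
      have h3 : (2 * n : ℝ) ^ (-(k : ℝ) / (2 * K)) ≤ (2 * n : ℝ) ^ ((k₀ : ℝ) / (2 * K))
          * (2 * n : ℝ) ^ (-(1 / 2) : ℝ) := by
        rw [← Real.rpow_add hn0]
        refine Real.rpow_le_rpow_of_exponent_le hn2 ?_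
        have h4 : (K : ℝ) ≤ k + k₀ := by exact_mod_cast h
        rw [div_add' _ _ _ (by positivity), div_le_div_iff_of_pos_right (by positivity)]
        linarith
      have h5 := imageNorm_nonneg (J K) R
      have h6 := imageNorm_le_towerNorm (J := J) (K := K) R
      calc _ ≤ (2 * n : ℝ) ^ ((k₀ : ℝ) / (2 * K)) * (2 * n : ℝ) ^ (-(1 / 2) : ℝ)
            * (c * imageNorm (J K) R) := by
            refine mul_le_mul h3 h1 (testNorm_nonneg _ _) (by positivity)
        _ = c * (2 * n : ℝ) ^ ((k₀ : ℝ) / (2 * K))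
            * ((2 * n : ℝ) ^ (-(1 / 2) : ℝ) * imageNorm (J K) R) := by ring
        _ ≤ _ := by gcongr
  · have h1 : imageNorm (J K) (Tᴴ * R) ≤ c * imageNorm (J K) R := by
      refine imageNorm_le (mul_nonneg hc.le (imageNorm_nonneg _ _)) fun u hu => ?_
      rw [← mulVec_mulVec]
      have h2 := vnorm_mulVec_le Tᴴ (R *ᵥ u)
      rw [l2_opNorm_conjTranspose] at h2
      have h3 := vnorm_mulVec_le_imageNorm (R := R) hn hu
      have h4 := vnorm_nonneg (R *ᵥ u)
      calc _ ≤ c * vnorm (R *ᵥ u) := h2.trans (by gcongr)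
        _ ≤ c * (imageNorm (J K) R * vnorm u) := by gcongr
        _ = _ := by ring
    have h6 := imageNorm_le_towerNorm (J := J) (K := K) R
    have h8 := imageNorm_nonneg (J K) R
    have h7 : 1 ≤ (2 * n : ℝ) ^ ((k₀ : ℝ) / (2 * K)) := Real.one_le_rpow hn2 (by positivity)
    calc _ ≤ (2 * n : ℝ) ^ (-(1 / 2) : ℝ) * (c * imageNorm (J K) R) := by gcongr
      _ = c * 1 * ((2 * n : ℝ) ^ (-(1 / 2) : ℝ) * imageNorm (J K) R) := by ring
      _ ≤ _ := by gcongr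

namespace Data

variable {D : Data n} {Γ : ℝ}

/-- The closure properties of the sets of test vectors. -/
structure Tower (D : Data n) (J : ℕ → Set (Vec n)) : Prop where
  mono : Monotone J
  std : ∀ a, stdVec a ∈ J 0
  mul_M : ∀ k, ∀ u ∈ J k, D.M *ᵥ u ∈ J (k + 1)
  mul_S : ∀ k, ∀ u ∈ J k, ∀ b, (fun a => (symVar D.S a b : ℂ) * (D.M *ᵥ u) a) ∈ J (k + 1)

variable {J : ℕ → Set (Vec n)}

theorem Tower.attains_M (t : D.Tower J) (h : D.Regular Γ) : Attains J 1 (4 * Γ) D.M :=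
  fun k u hu _ hf => (hf _ (t.mul_M k u hu)).trans ((vnorm_mulVec_le _ _).trans
    (mul_le_mul_of_nonneg_right h.norm_M_le (vnorm_nonneg u)))

theorem Tower.attains_act_mul_M (t : D.Tower J) (h : D.Regular Γ) {r : Idx n → ℂ} {c : ℝ}
    (hr : ∀ a, ‖r a‖ ≤ c) : Attains J 1 (8 * Γ ^ 2 * c) (diagonal (act D.S r) * D.M) :=
  fun k u hu f hf => by
    have hn := h.n_pos'
    have hΓ := h.Λ_pos
    have hc : 0 ≤ c := (norm_nonneg _).trans (hr (Sum.inl ⟨0, h.n_pos⟩))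
    have e : (diagonal (act D.S r) * D.M) *ᵥ u
        = ∑ b, r b • fun a => (symVar D.S a b : ℂ) * (D.M *ᵥ u) a := by
      funext a
      rw [← mulVec_mulVec, mulVec_diagonal, act_apply, Finset.sum_apply, Finset.sum_mul]
      refine Finset.sum_congr rfl fun b _ => ?_
      rw [Pi.smul_apply, smul_eq_mul]; ring
    have key : ∀ b, ‖r b * f fun a => (symVar D.S a b : ℂ) * (D.M *ᵥ u) a‖
        ≤ c * (Γ / n * (4 * Γ * vnorm u)) := by
      intro b
      rw [norm_mul]
      refine mul_le_mul (hr b) ((hf _ (t.mul_S k u hu b)).trans ?_) (norm_nonneg _) hc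
      have e1 : (fun a => (symVar D.S a b : ℂ) * (D.M *ᵥ u) a)
          = diagonal (fun a => (symVar D.S a b : ℂ)) *ᵥ (D.M *ᵥ u) := by
        funext a; rw [mulVec_diagonal]
      rw [e1]
      refine (vnorm_mulVec_le _ _).trans (mul_le_mul ?_ ((vnorm_mulVec_le _ _).trans
        (mul_le_mul_of_nonneg_right h.norm_M_le (vnorm_nonneg u))) (vnorm_nonneg _) (by positivity))
      refine norm_diagonal_le (by positivity) fun a => ?_
      rw [norm_real, norm_of_nonneg (h.symVar_nonneg a b)]
      exact h.symVar_le a b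
    rw [e, map_sum]
    simp only [map_smul, smul_eq_mul]
    refine (norm_sum_le _ _).trans ((Finset.sum_le_sum fun b _ => key b).trans (le_of_eq ?_))
    simp only [Finset.sum_const, Finset.card_univ, Fintype.card_sum, Fintype.card_fin, nsmul_eq_mul]
    push_cast
    field_simp
    ring

end Data

namespace Data

variable {D : Data n} {Γ : ℝ}

/-- The diagonal matrix of `u`. -/
def U (D : Data n) : Mat n := diagonal fun a => (D.u a : ℂ)

/-- The diagonal matrix `S[E_- Im M]`, up to the sign. -/
def signMul (D : Data n) : Mat n :=
  diagonal (act D.S fun a => -((sgn a * (D.ρ * D.F a) : ℝ) : ℂ))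

namespace Regular

theorem act_ρ_F (h : D.Regular Γ) (a : Idx n) :
    act D.S (fun a => (D.ρ * D.F a : ℂ)) a = D.ρ * (D.G a / D.u a) - D.η := by
  have h1 := h.act_F a
  have hρ : (D.ρ : ℂ) ≠ 0 := by exact_mod_cast h.ρ_pos.ne'
  have e : act D.S (fun a => (D.ρ * D.F a : ℂ)) a = D.ρ * act D.S (fun a => (D.F a : ℂ)) a := by
    rw [act_apply, act_apply, Finset.mul_sum]
    exact Finset.sum_congr rfl fun b _ => by ring
  rw [e, h1]
  push_cast
  field_simp

theorem signMul_eq (h : D.Regular Γ) :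
    D.signMul = diagonal fun a => (sgn a * (D.ρ * (D.G a / D.u a) - D.η) : ℂ) := by
  unfold signMul
  congr 1
  funext a
  rw [← h.act_ρ_F a, act_apply, act_apply, Finset.mul_sum]
  refine Finset.sum_congr rfl fun b _ => ?_
  rcases a with i | i <;> rcases b with j | j <;> simp [symVar]

theorem U_eq_diagOff (D : Data n) : D.U = diagOff D.z (fun a => (D.u a : ℂ)) 0 :=
  diagonal_eq_diagOff _ _

theorem offDiag_eq_diagOff (z : ℂ) : offDiag n z = diagOff z 0 (fun _ => 1) := by
  have e : (diagonal (0 : Idx n → ℂ) : Mat n) = 0 := diagonal_zero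
  rw [diagOff, e, diagonal_one, zero_add, one_mul]

theorem one_eq_diagOff (z : ℂ) : (1 : Mat n) = diagOff z (fun _ => 1) 0 := by
  rw [← diagonal_one, diagonal_eq_diagOff z]

theorem offDiag_mul_M (h : D.Regular Γ) : offDiag n D.z * D.M
    = diagOff D.z (fun a => -(((‖D.z‖ ^ 2 : ℝ) : ℂ) * D.u a)) (fun a => I * D.ρ * D.G a) := by
  rw [offDiag_eq_diagOff, M_eq_diagOff, diagOff_mul]
  congr 1
  · funext a
    simp [h.u_swap]
  · funext a
    simp [Data.G]

theorem diag_relation (h : D.Regular Γ) (a : Idx n) :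
    ((D.ρ * D.F a) * (D.ρ * D.G a) : ℂ) = D.u a * (1 - D.u a * ((‖D.z‖ ^ 2 : ℝ) : ℂ)) := by
  have h1 := congrArg (fun x : ℝ => (x : ℂ)) (h.det_eq a)
  push_cast at h1 ⊢
  unfold Data.G
  linear_combination h1

theorem U_mul_M (h : D.Regular Γ) : D.U * D.M = D.M * D.U := by
  rw [U_eq_diagOff, M_eq_diagOff, diagOff_mul, diagOff_mul]
  congr 1
  · funext a; simp [mul_comm]
  · funext a; simp [h.u_swap]

theorem offDiag_M_sq (h : D.Regular Γ) : (offDiag n D.z * D.M) * (offDiag n D.z * D.M)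
    = -(((‖D.z‖ ^ 2 : ℝ) : ℂ) • ((2 : ℂ) • (D.U * (offDiag n D.z * D.M)) + D.U)) := by
  rw [h.offDiag_mul_M, U_eq_diagOff, diagOff_mul, diagOff_mul, diagOff_smul, diagOff_add,
    diagOff_smul, ← neg_one_smul ℂ (diagOff _ _ _), diagOff_smul]
  congr 1
  · funext a
    have h1 := h.diag_relation a
    simp only [G_swap, Pi.zero_apply]
    linear_combination (-((‖D.z‖ ^ 2 : ℝ) : ℂ)) * h1
      + ((‖D.z‖ ^ 2 : ℝ) : ℂ) * (D.ρ * D.F a) * (D.ρ * D.G a) * Complex.I_sq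
  · funext a
    simp only [h.u_swap, Pi.zero_apply]
    ring

theorem M_mul_offDiag_mul_M (h : D.Regular Γ) : D.M * (offDiag n D.z * D.M)
    = -((2 * ((‖D.z‖ ^ 2 : ℝ) : ℂ)) • (D.U * D.M) + D.U * offDiag n D.z) := by
  rw [h.offDiag_mul_M, U_eq_diagOff, M_eq_diagOff, offDiag_eq_diagOff, diagOff_mul, diagOff_mul,
    diagOff_mul, diagOff_smul, diagOff_add, ← neg_one_smul ℂ (diagOff _ _ _), diagOff_smul]
  congr 1
  · funext a
    simp only [h.u_swap, G_swap, Pi.zero_apply]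
    ring
  · funext a
    have h1 := h.diag_relation a
    simp only [h.u_swap, Pi.zero_apply]
    linear_combination (-1 : ℂ) * h1 + (D.ρ * D.F a) * (D.ρ * D.G a) * Complex.I_sq

theorem conjTranspose_M_eq (h : D.Regular Γ) : D.Mᴴ
    = D.M * ((4 * ((‖D.z‖ ^ 2 : ℝ) : ℂ)) • D.U + (2 : ℂ) • (offDiag n D.z * D.M) - 1) := by
  rw [Matrix.mul_sub, Matrix.mul_add, Matrix.mul_smul, Matrix.mul_smul, h.M_mul_offDiag_mul_M,
    ← h.U_mul_M, mul_one, U_eq_diagOff, M_eq_diagOff, offDiag_eq_diagOff, diagOff_conjTranspose,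
    diagOff_mul, diagOff_mul, diagOff_smul, diagOff_smul, diagOff_add,
    ← neg_one_smul ℂ (diagOff _ _ _), diagOff_smul, diagOff_smul, diagOff_add, diagOff_sub]
  congr 1
  · funext a
    simp
    ring
  · funext a
    simp [h.u_swap]
    ring

theorem signMul_mul_M (h : D.Regular Γ) : D.signMul * D.M
    = diagOff D.z (fun a => (sgn a : ℂ) * I
        * (1 - D.u a * ((‖D.z‖ ^ 2 : ℝ) : ℂ) - D.η * (D.ρ * D.F a)))
      (fun a => -((sgn a : ℂ) * (D.ρ * D.G a - D.η * D.u a))) := by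
  rw [h.signMul_eq, diagonal_eq_diagOff D.z, M_eq_diagOff, diagOff_mul]
  congr 1
  · funext a
    have h1 := h.diag_relation a
    have hu : (D.u a : ℂ) ≠ 0 := by exact_mod_cast (h.u_pos a).ne'
    simp only [Pi.zero_apply]
    field_simp
    linear_combination ((sgn a : ℂ)) * I * h1
  · funext a
    have hu : (D.u a : ℂ) ≠ 0 := by exact_mod_cast (h.u_pos a).ne'
    simp only [Pi.zero_apply]
    field_simp
    ring

theorem quadratic_relation (h : D.Regular Γ) {e : ℂ} (he : e = I * D.η) :
    (D.signMul * D.M) * (D.signMul * D.M) + 1 + (2 * e) • D.M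
      + (e • D.M - offDiag n D.z * D.M) * (e • D.M - offDiag n D.z * D.M)
    = (4 * e * ((‖D.z‖ ^ 2 : ℝ) : ℂ)) • (D.U * D.M)
      - (2 * (e ^ 2 + ((‖D.z‖ ^ 2 : ℝ) : ℂ))) • (D.U * (offDiag n D.z * D.M)) := by
  have hs : ∀ a : Idx n, (sgn a : ℂ) * sgn a = 1 := fun a => by rcases a with i | i <;> simp
  rw [h.signMul_mul_M, h.offDiag_mul_M, U_eq_diagOff, M_eq_diagOff, one_eq_diagOff D.z]
  simp only [diagOff_mul, diagOff_smul, diagOff_add, diagOff_sub]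
  congr 1
  · funext a
    have h1 := h.diag_relation a
    simp only [h.u_swap, G_swap, Pi.zero_apply, sgn_swap, Complex.ofReal_neg, he]
    generalize ((‖D.z‖ ^ 2 : ℝ) : ℂ) = σ at *
    have h2 := hs a
    have h3 := Complex.I_sq
    generalize (D.F a : ℂ) = f at *
    generalize (D.G a : ℂ) = g at *
    generalize (D.u a : ℂ) = u at *
    generalize (D.η : ℂ) = η at *
    generalize (D.ρ : ℂ) = ρ at *
    generalize (sgn a : ℂ) = s at *
    generalize I = i at *
    grind
  · funext a
    have h1 := h.diag_relation a
    have h1' := h.diag_relation a.swap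
    have e1 : (D.F a.swap : ℂ) = D.G a := rfl
    simp only [h.u_swap, G_swap, Pi.zero_apply, sgn_swap, Complex.ofReal_neg, he, e1] at h1' ⊢
    clear e1
    generalize ((‖D.z‖ ^ 2 : ℝ) : ℂ) = σ at *
    have h2 := hs a
    have h3 := Complex.I_sq
    generalize (D.F a : ℂ) = f at *
    generalize (D.G a : ℂ) = g at *
    generalize (D.u a : ℂ) = u at *
    generalize (D.η : ℂ) = η at *
    generalize (D.ρ : ℂ) = ρ at *
    generalize (sgn a : ℂ) = s at *
    generalize I = i at *
    grind

theorem U_relation (h : D.Regular Γ) {e s : ℂ} (he : e = I * D.η)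
    (hs : s = ((‖D.z‖ ^ 2 : ℝ) : ℂ)) {F₁ F₂ : Mat n}
    (hF₁ : F₁ = (D.signMul * D.M) * (D.signMul * D.M) + 1 + (2 * e) • D.M
      + (e • D.M - offDiag n D.z * D.M) * (e • D.M - offDiag n D.z * D.M)
      - ((e ^ 2 + s) / s) • ((offDiag n D.z * D.M) * (offDiag n D.z * D.M)))
    (hF₂ : F₂ = D.M * F₁ + (2 * e) • (D.M * ((offDiag n D.z * D.M) * D.M))
      - (e / s) • ((offDiag n D.z * D.M) * (offDiag n D.z * D.M))) :
    ((s - e ^ 2) ^ 2) • D.U = (e ^ 2 + s) • F₁ - (4 * e * s) • F₂ := by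
  have hs0 : s ≠ 0 := by
    rw [hs]
    exact_mod_cast (by linarith [h.z_sq_lower] : (‖D.z‖ ^ 2 : ℝ) ≠ 0)
  have h1 := h.offDiag_M_sq
  rw [← hs] at h1
  have h2 : (s⁻¹) • ((offDiag n D.z * D.M) * (offDiag n D.z * D.M))
      = -((2 : ℂ) • (D.U * (offDiag n D.z * D.M)) + D.U) := by
    rw [h1, smul_neg, smul_smul, inv_mul_cancel₀ hs0, one_smul]
  have h3 : F₁ = (4 * e * s) • (D.U * D.M) + (e ^ 2 + s) • D.U := by
    rw [hF₁, h.quadratic_relation he, ← hs, div_eq_mul_inv, mul_smul (e ^ 2 + s) s⁻¹, h2]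
    module
  have h4 : D.M * ((offDiag n D.z * D.M) * D.M)
      = -((2 * s) • (D.U * D.M * D.M) + D.U * (offDiag n D.z * D.M)) := by
    rw [← Matrix.mul_assoc, h.M_mul_offDiag_mul_M, ← hs, Matrix.neg_mul, Matrix.add_mul,
      Matrix.smul_mul, Matrix.mul_assoc D.U (offDiag n D.z)]
  have h5 : F₂ = (e ^ 2 + s) • (D.U * D.M) + e • D.U := by
    rw [hF₂, h4, h3, div_eq_mul_inv, mul_smul e s⁻¹, h2, Matrix.mul_add, Matrix.mul_smul, Matrix.mul_smul,
      ← Matrix.mul_assoc, ← h.U_mul_M]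
    module
  rw [h3, h5]
  module

theorem offDiag_mul_M_eq (h : D.Regular Γ) {e : ℂ} (he : e = I * D.η) :
    offDiag n D.z * D.M = -1 - e • D.M
      - I • (diagonal (act D.S fun a => (D.ρ * D.F a : ℂ)) * D.M) := by
  have e1 : act D.S (fun a => (D.ρ * D.F a : ℂ)) = fun a => (D.ρ * (D.G a / D.u a) - D.η : ℂ) :=
    funext h.act_ρ_F
  rw [e1, h.offDiag_mul_M, diagonal_eq_diagOff D.z, M_eq_diagOff, one_eq_diagOff D.z, diagOff_mul,
    ← neg_one_smul ℂ (diagOff _ (fun _ => 1) _)]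
  simp only [diagOff_smul, diagOff_sub]
  congr 1
  · funext a
    have h1 := h.diag_relation a
    have hu : (D.u a : ℂ) ≠ 0 := by exact_mod_cast (h.u_pos a).ne'
    have h2 := Complex.I_sq
    simp only [Pi.zero_apply, he]
    field_simp
    grind
  · funext a
    have hu : (D.u a : ℂ) ≠ 0 := by exact_mod_cast (h.u_pos a).ne'
    simp only [Pi.zero_apply, he]
    field_simp
    ring

theorem norm_ρ_F_le (h : D.Regular Γ) (a : Idx n) : ‖(D.ρ * D.F a : ℂ)‖ ≤ Γ := by
  rw [norm_mul, norm_real, norm_real, norm_of_nonneg h.ρ_pos.le,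
    norm_of_nonneg (h.F_pos a).le]
  calc _ ≤ 1 * Γ := by
        have := h.ρ_le_one
        have := h.F_upper a
        have := h.ρ_pos.le
        have := (h.F_pos a).le
        gcongr
    _ = _ := one_mul _

theorem η_le (h : D.Regular Γ) : D.η ≤ 1 / 2 := by
  have h1 := (η_div_le D).trans h.del_le
  rw [div_le_iff₀ h.ρ_pos] at h1
  linarith [h.ρ_le_one]

end Regular

namespace Tower

variable {J : ℕ → Set (Vec n)}

theorem attains_offDiag_mul_M (t : D.Tower J) (h : D.Regular Γ) :
    Attains J 1 (13 * Γ ^ 3) (offDiag n D.z * D.M) := by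
  have hΓ := h.Λ_pos
  have h1 := h.one_le
  obtain ⟨e, he⟩ : ∃ e, e = I * D.η := ⟨_, rfl⟩
  have hen : ‖e‖ ≤ 1 / 2 := by
    rw [he, norm_mul, norm_I, one_mul, norm_real, norm_of_nonneg h.η_pos.le]
    exact h.η_le
  have p0 : (1 : ℝ) ≤ Γ ^ 3 := one_le_pow₀ h1
  have p1 : Γ ≤ Γ ^ 3 := le_self_pow₀ h1 (by norm_num)
  rw [h.offDiag_mul_M_eq he, ← neg_one_smul ℂ (1 : Mat n)]
  refine ((((Attains.one J).smul (-1)).mono t.mono (Nat.zero_le 1) le_rfl).sub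
    ((t.attains_M h).smul e)).sub ((t.attains_act_mul_M h h.norm_ρ_F_le).smul I) |>.mono t.mono le_rfl ?_
  rw [norm_neg, norm_one, norm_I]
  have : ‖e‖ * (4 * Γ) ≤ 1 / 2 * (4 * Γ) := by gcongr
  have e1 : 8 * Γ ^ 2 * Γ = 8 * Γ ^ 3 := by ring
  rw [e1]
  linarith

theorem attains_U (t : D.Tower J) (h : D.Regular Γ) : Attains J 3 (2 * 10 ^ 5 * Γ ^ 7) D.U := by
  have hΓ := h.Λ_pos
  have h1 := h.one_le
  obtain ⟨e, he⟩ : ∃ e, e = I * D.η := ⟨_, rfl⟩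
  obtain ⟨s, hs⟩ : ∃ s : ℂ, s = ((‖D.z‖ ^ 2 : ℝ) : ℂ) := ⟨_, rfl⟩
  have hen : ‖e‖ ≤ 1 / 2 := by
    rw [he, norm_mul, norm_I, one_mul, norm_real, norm_of_nonneg h.η_pos.le]
    exact h.η_le
  have he2 : ‖e ^ 2‖ ≤ 1 / 4 := by
    rw [norm_pow]
    calc _ ≤ (1 / 2 : ℝ) ^ 2 := by gcongr
      _ = _ := by norm_num
  have hsn : ‖s‖ = ‖D.z‖ ^ 2 := by rw [hs, norm_real, norm_of_nonneg (sq_nonneg _)]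
  have hs1 := h.z_sq_lower
  have hs2 := h.z_sq_upper
  rw [← hsn] at hs1 hs2
  have hes : ‖e ^ 2 + s‖ ≤ 2 := (norm_add_le _ _).trans (by linarith)
  have hese : 1 / 2 ≤ ‖s - e ^ 2‖ := by
    have e1 : s - e ^ 2 = ((‖D.z‖ ^ 2 + D.η ^ 2 : ℝ) : ℂ) := by
      rw [hs, he, mul_pow, Complex.I_sq]; push_cast; ring
    rw [e1, norm_real, norm_of_nonneg (by positivity)]
    have := sq_nonneg D.η
    rw [hsn] at hs1
    linarith
  have p0 : (1 : ℝ) ≤ Γ ^ 3 := one_le_pow₀ h1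
  have p1 : Γ ≤ Γ ^ 3 := le_self_pow₀ h1 (by norm_num)
  have hM := t.attains_M h
  have hQ : Attains J 1 (8 * Γ ^ 3) (D.signMul * D.M) := by
    refine (t.attains_act_mul_M h (c := Γ) fun a => ?_).mono t.mono le_rfl (le_of_eq (by ring))
    rw [norm_neg, Complex.ofReal_mul, norm_mul, norm_real, Real.norm_eq_abs, abs_sgn,
      one_mul, Complex.ofReal_mul]
    exact h.norm_ρ_F_le a
  have hP := t.attains_offDiag_mul_M h
  have hR : Attains J 1 (15 * Γ ^ 3) (e • D.M - offDiag n D.z * D.M) := by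
    refine ((hM.smul e).sub hP).mono t.mono le_rfl ?_
    have : ‖e‖ * (4 * Γ) ≤ 1 / 2 * (4 * Γ) := by gcongr
    linarith
  have hPP : Attains J 2 (13 * Γ ^ 3 * (13 * Γ ^ 3))
      ((offDiag n D.z * D.M) * (offDiag n D.z * D.M)) := hP.mul hP (by positivity)
  obtain ⟨F₁, hF₁⟩ : ∃ F₁, F₁ = (D.signMul * D.M) * (D.signMul * D.M) + 1 + (2 * e) • D.M
      + (e • D.M - offDiag n D.z * D.M) * (e • D.M - offDiag n D.z * D.M)
      - ((e ^ 2 + s) / s) • ((offDiag n D.z * D.M) * (offDiag n D.z * D.M)) := ⟨_, rfl⟩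
  obtain ⟨F₂, hF₂⟩ : ∃ F₂, F₂ = D.M * F₁ + (2 * e) • (D.M * ((offDiag n D.z * D.M) * D.M))
      - (e / s) • ((offDiag n D.z * D.M) * (offDiag n D.z * D.M)) := ⟨_, rfl⟩
  have q1 : (1 : ℝ) ≤ Γ ^ 6 := one_le_pow₀ h1
  have q2 : Γ ≤ Γ ^ 6 := le_self_pow₀ h1 (by norm_num)
  have q3 : Γ ^ 6 ≤ Γ ^ 7 := pow_le_pow_right₀ h1 (by norm_num)
  have q4 : Γ ^ 5 ≤ Γ ^ 7 := pow_le_pow_right₀ h1 (by norm_num)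
  have q5 : 0 ≤ Γ ^ 6 := by positivity
  have n1 : ‖(2 * e : ℂ)‖ ≤ 1 := by
    rw [norm_mul, RCLike.norm_ofNat]; linarith
  have hs0 : 0 < ‖s‖ := by linarith
  have A1 : Attains J 2 (1000 * Γ ^ 6) F₁ := by
    have n2 : ‖(e ^ 2 + s) / s‖ ≤ 4 := by
      rw [norm_div, div_le_iff₀ hs0]; linarith
    rw [hF₁]
    refine ((((hQ.mul hQ (by positivity)).add ((Attains.one J).mono t.mono (Nat.zero_le 2) le_rfl)).add
      ((hM.smul (2 * e)).mono t.mono one_le_two le_rfl)).add (hR.mul hR (by positivity))).sub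
      (hPP.smul ((e ^ 2 + s) / s)) |>.mono t.mono le_rfl ?_
    have m1 : ‖(2 * e : ℂ)‖ * (4 * Γ) ≤ 1 * (4 * Γ) := by gcongr
    have m2 : ‖(e ^ 2 + s) / s‖ * (13 * Γ ^ 3 * (13 * Γ ^ 3)) ≤ 4 * (13 * Γ ^ 3 * (13 * Γ ^ 3)) := by
      gcongr
    have m3 : 13 * Γ ^ 3 * (13 * Γ ^ 3) = 169 * Γ ^ 6 := by ring
    have m4 : 8 * Γ ^ 3 * (8 * Γ ^ 3) = 64 * Γ ^ 6 := by ring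
    have m5 : 15 * Γ ^ 3 * (15 * Γ ^ 3) = 225 * Γ ^ 6 := by ring
    rw [m4, m5]
    rw [m3] at m2 ⊢
    linarith
  have A2 : Attains J 3 (4400 * Γ ^ 7) F₂ := by
    have n3 : ‖e / s‖ ≤ 1 := by
      rw [norm_div, div_le_iff₀ hs0]; linarith
    rw [hF₂]
    refine ((hM.mul A1 (by positivity)).add ((hM.mul (hP.mul hM (by positivity))
      (by positivity)).smul (2 * e))).sub ((hPP.mono t.mono (by norm_num) le_rfl).smul (e / s))
      |>.mono t.mono le_rfl ?_
    have m1 : ‖(2 * e : ℂ)‖ * (4 * Γ * (13 * Γ ^ 3 * (4 * Γ))) ≤ 1 * (4 * Γ * (13 * Γ ^ 3 * (4 * Γ))) := by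
      gcongr
    have m2 : ‖e / s‖ * (13 * Γ ^ 3 * (13 * Γ ^ 3)) ≤ 1 * (13 * Γ ^ 3 * (13 * Γ ^ 3)) := by
      gcongr
    have m3 : 13 * Γ ^ 3 * (13 * Γ ^ 3) = 169 * Γ ^ 6 := by ring
    have m4 : 4 * Γ * (13 * Γ ^ 3 * (4 * Γ)) = 208 * Γ ^ 5 := by ring
    have m5 : 4 * Γ * (1000 * Γ ^ 6) = 4000 * Γ ^ 7 := by ring
    rw [m5]
    rw [m4] at m1 ⊢
    rw [m3] at m2 ⊢
    linarith
  have key := h.U_relation he hs hF₁ hF₂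
  have hne : (s - e ^ 2) ^ 2 ≠ 0 := pow_ne_zero 2 (norm_pos_iff.1 (by linarith))
  have key2 : D.U = ((s - e ^ 2) ^ 2)⁻¹ • ((e ^ 2 + s) • F₁ - (4 * e * s) • F₂) := by
    rw [← key, smul_smul, inv_mul_cancel₀ hne, one_smul]
  rw [key2]
  refine ((((A1.mono t.mono (by norm_num) le_rfl).smul (e ^ 2 + s)).sub
    (A2.smul (4 * e * s))).smul _).mono t.mono le_rfl ?_
  have n4 : ‖((s - e ^ 2) ^ 2)⁻¹‖ ≤ 4 := by
    rw [norm_inv, norm_pow]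
    refine inv_le_of_inv_le₀ (by norm_num) ?_
    calc (4 : ℝ)⁻¹ = (1 / 2) ^ 2 := by norm_num
      _ ≤ _ := by gcongr
  have n5 : ‖4 * e * s‖ ≤ 3 := by
    rw [norm_mul, norm_mul, RCLike.norm_ofNat]
    calc _ ≤ 4 * (1 / 2) * (3 / 2 : ℝ) := by gcongr
      _ = _ := by norm_num
  calc _ ≤ 4 * (2 * (1000 * Γ ^ 6) + 3 * (4400 * Γ ^ 7)) := by gcongr
    _ ≤ _ := by linarith

/-- Multiplication of test vectors by `M^*`, possibly followed by a diagonal matrix in the range of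
the self-energy operator. -/
theorem attains_mul_conjTranspose (t : D.Tower J) (h : D.Regular Γ) {c : ℝ} {W : Mat n} (hc : 0 < c)
    (hW : Attains J 1 c (W * D.M)) : Attains J 4 (2 * 10 ^ 6 * Γ ^ 7 * c) (W * D.Mᴴ) := by
  have hΓ := h.Λ_pos
  have h1 := h.one_le
  have hV : Attains J 3 (2 * 10 ^ 6 * Γ ^ 7)
      ((4 * ((‖D.z‖ ^ 2 : ℝ) : ℂ)) • D.U + (2 : ℂ) • (offDiag n D.z * D.M) - 1) := by
    have hP := t.attains_offDiag_mul_M h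
    refine (((t.attains_U h).smul _).add ((hP.mono t.mono (by norm_num) le_rfl).smul 2)).sub
      ((Attains.one J).mono t.mono (by norm_num) le_rfl) |>.mono t.mono le_rfl ?_
    have n1 : ‖(4 * ((‖D.z‖ ^ 2 : ℝ) : ℂ) : ℂ)‖ ≤ 6 := by
      rw [norm_mul, RCLike.norm_ofNat, norm_real, norm_of_nonneg (sq_nonneg _)]
      linarith [h.z_sq_upper]
    rw [RCLike.norm_ofNat]
    have q3 : Γ ^ 3 ≤ Γ ^ 7 := pow_le_pow_right₀ h1 (by norm_num)
    have q4 : 1 ≤ Γ ^ 7 := one_le_pow₀ h1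
    have q5 : ‖(4 * ((‖D.z‖ ^ 2 : ℝ) : ℂ) : ℂ)‖ * (2 * 10 ^ 5 * Γ ^ 7)
        ≤ 6 * (2 * 10 ^ 5 * Γ ^ 7) := by gcongr
    linarith
  rw [h.conjTranspose_M_eq, ← Matrix.mul_assoc]
  exact (hW.mul hV hc).mono t.mono le_rfl (le_of_eq (by ring))

end Tower

end Data

/-! ### The test vectors of the model -/

section
variable {Ω : Type*} [MeasurableSpace Ω] {P : Measure Ω} [IsProbabilityMeasure P]
  {X : Ω → Matrix (Fin n) (Fin n) ℂ} {s_lo s_hi : ℝ}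

theorem fluct_inl_inr (h : FlatModel s_lo s_hi P X) (z : ℂ) (ω : Ω) (i j : Fin n) :
    fluct P X z ω (Sum.inl i) (Sum.inr j) = X ω i j := by
  have hi : Integrable (fun ω => X ω i j) P := (h.memLp i j).integrable (by norm_num)
  have e : ∫ ω', (X ω' i j - (z • (1 : Matrix (Fin n) (Fin n) ℂ)) i j) ∂P
      = -(z • (1 : Matrix (Fin n) (Fin n) ℂ)) i j := by
    rw [integral_sub hi (integrable_const _), h.centered, integral_const]
    simp
  simp only [fluct, hermitization, Matrix.of_apply, Matrix.fromBlocks_apply₁₂, Matrix.sub_apply]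
  rw [e]
  ring

theorem fluct_inr_inl (h : FlatModel s_lo s_hi P X) (z : ℂ) (ω : Ω) (i j : Fin n) :
    fluct P X z ω (Sum.inr i) (Sum.inl j) = conj (X ω j i) := by
  rw [← fluct_inl_inr h z ω j i]
  simp only [fluct, hermitization, Matrix.of_apply, Matrix.fromBlocks_apply₁₂,
    Matrix.fromBlocks_apply₂₁, conjTranspose_apply, map_sub]
  rw [← integral_conj]
  rfl

theorem sCov_eq (h : FlatModel s_lo s_hi P X) (z : ℂ) (a b : Idx n) :
    sCov P X z a b = (symVar (varMat P X) a b : ℂ) := by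
  unfold sCov
  congr 1
  rcases a with i | i <;> rcases b with j | j
  · simp [fluct, hermitization, symVar]
  · simp only [fluct_inl_inr h]
    simp [symVar, varMat]
  · simp only [fluct_inr_inl h, RCLike.norm_conj]
    simp [symVar, varMat]
  · simp [fluct, hermitization, symVar]

theorem tower_testVecs (h : FlatModel s_lo s_hi P X) (z : ℂ) {D : Data n} (hS : D.S = varMat P X)
    (L Ls : Mat n) (x y : Vec n) :
    D.Tower (testVecs (sCov P X z) (tCov P X z) D.M L Ls x y) where
  mono := monotone_nat_of_le_succ fun _ _ hu => Or.inl (Or.inl hu)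
  std a := Or.inr ⟨a, Or.inl rfl⟩
  mul_M _ u hu := Or.inl (Or.inr ⟨u, hu, rfl⟩)
  mul_S _ u hu b := by
    refine Or.inr ⟨u, hu, b, b, Or.inl ?_⟩
    funext d
    simp only [weightedKappa, kappaC, and_true, mul_ite, mul_zero, Finset.sum_ite_eq',
      Finset.mem_univ, if_true]
    rw [sCov_eq h, hS, mul_comm]

end

namespace Data

variable {D : Data n} {Γ : ℝ} {J : ℕ → Set (Vec n)} {K : ℕ}

theorem conjTranspose_selfEnergy (S : Matrix (Fin n) (Fin n) ℝ) (R : Mat n) :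
    (selfEnergy S R)ᴴ = diagonal (act S fun a => conj (R a a)) := by
  rw [selfEnergy_eq, diagonal_conjTranspose]
  congr 1
  funext a
  simp [act_apply, diag_apply]

theorem two_mul_rpow_le (hK : 0 < K) :
    (2 * n : ℝ) ^ (((4 : ℕ) : ℝ) / (2 * K)) ≤ 4 * (n : ℝ) ^ ((2 : ℝ) / K) := by
  have hK' : (1 : ℝ) ≤ K := by exact_mod_cast hK
  have e : ((4 : ℕ) : ℝ) / (2 * K) = 2 / K := by
    push_cast
    rw [div_eq_div_iff (by positivity) (by positivity)]; ring
  rw [e, Real.mul_rpow (by norm_num) (by positivity)]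
  have h1 : (2 : ℝ) ^ ((2 : ℝ) / K) ≤ 2 ^ (2 : ℝ) :=
    Real.rpow_le_rpow_of_exponent_le (by norm_num) (div_le_self (by norm_num) hK')
  have h2 : (2 : ℝ) ^ (2 : ℝ) = 4 := by norm_num
  rw [h2] at h1
  gcongr

namespace Tower

theorem entry_le (t : D.Tower J) (h : D.Regular Γ) (hK : 0 < K) (R : Mat n) (a b : Idx n) :
    ‖R a b‖ ≤ towerNorm J K R :=
  norm_entry_le_towerNorm h.n_pos t.std hK R a b

theorem towerNorm_M_mul_le (t : D.Tower J) (h : D.Regular Γ) (hK : 0 < K) (R : Mat n) :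
    towerNorm J K (D.M * R)
      ≤ 10 ^ 8 * Γ ^ 9 * (K + 1) * (n : ℝ) ^ ((2 : ℝ) / K) * towerNorm J K R := by
  have hΓ := h.Λ_pos
  have h0 := towerNorm_nonneg J K R
  have h1 := t.attains_mul_conjTranspose h (W := 1) (c := 4 * Γ) (by positivity)
    (by rw [one_mul]; exact t.attains_M h)
  rw [one_mul] at h1
  have e1 : Γ ≤ Γ ^ 8 := le_self_pow₀ h.one_le (by norm_num)
  have e2 : Γ ^ 8 ≤ Γ ^ 9 := pow_le_pow_right₀ h.one_le (by norm_num)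
  have h2 := towerNorm_mul_le h.n_pos t.mono hK (c := 2 * 10 ^ 6 * Γ ^ 7 * (4 * Γ))
    (by positivity) h1 (by
      rw [l2_opNorm_conjTranspose]
      refine h.norm_M_le.trans ?_
      have e : 2 * 10 ^ 6 * Γ ^ 7 * (4 * Γ) = 8 * 10 ^ 6 * Γ ^ 8 := by ring
      rw [e]
      linarith) R
  rw [conjTranspose_conjTranspose] at h2
  refine h2.trans ?_
  have h3 := two_mul_rpow_le (n := n) hK
  calc _ ≤ 2 * 10 ^ 6 * Γ ^ 7 * (4 * Γ) * (K + 1) * (4 * (n : ℝ) ^ ((2 : ℝ) / K)) * towerNorm J K R := by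
        gcongr
    _ = 32 * 10 ^ 6 * Γ ^ 8 * ((K + 1) * (n : ℝ) ^ ((2 : ℝ) / K) * towerNorm J K R) := by ring
    _ ≤ 10 ^ 8 * Γ ^ 9 * ((K + 1) * (n : ℝ) ^ ((2 : ℝ) / K) * towerNorm J K R) := by
        gcongr
        norm_num
    _ = _ := by ring

theorem towerNorm_quad_le (t : D.Tower J) (h : D.Regular Γ) (hK : 0 < K) {X : Mat n} {d : ℝ}
    (hX : ∀ a, ‖X a a‖ ≤ d) (Y : Mat n) : towerNorm J K (D.quad X Y)
      ≤ 10 ^ 8 * Γ ^ 9 * (K + 1) * (n : ℝ) ^ ((2 : ℝ) / K) * (d * towerNorm J K Y) := by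
  have hΓ := h.Λ_pos
  have hd : 0 ≤ d := (norm_nonneg _).trans (hX (Sum.inl ⟨0, h.n_pos⟩))
  have h0 := towerNorm_nonneg J K Y
  rcases hd.eq_or_lt with hd0 | hd0
  · have e1 := towerNorm_le_norm h.n_pos J K (D.quad X Y)
    have e2 := h.norm_quad_le (Y := Y) hd hX
    rw [← hd0, mul_zero, zero_mul] at e2
    have e3 : ‖D.quad X Y‖ = 0 := le_antisymm e2 (norm_nonneg _)
    rw [e3, mul_zero] at e1
    exact e1.trans (by positivity)
  · have h1 := t.attains_mul_conjTranspose h (W := diagonal (act D.S fun a => conj (X a a)))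
      (c := 8 * Γ ^ 2 * d) (by positivity)
      (t.attains_act_mul_M h fun a => by rw [RCLike.norm_conj]; exact hX a)
    rw [← conjTranspose_selfEnergy, ← conjTranspose_mul] at h1
    have e1 : Γ ^ 2 ≤ Γ ^ 9 := pow_le_pow_right₀ h.one_le (by norm_num)
    have h2 := towerNorm_mul_le h.n_pos t.mono hK (c := 2 * 10 ^ 6 * Γ ^ 7 * (8 * Γ ^ 2 * d))
      (by positivity) h1 (by
        rw [l2_opNorm_conjTranspose]
        refine (norm_mul_le _ _).trans ?_
        calc _ ≤ 4 * Γ * (Γ * d) := by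
              have e3 := h.norm_M_le
              have e4 := h.norm_selfEnergy_le hd hX
              gcongr
          _ = 4 * Γ ^ 2 * d := by ring
          _ ≤ 16 * 10 ^ 6 * Γ ^ 9 * d := by
              gcongr
              linarith
          _ = _ := by ring) Y
    rw [conjTranspose_conjTranspose] at h2
    refine h2.trans ?_
    have h3 := two_mul_rpow_le (n := n) hK
    calc _ ≤ 2 * 10 ^ 6 * Γ ^ 7 * (8 * Γ ^ 2 * d) * (K + 1) * (4 * (n : ℝ) ^ ((2 : ℝ) / K))
          * towerNorm J K Y := by gcongr
      _ = 64 * 10 ^ 6 * (Γ ^ 9 * (K + 1) * (n : ℝ) ^ ((2 : ℝ) / K) * (d * towerNorm J K Y)) := by ring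
      _ ≤ 10 ^ 8 * (Γ ^ 9 * (K + 1) * (n : ℝ) ^ ((2 : ℝ) / K) * (d * towerNorm J K Y)) := by
          gcongr
          norm_num
      _ = _ := by ring

variable {β βs : ℂ} {B Bs : Mat n} {l ls : Idx n → ℂ}

theorem towerNorm_invQ_le (t : D.Tower J) (s : D.Setup Γ β βs B Bs l ls) (hK : 0 < K) (R : Mat n) :
    towerNorm J K (invQ D.S D.M β βs R) ≤ 3201 * Γ ^ 16 * (K + 1) * towerNorm J K R := by
  have hΓ := s.Γ_pos
  have h0 := towerNorm_nonneg J K R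
  have h1 := s.norm_invQ_sub_le (fun a => t.entry_le s.reg hK R a a)
  have h2 := towerNorm_le_norm s.reg.n_pos J K (invQ D.S D.M β βs R - R)
  have h3 := towerNorm_add_le s.reg.n_pos J K (invQ D.S D.M β βs R - R) R
  rw [sub_add_cancel] at h3
  have h4 : ((K : ℝ) + 1) * ‖invQ D.S D.M β βs R - R‖
      ≤ (K + 1) * (3200 * Γ ^ 16 * towerNorm J K R) := by gcongr
  have h5 : 1 * 1 * towerNorm J K R ≤ Γ ^ 16 * (K + 1) * towerNorm J K R := by
    have : 1 ≤ Γ ^ 16 := one_le_pow₀ s.one_le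
    gcongr
    linarith [(Nat.cast_nonneg K : (0 : ℝ) ≤ K)]
  linarith

theorem norm_hs_l_quad_le (t : D.Tower J) (s : D.Setup Γ β βs B Bs l ls) (hK : 0 < K) (X Y : Mat n) :
    ‖hs (diagonal l) (D.quad X Y)‖ ≤ 8 * Γ ^ 3 * (towerNorm J K X * towerNorm J K Y) := by
  refine (s.norm_hs_l_le fun a => s.reg.norm_quad_apply_le (fun a => t.entry_le s.reg hK X a a)
    (t.entry_le s.reg hK Y) a a).trans (le_of_eq (by ring))

end Tower
end Data

/-! ### The expansion along the unstable directions -/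

/-- The bootstrap for the remainder and for the coefficient of the second unstable direction. -/
theorem bootstrap_le {C N θ w T v r₁ δ r : ℝ} (hC : 1 ≤ C) (hN : 1 ≤ N) (hθ : 0 ≤ θ) (hw : 0 ≤ w)
    (hT : 0 ≤ T) (hv : 0 ≤ v) (hr₁ : 0 ≤ r₁) (hδ : 0 ≤ δ) (hr : 0 ≤ r)
    (h1 : T ≤ C * (w + N * v + θ ^ 2 + N * θ * T + N * T ^ 2))
    (h2 : w ≤ C * (δ * θ + r₁ + r * θ ^ 2 + N * θ * T + N * T ^ 2))
    (s1 : 24 * C ^ 3 * (N * θ) ≤ 1) (s2 : 24 * C ^ 3 * (N * T) ≤ 1)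
    (s3 : 24 * C ^ 3 * (N ^ 2 * v) ≤ 1) :
    w + N * θ * T + N * T ^ 2 ≤ 50 * C ^ 3
      * (δ * θ + r₁ + r * θ ^ 2 + N ^ 2 * θ * v + N * θ ^ 3 + N ^ 3 * v ^ 2) := by
  have hC0 : 0 < C := by linarith
  have hN0 : 0 < N := by linarith
  have hCC : C ≤ C ^ 3 := le_self_pow₀ hC (by norm_num)
  have hC2 : C ^ 2 ≤ C ^ 3 := pow_le_pow_right₀ hC (by norm_num)
  have hC1 : C ≤ C ^ 2 := le_self_pow₀ hC (by norm_num)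
  have hC13 : 1 ≤ C ^ 3 := one_le_pow₀ hC
  have a1 : C * (N * θ) ≤ C ^ 3 * (N * θ) := by gcongr
  have a2 : C * (N * T) ≤ C ^ 3 * (N * T) := by gcongr
  have b1 : C * (N * θ) * T ≤ 1 / 24 * T := by gcongr; linarith
  have b2 : C * (N * T) * T ≤ 1 / 24 * T := by gcongr; linarith
  have h3 : T ≤ 2 * C * (w + N * v + θ ^ 2) := by
    have e : C * (w + N * v + θ ^ 2 + N * θ * T + N * T ^ 2)
        = C * (w + N * v + θ ^ 2) + C * (N * θ) * T + C * (N * T) * T := by ring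
    rw [e] at h1
    linarith
  have hθ1 : θ ≤ 1 := by
    have : 1 * 1 * θ ≤ C ^ 3 * N * θ := by gcongr
    linarith
  have c1 : N * θ * T ≤ N * θ * (2 * C * (w + N * v + θ ^ 2)) := by gcongr
  have c2 : N * T * T ≤ N * T * (2 * C * (w + N * v + θ ^ 2)) := by gcongr
  have c3 : N * T * (2 * C * (N * v + θ ^ 2))
      ≤ N * (2 * C * (w + N * v + θ ^ 2)) * (2 * C * (N * v + θ ^ 2)) := by gcongr
  have d1 : N * θ ^ 4 ≤ N * θ ^ 3 := by
    have : θ ^ 4 ≤ θ ^ 3 := pow_le_pow_of_le_one hθ hθ1 (by norm_num)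
    gcongr
  have d2 : N * (N * v + θ ^ 2) ^ 2 ≤ 2 * (N ^ 3 * v ^ 2 + N * θ ^ 4) := by
    have : 0 ≤ N * (N * v - θ ^ 2) ^ 2 := by positivity
    linarith
  have d3 : C ^ 3 * (N * θ ^ 2) ≤ C ^ 3 * (N * θ) := by
    have : θ ^ 2 ≤ θ := pow_le_of_le_one hθ hθ1 two_ne_zero
    gcongr
  obtain ⟨X, hX⟩ : ∃ X, X = N * θ * T + N * T ^ 2 := ⟨_, rfl⟩
  obtain ⟨Y, hY⟩ : ∃ Y, Y = N ^ 2 * θ * v + N * θ ^ 3 + N ^ 3 * v ^ 2 := ⟨_, rfl⟩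
  have hY0 : 0 ≤ Y := by rw [hY]; positivity
  have g1 : X ≤ (2 * C * (N * θ) + 2 * C * (N * T) + 4 * C ^ 2 * (N ^ 2 * v + N * θ ^ 2)) * w
      + 2 * C * (N ^ 2 * θ * v + N * θ ^ 3) + 8 * C ^ 2 * (N ^ 3 * v ^ 2 + N * θ ^ 4) := by
    have e1 : 4 * C ^ 2 * (N * (N * v + θ ^ 2) ^ 2) ≤ 4 * C ^ 2 * (2 * (N ^ 3 * v ^ 2 + N * θ ^ 4)) := by
      gcongr
    rw [hX]
    linarith
  have g2 : 8 * C ^ 2 * (N ^ 3 * v ^ 2 + N * θ ^ 4) + 2 * C * (N ^ 2 * θ * v + N * θ ^ 3)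
      ≤ 10 * C ^ 2 * Y := by
    have e1 : 8 * C ^ 2 * (N ^ 3 * v ^ 2 + N * θ ^ 4) ≤ 8 * C ^ 2 * Y := by
      gcongr
      rw [hY]
      have : 0 ≤ N ^ 2 * θ * v := by positivity
      linarith
    have e2 : 2 * C * (N ^ 2 * θ * v + N * θ ^ 3) ≤ 2 * C ^ 2 * Y := by
      gcongr
      rw [hY]
      have : 0 ≤ N ^ 3 * v ^ 2 := by positivity
      linarith
    linarith
  have g3 : C * (2 * C * (N * θ) + 2 * C * (N * T) + 4 * C ^ 2 * (N ^ 2 * v + N * θ ^ 2)) ≤ 1 / 2 := by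
    have e1 : C ^ 2 * (N * θ) ≤ C ^ 3 * (N * θ) := by gcongr
    have e2 : C ^ 2 * (N * T) ≤ C ^ 3 * (N * T) := by gcongr
    linarith
  have g4 : C * X ≤ 1 / 2 * w + 10 * C ^ 3 * Y := by
    have e1 : C * X ≤ C * ((2 * C * (N * θ) + 2 * C * (N * T)
        + 4 * C ^ 2 * (N ^ 2 * v + N * θ ^ 2)) * w + 10 * C ^ 2 * Y) := by
      gcongr; linarith
    have e2 : C * (2 * C * (N * θ) + 2 * C * (N * T) + 4 * C ^ 2 * (N ^ 2 * v + N * θ ^ 2)) * w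
        ≤ 1 / 2 * w := by gcongr
    linarith
  obtain ⟨Z, hZ⟩ : ∃ Z, Z = δ * θ + r₁ + r * θ ^ 2 := ⟨_, rfl⟩
  have hZ0 : 0 ≤ Z := by rw [hZ]; positivity
  have g5 : w ≤ 2 * C * Z + 20 * C ^ 3 * Y := by
    have e1 : C * (δ * θ + r₁ + r * θ ^ 2 + N * θ * T + N * T ^ 2) = C * Z + C * X := by
      rw [hZ, hX]; ring
    linarith
  have g6 : X ≤ C * X := by
    have : 0 ≤ X := by rw [hX]; positivity
    have := mul_le_mul_of_nonneg_right hC this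
    linarith
  have g7 : C * Z ≤ C ^ 3 * Z := by gcongr
  have e3 : w + N * θ * T + N * T ^ 2 = w + X := by rw [hX]; ring
  have e4 : 50 * C ^ 3 * (δ * θ + r₁ + r * θ ^ 2 + N ^ 2 * θ * v + N * θ ^ 3 + N ^ 3 * v ^ 2)
      = 50 * (C ^ 3 * Z) + 50 * (C ^ 3 * Y) := by rw [hZ, hY]; ring
  have g8 : 0 ≤ C ^ 3 * Y := by positivity
  have g9 : 0 ≤ C ^ 3 * Z := by positivity
  rw [e3, e4]
  linarith

namespace Data

variable {D : Data n} {Γ : ℝ}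

/-- The expansion of the difference of solutions along the unstable directions. -/
structure Expansion (D : Data n) (β βs : ℂ) (B Bs : Mat n) (l : Idx n → ℂ) (V Δ T E Q : Mat n)
    (Θ Θs : ℂ) : Prop where
  coeff_eq : Θ = hs (diagonal l) Δ / hs (diagonal l) B
  sub_eq : Δ = Θ • B + T
  T_eq : T = E - invQ D.S D.M β βs (D.M * V) + Θ ^ 2 • invQ D.S D.M β βs (D.quad B B)
  E_eq : E = Θs • Bs + invQ D.S D.M β βs Q
  Q_eq : Q = Θ • (D.quad B T + D.quad T B) + D.quad T T
  constraint : Θ * hs Eminus B + Θs * hs Eminus Bs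
    + Θ ^ 2 * hs Eminus (invQ D.S D.M β βs (D.quad B B)) + hs Eminus (invQ D.S D.M β βs Q)
    = hs (matR₁ D.S D.M β βs) V
  cubic : β * (Θ * hs (diagonal l) B)
    = -hs (diagonal l) (D.M * V) + hs (diagonal l) (D.quad Δ Δ)

/-- The equation for the difference of the solutions of the perturbed and the unperturbed
equation. -/
theorem stabOp_sub (hMu : IsUnit D.M)
    (hM : -D.M⁻¹ = spectralMat n D.z D.η + selfEnergy D.S D.M) {G V : Mat n}
    (hG : IsPerturbedDysonSolution D.S D.z D.η V G) :
    stabOp D.S D.M (G - D.M) = -(D.M * V) + D.quad (G - D.M) (G - D.M) := by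
  have hM1 : D.M * D.M⁻¹ = 1 := Matrix.mul_nonsing_inv _ ((Matrix.isUnit_iff_isUnit_det _).1 hMu)
  have hG1 : G⁻¹ * G = 1 := Matrix.nonsing_inv_mul _ ((Matrix.isUnit_iff_isUnit_det _).1 hG.isUnit)
  have e1 : D.M * (spectralMat n D.z D.η + selfEnergy D.S D.M) = -1 := by
    rw [← hM, Matrix.mul_neg, hM1]
  have e2 : (spectralMat n D.z D.η + selfEnergy D.S G) * G = V - 1 := by
    have h := congrArg (· * G) hG.equation
    simp only [Matrix.sub_mul, Matrix.neg_mul, Matrix.mul_assoc, hG1, Matrix.mul_one] at h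
    rw [eq_sub_iff_add_eq] at h
    rw [← h]; abel
  have e3 : D.M * selfEnergy D.S (G - D.M) * G = D.M * V - D.M + G := by
    have e : D.M * selfEnergy D.S (G - D.M) * G
        = D.M * ((spectralMat n D.z D.η + selfEnergy D.S G) * G)
          - D.M * (spectralMat n D.z D.η + selfEnergy D.S D.M) * G := by
      rw [map_sub]; noncomm_ring
    rw [e, e1, e2]
    noncomm_ring
  rw [stabOp_apply, quad, Matrix.mul_sub _ G D.M, e3]
  abel

namespace Setup

variable {β βs : ℂ} {B Bs : Mat n} {l ls : Idx n → ℂ}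

theorem exists_expansion (s : D.Setup Γ β βs B Bs l ls) (hMu : IsUnit D.M)
    (hM : -D.M⁻¹ = spectralMat n D.z D.η + selfEnergy D.S D.M) {G V : Mat n}
    (hG : IsPerturbedDysonSolution D.S D.z D.η V G) (hE : hs Eminus G = 0) :
    ∃ (T E Q : Mat n) (Θs : ℂ), D.Expansion β βs B Bs l V (G - D.M) T E Q
      (hs (diagonal l) (G - D.M) / hs (diagonal l) B) Θs := by
  have h1 := stabOp_sub hMu hM hG
  obtain ⟨Δ, hΔ⟩ : ∃ Δ, Δ = G - D.M := ⟨_, rfl⟩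
  rw [← hΔ] at h1 ⊢
  obtain ⟨Θ, hΘ⟩ : ∃ Θ, Θ = hs (diagonal l) Δ / hs (diagonal l) B := ⟨_, rfl⟩
  obtain ⟨Θs, hΘs⟩ : ∃ Θs, Θs = hs (diagonal ls) Δ / hs (diagonal ls) Bs := ⟨_, rfl⟩
  have hE0 : hs Eminus Δ = 0 := by rw [hΔ, hs_sub_right, hE, s.reg.hs_Eminus_M, sub_zero]
  obtain ⟨T, hT⟩ : ∃ T, T = Δ - Θ • B := ⟨_, rfl⟩
  obtain ⟨Q, hQ⟩ : ∃ Q, Q = Θ • (D.quad B T + D.quad T B) + D.quad T T := ⟨_, rfl⟩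
  have hsub : Δ = Θ • B + T := by rw [hT]; abel
  have hquad : D.quad Δ Δ = Θ ^ 2 • D.quad B B + Q := by
    rw [hQ, hsub]
    simp only [quad_add_left, quad_add_right, quad_smul_left, quad_smul_right]
    module
  have h2 := s.invQ_stabOp Δ
  rw [h1, hquad, map_add, map_neg, map_add, map_smul, unstable, ← hΘ, ← hΘs] at h2
  have hTeq : T = Θs • Bs + invQ D.S D.M β βs Q - invQ D.S D.M β βs (D.M * V)
      + Θ ^ 2 • invQ D.S D.M β βs (D.quad B B) := by
    have e : T = (Δ - (Θ • B + Θs • Bs)) + Θs • Bs := by rw [hT]; abel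
    rw [e, ← h2]; abel
  refine ⟨T, Θs • Bs + invQ D.S D.M β βs Q, Q, Θs, ?_⟩
  rw [← hΘ]
  refine ⟨hΘ, hsub, hTeq, rfl, hQ, ?_, ?_⟩
  · have e1 : hs Eminus Δ = Θ * hs Eminus B + hs Eminus T := by
      rw [hsub, hs_add_right, hs_smul_right]
    rw [hE0, hTeq, hs_add_right, hs_sub_right, hs_add_right, hs_smul_right, hs_smul_right,
      ← hs_matR₁] at e1
    linear_combination -e1
  · have e1 := s.hs_left Δ
    rw [h1, hs_add_right, hs_neg_right] at e1
    rw [hΘ, div_mul_cancel₀ _ s.hs_l_B_ne, ← e1]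

end Setup
end Data

/-- The constant in the estimates of the expansion. -/
def expConst (Γ : ℝ) (K : ℕ) : ℝ := 10 ^ 13 * Γ ^ 30 * ((K : ℝ) + 1) ^ 3

theorem le_expConst {Γ : ℝ} (hΓ : 1 ≤ Γ) (K : ℕ) {a : ℝ} (ha : a ≤ 10 ^ 13) {i j : ℕ}
    (hi : i ≤ 30) (hj : j ≤ 3) : a * Γ ^ i * ((K : ℝ) + 1) ^ j ≤ expConst Γ K := by
  have hK : (1 : ℝ) ≤ K + 1 := by linarith [(Nat.cast_nonneg K : (0 : ℝ) ≤ K)]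
  unfold expConst
  gcongr

theorem one_le_expConst {Γ : ℝ} (hΓ : 1 ≤ Γ) (K : ℕ) : 1 ≤ expConst Γ K := by
  have := le_expConst hΓ K (a := 1) (by norm_num) (Nat.zero_le 30) (Nat.zero_le 3)
  simpa using this

theorem one_le_rpow_two_div (hn : 0 < n) (K : ℕ) : 1 ≤ (n : ℝ) ^ ((2 : ℝ) / K) :=
  Real.one_le_rpow (by exact_mod_cast hn) (by positivity)

namespace Data

variable {D : Data n} {Γ : ℝ} {J : ℕ → Set (Vec n)} {K : ℕ}
  {β βs : ℂ} {B Bs : Mat n} {l ls : Idx n → ℂ} {V Δ T E Q : Mat n} {Θ Θs : ℂ}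

namespace Setup

theorem towerNorm_B_le (s : D.Setup Γ β βs B Bs l ls) (J : ℕ → Set (Vec n)) (K : ℕ) :
    towerNorm J K B ≤ 6 * Γ ^ 2 * (K + 1) :=
  (towerNorm_le_norm s.reg.n_pos J K B).trans (by
    have := s.norm_B_le
    calc _ ≤ ((K : ℝ) + 1) * (6 * Γ ^ 2) := by gcongr
      _ = _ := by ring)

theorem towerNorm_Bs_le (s : D.Setup Γ β βs B Bs l ls) (J : ℕ → Set (Vec n)) (K : ℕ) :
    towerNorm J K Bs ≤ 2 * Γ * (K + 1) :=
  (towerNorm_le_norm s.reg.n_pos J K Bs).trans (by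
    have := s.norm_Bs_le
    calc _ ≤ ((K : ℝ) + 1) * (2 * Γ) := by gcongr
      _ = _ := by ring)

theorem towerNorm_invQ_quad_B_B_le (s : D.Setup Γ β βs B Bs l ls) (J : ℕ → Set (Vec n)) (K : ℕ) :
    towerNorm J K (invQ D.S D.M β βs (D.quad B B)) ≤ expConst Γ K :=
  (towerNorm_le_norm s.reg.n_pos J K _).trans (by
    have := s.norm_invQ_quad_B_B_le
    calc _ ≤ ((K : ℝ) + 1) * (10 ^ 6 * Γ ^ 22) := by gcongr
      _ = 10 ^ 6 * Γ ^ 22 * ((K : ℝ) + 1) ^ 1 := by ring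
      _ ≤ _ := le_expConst s.one_le K (by norm_num) (by norm_num) (by norm_num))

end Setup

namespace Tower

theorem norm_hs_Eminus_le (t : D.Tower J) (h : D.Regular Γ) (hK : 0 < K) (R : Mat n) :
    ‖hs Eminus R‖ ≤ towerNorm J K R := by
  rw [Eminus_eq_sgn, hs_diagonal_eq]
  refine (norm_dpair_le h.n_pos (c := 1) (fun a => ?_) fun a => t.entry_le h hK R a a).trans
    (le_of_eq (one_mul _))
  rw [norm_real, Real.norm_eq_abs, abs_sgn]

theorem towerNorm_invQ_M_mul_le (t : D.Tower J) (s : D.Setup Γ β βs B Bs l ls) (hK : 0 < K)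
    (V : Mat n) : towerNorm J K (invQ D.S D.M β βs (D.M * V))
      ≤ expConst Γ K * ((n : ℝ) ^ ((2 : ℝ) / K) * towerNorm J K V) := by
  have hΓ := s.Γ_pos
  have h0 := towerNorm_nonneg J K V
  refine (t.towerNorm_invQ_le s hK _).trans ?_
  have h1 := t.towerNorm_M_mul_le s.reg hK V
  calc _ ≤ 3201 * Γ ^ 16 * (K + 1) * (10 ^ 8 * Γ ^ 9 * (K + 1) * (n : ℝ) ^ ((2 : ℝ) / K)
        * towerNorm J K V) := by gcongr
    _ = (3201 * 10 ^ 8) * Γ ^ 25 * ((K : ℝ) + 1) ^ 2 * ((n : ℝ) ^ ((2 : ℝ) / K) * towerNorm J K V) := by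
        ring
    _ ≤ _ := by
        have := le_expConst s.one_le K (a := 3201 * 10 ^ 8) (by norm_num)
          (by norm_num : 25 ≤ 30) (by norm_num : 2 ≤ 3)
        gcongr

end Tower

namespace Expansion

theorem norm_coeff_le (x : D.Expansion β βs B Bs l V Δ T E Q Θ Θs) (t : D.Tower J)
    (s : D.Setup Γ β βs B Bs l ls) (hK : 0 < K) : ‖Θ‖ ≤ 4 * Γ ^ 3 * towerNorm J K Δ := by
  have hΓ := s.Γ_pos
  rw [x.coeff_eq]
  refine (Setup.norm_div_le (by positivity) (s.norm_hs_l_le fun a => t.entry_le s.reg hK Δ a a)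
    s.hs_l_B_lower).trans (le_of_eq (by ring))

theorem norm_coeff_le' (x : D.Expansion β βs B Bs l V Δ T E Q Θ Θs) (t : D.Tower J)
    (s : D.Setup Γ β βs B Bs l ls) (hK : 0 < K) : ‖Θ‖ ≤ expConst Γ K * towerNorm J K Δ := by
  refine (x.norm_coeff_le t s hK).trans ?_
  have := le_expConst s.one_le K (a := 4) (by norm_num) (by norm_num : 3 ≤ 30) (Nat.zero_le 3)
  rw [pow_zero, mul_one] at this
  have h0 := towerNorm_nonneg J K Δ
  gcongr

theorem towerNorm_T_le (x : D.Expansion β βs B Bs l V Δ T E Q Θ Θs) (t : D.Tower J)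
    (s : D.Setup Γ β βs B Bs l ls) (hK : 0 < K) :
    towerNorm J K T ≤ expConst Γ K * towerNorm J K Δ := by
  have hΓ := s.Γ_pos
  have h0 := towerNorm_nonneg J K Δ
  have e : T = Δ - Θ • B := by rw [x.sub_eq]; abel
  have h1 := towerNorm_sub_le s.reg.n_pos J K Δ (Θ • B)
  rw [← e] at h1
  have h2 := (towerNorm_smul_le s.reg.n_pos J K Θ B).trans (mul_le_mul (x.norm_coeff_le t s hK)
    (s.towerNorm_B_le J K) (towerNorm_nonneg _ _ _) (by positivity))
  have h3 := le_expConst s.one_le K (a := 25) (by norm_num) (by norm_num : 5 ≤ 30)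
    (by norm_num : 1 ≤ 3)
  rw [pow_one] at h3
  have h4 : 1 ≤ Γ ^ 5 * ((K : ℝ) + 1) := by
    have h5 : 1 ≤ Γ ^ 5 := one_le_pow₀ s.one_le
    have h6 : (1 : ℝ) ≤ K + 1 := by linarith [(Nat.cast_nonneg K : (0 : ℝ) ≤ K)]
    calc (1 : ℝ) = 1 * 1 := (one_mul 1).symm
      _ ≤ _ := by gcongr
  calc towerNorm J K T ≤ (1 + 24 * (Γ ^ 5 * ((K : ℝ) + 1))) * towerNorm J K Δ := by linarith
    _ ≤ 25 * Γ ^ 5 * ((K : ℝ) + 1) * towerNorm J K Δ := by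
        gcongr
        linarith
    _ ≤ _ := by gcongr

theorem towerNorm_Q_le (x : D.Expansion β βs B Bs l V Δ T E Q Θ Θs) (t : D.Tower J)
    (s : D.Setup Γ β βs B Bs l ls) (hK : 0 < K) :
    towerNorm J K (invQ D.S D.M β βs Q) ≤ expConst Γ K
      * ((n : ℝ) ^ ((2 : ℝ) / K) * ‖Θ‖ * towerNorm J K T
        + (n : ℝ) ^ ((2 : ℝ) / K) * towerNorm J K T ^ 2) := by
  have hΓ := s.Γ_pos
  have hn := s.reg.n_pos
  have h0 := towerNorm_nonneg J K T
  have hB0 := towerNorm_nonneg J K B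
  have hB := s.towerNorm_B_le J K
  have hN := one_le_rpow_two_div hn K
  obtain ⟨N, hNe⟩ : ∃ N, N = (n : ℝ) ^ ((2 : ℝ) / K) := ⟨_, rfl⟩
  obtain ⟨q, hq⟩ : ∃ q : ℝ, q = 10 ^ 8 * Γ ^ 9 * (K + 1) * N := ⟨_, rfl⟩
  have hN0 : 0 < N := by rw [hNe]; linarith
  have hq0 : 0 < q := by rw [hq]; positivity
  have b1 := t.towerNorm_quad_le s.reg hK (fun a => t.entry_le s.reg hK B a a) T
  have b2 := t.towerNorm_quad_le s.reg hK (fun a => t.entry_le s.reg hK T a a) B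
  have b3 := t.towerNorm_quad_le s.reg hK (fun a => t.entry_le s.reg hK T a a) T
  rw [← hNe, ← hq] at b1 b2 b3
  rw [← hNe]
  have b4 := (towerNorm_smul_le hn J K Θ (D.quad B T + D.quad T B)).trans
    (mul_le_mul_of_nonneg_left ((towerNorm_add_le hn J K _ _).trans (add_le_add b1 b2))
      (norm_nonneg Θ))
  have b5 := (towerNorm_add_le hn J K _ _).trans (add_le_add b4 b3)
  rw [← x.Q_eq] at b5
  have hk : (1 : ℝ) ≤ K + 1 := by linarith [(Nat.cast_nonneg K : (0 : ℝ) ≤ K)]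
  have c1 : ‖Θ‖ * (q * (towerNorm J K B * towerNorm J K T) + q * (towerNorm J K T * towerNorm J K B))
      ≤ ‖Θ‖ * (q * (6 * Γ ^ 2 * (K + 1) * towerNorm J K T)
        + q * (towerNorm J K T * (6 * Γ ^ 2 * (K + 1)))) := by gcongr
  have c2 : 1 * (q * (towerNorm J K T * towerNorm J K T))
      ≤ 12 * Γ ^ 2 * (K + 1) * (q * (towerNorm J K T * towerNorm J K T)) := by
    have : 1 ≤ Γ ^ 2 := one_le_pow₀ s.one_le
    have : 1 ≤ 12 * Γ ^ 2 * ((K : ℝ) + 1) := by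
      calc (1 : ℝ) ≤ 12 * 1 * 1 := by norm_num
        _ ≤ _ := by gcongr
    gcongr
  have b6 : towerNorm J K Q ≤ 12 * Γ ^ 2 * (K + 1) * q * (‖Θ‖ * towerNorm J K T + towerNorm J K T ^ 2) := by
    linarith
  refine (t.towerNorm_invQ_le s hK Q).trans ?_
  calc _ ≤ 3201 * Γ ^ 16 * (K + 1) * (12 * Γ ^ 2 * (K + 1) * q
        * (‖Θ‖ * towerNorm J K T + towerNorm J K T ^ 2)) := by gcongr
    _ = (3201 * 12 * 10 ^ 8) * Γ ^ 27 * ((K : ℝ) + 1) ^ 3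
        * (N * ‖Θ‖ * towerNorm J K T + N * towerNorm J K T ^ 2) := by rw [hq]; ring
    _ ≤ _ := by
        have := le_expConst s.one_le K (a := 3201 * 12 * 10 ^ 8) (by norm_num)
          (by norm_num : 27 ≤ 30) (le_refl 3)
        gcongr

/-- The size of the remainder in the expansion. -/
theorem towerNorm_E_le (x : D.Expansion β βs B Bs l V Δ T E Q Θ Θs) (t : D.Tower J)
    (s : D.Setup Γ β βs B Bs l ls) (hK : 0 < K) {N : ℝ} (hNe : N = (n : ℝ) ^ ((2 : ℝ) / K))
    (hsm : 24 * expConst Γ K ^ 4 * (N ^ 7 * (towerNorm J K Δ + towerNorm J K V)) ≤ 1) :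
    towerNorm J K E ≤ 50 * expConst Γ K ^ 4 * (D.del * ‖Θ‖ + ‖hs (matR₁ D.S D.M β βs) V‖
      + D.rad * ‖Θ‖ ^ 2 + N ^ 2 * ‖Θ‖ * towerNorm J K V + N * ‖Θ‖ ^ 3 + N ^ 3 * towerNorm J K V ^ 2) := by
  have hΓ := s.Γ_pos
  have hn := s.reg.n_pos
  have hC := one_le_expConst s.one_le K
  have hN : 1 ≤ N := by rw [hNe]; exact one_le_rpow_two_div hn K
  have b1 := x.norm_coeff_le' t s hK
  have b2 := x.towerNorm_T_le t s hK
  have b3 := x.towerNorm_Q_le t s hK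
  have b4 := t.towerNorm_invQ_M_mul_le s hK V
  have b5 := s.towerNorm_invQ_quad_B_B_le J K
  have b6 := (towerNorm_smul_le hn J K Θs Bs).trans
    (mul_le_mul_of_nonneg_left (s.towerNorm_Bs_le J K) (norm_nonneg Θs))
  have f1 := le_expConst s.one_le K (a := 2) (by norm_num) (by norm_num : 1 ≤ 30)
    (by norm_num : 1 ≤ 3)
  have f2 := le_expConst s.one_le K (a := 10 ^ 6) (by norm_num) (by norm_num : 22 ≤ 30) (Nat.zero_le 3)
  have f3 := le_expConst s.one_le K (a := 1) (by norm_num) (by norm_num : 1 ≤ 30) (Nat.zero_le 3)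
  rw [pow_one, pow_one] at f1
  rw [pow_zero, mul_one] at f2 f3
  rw [one_mul, pow_one] at f3
  rw [← hNe] at b3 b4
  have hx0 := towerNorm_nonneg J K Δ
  have hv0 := towerNorm_nonneg J K V
  have hT0 := towerNorm_nonneg J K T
  have hδ := s.reg.del_pos.le
  have hr := hδ.trans s.reg.del_le_rad
  -- the bound on the remainder `T`
  have h1 : towerNorm J K T ≤ expConst Γ K * (‖Θs‖ + N * towerNorm J K V + ‖Θ‖ ^ 2
      + N * ‖Θ‖ * towerNorm J K T + N * towerNorm J K T ^ 2) := by
    have c1 := towerNorm_add_le hn J K (E - invQ D.S D.M β βs (D.M * V))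
      (Θ ^ 2 • invQ D.S D.M β βs (D.quad B B))
    rw [← x.T_eq] at c1
    have c2 := towerNorm_sub_le hn J K E (invQ D.S D.M β βs (D.M * V))
    have c3 := towerNorm_add_le hn J K (Θs • Bs) (invQ D.S D.M β βs Q)
    rw [← x.E_eq] at c3
    have c4 := (towerNorm_smul_le hn J K (Θ ^ 2) (invQ D.S D.M β βs (D.quad B B))).trans
      (mul_le_mul_of_nonneg_left b5 (norm_nonneg _))
    rw [norm_pow] at c4
    have c5 : ‖Θs‖ * (2 * Γ * (K + 1)) ≤ ‖Θs‖ * expConst Γ K := by gcongr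
    linarith
  -- the bound on the coefficient of the second direction
  have h2 : ‖Θs‖ ≤ expConst Γ K * (D.del * ‖Θ‖ + ‖hs (matR₁ D.S D.M β βs) V‖
      + D.rad * ‖Θ‖ ^ 2 + N * ‖Θ‖ * towerNorm J K T + N * towerNorm J K T ^ 2) := by
    have c1 : Θs * hs Eminus Bs = hs (matR₁ D.S D.M β βs) V - Θ * hs Eminus B
        - Θ ^ 2 * hs Eminus (invQ D.S D.M β βs (D.quad B B)) - hs Eminus (invQ D.S D.M β βs Q) := by
      rw [← x.constraint]; ring
    have c2 : ‖Θs‖ ≤ ‖Θs * hs Eminus Bs‖ := by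
      rw [norm_mul]
      exact le_mul_of_one_le_right (norm_nonneg _) s.hs_Eminus_Bs
    have c3 : ‖Θ * hs Eminus B‖ ≤ expConst Γ K * (D.del * ‖Θ‖) := by
      rw [norm_mul]
      have := s.hs_Eminus_B
      calc _ ≤ ‖Θ‖ * (Γ * D.del) := by gcongr
        _ ≤ ‖Θ‖ * (expConst Γ K * D.del) := by gcongr
        _ = _ := by ring
    have c4 : ‖Θ ^ 2 * hs Eminus (invQ D.S D.M β βs (D.quad B B))‖
        ≤ expConst Γ K * (D.rad * ‖Θ‖ ^ 2) := by
      rw [norm_mul, norm_pow]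
      have := s.hs_Eminus_invQ_quad_B_B_le
      calc _ ≤ ‖Θ‖ ^ 2 * (10 ^ 6 * Γ ^ 22 * D.rad) := by gcongr
        _ ≤ ‖Θ‖ ^ 2 * (expConst Γ K * D.rad) := by gcongr
        _ = _ := by ring
    have c5 := (t.norm_hs_Eminus_le s.reg hK _).trans b3
    have c6 : 1 * ‖hs (matR₁ D.S D.M β βs) V‖ ≤ expConst Γ K * ‖hs (matR₁ D.S D.M β βs) V‖ := by
      gcongr
    rw [c1] at c2
    have c7 := norm_sub_le (hs (matR₁ D.S D.M β βs) V - Θ * hs Eminus B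
        - Θ ^ 2 * hs Eminus (invQ D.S D.M β βs (D.quad B B))) (hs Eminus (invQ D.S D.M β βs Q))
    have c8 := norm_sub_le (hs (matR₁ D.S D.M β βs) V - Θ * hs Eminus B)
        (Θ ^ 2 * hs Eminus (invQ D.S D.M β βs (D.quad B B)))
    have c9 := norm_sub_le (hs (matR₁ D.S D.M β βs) V) (Θ * hs Eminus B)
    linarith
  have p7 : N ≤ N ^ 7 := le_self_pow₀ hN (by norm_num)
  have p27 : N ^ 2 ≤ N ^ 7 := pow_le_pow_right₀ hN (by norm_num)
  have hN7 : 0 ≤ N ^ 7 := by positivity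
  have q1 : 24 * expConst Γ K ^ 3 * (N * ‖Θ‖) ≤ 1 := by
    calc _ ≤ 24 * expConst Γ K ^ 3 * (N ^ 7 * (expConst Γ K * (towerNorm J K Δ + towerNorm J K V))) := by
          gcongr
          refine b1.trans ?_
          gcongr
          linarith
      _ = 24 * expConst Γ K ^ 4 * (N ^ 7 * (towerNorm J K Δ + towerNorm J K V)) := by ring
      _ ≤ 1 := hsm
  have q2 : 24 * expConst Γ K ^ 3 * (N * towerNorm J K T) ≤ 1 := by
    calc _ ≤ 24 * expConst Γ K ^ 3 * (N ^ 7 * (expConst Γ K * (towerNorm J K Δ + towerNorm J K V))) := by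
          gcongr
          refine b2.trans ?_
          gcongr
          linarith
      _ = 24 * expConst Γ K ^ 4 * (N ^ 7 * (towerNorm J K Δ + towerNorm J K V)) := by ring
      _ ≤ 1 := hsm
  have q3 : 24 * expConst Γ K ^ 3 * (N ^ 2 * towerNorm J K V) ≤ 1 := by
    calc _ ≤ 24 * expConst Γ K ^ 4 * (N ^ 7 * (towerNorm J K Δ + towerNorm J K V)) := by
          gcongr
          · norm_num
          · linarith
      _ ≤ 1 := hsm
  have key := bootstrap_le hC hN (norm_nonneg Θ) (norm_nonneg Θs) hT0 hv0 (norm_nonneg _) hδ hr h1 h2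
    q1 q2 q3
  have c1 := towerNorm_add_le hn J K (Θs • Bs) (invQ D.S D.M β βs Q)
  rw [← x.E_eq] at c1
  have c2 : ‖Θs‖ * (2 * Γ * (K + 1)) ≤ ‖Θs‖ * expConst Γ K := by gcongr
  have c3 : towerNorm J K E ≤ expConst Γ K * (‖Θs‖ + N * ‖Θ‖ * towerNorm J K T + N * towerNorm J K T ^ 2) := by
    linarith
  refine c3.trans ((mul_le_mul_of_nonneg_left key (by linarith)).trans (le_of_eq (by ring)))

end Expansion
end Data

/-! ### The cubic equation -/

theorem mul_sq_le_cubes {k a b : ℝ} (hk : 0 < k) (hk1 : k ≤ 1) (ha : 0 ≤ a) (hb : 0 ≤ b) :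
    a * b ^ 2 ≤ k * a ^ 3 + k⁻¹ ^ 2 * b ^ 3 := by
  have hki : 1 ≤ k⁻¹ := (one_le_inv₀ hk).2 hk1
  rcases le_total b (k * a) with h | h
  · have h1 : a * b ^ 2 ≤ a * (k * a) ^ 2 := by gcongr
    have h2 : k ^ 2 * a ^ 3 ≤ k * a ^ 3 := by
      have : k ^ 2 ≤ k := pow_le_of_le_one hk.le hk1 two_ne_zero
      gcongr
    have h3 : 0 ≤ k⁻¹ ^ 2 * b ^ 3 := by positivity
    linarith
  · have h0 : a ≤ k⁻¹ * b := by
      rw [le_inv_mul_iff₀ hk]; exact h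
    have h1 : a * b ^ 2 ≤ k⁻¹ * b * b ^ 2 := by gcongr
    have h2 : k⁻¹ * b ^ 3 ≤ k⁻¹ ^ 2 * b ^ 3 := by
      have : k⁻¹ ≤ k⁻¹ ^ 2 := le_self_pow₀ hki two_ne_zero
      gcongr
    have h3 : 0 ≤ k * a ^ 3 := by positivity
    linarith

theorem sq_mul_le_cubes {k a b : ℝ} (hk : 0 < k) (ha : 0 ≤ a) (hb : 0 ≤ b) :
    a ^ 2 * b ≤ k * a ^ 3 + k⁻¹ ^ 2 * b ^ 3 := by
  rcases le_total b (k * a) with h | h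
  · have h1 : a ^ 2 * b ≤ a ^ 2 * (k * a) := by gcongr
    have h3 : 0 ≤ k⁻¹ ^ 2 * b ^ 3 := by positivity
    linarith
  · have h0 : a ≤ k⁻¹ * b := by
      rw [le_inv_mul_iff₀ hk]; exact h
    have h1 : a ^ 2 * b ≤ (k⁻¹ * b) ^ 2 * b := by gcongr
    have h3 : 0 ≤ k * a ^ 3 := by positivity
    linarith

theorem sq_add_three_le (a b c : ℝ) : (a + b + c) ^ 2 ≤ 3 * (a ^ 2 + b ^ 2 + c ^ 2) := by
  nlinarith [sq_nonneg (a - b), sq_nonneg (b - c), sq_nonneg (a - c)]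

/-- Absorption of the error terms of the cubic equation into its three coefficients. -/
theorem absorb_le {k N θ v p q δ ρ e Φ : ℝ} (hk : 0 < k) (hk1 : k ≤ 1) (hN : 1 ≤ N) (hθ : 0 ≤ θ)
    (hv : 0 ≤ v) (hp : 0 ≤ p) (hq : 0 ≤ q) (hδ : 0 ≤ δ) (hρ : 0 ≤ ρ) (he : 0 ≤ e) (heδ : e ≤ δ)
    (hδ1 : δ ≤ 1) (hρ1 : ρ ≤ 1) (hp1 : p ≤ 1) (hNθ : N ^ 7 * θ ≤ k) (hNv : N ^ 7 * v ≤ k)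
    (hΦ : Φ = δ * θ + p ^ 2 + (ρ + e) * θ ^ 2 + N ^ 2 * θ * v + N * θ ^ 3 + N ^ 3 * v ^ 2) :
    θ * Φ + θ ^ 4 + Φ ^ 2 + N * v * θ ^ 2 + N * v * Φ + θ * q ^ 2
      ≤ 50 * k * (θ ^ 3 + ρ * θ ^ 2 + δ * θ) + 20 * k⁻¹ ^ 2 * (N ^ 6 * v ^ 3 + p ^ 3 + q ^ 3) := by
  have hN0 : 0 < N := by linarith
  have hki : 1 ≤ k⁻¹ ^ 2 := one_le_pow₀ ((one_le_inv₀ hk).2 hk1)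
  have pN : ∀ {i j : ℕ}, i ≤ j → N ^ i ≤ N ^ j := fun h => pow_le_pow_right₀ hN h
  have t1 : N * θ ≤ k := by
    refine le_trans ?_ hNθ
    gcongr
    exact le_self_pow₀ hN (by norm_num)
  have t0 : θ ≤ k := by
    have : 1 * θ ≤ N * θ := by gcongr
    linarith
  have t01 : θ ≤ 1 := t0.trans hk1
  have v2 : N ^ 2 * v ≤ k := by
    refine le_trans ?_ hNv
    have := pN (by norm_num : 2 ≤ 7)
    gcongr
  have v1 : N * v ≤ k := by
    refine le_trans ?_ v2
    gcongr
    exact le_self_pow₀ hN (by norm_num)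
  have v0 : v ≤ k := by
    have : 1 * v ≤ N * v := by gcongr
    linarith
  obtain ⟨S, hS⟩ : ∃ S, S = N ^ 6 * v ^ 3 := ⟨_, rfl⟩
  have hS0 : 0 ≤ S := by rw [hS]; positivity
  have y1 := mul_sq_le_cubes hk hk1 hθ hp
  have y2 := mul_sq_le_cubes hk hk1 hθ hq
  have y3 := sq_mul_le_cubes hk hθ (by positivity : 0 ≤ N ^ 2 * v)
  have y4 := mul_sq_le_cubes hk hk1 hθ (by positivity : 0 ≤ N ^ 2 * v)
  have y5 := mul_sq_le_cubes one_pos le_rfl (by positivity : 0 ≤ N * v) hp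
  have eS : (N ^ 2 * v) ^ 3 = S := by rw [hS]; ring
  rw [eS] at y3 y4
  -- the basic monomials
  have m1 : δ * θ ^ 2 ≤ k * (δ * θ) := by
    have : θ * (δ * θ) ≤ k * (δ * θ) := by gcongr
    linarith
  have m2 : ρ * θ ^ 3 ≤ k * (ρ * θ ^ 2) := by
    have : θ * (ρ * θ ^ 2) ≤ k * (ρ * θ ^ 2) := by gcongr
    linarith
  have m3 : e * θ ^ 3 ≤ k * (δ * θ) := by
    have h1 : θ * (e * θ ^ 2) ≤ k * (δ * θ) := by
      have : θ ^ 2 ≤ θ := pow_le_of_le_one hθ t01 two_ne_zero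
      gcongr
    linarith
  have m4 : N * θ ^ 4 ≤ k * θ ^ 3 := by
    have : N * θ * θ ^ 3 ≤ k * θ ^ 3 := by gcongr
    linarith
  have m5 : θ ^ 4 ≤ k * θ ^ 3 := by
    have : θ * θ ^ 3 ≤ k * θ ^ 3 := by gcongr
    linarith
  have m6 : N ^ 3 * θ * v ^ 2 ≤ θ * (N ^ 2 * v) ^ 2 := by
    have h1 : N ^ 3 * (θ * v ^ 2) ≤ N ^ 4 * (θ * v ^ 2) := by
      have := pN (by norm_num : 3 ≤ 4)
      gcongr
    linarith
  have m7 : N * v * θ ^ 2 ≤ θ ^ 2 * (N ^ 2 * v) := by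
    have h1 : N * (v * θ ^ 2) ≤ N ^ 2 * (v * θ ^ 2) := by
      have : N ≤ N ^ 2 := le_self_pow₀ hN two_ne_zero
      gcongr
    linarith
  have m8 : N * v * (δ * θ) ≤ k * (δ * θ) := by gcongr
  have m9 : N ^ 3 * v ^ 3 ≤ S := by
    rw [hS]
    have := pN (by norm_num : 3 ≤ 6)
    gcongr
  have m10 : N * v * ((ρ + e) * θ ^ 2) ≤ 2 * (θ ^ 2 * (N ^ 2 * v)) := by
    have h1 : (ρ + e) * (N * v * θ ^ 2) ≤ 2 * (N * v * θ ^ 2) := by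
      gcongr
      linarith
    linarith
  have m11 : N ^ 2 * v * θ ^ 3 ≤ k * θ ^ 3 := by gcongr
  have m12 : N ^ 4 * v ^ 3 ≤ S := by
    rw [hS]
    have := pN (by norm_num : 4 ≤ 6)
    gcongr
  have m13 : (δ * θ) ^ 2 ≤ k * (δ * θ) := by
    have h1 : δ * θ * (δ * θ) ≤ 1 * k * (δ * θ) := by gcongr
    linarith
  have m14 : (p ^ 2) ^ 2 ≤ p ^ 3 := by
    rw [← pow_mul]; exact pow_le_pow_of_le_one hp hp1 (by norm_num)
  have m15 : ((ρ + e) * θ ^ 2) ^ 2 ≤ 4 * (k * θ ^ 3) := by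
    have h1 : (ρ + e) ^ 2 * θ ^ 4 ≤ 2 ^ 2 * (k * θ ^ 3) := by
      gcongr
      linarith
    linarith
  have m16 : (N ^ 2 * θ * v) ^ 2 ≤ θ ^ 2 * (N ^ 2 * v) := by
    have h1 : N ^ 2 * v * (θ ^ 2 * (N ^ 2 * v)) ≤ 1 * (θ ^ 2 * (N ^ 2 * v)) := by
      gcongr
      linarith
    linarith
  have m17 : (N * θ ^ 3) ^ 2 ≤ k * θ ^ 3 := by
    have h1 : (N * θ) * (N * θ) * (θ * θ ^ 3) ≤ 1 * 1 * (k * θ ^ 3) := by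
      gcongr
      · linarith
      · linarith
    linarith
  have m18 : (N ^ 3 * v ^ 2) ^ 2 ≤ S := by
    have h1 : v * (N ^ 6 * v ^ 3) ≤ 1 * (N ^ 6 * v ^ 3) := by
      gcongr
      linarith
    rw [hS]
    linarith
  have hsq : Φ ^ 2 ≤ 6 * ((δ * θ) ^ 2 + (p ^ 2) ^ 2 + ((ρ + e) * θ ^ 2) ^ 2 + (N ^ 2 * θ * v) ^ 2
      + (N * θ ^ 3) ^ 2 + (N ^ 3 * v ^ 2) ^ 2) := by
    have h1 := sq_add_three_le (δ * θ) (p ^ 2) ((ρ + e) * θ ^ 2)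
    have h2 := sq_add_three_le (N ^ 2 * θ * v) (N * θ ^ 3) (N ^ 3 * v ^ 2)
    have h3 := sq_nonneg ((δ * θ + p ^ 2 + (ρ + e) * θ ^ 2) - (N ^ 2 * θ * v + N * θ ^ 3 + N ^ 3 * v ^ 2))
    rw [hΦ]
    linarith
  have f1 : θ * Φ = δ * θ ^ 2 + θ * p ^ 2 + ρ * θ ^ 3 + e * θ ^ 3 + θ ^ 2 * (N ^ 2 * v) + N * θ ^ 4
      + N ^ 3 * θ * v ^ 2 := by rw [hΦ]; ring
  have f2 : N * v * Φ = N * v * (δ * θ) + N * v * p ^ 2 + N * v * ((ρ + e) * θ ^ 2)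
      + N ^ 3 * θ * v ^ 2 + N ^ 2 * v * θ ^ 3 + N ^ 4 * v ^ 3 := by rw [hΦ]; ring
  have g1 : 1 * S ≤ k⁻¹ ^ 2 * S := by gcongr
  have g2 : 1 * p ^ 3 ≤ k⁻¹ ^ 2 * p ^ 3 := by gcongr
  have g3 : 0 ≤ k⁻¹ ^ 2 * q ^ 3 := by positivity
  have g4 : 0 ≤ k * θ ^ 3 := by positivity
  have g5 : 0 ≤ k * (ρ * θ ^ 2) := by positivity
  have g6 : 0 ≤ k * (δ * θ) := by positivity
  have g7 : 0 ≤ k⁻¹ ^ 2 * p ^ 3 := by positivity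
  have g8 : 0 ≤ k⁻¹ ^ 2 * S := by positivity
  have e5 : (1 : ℝ)⁻¹ ^ 2 = 1 := by norm_num
  rw [e5] at y5
  have e6 : (N * v) ^ 3 = N ^ 3 * v ^ 3 := by ring
  rw [e6] at y5
  rw [f1, f2, ← hS]
  clear hΦ f1 f2
  have A1 : k * (δ * θ) = k * δ * θ := by ring
  linarith

theorem exists_split {e : ℂ} {a b : ℝ} (ha : 0 ≤ a) (hb : 0 ≤ b) (h : ‖e‖ ≤ a + b) :
    ∃ e₁ e₂ : ℂ, e = e₁ + e₂ ∧ ‖e₁‖ ≤ a ∧ ‖e₂‖ ≤ b := by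
  rcases (add_nonneg ha hb).eq_or_lt with h0 | h0
  · rw [← h0] at h
    have : e = 0 := norm_eq_zero.1 (le_antisymm h (norm_nonneg _))
    exact ⟨0, 0, by simp [this], by simpa using ha, by simpa using hb⟩
  · have h1 : (((a + b : ℝ)) : ℂ) ≠ 0 := by exact_mod_cast h0.ne'
    have h2 : ‖e‖ * (a + b)⁻¹ ≤ 1 := by rw [← div_eq_mul_inv]; exact (div_le_one h0).2 h
    refine ⟨e * ((a + b : ℝ) : ℂ)⁻¹ * a, e * ((a + b : ℝ) : ℂ)⁻¹ * b, ?_, ?_, ?_⟩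
    · have : ((a : ℂ) + b) = ((a + b : ℝ) : ℂ) := by push_cast; ring
      rw [← mul_add, this, mul_assoc, inv_mul_cancel₀ h1, mul_one]
    · rw [norm_mul, norm_mul, norm_inv, norm_real, norm_real, norm_of_nonneg h0.le,
        norm_of_nonneg ha]
      exact mul_le_of_le_one_left ha h2
    · rw [norm_mul, norm_mul, norm_inv, norm_real, norm_real, norm_of_nonneg h0.le,
        norm_of_nonneg hb]
      exact mul_le_of_le_one_left hb h2

theorem exists_factor {e y : ℂ} {k : ℝ} (hk : 0 ≤ k) (h : ‖e‖ ≤ k * ‖y‖) :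
    ∃ x : ℂ, e = x * y ∧ ‖x‖ ≤ k := by
  rcases eq_or_ne y 0 with hy | hy
  · rw [hy, norm_zero, mul_zero] at h
    exact ⟨0, by rw [zero_mul]; exact norm_eq_zero.1 (le_antisymm h (norm_nonneg _)), by simpa using hk⟩
  · refine ⟨e / y, (div_mul_cancel₀ e hy).symm, ?_⟩
    rw [norm_div]
    exact div_le_of_le_mul₀ (norm_nonneg _) hk h

theorem exists_coefficients {e y₁ y₂ y₃ : ℂ} {k S : ℝ} (hk : 0 ≤ k) (hS : 0 ≤ S)
    (h : ‖e‖ ≤ k * (‖y₁‖ + ‖y₂‖ + ‖y₃‖) + S) :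
    ∃ x₁ x₂ x₃ d : ℂ, e = x₁ * y₁ + x₂ * y₂ + x₃ * y₃ + d ∧ ‖x₁‖ ≤ k ∧ ‖x₂‖ ≤ k ∧ ‖x₃‖ ≤ k
      ∧ ‖d‖ ≤ S := by
  have h1 := mul_nonneg hk (norm_nonneg y₁)
  have h2 := mul_nonneg hk (norm_nonneg y₂)
  have h3 := mul_nonneg hk (norm_nonneg y₃)
  rw [mul_add, mul_add] at h
  obtain ⟨e', d, he, he', hd⟩ := exists_split (by positivity) hS h
  obtain ⟨e'', e₃, he2, he2', hd3⟩ := exists_split (by positivity) h3 he'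
  obtain ⟨e₁, e₂, he3, hd1, hd2⟩ := exists_split h1 h2 he2'
  obtain ⟨x₁, hx₁, hx₁'⟩ := exists_factor hk hd1
  obtain ⟨x₂, hx₂, hx₂'⟩ := exists_factor hk hd2
  obtain ⟨x₃, hx₃, hx₃'⟩ := exists_factor hk hd3
  exact ⟨x₁, x₂, x₃, d, by rw [he, he2, he3, hx₁, hx₂, hx₃], hx₁', hx₂', hx₃', hd⟩

theorem rpow_three_halves {r : ℝ} (hr : 0 ≤ r) : r ^ ((3 : ℝ) / 2) = Real.sqrt r ^ 3 := by
  rw [Real.sqrt_eq_rpow, ← Real.rpow_natCast, ← Real.rpow_mul hr]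
  norm_num

namespace Data

variable {D : Data n} {Γ : ℝ} {J : ℕ → Set (Vec n)} {K : ℕ}
  {β βs : ℂ} {B Bs : Mat n} {l ls : Idx n → ℂ} {V Δ T E Q : Mat n} {Θ Θs : ℂ}

/-- The leading coefficients in the cubic equation. -/
def cubicCoeff (D : Data n) (β βs : ℂ) (B : Mat n) (l : Idx n → ℂ) : ℂ :=
  hs (diagonal l) (D.quad B (invQ D.S D.M β βs (D.quad B B)))
    + hs (diagonal l) (D.quad (invQ D.S D.M β βs (D.quad B B)) B)

/-- The error term in the cubic equation. -/
def cubicError (D : Data n) (l : Idx n → ℂ) (B E H Y : Mat n) (Θ r : ℂ) : ℂ :=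
  Θ * (hs (diagonal l) (D.quad B E) + hs (diagonal l) (D.quad E B))
    + hs (diagonal l) (D.quad H H) - hs (diagonal l) (D.quad H Y)
    - hs (diagonal l) (D.quad Y H) - Θ * r

namespace Expansion

theorem cubic_identity (x : D.Expansion β βs B Bs l V Δ T E Q Θ Θs) {r : ℂ}
    (hr : r = hs (diagonal l) (D.quad B (invQ D.S D.M β βs (D.M * V)))
      + hs (diagonal l) (D.quad (invQ D.S D.M β βs (D.M * V)) B)) :
    cubicCoeff D β βs B l * Θ ^ 3 + hs (diagonal l) (D.quad B B) * Θ ^ 2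
      - β * (Θ * hs (diagonal l) B)
      + cubicError D l B E (E + Θ ^ 2 • invQ D.S D.M β βs (D.quad B B))
        (invQ D.S D.M β βs (D.M * V)) Θ r
    = hs (diagonal l) (D.M * V) - hs (diagonal l)
      (D.quad (invQ D.S D.M β βs (D.M * V)) (invQ D.S D.M β βs (D.M * V))) := by
  have hT : T = E + Θ ^ 2 • invQ D.S D.M β βs (D.quad B B) - invQ D.S D.M β βs (D.M * V) := by
    rw [x.T_eq]; abel
  rw [x.cubic, x.sub_eq, hT, hr, cubicCoeff, cubicError]
  generalize invQ D.S D.M β βs (D.M * V) = Y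
  generalize invQ D.S D.M β βs (D.quad B B) = Z
  simp only [sub_eq_add_neg, ← neg_one_smul ℂ Y, quad_add_left, quad_add_right, quad_smul_left,
    quad_smul_right, hs_add_right, hs_smul_right]
  ring

theorem norm_cubicError_le (_x : D.Expansion β βs B Bs l V Δ T E Q Θ Θs) (t : D.Tower J)
    (s : D.Setup Γ β βs B Bs l ls) (hK : 0 < K) {N X : ℝ} (hNe : N = (n : ℝ) ^ ((2 : ℝ) / K))
    (hX : towerNorm J K E ≤ X) (r : ℂ) :
    ‖cubicError D l B E (E + Θ ^ 2 • invQ D.S D.M β βs (D.quad B B))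
        (invQ D.S D.M β βs (D.M * V)) Θ r‖
      ≤ 2 * expConst Γ K ^ 3 * (‖Θ‖ * X + ‖Θ‖ ^ 4 + X ^ 2 + N * towerNorm J K V * ‖Θ‖ ^ 2
        + N * towerNorm J K V * X + ‖Θ‖ * ‖r‖) := by
  have hΓ := s.Γ_pos
  have hn := s.reg.n_pos
  have hk1 := s.one_le
  have hC := one_le_expConst s.one_le K
  have hN : 1 ≤ N := by rw [hNe]; exact one_le_rpow_two_div hn K
  have hv0 := towerNorm_nonneg J K V
  have hE0 := towerNorm_nonneg J K E
  have hX0 := hE0.trans hX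
  have hY := t.towerNorm_invQ_M_mul_le s hK V
  have hZ := s.towerNorm_invQ_quad_B_B_le J K
  have hB : towerNorm J K B ≤ expConst Γ K := (s.towerNorm_B_le J K).trans (by
    have := le_expConst s.one_le K (a := 6) (by norm_num) (by norm_num : 2 ≤ 30)
      (by norm_num : 1 ≤ 3)
    rwa [pow_one] at this)
  have h8 : 8 * Γ ^ 3 ≤ expConst Γ K := by
    have := le_expConst s.one_le K (a := 8) (by norm_num) (by norm_num : 3 ≤ 30) (Nat.zero_le 3)
    rwa [pow_zero, mul_one] at this
  rw [← hNe] at hY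
  obtain ⟨C, hCe⟩ : ∃ C, C = expConst Γ K := ⟨_, rfl⟩
  obtain ⟨v, hve⟩ : ∃ v, v = towerNorm J K V := ⟨_, rfl⟩
  obtain ⟨θ, hθe⟩ : ∃ θ, θ = ‖Θ‖ := ⟨_, rfl⟩
  have hθ0 : 0 ≤ θ := by rw [hθe]; exact norm_nonneg _
  obtain ⟨Y, hYe⟩ : ∃ Y, Y = invQ D.S D.M β βs (D.M * V) := ⟨_, rfl⟩
  obtain ⟨H, hHe⟩ : ∃ H, H = E + Θ ^ 2 • invQ D.S D.M β βs (D.quad B B) := ⟨_, rfl⟩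
  have hH : towerNorm J K H ≤ X + C * θ ^ 2 := by
    rw [hHe]
    refine (towerNorm_add_le hn J K _ _).trans (add_le_add hX ((towerNorm_smul_le hn J K _ _).trans ?_))
    rw [norm_pow, ← hθe, mul_comm, hCe]
    gcongr
  rw [← hYe, ← hHe, ← hCe, ← hve, ← hθe]
  rw [← hYe, ← hCe, ← hve] at hY
  rw [← hCe] at hB h8 hC
  have hv0' : 0 ≤ v := by rw [hve]; exact hv0
  have hC0 : 0 < C := by linarith
  have hb : ∀ {A A' : Mat n} {a a' : ℝ}, towerNorm J K A ≤ a → towerNorm J K A' ≤ a' →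
      ‖hs (diagonal l) (D.quad A A')‖ ≤ C * (a * a') := fun {A A' a a'} h1 h2 => by
    refine (t.norm_hs_l_quad_le s hK A A').trans ?_
    have := towerNorm_nonneg J K A
    have := towerNorm_nonneg J K A'
    have ha : 0 ≤ a := by linarith
    gcongr
  have b1 := hb hB hX
  have b2 := hb hX hB
  have b3 := hb hH hH
  have b4 := hb hH hY
  have b5 := hb hY hH
  have g1 : ‖Θ * (hs (diagonal l) (D.quad B E) + hs (diagonal l) (D.quad E B))‖
      ≤ θ * (C * (C * X) + C * (X * C)) := by
    rw [norm_mul, ← hθe]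
    have := norm_add_le (hs (diagonal l) (D.quad B E)) (hs (diagonal l) (D.quad E B))
    gcongr
    linarith
  have g2 : ‖Θ * r‖ = θ * ‖r‖ := by rw [norm_mul, ← hθe]
  have key : ‖cubicError D l B E H Y Θ r‖ ≤ θ * (C * (C * X) + C * (X * C))
      + C * ((X + C * θ ^ 2) * (X + C * θ ^ 2)) + C * ((X + C * θ ^ 2) * (C * (N * v)))
      + C * (C * (N * v) * (X + C * θ ^ 2)) + θ * ‖r‖ := by
    unfold cubicError
    refine (norm_sub_le _ _).trans (add_le_add ((norm_sub_le _ _).trans (add_le_add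
      ((norm_sub_le _ _).trans (add_le_add ((norm_add_le _ _).trans (add_le_add g1 b3)) b4)) b5))
      g2.le)
  refine key.trans ?_
  have c1 : C ≤ C ^ 3 := le_self_pow₀ hC (by norm_num)
  have c2 : C ^ 2 ≤ C ^ 3 := pow_le_pow_right₀ hC (by norm_num)
  have c3 : 1 ≤ C ^ 3 := one_le_pow₀ hC
  have d1 : C ^ 2 * (θ * X) ≤ C ^ 3 * (θ * X) := by gcongr
  have d2 : C * (X + C * θ ^ 2) ^ 2 ≤ 2 * (C * X ^ 2) + 2 * (C ^ 3 * θ ^ 4) := by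
    have : 0 ≤ C * (X - C * θ ^ 2) ^ 2 := by positivity
    linarith
  have d3 : C * X ^ 2 ≤ C ^ 3 * X ^ 2 := by gcongr
  have d4 : C ^ 2 * (N * v * X) ≤ C ^ 3 * (N * v * X) := by gcongr
  have d5 : 1 * (θ * ‖r‖) ≤ C ^ 3 * (θ * ‖r‖) := by gcongr
  have d6 : 0 ≤ C ^ 3 * (θ * ‖r‖) := by positivity
  linarith

end Expansion

theorem Regular.cubicMass_upper (h : D.Regular Γ) : D.cubicMass ≤ Γ ^ 4 := by
  have h2 : ‖(D.cubicMass : ℂ)‖ ≤ Γ ^ 4 := by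
    unfold cubicMass
    push_cast
    refine norm_average_le h.n_pos fun a => ?_
    rw [norm_pow]
    calc _ ≤ (Γ ^ 2) ^ 2 := by
          have := h.norm_lead_le a
          gcongr
      _ = _ := by ring
  rw [norm_real, Real.norm_eq_abs] at h2
  exact (le_abs_self _).trans h2

theorem Tower.norm_hs_matR₁_le (t : D.Tower J) (s : D.Setup Γ β βs B Bs l ls) (hK : 0 < K) (V : Mat n) :
    ‖hs (matR₁ D.S D.M β βs) V‖ ≤ expConst Γ K * towerNorm J K V := by
  have hΓ := s.Γ_pos
  rw [Setup.hs_matR₁, Eminus_eq_sgn, hs_diagonal_eq]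
  refine (norm_dpair_le s.reg.n_pos (c := 1) (fun a => ?_) (s.diag_invQ_le fun a =>
    s.reg.norm_M_mul_apply_le (t.entry_le s.reg hK V) a a)).trans ?_
  · rw [norm_real, Real.norm_eq_abs, abs_sgn]
  · have := le_expConst s.one_le K (a := 198 * 4) (by norm_num) (by norm_num : 14 ≤ 30) (Nat.zero_le 3)
    rw [pow_zero, mul_one] at this
    have h0 := towerNorm_nonneg J K V
    calc _ = 198 * 4 * Γ ^ 14 * towerNorm J K V := by ring
      _ ≤ _ := by gcongr

/-- The threshold below which the solutions are close to each other. -/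
def smallConst (Γ : ℝ) (K : ℕ) : ℝ := (8 * Γ ^ 4)⁻¹ / (250000 * expConst Γ K ^ 11)

theorem smallConst_pos {Γ : ℝ} (hΓ : 1 ≤ Γ) (K : ℕ) : 0 < smallConst Γ K := by
  have := one_le_expConst hΓ K
  unfold smallConst
  positivity

theorem smallConst_le_one {Γ : ℝ} (hΓ : 1 ≤ Γ) (K : ℕ) : smallConst Γ K ≤ 1 := by
  have h1 := one_le_expConst hΓ K
  unfold smallConst
  refine div_le_one_of_le₀ ?_ (by positivity)
  have h2 : (8 * Γ ^ 4)⁻¹ ≤ 1 := inv_le_one_of_one_le₀ (by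
    have : 1 ≤ Γ ^ 4 := one_le_pow₀ hΓ
    linarith)
  have h3 : 1 ≤ expConst Γ K ^ 11 := one_le_pow₀ h1
  linarith

namespace Expansion

theorem norm_cubicError_le_absorbed (x : D.Expansion β βs B Bs l V Δ T E Q Θ Θs) (t : D.Tower J)
    (s : D.Setup Γ β βs B Bs l ls) (hK : 0 < K) {N : ℝ} (hNe : N = (n : ℝ) ^ ((2 : ℝ) / K))
    (hsm : 24 * expConst Γ K ^ 4 * (N ^ 7 * (towerNorm J K Δ + towerNorm J K V)) ≤ smallConst Γ K)
    (r : ℂ) : ‖cubicError D l B E (E + Θ ^ 2 • invQ D.S D.M β βs (D.quad B B))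
        (invQ D.S D.M β βs (D.M * V)) Θ r‖
      ≤ (8 * Γ ^ 4)⁻¹ * (‖Θ‖ ^ 3 + D.ρ * ‖Θ‖ ^ 2 + D.del * ‖Θ‖)
        + 10 ^ 5 * expConst Γ K ^ 11 * (smallConst Γ K)⁻¹ ^ 2 * (N ^ 6 * towerNorm J K V ^ 3
          + ‖hs (matR₁ D.S D.M β βs) V‖ ^ ((3 : ℝ) / 2) + ‖r‖ ^ ((3 : ℝ) / 2)) := by
  have hΓ := s.Γ_pos
  have hk0 := smallConst_pos s.one_le K
  have hk1 := smallConst_le_one s.one_le K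
  have hC := one_le_expConst s.one_le K
  have hN : 1 ≤ N := by rw [hNe]; exact one_le_rpow_two_div s.reg.n_pos K
  have hE := x.towerNorm_E_le t s hK hNe (hsm.trans hk1)
  have hM := x.norm_cubicError_le t s hK hNe hE r
  have hx0 := towerNorm_nonneg J K Δ
  have hv0 := towerNorm_nonneg J K V
  have hN7 : 0 ≤ N ^ 7 := by positivity
  have hθ : N ^ 7 * ‖Θ‖ ≤ smallConst Γ K := by
    refine le_trans ?_ hsm
    calc _ ≤ N ^ 7 * (expConst Γ K * towerNorm J K Δ) := by
          have := x.norm_coeff_le' t s hK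
          gcongr
      _ = 1 * expConst Γ K * (N ^ 7 * (towerNorm J K Δ + 0)) := by ring
      _ ≤ _ := by
          have : expConst Γ K ≤ expConst Γ K ^ 4 := le_self_pow₀ hC (by norm_num)
          gcongr
          norm_num
  have hvs : expConst Γ K * (N ^ 7 * towerNorm J K V) ≤ smallConst Γ K := by
    refine le_trans ?_ hsm
    calc _ = 1 * expConst Γ K * (N ^ 7 * (0 + towerNorm J K V)) := by ring
      _ ≤ _ := by
          have : expConst Γ K ≤ expConst Γ K ^ 4 := le_self_pow₀ hC (by norm_num)
          gcongr
          norm_num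
  have hN7v : 0 ≤ N ^ 7 * towerNorm J K V := by positivity
  have hv : N ^ 7 * towerNorm J K V ≤ smallConst Γ K := by
    refine le_trans ?_ hvs
    exact le_mul_of_one_le_left hN7v hC
  have hp1 : Real.sqrt ‖hs (matR₁ D.S D.M β βs) V‖ ≤ 1 := by
    rw [Real.sqrt_le_one]
    refine (t.norm_hs_matR₁_le s hK V).trans (le_trans ?_ (hvs.trans hk1))
    have : 1 ≤ N ^ 7 := one_le_pow₀ hN
    gcongr
    exact le_mul_of_one_le_left hv0 this
  have e1 := Real.sq_sqrt (norm_nonneg (hs (matR₁ D.S D.M β βs) V))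
  have e2 := Real.sq_sqrt (norm_nonneg r)
  obtain ⟨Φ, hΦ⟩ : ∃ Φ, Φ = D.del * ‖Θ‖ + ‖hs (matR₁ D.S D.M β βs) V‖ + D.rad * ‖Θ‖ ^ 2
      + N ^ 2 * ‖Θ‖ * towerNorm J K V + N * ‖Θ‖ ^ 3 + N ^ 3 * towerNorm J K V ^ 2 := ⟨_, rfl⟩
  have hΦ0 : 0 ≤ Φ := by
    have := s.reg.del_pos
    have := s.reg.del_le_rad
    have : 0 ≤ D.rad := by linarith
    rw [hΦ]; positivity
  have key := absorb_le hk0 hk1 hN (norm_nonneg Θ) hv0 (Real.sqrt_nonneg _) (Real.sqrt_nonneg _)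
    s.reg.del_pos.le s.reg.ρ_pos.le s.reg.η_div_pos.le (Regular.η_div_le D)
    (s.reg.del_le.trans (by norm_num)) s.reg.ρ_le_one hp1 hθ hv (q := Real.sqrt ‖r‖) (Φ := Φ) (by
      rw [e1, hΦ]; rfl)
  rw [e2, ← rpow_three_halves (norm_nonneg _), ← rpow_three_halves (norm_nonneg _)] at key
  rw [← hΦ] at hM
  refine hM.trans ?_
  obtain ⟨S, hS⟩ : ∃ S, S = N ^ 6 * towerNorm J K V ^ 3
    + ‖hs (matR₁ D.S D.M β βs) V‖ ^ ((3 : ℝ) / 2) + ‖r‖ ^ ((3 : ℝ) / 2) := ⟨_, rfl⟩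
  rw [← hS] at key ⊢
  obtain ⟨C, hCe⟩ : ∃ C, C = expConst Γ K := ⟨_, rfl⟩
  have e3 : 250000 * C ^ 11 * smallConst Γ K = (8 * Γ ^ 4)⁻¹ := by
    rw [smallConst, ← hCe]
    have : C ≠ 0 := by rw [hCe]; linarith
    field_simp
  rw [← hCe] at hC ⊢
  generalize smallConst Γ K = k at *
  generalize towerNorm J K V = v at *
  have hθ0 := norm_nonneg Θ
  have hr0 := norm_nonneg r
  generalize ‖Θ‖ = θ at *
  generalize ‖r‖ = q at *
  have hA : 1 ≤ 50 * C ^ 4 := by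
    have : 1 ≤ C ^ 4 := one_le_pow₀ hC
    linarith
  obtain ⟨A, hAe⟩ : ∃ A, A = 50 * C ^ 4 := ⟨_, rfl⟩
  have hAA : A ≤ A ^ 2 := le_self_pow₀ (by rw [hAe]; exact hA) two_ne_zero
  have hA2 : 1 ≤ A ^ 2 := one_le_pow₀ (by rw [hAe]; exact hA)
  rw [← hAe]
  have p1 : θ * (A * Φ) ≤ A ^ 2 * (θ * Φ) := by
    have : A * (θ * Φ) ≤ A ^ 2 * (θ * Φ) := by gcongr
    linarith
  have p2 : 1 * θ ^ 4 ≤ A ^ 2 * θ ^ 4 := by gcongr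
  have p3 : 1 * (N * v * θ ^ 2) ≤ A ^ 2 * (N * v * θ ^ 2) := by gcongr
  have p4 : N * v * (A * Φ) ≤ A ^ 2 * (N * v * Φ) := by
    have : A * (N * v * Φ) ≤ A ^ 2 * (N * v * Φ) := by gcongr
    linarith
  have p5 : 1 * (θ * q) ≤ A ^ 2 * (θ * q) := by gcongr
  calc 2 * C ^ 3 * (θ * (A * Φ) + θ ^ 4 + (A * Φ) ^ 2 + N * v * θ ^ 2 + N * v * (A * Φ) + θ * q)
      ≤ 2 * C ^ 3 * (A ^ 2 * (θ * Φ + θ ^ 4 + Φ ^ 2 + N * v * θ ^ 2 + N * v * Φ + θ * q)) := by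
        gcongr
        linarith
    _ ≤ 2 * C ^ 3 * (A ^ 2 * (50 * k * (θ ^ 3 + D.ρ * θ ^ 2 + D.del * θ) + 20 * k⁻¹ ^ 2 * S)) := by
        gcongr
    _ = 250000 * C ^ 11 * k * (θ ^ 3 + D.ρ * θ ^ 2 + D.del * θ) + 10 ^ 5 * C ^ 11 * k⁻¹ ^ 2 * S := by
        rw [hAe]; ring
    _ = _ := by rw [e3]

end Expansion
end Data

theorem inv_mul_le_norm_div {num den : ℂ} {p t a : ℝ} (hp : 0 ≤ p) (ht : 0 < t) (h1 : a * p ≤ ‖num‖)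
    (h2 : ‖den‖ ≤ 2 * t) (h0 : 0 < ‖den‖) (ha : t⁻¹ / 4 ≤ a) : (26 * t ^ 2)⁻¹ * p ≤ ‖num / den‖ := by
  rw [norm_div, le_div_iff₀ h0]
  refine le_trans ?_ h1
  calc (26 * t ^ 2)⁻¹ * p * ‖den‖ ≤ (26 * t ^ 2)⁻¹ * p * (2 * t) := by gcongr
    _ = (1 / 13) * t⁻¹ * p := by field_simp; ring
    _ ≤ a * p := by
      gcongr
      have : 0 < t⁻¹ := inv_pos.2 ht
      linarith

theorem norm_div_le_mul {num den : ℂ} {p t a : ℝ} (hp : 0 ≤ p) (ht : 0 < t) (h1 : ‖num‖ ≤ a * p)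
    (h2 : (2 * t)⁻¹ ≤ ‖den‖) (ha : a ≤ 13 * t) : ‖num / den‖ ≤ 26 * t ^ 2 * p := by
  have h0 : 0 < ‖den‖ := lt_of_lt_of_le (by positivity) h2
  rw [norm_div, div_le_iff₀ h0]
  refine h1.trans ?_
  calc a * p ≤ 13 * t * p := by gcongr
    _ = 26 * t ^ 2 * p * (2 * t)⁻¹ := by field_simp; ring
    _ ≤ _ := by gcongr

/-- Normalizing a perturbed cubic equation. -/
theorem exists_cubic_equation {t ψ ρ δ S : ℝ} {μ b w e g Θ : ℂ} (ht : 1 ≤ t) (hρ : 0 ≤ ρ)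
    (hδ : 0 ≤ δ) (hS : 0 ≤ S) (hψ : t⁻¹ ≤ ψ) (hψ' : ψ ≤ t)
    (h : μ * Θ ^ 3 + b * Θ ^ 2 - w * Θ + e = g) (hμ : ‖μ - ψ‖ ≤ t⁻¹ / 4)
    (hb : ‖b - 3 * I * ρ * ψ‖ * ‖Θ‖ ≤ t⁻¹ / 8 * δ)
    (hw : t⁻¹ / 2 * δ ≤ ‖w‖) (hw' : ‖w‖ ≤ 12 * t * δ)
    (he : ‖e‖ ≤ t⁻¹ / 8 * (‖Θ‖ ^ 3 + ρ * ‖Θ‖ ^ 2 + δ * ‖Θ‖) + S) :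
    ∃ ξ₂ ξ₁ εs : ℂ, Θ ^ 3 + ξ₂ * Θ ^ 2 + ξ₁ * Θ = εs ∧
      ((26 * t ^ 2)⁻¹ * ρ ≤ ‖ξ₂‖ ∧ ‖ξ₂‖ ≤ 26 * t ^ 2 * ρ) ∧
      ((26 * t ^ 2)⁻¹ * δ ≤ ‖ξ₁‖ ∧ ‖ξ₁‖ ≤ 26 * t ^ 2 * δ) ∧
      ‖εs‖ ≤ 2 * t * (‖g‖ + S) := by
  have ht0 : 0 < t := by linarith
  have hq0 : 0 < t⁻¹ := inv_pos.2 ht0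
  have hq1 : t⁻¹ ≤ 1 := inv_le_one_of_one_le₀ ht
  obtain ⟨x₁, x₂, x₃, d, hx, h1, h2, h3, hd⟩ :=
    exists_coefficients (e := e) (y₁ := Θ ^ 3) (y₂ := ρ * Θ ^ 2) (y₃ := δ * Θ)
      (k := t⁻¹ / 8) (S := S) (by positivity) hS (by
        simpa only [norm_mul, norm_pow, norm_real, norm_of_nonneg hρ,
          norm_of_nonneg hδ] using he)
  obtain ⟨ν, hν⟩ : ∃ ν, ν = μ + x₁ := ⟨_, rfl⟩
  have hψn : ‖(ψ : ℂ)‖ = ψ := by rw [norm_real, norm_of_nonneg (hq0.le.trans hψ)]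
  have e1 : ‖ν - ψ‖ ≤ t⁻¹ / 4 + t⁻¹ / 8 := by
    rw [hν, add_sub_right_comm]
    exact (norm_add_le _ _).trans (add_le_add hμ h1)
  have e2 := norm_sub_norm_le (ψ : ℂ) ν
  have e3 := norm_sub_norm_le ν (ψ : ℂ)
  rw [norm_sub_rev] at e2
  have hν1 : (2 * t)⁻¹ ≤ ‖ν‖ := by
    rw [mul_inv]; linarith
  have hν2 : ‖ν‖ ≤ 2 * t := by linarith
  have hν0 : 0 < ‖ν‖ := lt_of_lt_of_le (by positivity) hν1
  have hne : ν ≠ 0 := norm_pos_iff.1 hν0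
  obtain ⟨p, hp⟩ : ∃ p, p = 3 * I * ρ * ψ + x₂ * ρ := ⟨_, rfl⟩
  obtain ⟨r, hr⟩ : ∃ r, r = (b - 3 * I * ρ * ψ) * Θ - w + x₃ * δ := ⟨_, rfl⟩
  have a1 : ‖3 * I * ρ * (ψ : ℂ)‖ = 3 * ψ * ρ := by
    rw [norm_mul, norm_mul, norm_mul, hψn, norm_I, norm_real, norm_of_nonneg hρ]
    norm_num; ring
  have a2 : ‖x₂ * ρ‖ ≤ t⁻¹ / 8 * ρ := by
    rw [norm_mul, norm_real, norm_of_nonneg hρ]; gcongr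
  have a3 : ‖x₃ * δ‖ ≤ t⁻¹ / 8 * δ := by
    rw [norm_mul, norm_real, norm_of_nonneg hδ]; gcongr
  have a4 : ‖(b - 3 * I * ρ * ψ) * Θ‖ ≤ t⁻¹ / 8 * δ := by rwa [norm_mul]
  have a5 : t⁻¹ * ρ ≤ ψ * ρ := by gcongr
  have a6 : ψ * ρ ≤ t * ρ := by gcongr
  have a7 : t⁻¹ * ρ ≤ t * ρ := a5.trans a6
  have a8 : 0 ≤ t⁻¹ * ρ := by positivity
  have a9 : t⁻¹ * δ ≤ t * δ := by gcongr; linarith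
  have a10 : 0 ≤ t⁻¹ * δ := by positivity
  have p1 : t⁻¹ * ρ ≤ ‖p‖ := by
    have := norm_sub_le_norm_add (3 * I * ρ * (ψ : ℂ)) (x₂ * ρ)
    rw [hp]; linarith
  have p2 : ‖p‖ ≤ 4 * t * ρ := by
    have := norm_add_le (3 * I * ρ * (ψ : ℂ)) (x₂ * ρ)
    rw [hp]; linarith
  have r1 : t⁻¹ / 4 * δ ≤ ‖r‖ := by
    have b1 := norm_add_le (w - (b - 3 * I * ρ * ψ) * Θ - x₃ * δ)
      ((b - 3 * I * ρ * ψ) * Θ + x₃ * δ)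
    have b2 := norm_add_le ((b - 3 * I * ρ * ψ) * Θ) (x₃ * δ)
    have b3 : ‖w - (b - 3 * I * ρ * ψ) * Θ - x₃ * δ‖ = ‖r‖ := by
      rw [← norm_neg, hr]; congr 1; ring
    rw [b3, show w - (b - 3 * I * ρ * ψ) * Θ - x₃ * δ
      + ((b - 3 * I * ρ * ψ) * Θ + x₃ * δ) = w by ring] at b1
    linarith
  have r2 : ‖r‖ ≤ 13 * t * δ := by
    have b1 := norm_add_le ((b - 3 * I * ρ * ψ) * Θ - w) (x₃ * δ)
    have b2 := norm_sub_le ((b - 3 * I * ρ * ψ) * Θ) w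
    rw [hr]; linarith
  refine ⟨p / ν, r / ν, (g - d) / ν, ?_,
    ⟨inv_mul_le_norm_div hρ ht0 p1 hν2 hν0 (by linarith), norm_div_le_mul hρ ht0 p2 hν1 (by linarith)⟩,
    ⟨inv_mul_le_norm_div hδ ht0 r1 hν2 hν0 le_rfl, norm_div_le_mul hδ ht0 r2 hν1 le_rfl⟩, ?_⟩
  · rw [eq_div_iff hne]
    have : (Θ ^ 3 + p / ν * Θ ^ 2 + r / ν * Θ) * ν = ν * Θ ^ 3 + p * Θ ^ 2 + r * Θ := by
      field_simp
    rw [this, hp, hr, ← h, hx, hν]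
    ring
  · rw [norm_div, div_le_iff₀ hν0]
    have hg := norm_nonneg g
    calc ‖g - d‖ ≤ 1 * (‖g‖ + S) := by linarith [norm_sub_le g d]
      _ = 2 * t * (‖g‖ + S) * (2 * t)⁻¹ := by field_simp
      _ ≤ _ := by gcongr

namespace Data

variable {D : Data n} {Γ : ℝ} {J : ℕ → Set (Vec n)} {K : ℕ}
  {β βs : ℂ} {B Bs : Mat n} {l ls : Idx n → ℂ} {V Δ T E Q : Mat n} {Θ Θs : ℂ}

namespace Expansion

theorem cubic_equation (x : D.Expansion β βs B Bs l V Δ T E Q Θ Θs) (t : D.Tower J)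
    (s : D.Setup Γ β βs B Bs l ls) (hK : 0 < K) {N : ℝ} (hNe : N = (n : ℝ) ^ ((2 : ℝ) / K))
    (hrad : 4 * 10 ^ 8 * Γ ^ 31 * D.rad ≤ 1)
    (hsm : 24 * expConst Γ K ^ 4 * (N ^ 7 * (towerNorm J K Δ + towerNorm J K V)) ≤ smallConst Γ K)
    {r : ℂ} (hr : r = hs (diagonal l) (D.quad B (invQ D.S D.M β βs (D.M * V)))
      + hs (diagonal l) (D.quad (invQ D.S D.M β βs (D.M * V)) B)) :
    ∃ ξ₂ ξ₁ εs : ℂ, Θ ^ 3 + ξ₂ * Θ ^ 2 + ξ₁ * Θ = εs ∧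
      ((26 * (Γ ^ 4) ^ 2)⁻¹ * D.ρ ≤ ‖ξ₂‖ ∧ ‖ξ₂‖ ≤ 26 * (Γ ^ 4) ^ 2 * D.ρ) ∧
      ((26 * (Γ ^ 4) ^ 2)⁻¹ * D.del ≤ ‖ξ₁‖ ∧ ‖ξ₁‖ ≤ 26 * (Γ ^ 4) ^ 2 * D.del) ∧
      ‖εs‖ ≤ 2 * Γ ^ 4 * (‖hs (diagonal l) (D.M * V) - hs (diagonal l)
          (D.quad (invQ D.S D.M β βs (D.M * V)) (invQ D.S D.M β βs (D.M * V)))‖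
        + 10 ^ 5 * expConst Γ K ^ 11 * (smallConst Γ K)⁻¹ ^ 2 * (N ^ 6 * towerNorm J K V ^ 3
          + ‖hs (matR₁ D.S D.M β βs) V‖ ^ ((3 : ℝ) / 2) + ‖r‖ ^ ((3 : ℝ) / 2))) := by
  have hΓ := s.Γ_pos
  have hΓ1 := s.one_le
  have hδ := s.reg.del_pos
  have hk0 := smallConst_pos hΓ1 K
  have hC := one_le_expConst hΓ1 K
  have hN : 1 ≤ N := by rw [hNe]; exact one_le_rpow_two_div s.reg.n_pos K
  have hv0 := towerNorm_nonneg J K V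
  have hx0 := towerNorm_nonneg J K Δ
  have hθ : ‖Θ‖ ≤ smallConst Γ K := by
    refine le_trans (x.norm_coeff_le' t s hK) (le_trans ?_ hsm)
    have h1 : expConst Γ K ≤ expConst Γ K ^ 4 := le_self_pow₀ hC (by norm_num)
    have h2 : 1 ≤ N ^ 7 := one_le_pow₀ hN
    calc _ = 1 * expConst Γ K * (1 * (towerNorm J K Δ + 0)) := by ring
      _ ≤ _ := by gcongr; norm_num
  have hm := s.hs_l_quad_B_B_sub
  have hμ := s.hs_l_quad_invQ_sub
  refine exists_cubic_equation (μ := cubicCoeff D β βs B l) (t := Γ ^ 4) (ψ := D.cubicMass) (one_le_pow₀ hΓ1) s.reg.ρ_pos.le hδ.le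
    (by positivity) s.reg.cubicMass_lower s.reg.cubicMass_upper
    (w := β * hs (diagonal l) B) (b := hs (diagonal l) (D.quad B B))
    (by rw [← x.cubic_identity hr]; ring) ?_ ?_ ?_ ?_
    ((x.norm_cubicError_le_absorbed t s hK hNe hsm r).trans_eq (by rw [mul_inv, inv_mul_eq_div]))
  · refine hμ.trans ?_
    rw [inv_eq_one_div, div_div, le_div_iff₀ (by positivity)]
    linarith
  · calc _ ≤ 323 * Γ ^ 7 * D.del * smallConst Γ K := by gcongr
      _ = 323 * Γ ^ 7 / (250000 * expConst Γ K ^ 11) * ((Γ ^ 4)⁻¹ / 8 * D.del) := by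
        rw [smallConst]; field_simp
      _ ≤ 1 * ((Γ ^ 4)⁻¹ / 8 * D.del) := by
        gcongr
        refine div_le_one_of_le₀ ?_ (by positivity)
        have h1 := le_expConst hΓ1 K (a := 323) (by norm_num) (by norm_num : 7 ≤ 30) (Nat.zero_le 3)
        have h2 : expConst Γ K ≤ expConst Γ K ^ 11 := le_self_pow₀ hC (by norm_num)
        rw [pow_zero, mul_one] at h1
        linarith
      _ = _ := one_mul _
  · rw [norm_mul]
    calc (Γ ^ 4)⁻¹ / 2 * D.del = (Γ ^ 4)⁻¹ * (D.del / 2) := by ring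
      _ ≤ (Γ ^ 3)⁻¹ * (D.del / 2) := by
        gcongr
        norm_num
      _ = Γ⁻¹ * D.del * (2 * Γ ^ 2)⁻¹ := by field_simp
      _ ≤ _ := mul_le_mul s.pair.lower s.hs_l_B_lower (by positivity) (norm_nonneg _)
  · rw [norm_mul]
    have h1 := s.norm_hs_l_le (R := B) (m := 6 * Γ ^ 2)
      (fun a => (norm_entry_le B a a).trans s.norm_B_le)
    calc _ ≤ Γ * D.del * (2 * Γ * (6 * Γ ^ 2)) :=
          mul_le_mul s.pair.upper h1 (norm_nonneg _) (by positivity)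
      _ = _ := by ring

end Expansion

end Data

theorem rpow_nat_mul_div {n : ℕ} {K : ℕ} {N : ℝ} (hNe : N = (n : ℝ) ^ ((2 : ℝ) / K)) (m : ℕ) :
    (n : ℝ) ^ ((2 * m : ℝ) / K) = N ^ m := by
  rw [hNe, ← Real.rpow_natCast, ← Real.rpow_mul (Nat.cast_nonneg n)]
  congr 1; ring

theorem rpow_neg_nat_mul_div {n : ℕ} {K : ℕ} {N : ℝ} (hNe : N = (n : ℝ) ^ ((2 : ℝ) / K)) (m : ℕ) :
    (n : ℝ) ^ (-(2 * m : ℝ) / K) = (N ^ m)⁻¹ := by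
  rw [← rpow_nat_mul_div hNe, ← Real.rpow_neg (Nat.cast_nonneg n), neg_div]

/-- Interpolating the two smallness conditions. -/
theorem pow_seven_mul_le {N a A κ : ℝ} (hN : 1 ≤ N) (ha : 0 ≤ a) (hA : 0 < A) (hκ : 0 ≤ κ)
    (h1 : a ≤ A * (N ^ 15)⁻¹) (h2 : a ≤ κ ^ 2 / A) : N ^ 7 * a ≤ κ := by
  refine le_of_sq_le_sq ?_ hκ
  have hN0 : 0 < N := by linarith
  calc (N ^ 7 * a) ^ 2 = N ^ 14 * (a * a) := by ring
    _ ≤ N ^ 14 * ((A * (N ^ 15)⁻¹) * (κ ^ 2 / A)) := by gcongr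
    _ = κ ^ 2 * N⁻¹ := by field_simp
    _ ≤ κ ^ 2 * 1 := by
      gcongr
      exact inv_le_one_of_one_le₀ hN
    _ = κ ^ 2 := mul_one _

namespace Data

variable {n : ℕ} {D : Data n} {Γ : ℝ} {J : ℕ → Set (Vec n)} {K : ℕ}
  {β βs : ℂ} {B Bs : Mat n} {l ls : Idx n → ℂ} {V : Mat n}

/-- The expansion and the cubic equation. -/
theorem Setup.expansion_and_cubic (s : D.Setup Γ β βs B Bs l ls) (t : D.Tower J)
    (hMu : IsUnit D.M) (hM : -D.M⁻¹ = spectralMat n D.z D.η + selfEnergy D.S D.M)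
    (hrad : 4 * 10 ^ 8 * Γ ^ 31 * D.rad ≤ 1) {R₂ : Mat n}
    (hR₂ : ∀ R, hs R₂ R = hs (diagonal l) (D.quad B (invQ D.S D.M β βs (D.M * R)))
      + hs (diagonal l) (D.quad (invQ D.S D.M β βs (D.M * R)) B))
    (hK : 0 < K) {C C' : ℝ} (hC : 26 * (Γ ^ 4) ^ 2 ≤ C)
    (hC' : C' = 10 ^ 6 * Γ ^ 4 * expConst Γ K ^ 11 * (smallConst Γ K)⁻¹ ^ 2) {G : Mat n}
    (hG : IsPerturbedDysonSolution D.S D.z D.η V G) (hE : hs Eminus G = 0)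
    {A : ℝ} (hA : 0 < A) {κ : ℝ} (hκ : κ = smallConst Γ K / (24 * expConst Γ K ^ 4))
    (h1 : towerNorm J K (G - D.M) + towerNorm J K V ≤ A * (n : ℝ) ^ (-(30 : ℝ) / K))
    (h2 : towerNorm J K (G - D.M) + towerNorm J K V ≤ κ ^ 2 / A) {Θ : ℂ}
    (hΘ : Θ = hs (diagonal l) (G - D.M) / hs (diagonal l) B) :
    (∃ E : Mat n,
      G - D.M = Θ • B - invQ D.S D.M β βs (D.M * V) + Θ ^ 2 • invQ D.S D.M β βs (D.quad B B) + E ∧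
      towerNorm J K E ≤ C' * (‖Θ‖ ^ 2 * D.rad
        + (n : ℝ) ^ ((16 : ℝ) / K) * (‖Θ‖ ^ 3 + ‖Θ‖ * (towerNorm J K V + D.ρ ^ 2 + D.η / D.ρ)
          + towerNorm J K V ^ 2 + ‖hs (matR₁ D.S D.M β βs) V‖))) ∧
    (∃ ξ₂ ξ₁ εs : ℂ,
      Θ ^ 3 + ξ₂ * Θ ^ 2 + ξ₁ * Θ = εs ∧
      (C⁻¹ * D.ρ ≤ ‖ξ₂‖ ∧ ‖ξ₂‖ ≤ C * D.ρ) ∧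
      (C⁻¹ * (D.η / D.ρ + D.ρ ^ 2) ≤ ‖ξ₁‖ ∧ ‖ξ₁‖ ≤ C * (D.η / D.ρ + D.ρ ^ 2)) ∧
      ‖εs‖ ≤ C' * ((n : ℝ) ^ ((62 : ℝ) / K) * (towerNorm J K V ^ 3
          + ‖hs (matR₁ D.S D.M β βs) V‖ ^ ((3 : ℝ) / 2) + ‖hs R₂ V‖ ^ ((3 : ℝ) / 2))
        + ‖hs (diagonal l) (D.M * V)‖
        + ‖hs (diagonal l)
          (D.quad (invQ D.S D.M β βs (D.M * V)) (invQ D.S D.M β βs (D.M * V)))‖)) := by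
  have hΓ := s.Γ_pos
  have hΓ1 := s.one_le
  have hδ := s.reg.del_pos
  have hρ := s.reg.ρ_pos
  have hk0 := smallConst_pos hΓ1 K
  have hk1 := smallConst_le_one hΓ1 K
  have hc := one_le_expConst hΓ1 K
  obtain ⟨N, hNe⟩ : ∃ N, N = (n : ℝ) ^ ((2 : ℝ) / K) := ⟨_, rfl⟩
  have hN : 1 ≤ N := by rw [hNe]; exact one_le_rpow_two_div s.reg.n_pos K
  have n16 := rpow_nat_mul_div hNe 8
  have n62 := rpow_nat_mul_div hNe 31
  have n30 := rpow_neg_nat_mul_div hNe 15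
  norm_num at n16 n62 n30
  rw [n16, n62]
  rw [n30] at h1
  have hv0 := towerNorm_nonneg J K V
  have hx0 := towerNorm_nonneg J K (G - D.M)
  have hsm : 24 * expConst Γ K ^ 4 * (N ^ 7 * (towerNorm J K (G - D.M) + towerNorm J K V))
      ≤ smallConst Γ K := by
    have := pow_seven_mul_le hN (by positivity) hA (by rw [hκ]; positivity) h1 h2
    calc _ ≤ 24 * expConst Γ K ^ 4 * κ := by gcongr
      _ = _ := by rw [hκ]; field_simp
  obtain ⟨T, E, Q, Θs, x⟩ := s.exists_expansion hMu hM hG hE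
  rw [← hΘ] at x
  have hE := x.towerNorm_E_le t s hK hNe (hsm.trans hk1)
  obtain ⟨ξ₂, ξ₁, εs, hcub, hξ₂, hξ₁, hεs⟩ := x.cubic_equation t s hK hNe hrad hsm (hR₂ V)
  have hrad0 : 0 ≤ D.rad := hδ.le.trans s.reg.del_le_rad
  have hki : 1 ≤ (smallConst Γ K)⁻¹ ^ 2 := one_le_pow₀ ((one_le_inv₀ hk0).2 hk1)
  have hΓ4 : 1 ≤ Γ ^ 4 := one_le_pow₀ hΓ1
  have hc11 : 1 ≤ expConst Γ K ^ 11 := one_le_pow₀ hc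
  have hdel : D.del = D.η / D.ρ + D.ρ ^ 2 := add_comm _ _
  have hC0 : 0 < 26 * (Γ ^ 4) ^ 2 := by positivity
  refine ⟨⟨E, by rw [x.sub_eq, x.T_eq]; abel, hE.trans ?_⟩, ξ₂, ξ₁, εs, hcub,
    ⟨le_trans ?_ hξ₂.1, hξ₂.2.trans ?_⟩, ⟨le_trans ?_ hξ₁.1, hξ₁.2.trans ?_⟩, hεs.trans ?_⟩
  · have hR := norm_nonneg (hs (matR₁ D.S D.M β βs) V)
    have hθ := norm_nonneg Θ
    have hA : 50 * expConst Γ K ^ 4 ≤ C' := by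
      rw [hC']
      calc 50 * expConst Γ K ^ 4 = 50 * 1 * expConst Γ K ^ 4 * 1 := by ring
        _ ≤ _ := by gcongr <;> norm_num
    refine mul_le_mul hA ?_ (by positivity) (le_trans (by positivity) hA)
    rw [show D.ρ ^ 2 = D.del - D.η / D.ρ by rw [hdel]; ring]
    generalize towerNorm J K V = v at *
    generalize ‖Θ‖ = θ at *
    generalize ‖hs (matR₁ D.S D.M β βs) V‖ = r at *
    have q1 : 1 ≤ N ^ 8 := one_le_pow₀ hN
    have m1 : D.del * θ * 1 ≤ D.del * θ * N ^ 8 := by gcongr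
    have m2 : r * 1 ≤ r * N ^ 8 := by gcongr
    have m3 : θ * v * N ^ 2 ≤ θ * v * N ^ 8 := by gcongr; norm_num
    have m4 : θ ^ 3 * N ≤ θ ^ 3 * N ^ 8 := by
      gcongr; exact le_self_pow₀ hN (by norm_num)
    have m5 : v ^ 2 * N ^ 3 ≤ v ^ 2 * N ^ 8 := by gcongr; norm_num
    linarith
  · gcongr
  · gcongr
  · rw [← hdel]; gcongr
  · rw [← hdel]; gcongr
  · obtain ⟨S, hS⟩ : ∃ S, S = towerNorm J K V ^ 3 + ‖hs (matR₁ D.S D.M β βs) V‖ ^ ((3 : ℝ) / 2)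
      + ‖hs R₂ V‖ ^ ((3 : ℝ) / 2) := ⟨_, rfl⟩
    have hS0 : 0 ≤ S := by rw [hS]; positivity
    have hS1 : N ^ 6 * towerNorm J K V ^ 3 + ‖hs (matR₁ D.S D.M β βs) V‖ ^ ((3 : ℝ) / 2)
        + ‖hs R₂ V‖ ^ ((3 : ℝ) / 2) ≤ N ^ 31 * S := by
      have q1 : 1 ≤ N ^ 31 := one_le_pow₀ hN
      have p1 : 0 ≤ ‖hs (matR₁ D.S D.M β βs) V‖ ^ ((3 : ℝ) / 2) := by positivity
      have p2 : 0 ≤ ‖hs R₂ V‖ ^ ((3 : ℝ) / 2) := by positivity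
      have m1 : N ^ 6 * towerNorm J K V ^ 3 ≤ N ^ 31 * towerNorm J K V ^ 3 := by
        gcongr; norm_num
      have m2 := le_mul_of_one_le_left p1 q1
      have m3 := le_mul_of_one_le_left p2 q1
      rw [hS]; linarith
    rw [← hS]
    have hsub := norm_sub_le (hs (diagonal l) (D.M * V)) (hs (diagonal l)
      (D.quad (invQ D.S D.M β βs (D.M * V)) (invQ D.S D.M β βs (D.M * V))))
    refine (mul_le_mul_of_nonneg_left (add_le_add hsub
      (mul_le_mul_of_nonneg_left hS1 (by positivity))) (by positivity)).trans ?_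
    have hg1 := norm_nonneg (hs (diagonal l) (D.M * V))
    have hg2 := norm_nonneg (hs (diagonal l)
      (D.quad (invQ D.S D.M β βs (D.M * V)) (invQ D.S D.M β βs (D.M * V))))
    generalize ‖hs (diagonal l) (D.M * V)‖ = g₁ at *
    generalize ‖hs (diagonal l)
      (D.quad (invQ D.S D.M β βs (D.M * V)) (invQ D.S D.M β βs (D.M * V)))‖ = g₂ at *
    obtain ⟨P, hP⟩ : ∃ P, P = expConst Γ K ^ 11 * (smallConst Γ K)⁻¹ ^ 2 := ⟨_, rfl⟩
    have hP1 : 1 ≤ P := by rw [hP]; exact one_le_mul_of_one_le_of_one_le hc11 hki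
    have e1 : C' = 10 ^ 6 * Γ ^ 4 * P := by rw [hC', hP]; ring
    have e2 : 10 ^ 5 * expConst Γ K ^ 11 * (smallConst Γ K)⁻¹ ^ 2 = 10 ^ 5 * P := by rw [hP]; ring
    rw [e1, e2]
    have hW : 0 ≤ N ^ 31 * S := by positivity
    have hX : 0 ≤ P * (N ^ 31 * S) := by positivity
    have hY : 0 ≤ g₁ + g₂ := by linarith
    have hZ := le_mul_of_one_le_left hY hP1
    have : g₁ + g₂ + 10 ^ 5 * P * (N ^ 31 * S) ≤ 5 * 10 ^ 5 * P * (N ^ 31 * S + g₁ + g₂) := by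
      linarith
    calc _ ≤ 2 * Γ ^ 4 * (5 * 10 ^ 5 * P * (N ^ 31 * S + g₁ + g₂)) := by gcongr
      _ = _ := by ring

end Data

end

end CuspMDE

theorem proposition4p1 (s_lo s_hi τ : ℝ) (hs_lo : 0 < s_lo) (hs_hi : s_lo < s_hi) (hτ : 1 < τ) :
    ∃ ε : ℝ, 0 < ε ∧ ∃ C₁ : ℝ, 0 < C₁ ∧ ∀ C₀ : ℝ, C₁ ≤ C₀ →
    ∃ ρs : ℝ, 0 < ρs ∧ ∃ C : ℝ, 0 < C ∧
    ∀ (K : ℕ), 0 < K → ∀ A : ℝ, 0 < A → ∃ c : ℝ, 0 < c ∧ ∃ C' : ℝ, 0 < C' ∧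
    ∀ (n : ℕ), 0 < n →
    ∀ (Ω : Type*) (_ : MeasurableSpace Ω) (P : Measure Ω) (_ : IsProbabilityMeasure P)
      (X : Ω → Matrix (Fin n) (Fin n) ℂ), CuspMDE.FlatModel s_lo s_hi P X →
    ∀ (z : ℂ), ‖z‖ < τ → ∀ (η : ℝ), 0 < η → η ≤ 1 →
    ∀ (M : CuspMDE.Mat n), CuspMDE.IsDysonSolution (CuspMDE.varMat P X) z η M →
      CuspMDE.rho M + η / CuspMDE.rho M ≤ ρs →
    -- the two unstable directions exist
    (∃ (β βs : ℂ) (B Bs L Ls : CuspMDE.Mat n),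
      CuspMDE.IsUnstablePair (CuspMDE.varMat P X) η M ε C₀ β βs B Bs L Ls) ∧
    -- and the expansion and the cubic equation hold for any choice of them
    ∀ (β βs : ℂ) (B Bs L Ls : CuspMDE.Mat n),
      CuspMDE.IsUnstablePair (CuspMDE.varMat P X) η M ε C₀ β βs B Bs L Ls →
      IsUnit (CuspMDE.stabOp (CuspMDE.varMat P X) M) ∧
      CuspMDE.hs L B ≠ 0 ∧
      CuspMDE.opNorm (CuspMDE.matR₁ (CuspMDE.varMat P X) M β βs) ≤ C ∧
      ∃ R₂ : CuspMDE.Mat n, CuspMDE.opNorm R₂ ≤ C ∧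
      ∀ (x y : CuspMDE.Vec n) (G D : CuspMDE.Mat n),
        let 𝒮 := CuspMDE.selfEnergy (CuspMDE.varMat P X)
        let BQ := CuspMDE.invQ (CuspMDE.varMat P X) M β βs
        let R₁ := CuspMDE.matR₁ (CuspMDE.varMat P X) M β βs
        let ρ := CuspMDE.rho M
        let nrm := CuspMDE.starNorm (CuspMDE.sCov P X z) (CuspMDE.tCov P X z) M L Ls K x y
        let Θ := CuspMDE.hs L (G - M) / CuspMDE.hs L B
        CuspMDE.IsPerturbedDysonSolution (CuspMDE.varMat P X) z η D G →
        CuspMDE.hs CuspMDE.Eminus G = 0 →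
        nrm (G - M) + nrm D ≤ A * (n : ℝ) ^ (-(30 : ℝ) / K) →
        nrm (G - M) + nrm D ≤ c →
        (∃ E : CuspMDE.Mat n,
          G - M = Θ • B - BQ (M * D) + Θ ^ 2 • BQ (M * 𝒮 B * B) + E ∧
          nrm E ≤ C' * (‖Θ‖ ^ 2 * (ρ + η / ρ)
            + (n : ℝ) ^ ((16 : ℝ) / K) * (‖Θ‖ ^ 3 + ‖Θ‖ * (nrm D + ρ ^ 2 + η / ρ)
              + nrm D ^ 2 + ‖CuspMDE.hs R₁ D‖))) ∧
        (∃ ξ₂ ξ₁ εs : ℂ,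
          Θ ^ 3 + ξ₂ * Θ ^ 2 + ξ₁ * Θ = εs ∧
          (C⁻¹ * ρ ≤ ‖ξ₂‖ ∧ ‖ξ₂‖ ≤ C * ρ) ∧
          (C⁻¹ * (η / ρ + ρ ^ 2) ≤ ‖ξ₁‖ ∧ ‖ξ₁‖ ≤ C * (η / ρ + ρ ^ 2)) ∧
          ‖εs‖ ≤ C' * ((n : ℝ) ^ ((62 : ℝ) / K) * (nrm D ^ 3
              + ‖CuspMDE.hs R₁ D‖ ^ ((3 : ℝ) / 2) + ‖CuspMDE.hs R₂ D‖ ^ ((3 : ℝ) / 2))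
            + ‖CuspMDE.hs L (M * D)‖
            + ‖CuspMDE.hs L (M * 𝒮 (BQ (M * D)) * BQ (M * D))‖)) := by
  obtain ⟨Λ, ρ₀, hΛ, hρ₀, -, hdata⟩ := CuspMDE.exists_regular_data s_lo s_hi τ hs_lo hs_hi hτ
  have hΛ0 : 0 < Λ := by linarith
  refine ⟨(Λ ^ 5)⁻¹ / 4, by positivity, 10 ^ 7 * Λ ^ 23, by positivity, fun C₀ hC₀ => ?_⟩
  have hC₀0 : 0 ≤ C₀ := le_trans (by positivity) hC₀
  obtain ⟨Γ, hΓ⟩ : ∃ Γ, Γ = Λ + C₀ + 10 * Λ ^ 2 := ⟨_, rfl⟩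
  have hΛ2 : 0 ≤ Λ ^ 2 := by positivity
  have hΓΛ : Λ ≤ Γ := by linarith
  have hΓ1 : 1 ≤ Γ := hΛ.trans hΓΛ
  have hΓ0 : 0 < Γ := by linarith
  refine ⟨min ρ₀ (min (10 ^ 9 * Λ ^ 40)⁻¹ (4 * 10 ^ 8 * Γ ^ 31)⁻¹), by positivity, 10 ^ 8 * Γ ^ 25,
    by positivity, fun K hK A hA => ?_⟩
  have hk0 := CuspMDE.Data.smallConst_pos hΓ1 K
  have hc := CuspMDE.one_le_expConst hΓ1 K
  have hc0 : 0 < CuspMDE.expConst Γ K := by linarith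
  refine ⟨(CuspMDE.Data.smallConst Γ K / (24 * CuspMDE.expConst Γ K ^ 4)) ^ 2 / A, by positivity,
    10 ^ 6 * Γ ^ 4 * CuspMDE.expConst Γ K ^ 11 * (CuspMDE.Data.smallConst Γ K)⁻¹ ^ 2, by positivity, ?_⟩
  intro n hn Ω _ P _ X hX z hz η hη _ M hM hrad
  rw [le_min_iff, le_min_iff] at hrad
  obtain ⟨hrad1, hrad2, hrad3⟩ := hrad
  obtain ⟨D, hD, hS, rfl, rfl, hρ, rfl⟩ := hdata hn _ hX.flat_lower hX.flat_upper hX.radius_one z hz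
    η hη M hM hrad1
  rw [← hρ] at hrad2 hrad3
  rw [← hS] at hM ⊢
  rw [← hρ]
  have hdr : D.del ≤ D.rad := hD.del_le_rad
  have hd : D.del ≤ (10 ^ 9 * Λ ^ 40)⁻¹ := hdr.trans hrad2
  have hr1 : 4 * 10 ^ 8 * Γ ^ 31 * D.rad ≤ 1 := by
    have := mul_le_mul_of_nonneg_left hrad3 (by positivity : 0 ≤ 4 * 10 ^ 8 * Γ ^ 31)
    rwa [mul_inv_cancel₀ (by positivity)] at this
  have hr2 : 4 * 10 ^ 8 * Γ ^ 31 * D.del ≤ 1 :=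
    (mul_le_mul_of_nonneg_left hdr (by positivity)).trans hr1
  have hdel := hD.del_pos
  have hsm : 10 ^ 4 * Γ ^ 20 * D.del ≤ 1 := by
    refine le_trans ?_ hr2
    have : Γ ^ 20 ≤ Γ ^ 31 := pow_le_pow_right₀ hΓ1 (by norm_num)
    gcongr
    norm_num
  have hsm' : Γ * D.del ≤ 1 / 2 := by
    have h1 : Γ ≤ Γ ^ 31 := le_self_pow₀ hΓ1 (by norm_num)
    have h2 : Γ * D.del ≤ Γ ^ 31 * D.del := by gcongr
    linarith
  refine ⟨?_, fun β βs B Bs L Ls hU => ?_⟩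
  · obtain ⟨β, βs, B, Bs, L, Ls, -, -, hU⟩ := hD.exists_unstablePair hd
    exact ⟨β, βs, B, Bs, L, Ls, hU C₀ hC₀⟩
  obtain ⟨hpair, hL, hLs⟩ := hD.pair_of_isUnstablePair hd hC₀0 hU
  have s : D.Setup Γ β βs B Bs L.diag Ls.diag :=
    ⟨hD.mono hΓΛ hsm', hpair.mono hdel.le (by linarith), hsm⟩
  obtain ⟨R₂, hR₂, hR₂'⟩ := s.exists_matR₂
  refine ⟨s.isUnit_stabOp, ?_, ?_, R₂, hR₂, ?_⟩
  · have := s.hs_l_B_ne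
    rwa [hL] at this
  · refine s.norm_matR₁_le.trans ?_
    gcongr
    all_goals first | exact hΓ1 | norm_num
  intro x y G V 𝒮 BQ R₁ ρ nrm Θ hG hE h1 h2
  have h := s.expansion_and_cubic (CuspMDE.tower_testVecs hX D.z hS L Ls x y) hM.isUnit hM.equation
    hr1 hR₂' hK (C := 10 ^ 8 * Γ ^ 25) ?_ rfl hG hE hA rfl h1 h2 rfl
  · rw [hL] at h
    exact h
  · calc 26 * (Γ ^ 4) ^ 2 = 26 * Γ ^ 8 := by ring
      _ ≤ 10 ^ 8 * Γ ^ 25 := by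
        have : Γ ^ 8 ≤ Γ ^ 25 := pow_le_pow_right₀ hΓ1 (by norm_num)
        gcongr
        norm_num
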